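/- Conventions. A graded supermanifold is a smooth real supermanifold with a $\mathbb Z$-grading (weight) independent of parity, described by local coordinates $x^a$ of parity $\tilde a$ and weight $w^a$; a function has weight $n$ if it is an eigenfunction of eigenvalue $n$ of the weight vector field (locally $\sum_a w^a x^a\partial_a$). Only parity is responsible for signs. $V[s]$ is the graded space with $V[s]^n=V^{n+s}$; $T^*M[s]$ is the cotangent bundle where the momentum $p_a$ has weight $-w^a+s$. Functions on $T^*M$ are formal power series in the momenta, and formal maps are given by formal power series (Taylor coefficients at $0$), equivalently by their values on formal points, i.e. on even functions $g$ that depend on formal parameters and vanish when these are zero. Let $k\in\mathbb Z$ and let $M_1,M_2$ be graded supermanifolds with $k$-shifted $S_\infty$-structures given by master Hamiltonians $H_i$: odd functions on $T^*M_i[1-k]$ of weight $2-k$ with $(H_i,H_i)=0$ for the canonical Poisson bracket. They generate the brackets $\{f_1,\dots,f_n\}_{H_i}=(\dots(H_i,f_1),\dots,f_n)|_{M_i}$ on functions and the Hamilton–Jacobi vector fields $Q_{H_i}$ on the supermanifolds of functions, with value $H_i(x,\partial f/\partial x)$ at the point $f$. Let $\Phi$ be a $(1-k)$-shifted thick morphism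 from $M_1$ to $M_2$: for every coordinate system $y^i$ on $M_2$, with conjugate momenta $q_i$, there is an even generating function $$S(x,q)=S^0(x)+\varphi^i(x)q_i+\tfrac12S^{ij}(x)q_jq_i+\cdots$$ of weight $1-k$ (where $q_i$ has weight $-w(y^i)+1-k$), where $y^i=\varphi^i(x)$ is a morphism $\varphi:M_1\to M_2$, such that for another coordinate system $y'$ $$S'(x,q')-y'^{b}q'_{b}=S(x,q)-y^iq_i,\qquad y^i=(-1)^{\tilde\imath}\frac{\partial S}{\partial q_i},\quad y'=y'(y),\quad q'_b=\frac{\partial y^i}{\partial y'^b}(y)\,q_i .$$ Suppose that $S$ satisfies, in all coordinate systems, the Hamilton–Jacobi equation $$H_1\Bigl(x,\frac{\partial S}{\partial x}\Bigr)=H_2\Bigl((-1)^{\tilde\imath}\frac{\partial S}{\partial q_i},q\Bigr).$$ (If $S^0\neq0$, it is part of this condition that the left-hand side makes sense, i.e. that each of its $q$-coefficients is a locally finite sum over the degrees of $H_1$ in the momenta; for $S^0=0$ this is automatic.) Theorem. The pullback $\Phi^*:g\mapsto f$, $$f(x)=g(y)+S(x,q)-y^iq_i,\qquad y^i=(-1)^{\tilde\imath}\frac{\partial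 S}{\partial q_i}(x,q),\quad q_i=\frac{\partial g}{\partial y^i}(y),$$ is a well-defined formal map $\Phi^*:\mathrm{Fun}(M_2)[1-k]\to\mathrm{Fun}(M_1)[1-k]$ of graded infinite-dimensional supermanifolds (every formal point $g$ has a unique image, which is even and has weight $1-k$ if $g$ has weight $1-k$), and it is a formal $Q$-morphism: $$\Phi^*\bigl(g+Q_{H_2}(g)\,\varepsilon\bigr)=\Phi^*(g)+Q_{H_1}(\Phi^*(g))\,\varepsilon$$ for every odd parameter $\varepsilon$. Its Taylor coefficients $F_n:\mathrm{Fun}(M_2)^n\to\mathrm{Fun}(M_1)$, $n\ge0$, are therefore uniquely determined, even, multilinear and symmetric in the super sense, of weight $0$ with respect to the shifted gradings, and they form an $L_\infty$-morphism from the brackets generated by $H_2$ to those generated by $H_1$ (which are odd symmetric brackets that satisfy the Jacobi identities of an $L_\infty$-structure and have weight $+1$ as the Taylor coefficients of the vector fields $Q_{H_i}$ on $\mathrm{Fun}(M_i)[1-k]$): for homogeneous functions $v_1,\dots,v_n$, $n\ge 0$, $$\sum_{I\sqcup J=\{1,\dots,n\}}\pm F\bigl(\{v_I\}_{H_2},v_J\bigr)=\sum_{r\ge0}\frac1{r!}\sum_{K_1\sqcup\dots\sqcup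 K_r=\{1,\dots,n\}}\pm\bigl\{F(v_{K_1}),\dots,F(v_{K_r})\bigr\}_{H_1},$$ with Koszul signs, where the $K_b$ may be empty and the sum over $r$ is locally finite. -/

import Mathlib

open TopologicalSpace (Opens)
open scoped ContDiff

/-- A supercommutative superalgebra over `ℝ`.  The `ℤ/2`-grading (parity) is encoded by its parity
involution `inv`, i.e. `inv a = a` on even and `inv a = -a` on odd elements. -/
class SuperAlgebra (A : Type*) [Ring A] [Algebra ℝ A] where
  inv : A →ₐ[ℝ] A
  inv_inv : ∀ a, inv (inv a) = a
  even_comm : ∀ a b, inv a = a → a * b = b * a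
  odd_comm : ∀ a b, inv a = -a → inv b = -b → a * b = -(b * a)

/-- `a` is homogeneous of parity `e` (`false` is even, `true` is odd). -/
def HasParity {A : Type*} [Ring A] [Algebra ℝ A] [SuperAlgebra A] (e : Bool) (a : A) : Prop :=
  SuperAlgebra.inv a = if e then -a else a

/-! ### Formal power series in supercommuting variables -/

/-- Exponents of monomials in variables `X i` of parity `π i`: odd variables square to zero. -/
def Adm {ι : Type*} (π : ι → Bool) (m : ι →₀ ℕ) : Prop := ∀ i, π i = true → m i ≤ 1

/-- The number of odd factors of the monomial `X ^ m`. -/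
def oddDeg {ι : Type*} [Fintype ι] (π : ι → Bool) (m : ι →₀ ℕ) : ℕ :=
  ∑ i, if π i then m i else 0

/-- The number of transpositions of odd factors that sort the product `X ^ m * X ^ n`. -/
def crossings {ι : Type*} [Fintype ι] [LinearOrder ι] (π : ι → Bool) (m n : ι →₀ ℕ) : ℕ :=
  ∑ i, ∑ j, if j < i ∧ π i = true ∧ π j = true then m i * n j else 0

/-- Formal power series `∑ F m X ^ m` with coefficients `F m` in `A` (written on the left of the
monomials) in variables `X i` of parity `π i`; the monomials are ordered by the index set. -/
def SSer (A : Type*) [Ring A] [Algebra ℝ A] {ι : Type*} (π : ι → Bool) : Type _ :=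
  ↥({ carrier := {F | ∀ m, ¬ Adm π m → F m = 0}
      add_mem' := fun {a b} ha hb m hm => by simp [ha m hm, hb m hm]
      zero_mem' := fun _ _ => rfl
      smul_mem' := fun c a ha m hm => by simp [ha m hm] } : Submodule ℝ ((ι →₀ ℕ) → A))

namespace SSer

section Basic
variable {A : Type*} [Ring A] [Algebra ℝ A] {ι : Type*} {π : ι → Bool}

instance : AddCommGroup (SSer A π) := by unfold SSer; infer_instance
instance : Module ℝ (SSer A π) := by unfold SSer; infer_instance

/-- The coefficient of `X ^ m`. -/
def coeff (m : ι →₀ ℕ) (F : SSer A π) : A := F.1 m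

open Classical in
/-- The series with prescribed coefficients (of the admissible monomials). -/
noncomputable def mk (π : ι → Bool) (c : (ι →₀ ℕ) → A) : SSer A π :=
  ⟨fun m => if Adm π m then c m else 0, fun _ hm => if_neg hm⟩

theorem coeff_mk {m : ι →₀ ℕ} (h : Adm π m) (c : (ι →₀ ℕ) → A) : coeff m (mk π c) = c m :=
  if_pos h

theorem ext {F G : SSer A π} (h : ∀ m, Adm π m → coeff m F = coeff m G) : F = G := by
  apply Subtype.ext
  funext m
  by_cases hm : Adm π m
  · exact h m hm
  · exact (F.2 m hm).trans (G.2 m hm).symm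

theorem coeff_add (m : ι →₀ ℕ) (F G : SSer A π) : coeff m (F + G) = coeff m F + coeff m G := rfl
theorem coeff_smul (m : ι →₀ ℕ) (c : ℝ) (F : SSer A π) : coeff m (c • F) = c • coeff m F := rfl
theorem coeff_zero (m : ι →₀ ℕ) : coeff m (0 : SSer A π) = 0 := rfl

open Classical in
/-- The constant series. -/
noncomputable def C (π : ι → Bool) (a : A) : SSer A π := mk π (fun m => if m = 0 then a else 0)

open Classical in
/-- The variable `X i`. -/
noncomputable def X (A : Type*) [Ring A] [Algebra ℝ A] (π : ι → Bool) (i : ι) : SSer A π :=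
  mk π (fun m => if m = Finsupp.single i 1 then 1 else 0)

/-- Application of a map to all coefficients. -/
noncomputable def map {B : Type*} [Ring B] [Algebra ℝ B] (f : A → B) (F : SSer A π) : SSer B π :=
  mk π (fun m => f (coeff m F))

/-- The sum of a family of series of which the `N`-th one has order at least `N` (so that the
coefficient of a monomial of degree `d` only involves `N ≤ d`). -/
noncomputable def orderSum (F : ℕ → SSer A π) : SSer A π :=
  mk π (fun m => ∑ N ∈ Finset.range (m.degree + 1), coeff m (F N))

end Basic

section Exponents
variable {ι : Type*} {π : ι → Bool}

theorem adm_left {m n : ι →₀ ℕ} (h : Adm π (m + n)) : Adm π m := fun i hi =>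
  (Nat.le_add_right _ _).trans (h i hi)
theorem adm_right {m n : ι →₀ ℕ} (h : Adm π (m + n)) : Adm π n := fun i hi =>
  (Nat.le_add_left _ _).trans (h i hi)


theorem oddDeg_zero [Fintype ι] : oddDeg π 0 = 0 := by simp [oddDeg]
theorem oddDeg_add [Fintype ι] (m n : ι →₀ ℕ) : oddDeg π (m + n) = oddDeg π m + oddDeg π n := by
  simp only [oddDeg, ← Finset.sum_add_distrib]
  refine Finset.sum_congr rfl fun i _ => ?_
  split <;> simp


theorem crossings_zero_left [Fintype ι] [LinearOrder ι] (m : ι →₀ ℕ) : crossings π 0 m = 0 := by simp [crossings]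
theorem crossings_zero_right [Fintype ι] [LinearOrder ι] (m : ι →₀ ℕ) : crossings π m 0 = 0 := by simp [crossings]
theorem crossings_add_left [Fintype ι] [LinearOrder ι] (m m' n : ι →₀ ℕ) :
    crossings π (m + m') n = crossings π m n + crossings π m' n := by
  simp only [crossings, ← Finset.sum_add_distrib]
  refine Finset.sum_congr rfl fun i _ => Finset.sum_congr rfl fun j _ => ?_
  split <;> simp [add_mul]
theorem crossings_add_right [Fintype ι] [LinearOrder ι] (m n n' : ι →₀ ℕ) :
    crossings π m (n + n') = crossings π m n + crossings π m n' := by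
  simp only [crossings, ← Finset.sum_add_distrib]
  refine Finset.sum_congr rfl fun i _ => Finset.sum_congr rfl fun j _ => ?_
  split <;> simp [mul_add]

end Exponents

section Mul
variable {A : Type*} [Ring A] [Algebra ℝ A] [SuperAlgebra A]
  {ι : Type*} [Fintype ι] [LinearOrder ι] {π : ι → Bool}

/-- The parity involution. -/
noncomputable def inv (F : SSer A π) : SSer A π :=
  mk π (fun m => (-1 : ℝ) ^ oddDeg π m • SuperAlgebra.inv (coeff m F))

/-- The product, by the sign rule: `(a X ^ m) (b X ^ n) = ± a b X ^ (m + n)`, where `X ^ m` is first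
moved past `b` and then the odd variables are sorted. -/
noncomputable instance : Mul (SSer A π) where
  mul F G := mk π (fun k => ∑ x ∈ Finset.HasAntidiagonal.antidiagonal k,
    (-1 : ℝ) ^ crossings π x.1 x.2 •
      (coeff x.1 F * SuperAlgebra.inv^[oddDeg π x.1] (coeff x.2 G)))

noncomputable instance : One (SSer A π) := ⟨C π 1⟩

theorem coeff_mul {k : ι →₀ ℕ} (h : Adm π k) (F G : SSer A π) :
    coeff k (F * G) = ∑ x ∈ Finset.HasAntidiagonal.antidiagonal k,
      (-1 : ℝ) ^ crossings π x.1 x.2 •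
        (coeff x.1 F * SuperAlgebra.inv^[oddDeg π x.1] (coeff x.2 G)) := coeff_mk h _

set_option linter.unusedSectionVars false in
theorem coeff_one {k : ι →₀ ℕ} (h : Adm π k) :
    coeff k (1 : SSer A π) = if k = 0 then 1 else 0 := by
  have h1 : (1 : SSer A π) = C π 1 := rfl
  rw [h1, C, coeff_mk h]
  by_cases hk : k = 0 <;> simp [hk]

/-- The iterated parity involution, as an algebra map. -/
private theorem iter_eq (n : ℕ) : ∃ f : A →ₐ[ℝ] A, ∀ a, SuperAlgebra.inv^[n] a = f a := by
  induction n with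
  | zero => exact ⟨AlgHom.id ℝ A, fun _ => rfl⟩
  | succ n ih =>
    obtain ⟨f, hf⟩ := ih
    exact ⟨f.comp SuperAlgebra.inv, fun a => by simp [Function.iterate_succ, hf]⟩

theorem iter_zero (n : ℕ) : SuperAlgebra.inv^[n] (0 : A) = 0 := by
  obtain ⟨f, hf⟩ := iter_eq (A := A) n; simp [hf]
theorem iter_one (n : ℕ) : SuperAlgebra.inv^[n] (1 : A) = 1 := by
  obtain ⟨f, hf⟩ := iter_eq (A := A) n; simp [hf]
theorem iter_add (n : ℕ) (a b : A) : SuperAlgebra.inv^[n] (a + b) =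
    SuperAlgebra.inv^[n] a + SuperAlgebra.inv^[n] b := by
  obtain ⟨f, hf⟩ := iter_eq (A := A) n; simp [hf]
theorem iter_mul (n : ℕ) (a b : A) : SuperAlgebra.inv^[n] (a * b) =
    SuperAlgebra.inv^[n] a * SuperAlgebra.inv^[n] b := by
  obtain ⟨f, hf⟩ := iter_eq (A := A) n; simp [hf]
theorem iter_smul (n : ℕ) (c : ℝ) (a : A) : SuperAlgebra.inv^[n] (c • a) =
    c • SuperAlgebra.inv^[n] a := by
  obtain ⟨f, hf⟩ := iter_eq (A := A) n; simp [hf]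
theorem iter_sum {κ : Type*} (n : ℕ) (s : Finset κ) (a : κ → A) :
    SuperAlgebra.inv^[n] (∑ x ∈ s, a x) = ∑ x ∈ s, SuperAlgebra.inv^[n] (a x) := by
  obtain ⟨f, hf⟩ := iter_eq (A := A) n; simp [hf]

private theorem mul_assoc' (F G H : SSer A π) : F * G * H = F * (G * H) := by
  refine ext fun k hk => ?_
  rw [coeff_mul hk, coeff_mul hk]
  have h1 : ∀ x ∈ Finset.HasAntidiagonal.antidiagonal k,
      (-1 : ℝ) ^ crossings π x.1 x.2 •
        (coeff x.1 (F * G) * SuperAlgebra.inv^[oddDeg π x.1] (coeff x.2 H)) =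
      ∑ y ∈ Finset.HasAntidiagonal.antidiagonal x.1,
        (-1 : ℝ) ^ (crossings π x.1 x.2 + crossings π y.1 y.2) •
        (coeff y.1 F * SuperAlgebra.inv^[oddDeg π y.1] (coeff y.2 G) *
          SuperAlgebra.inv^[oddDeg π x.1] (coeff x.2 H)) := by
    intro x hx
    rw [Finset.HasAntidiagonal.mem_antidiagonal] at hx
    rw [coeff_mul (adm_left (hx ▸ hk)), Finset.sum_mul, Finset.smul_sum]
    refine Finset.sum_congr rfl fun y _ => ?_
    rw [smul_mul_assoc, smul_smul, pow_add]
  have h2 : ∀ x ∈ Finset.HasAntidiagonal.antidiagonal k,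
      (-1 : ℝ) ^ crossings π x.1 x.2 •
        (coeff x.1 F * SuperAlgebra.inv^[oddDeg π x.1] (coeff x.2 (G * H))) =
      ∑ y ∈ Finset.HasAntidiagonal.antidiagonal x.2,
        (-1 : ℝ) ^ (crossings π x.1 x.2 + crossings π y.1 y.2) •
        (coeff x.1 F * SuperAlgebra.inv^[oddDeg π x.1] (coeff y.1 G) *
          SuperAlgebra.inv^[oddDeg π x.1 + oddDeg π y.1] (coeff y.2 H)) := by
    intro x hx
    rw [Finset.HasAntidiagonal.mem_antidiagonal] at hx
    rw [coeff_mul (adm_right (hx ▸ hk)), iter_sum, Finset.mul_sum, Finset.smul_sum]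
    refine Finset.sum_congr rfl fun y _ => ?_
    rw [iter_smul, iter_mul, mul_smul_comm, smul_smul, pow_add, Function.iterate_add_apply,
      mul_assoc]
  rw [Finset.sum_congr rfl h1, Finset.sum_congr rfl h2, Finset.sum_sigma', Finset.sum_sigma']
  refine Finset.sum_nbij' (fun x => ⟨(x.2.1, x.2.2 + x.1.2), (x.2.2, x.1.2)⟩)
    (fun x => ⟨(x.1.1 + x.2.1, x.2.2), (x.1.1, x.2.1)⟩) ?_ ?_ ?_ ?_ ?_
  · rintro ⟨⟨a, b⟩, ⟨c, d⟩⟩ h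
    simp only [Finset.mem_sigma, Finset.HasAntidiagonal.mem_antidiagonal] at h ⊢
    exact ⟨by rw [← h.1, ← h.2, add_assoc], trivial⟩
  · rintro ⟨⟨a, b⟩, ⟨c, d⟩⟩ h
    simp only [Finset.mem_sigma, Finset.HasAntidiagonal.mem_antidiagonal] at h ⊢
    exact ⟨by rw [← h.1, ← h.2, add_assoc], trivial⟩
  · rintro ⟨⟨a, b⟩, ⟨c, d⟩⟩ h
    simp only [Finset.mem_sigma, Finset.HasAntidiagonal.mem_antidiagonal] at h
    obtain ⟨h, rfl⟩ := h
    rfl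
  · rintro ⟨⟨a, b⟩, ⟨c, d⟩⟩ h
    simp only [Finset.mem_sigma, Finset.HasAntidiagonal.mem_antidiagonal] at h
    obtain ⟨h, rfl⟩ := h
    rfl
  · rintro ⟨⟨a, b⟩, ⟨c, d⟩⟩ h
    simp only [Finset.mem_sigma, Finset.HasAntidiagonal.mem_antidiagonal] at h
    obtain ⟨h, rfl⟩ := h
    simp only [crossings_add_left, crossings_add_right, oddDeg_add]
    congr 2
    omega

noncomputable instance : Ring (SSer A π) :=
  { (inferInstance : AddCommGroup (SSer A π)) with
    mul := (· * ·)
    one := 1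
    mul_assoc := mul_assoc'
    one_mul := fun F => ext fun k hk => by
      rw [coeff_mul hk, Finset.sum_eq_single (0, k)]
      · rw [coeff_one (fun _ _ => Nat.zero_le _)]
        simp [crossings_zero_left, oddDeg_zero]
      · rintro ⟨a, b⟩ hab hne
        rw [Finset.HasAntidiagonal.mem_antidiagonal] at hab
        have ha : a ≠ 0 := by
          rintro rfl
          exact hne (by simpa using hab)
        rw [coeff_one (adm_left (hab ▸ hk)), if_neg ha]
        simp
      · intro h
        exact absurd (by simp [Finset.HasAntidiagonal.mem_antidiagonal]) h
    mul_one := fun F => ext fun k hk => by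
      rw [coeff_mul hk, Finset.sum_eq_single (k, 0)]
      · rw [coeff_one (fun _ _ => Nat.zero_le _)]
        simp [crossings_zero_right]
      · rintro ⟨a, b⟩ hab hne
        rw [Finset.HasAntidiagonal.mem_antidiagonal] at hab
        have hb : b ≠ 0 := by
          rintro rfl
          exact hne (by simpa using hab)
        rw [coeff_one (adm_right (hab ▸ hk)), if_neg hb, iter_zero]
        simp
      · intro h
        exact absurd (by simp [Finset.HasAntidiagonal.mem_antidiagonal]) h
    zero_mul := fun F => ext fun k hk => by
      rw [coeff_mul hk]; simp [coeff_zero]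
    mul_zero := fun F => ext fun k hk => by
      rw [coeff_mul hk]; simp [coeff_zero]
    left_distrib := fun F G H => ext fun k hk => by
      rw [coeff_add, coeff_mul hk, coeff_mul hk, coeff_mul hk, ← Finset.sum_add_distrib]
      simp [coeff_add, mul_add]
    right_distrib := fun F G H => ext fun k hk => by
      rw [coeff_add, coeff_mul hk, coeff_mul hk, coeff_mul hk, ← Finset.sum_add_distrib]
      simp [coeff_add, add_mul] }

noncomputable instance : Algebra ℝ (SSer A π) :=
  Algebra.ofModule
    (fun c F G => ext fun k hk => by
      rw [coeff_smul, coeff_mul hk, coeff_mul hk, Finset.smul_sum]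
      refine Finset.sum_congr rfl fun x _ => ?_
      rw [coeff_smul, smul_mul_assoc, smul_comm])
    (fun c F G => ext fun k hk => by
      rw [coeff_smul, coeff_mul hk, coeff_mul hk, Finset.smul_sum]
      refine Finset.sum_congr rfl fun x _ => ?_
      rw [coeff_smul, iter_smul, mul_smul_comm, smul_comm])

end Mul
end SSer

namespace SSer
section Calculus
variable {A : Type*} [Ring A] [Algebra ℝ A] [SuperAlgebra A]
  {ι : Type*} [Fintype ι] [LinearOrder ι] {π : ι → Bool}

/-- The left partial derivative `∂ / ∂ X i`. -/
noncomputable def deriv (i : ι) (F : SSer A π) : SSer A π :=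
  mk π (fun m =>
    ((-1 : ℝ) ^ (if π i then oddDeg π (m.filter (· < i)) else 0) * ((m i : ℝ) + 1)) •
      SuperAlgebra.inv^[if π i then 1 else 0] (coeff (m + Finsupp.single i 1) F))

/-- `F` is even as an element of the superalgebra of power series. -/
def IsEven (F : SSer A π) : Prop := inv F = F

/-- `F` is odd as an element of the superalgebra of power series. -/
def IsOdd (F : SSer A π) : Prop := inv F = -F

end Calculus

section Subst
variable {A B : Type*} [Ring A] [Algebra ℝ A] [Ring B] [Algebra ℝ B] [SuperAlgebra B]
  {n : ℕ} {π : Fin n → Bool} {r : ℕ} {τ : Fin r → Bool}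

/-- The part of degree `N` of the substitution `F ↦ ∑ m, ρ (F m) * z ^ m`
of `z i` for the variables `X i`, where `ρ` is applied to the coefficients. -/
noncomputable def substDeg (ρ : A → SSer B τ) (z : Fin n → SSer B τ) (F : SSer A π) (N : ℕ) :
    SSer B τ :=
  ∑ m ∈ Finset.finsuppAntidiag Finset.univ N,
    ρ (coeff m F) * (List.ofFn fun i => z i ^ m i).prod

/-- The substitution `F ↦ ∑ m, ρ (F m) * z ^ m`, for `z i` without constant term. -/
noncomputable def subst (ρ : A → SSer B τ) (z : Fin n → SSer B τ) (F : SSer A π) : SSer B τ :=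
  orderSum (substDeg ρ z F)

end Subst
end SSer

/-! ### Graded supermanifolds -/

/-- The source of a chart as an open set. -/
abbrev srcOpens {X E : Type*} [TopologicalSpace X] [TopologicalSpace E]
    (χ : OpenPartialHomeomorph X E) : Opens X := ⟨χ.source, χ.open_source⟩

/-- Real-valued functions on the open set `W` that are smooth in the coordinates given by `χ`. -/
def smoothFun {X E : Type*} [TopologicalSpace X] [NormedAddCommGroup E] [NormedSpace ℝ E]
    (χ : OpenPartialHomeomorph X E) (W : Opens X) : Subalgebra ℝ (W → ℝ) where
  carrier := {f | ∀ x : W, ∃ F : E → ℝ, ContDiffAt ℝ ∞ F (χ x) ∧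
    ∀ᶠ z : W in nhds x, f z = F (χ z)}
  mul_mem' := by
    intro f g hf hg x
    obtain ⟨F, hF, hF'⟩ := hf x
    obtain ⟨G, hG, hG'⟩ := hg x
    refine ⟨fun z => F z * G z, hF.mul hG, ?_⟩
    filter_upwards [hF', hG'] with z h1 h2
    simp [h1, h2]
  add_mem' := by
    intro f g hf hg x
    obtain ⟨F, hF, hF'⟩ := hf x
    obtain ⟨G, hG, hG'⟩ := hg x
    refine ⟨fun z => F z + G z, hF.add hG, ?_⟩
    filter_upwards [hF', hG'] with z h1 h2
    simp [h1, h2]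
  algebraMap_mem' := fun c x => ⟨fun _ => c, contDiffAt_const, Filter.Eventually.of_forall fun _ => rfl⟩

/-- Smooth functions form a purely even superalgebra. -/
instance {X E : Type*} [TopologicalSpace X] [NormedAddCommGroup E] [NormedSpace ℝ E]
    (χ : OpenPartialHomeomorph X E) (W : Opens X) : SuperAlgebra (smoothFun χ W) where
  inv := AlgHom.id ℝ _
  inv_inv := fun _ => rfl
  even_comm := fun a b _ => mul_comm a b
  odd_comm := by
    intro a b ha _
    have h : a = 0 := by
      have h2 : (2 : ℝ) • a = 0 := by
        rw [two_smul]
        nth_rewrite 1 [show a = -a from ha]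
        exact neg_add_cancel a
      exact (smul_eq_zero.mp h2).resolve_left two_ne_zero
    simp [h]

namespace smoothFun
variable {X E : Type*} [TopologicalSpace X] [NormedAddCommGroup E] [NormedSpace ℝ E]
  {χ : OpenPartialHomeomorph X E}

/-- Restriction of smooth functions. -/
def res {W V : Opens X} (h : V ≤ W) (f : smoothFun χ W) : smoothFun χ V :=
  ⟨fun x => f.1 ⟨x, h x.2⟩, fun x => by
    obtain ⟨F, hF, hF'⟩ := f.2 ⟨x, h x.2⟩
    refine ⟨F, hF, ?_⟩
    have hc : Filter.Tendsto (fun z : V => (⟨z, h z.2⟩ : W)) (nhds x) (nhds ⟨x, h x.2⟩) :=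
      (Continuous.subtype_mk continuous_subtype_val _).tendsto _
    exact hc.eventually hF'⟩

/-- The smooth function given by a continuous linear function of the coordinates. -/
def ofLin (χ : OpenPartialHomeomorph X E) (W : Opens X) (l : E →L[ℝ] ℝ) : smoothFun χ W :=
  ⟨fun x => l (χ x), fun _ => ⟨l, l.contDiff.contDiffAt, Filter.Eventually.of_forall fun _ => rfl⟩⟩

open Classical in
/-- The function `f ∘ χ⁻¹` on the coordinate space, extended by zero. -/
noncomputable def inCoord {W : Opens X} (f : smoothFun χ W) (u : E) : ℝ :=
  if h : χ.symm u ∈ W then f.1 ⟨χ.symm u, h⟩ else 0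

theorem inCoord_eventuallyEq {W : Opens X} (hW : W ≤ srcOpens χ) (f : smoothFun χ W)
    (x : W) {F : E → ℝ} (h : ∀ᶠ z : W in nhds x, f.1 z = F (χ z)) :
    inCoord f =ᶠ[nhds (χ x)] F := by
  have hx : (x : X) ∈ χ.source := hW x.2
  have h' : ∀ᶠ z in nhds (x : X), ∀ hz : z ∈ W, f.1 ⟨z, hz⟩ = F (χ z) := by
    rw [nhds_subtype_eq_comap, Filter.eventually_comap] at h
    filter_upwards [h] with z hz hzW
    exact hz ⟨z, hzW⟩ rfl
  have hm : ∀ᶠ z in nhds (x : X), z ∈ W := W.isOpen.mem_nhds x.2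
  filter_upwards [(χ.tendsto_symm hx).eventually h', (χ.tendsto_symm hx).eventually hm,
    χ.eventually_right_inverse (χ.map_source hx)] with u h1 h2 h3
  rw [inCoord, dif_pos h2, h1 h2, h3]

/-- The derivative of a smooth function, in the direction `v` of the coordinate space. -/
noncomputable def dir {W : Opens X} (hW : W ≤ srcOpens χ) (v : E) (f : smoothFun χ W) :
    smoothFun χ W :=
  ⟨fun x => fderiv ℝ (inCoord f) (χ x) v, fun x => by
    obtain ⟨F, hF, hF'⟩ := f.2 x
    refine ⟨fun u => fderiv ℝ F u v,
      (hF.fderiv_right (m := ∞) (by simp)).clm_apply contDiffAt_const, ?_⟩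
    have h1 := (inCoord_eventuallyEq hW f x hF').fderiv (𝕜 := ℝ)
    have hc : Filter.Tendsto (fun z : W => χ z) (nhds x) (nhds (χ x)) :=
      (χ.continuousAt (hW x.2)).tendsto.comp continuous_subtype_val.continuousAt
    filter_upwards [hc.eventually h1] with z hz
    rw [hz]⟩

end smoothFun

/-- A topological space with a sheaf of supercommutative real superalgebras. -/
structure SuperSpace where
  pt : Type
  [top : TopologicalSpace pt]
  O : Opens pt → Type
  [ring : ∀ U, Ring (O U)]
  [alg : ∀ U, Algebra ℝ (O U)]
  [sup : ∀ U, SuperAlgebra (O U)]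
  res : ∀ {U V : Opens pt}, V ≤ U → O U →ₐ[ℝ] O V
  res_inv : ∀ {U V : Opens pt} (h : V ≤ U) (f : O U),
    res h (SuperAlgebra.inv f) = SuperAlgebra.inv (res h f)
  res_refl : ∀ {U : Opens pt} (f : O U), res le_rfl f = f
  res_res : ∀ {U V W : Opens pt} (h : V ≤ U) (h' : W ≤ V) (f : O U),
    res h' (res h f) = res (h'.trans h) f
  eq_of_locally_eq : ∀ {U : Opens pt} (f g : O U),
    (∀ x ∈ U, ∃ (W : Opens pt) (h : W ≤ U), x ∈ W ∧ res h f = res h g) → f = g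
  glue : ∀ {I : Type} (U : I → Opens pt) (f : ∀ i, O (U i)),
    (∀ i j, res (inf_le_left : U i ⊓ U j ≤ U i) (f i) = res inf_le_right (f j)) →
    ∃ g : O (iSup U), ∀ i, res (le_iSup U i) g = f i

attribute [instance] SuperSpace.top SuperSpace.ring SuperSpace.alg SuperSpace.sup

/-- The coordinate space of the even coordinates, for coordinates `i` of parity `π i`. -/
abbrev EvenSpace {n : ℕ} (π : Fin n → Bool) : Type := {i : Fin n // π i = false} → ℝ

/-- The parities of the odd coordinates (all odd). -/
abbrev allOdd {n : ℕ} (π : Fin n → Bool) : {i : Fin n // π i = true} → Bool := fun _ => true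

/-- A coordinate system on an open subset of a superspace, with coordinates `x i` of parity `π i`:
it identifies the sheaf on this subset with the sheaf `C^∞ ⊗ Λ(ξ)` of functions of the even and odd
coordinates. -/
structure Chart (X : SuperSpace) {n : ℕ} (π : Fin n → Bool) where
  body : OpenPartialHomeomorph X.pt (EvenSpace π)
  iso : ∀ W : Opens X.pt, W ≤ srcOpens body →
    X.O W ≃ₐ[ℝ] SSer (smoothFun body W) (allOdd π)
  iso_inv : ∀ W hW (f : X.O W), iso W hW (SuperAlgebra.inv f) = SSer.inv (iso W hW f)
  iso_res : ∀ (W V : Opens X.pt) (hW : W ≤ srcOpens body) (h : V ≤ W) (f : X.O W),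
    iso V (h.trans hW) (X.res h f) = SSer.map (smoothFun.res h) (iso W hW f)

namespace Chart
variable {X : SuperSpace} {n : ℕ} {π : Fin n → Bool} (c : Chart X π)

/-- The domain of a coordinate system. -/
abbrev dom : Opens X.pt := srcOpens c.body

/-- The coordinate `x i`, as a function on an open subset of the domain. -/
noncomputable def coord {W : Opens X.pt} (hW : W ≤ c.dom) (i : Fin n) : X.O W :=
  (c.iso W hW).symm
    (if h : π i = false then
      SSer.C _ (smoothFun.ofLin c.body W (ContinuousLinearMap.proj ⟨i, h⟩))
    else SSer.X _ _ ⟨i, by simpa using h⟩)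

/-- The (left) partial derivative `∂ / ∂ x i`, on an open subset of the domain. -/
noncomputable def pd {W : Opens X.pt} (hW : W ≤ c.dom) (i : Fin n) (f : X.O W) : X.O W :=
  (c.iso W hW).symm
    (if h : π i = false then
      SSer.map (smoothFun.dir hW (Pi.single ⟨i, h⟩ 1)) (c.iso W hW f)
    else SSer.deriv ⟨i, by simpa using h⟩ (c.iso W hW f))

end Chart

/-- A superspace with a weight (Euler) vector field, whose eigenfunctions with eigenvalue `k` are
the functions of weight `k`. -/
structure GradedSuperSpace extends SuperSpace where
  euler : ∀ U, O U →ₗ[ℝ] O U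
  euler_mul : ∀ U (f g : O U), euler U (f * g) = euler U f * g + f * euler U g
  euler_inv : ∀ U (f : O U), euler U (SuperAlgebra.inv f) = SuperAlgebra.inv (euler U f)
  euler_res : ∀ {U V : Opens pt} (h : V ≤ U) (f : O U), euler V (res h f) = res h (euler U f)

/-- The function `f` has weight `k`. -/
def GradedSuperSpace.HasWeight (X : GradedSuperSpace) {U : Opens X.pt} (f : X.O U) (k : ℤ) : Prop :=
  X.euler U f = (k : ℝ) • f

/-- A series with coefficients in functions on `U` has weight `k`, where the variable `X i` has
weight `u i`. -/
def GradedSuperSpace.SerHasWeight (X : GradedSuperSpace) {U : Opens X.pt} {n : ℕ} {π : Fin n → Bool}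
    (u : Fin n → ℤ) (F : SSer (X.O U) π) (k : ℤ) : Prop :=
  ∀ m, X.HasWeight (SSer.coeff m F) (k - ∑ i, (m i : ℤ) * u i)

/-- A coordinate system whose coordinates `x i` have weights `wt i`. -/
structure GradedChart (X : GradedSuperSpace) {n : ℕ} (π : Fin n → Bool) extends
    Chart X.toSuperSpace π where
  wt : Fin n → ℤ
  coord_weight : ∀ i, X.HasWeight (toChart.coord le_rfl i) (wt i)

/-- A (smooth) graded supermanifold, i.e. a supermanifold with a `ℤ`-grading by weights: it is
locally described by coordinates `x i`, `i < dim`, of parity `par i` and of certain weights. -/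
structure GradedSupermanifold extends GradedSuperSpace where
  dim : ℕ
  par : Fin dim → Bool
  t2 : T2Space pt
  sc : SecondCountableTopology pt
  exists_chart : ∀ x : pt, ∃ c : GradedChart toGradedSuperSpace par, x ∈ c.dom

namespace GradedSupermanifold

/-- The weighted coordinate systems of `M`. -/
abbrev Coord (M : GradedSupermanifold) := GradedChart M.toGradedSuperSpace M.par

/-- The functions on `M`. -/
abbrev Fun (M : GradedSupermanifold) := M.O ⊤

/-- Restriction of the coefficients of a series. -/
noncomputable def sres (M : GradedSupermanifold) {U V : Opens M.pt} (h : V ≤ U) {n : ℕ}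
    {π : Fin n → Bool} (F : SSer (M.O U) π) : SSer (M.O V) π := SSer.map (M.res h) F

/-- `f` is the sum of the family `F` of functions on `U`, which is locally finite in the sense that
near every point only finitely many members are non-zero. -/
def IsLocSum (M : GradedSupermanifold) {U : Opens M.pt} (F : ℕ → M.O U) (f : M.O U) : Prop :=
  ∀ x ∈ U, ∃ (W : Opens M.pt) (h : W ≤ U) (N₀ : ℕ), x ∈ W ∧
    (∀ N, N₀ ≤ N → M.res h (F N) = 0) ∧ ∑ N ∈ Finset.range N₀, M.res h (F N) = M.res h f

/-- The coefficientwise version of `IsLocSum` for power series. -/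
def IsLocSumSer (M : GradedSupermanifold) {U : Opens M.pt} {n : ℕ} {π : Fin n → Bool}
    (F : ℕ → SSer (M.O U) π) (f : SSer (M.O U) π) : Prop :=
  ∀ m, M.IsLocSum (fun N => SSer.coeff m (F N)) (SSer.coeff m f)

end GradedSupermanifold

/-! ### Master Hamiltonians and Hamilton-Jacobi vector fields -/

section Hamiltonian
variable {M : GradedSupermanifold}

/-- The canonical Poisson bracket on the cotangent bundle, in coordinates, for functions that are
formal power series in the momenta `p a` (`= X a`):
`(F, G) = ∑ (-1)^(ã(F̃+1)) ∂F/∂p_a ∂G/∂x^a - (-1)^(ãF̃) ∂F/∂x^a ∂G/∂p_a`. -/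
noncomputable def poisson (c : M.Coord) (F G : SSer (M.O c.dom) M.par) : SSer (M.O c.dom) M.par :=
  ∑ a, ((-1 : ℝ) ^ (if M.par a then 1 else 0) •
      (SSer.deriv a (SSer.inv^[if M.par a then 1 else 0] F) * SSer.map (c.pd le_rfl a) G) -
    SSer.map (c.pd le_rfl a) (SSer.inv^[if M.par a then 1 else 0] F) * SSer.deriv a G)

/-- A master Hamiltonian of a `k`-shifted `S_∞`-structure on `M`: an odd function `H` on
`T^*M[1-k]` of weight `2-k`, formal in the fibre directions, with `(H, H) = 0`. It is given by its
expression `H(x, p)` in all coordinate systems; under a change of coordinates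
`p_a = (∂x'^b/∂x^a) p'_b`, and the weight of `p_a` is `-w(x^a) + (1-k)`. -/
structure MasterHamiltonian (M : GradedSupermanifold) (k : ℤ) where
  H : ∀ c : M.Coord, SSer (M.O c.dom) M.par
  odd : ∀ c, (H c).IsOdd
  weight : ∀ c, M.SerHasWeight (fun a => (1 - k) - c.wt a) (H c) (2 - k)
  change : ∀ c c' : M.Coord,
    (M.sres inf_le_left (H c) : SSer (M.O (c.dom ⊓ c'.dom)) M.par).subst (SSer.C M.par)
      (fun a => ∑ b, SSer.C M.par (c.pd inf_le_left a (c'.coord inf_le_right b)) *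
        SSer.X _ M.par b) =
    M.sres inf_le_right (H c')
  master : ∀ c, poisson c (H c) (H c) = 0

/-- The homogeneous components, in the fibre degree `N`, of `H(x, ∂f/∂x)`, in coordinates, where `f`
is a function on `U` (depending on further parameters). -/
noncomputable def hamJacobi {k : ℤ} (H : MasterHamiltonian M k) (c : M.Coord) {U : Opens M.pt}
    (hU : U ≤ c.dom) {r : ℕ} {τ : Fin r → Bool} (f : SSer (M.O U) τ) (N : ℕ) : SSer (M.O U) τ :=
  SSer.substDeg (SSer.C τ) (fun a => SSer.map (c.pd hU a) f) (M.sres hU (H.H c)) N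

/-- `h = H(x, ∂f/∂x)`, i.e. `h` is the value at the point `f` (a function on `M`, depending on
parameters) of the Hamilton-Jacobi vector field `Q_H = ∫ Dx H(x, ∂f/∂x) δ/δf(x)`. -/
def IsHamJacobiValue {k : ℤ} (H : MasterHamiltonian M k) {r : ℕ} {τ : Fin r → Bool}
    (f h : SSer M.Fun τ) : Prop :=
  ∀ c : M.Coord, M.IsLocSumSer (hamJacobi H c le_rfl (M.sres le_top f)) (M.sres le_top h)

end Hamiltonian

/-! ### Thick morphisms -/

/-- A morphism of the underlying supermanifolds. -/
structure SuperMorphism (M₁ M₂ : GradedSupermanifold) where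
  base : C(M₁.pt, M₂.pt)
  pull : ∀ V : Opens M₂.pt, M₂.O V →ₐ[ℝ] M₁.O (Opens.comap base V)
  pull_inv : ∀ V (f : M₂.O V), pull V (SuperAlgebra.inv f) = SuperAlgebra.inv (pull V f)
  pull_res : ∀ {V W : Opens M₂.pt} (h : W ≤ V) (f : M₂.O V),
    pull W (M₂.res h f) = M₁.res (fun _ hx => h hx) (pull V f)

section Thick
variable {M₁ M₂ : GradedSupermanifold}

/-- The pullback of functions on `V`, restricted to an open subset of the preimage of `V`. -/
noncomputable def SuperMorphism.pullTo (φ : SuperMorphism M₁ M₂) {V : Opens M₂.pt} {U : Opens M₁.pt}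
    (h : U ≤ Opens.comap φ.base V) : M₂.O V →ₐ[ℝ] M₁.O U := (M₁.res h).comp (φ.pull V)

/-- The substitution `f(y) ↦ f(Y)` of the functions `Y i = φ^* y^i + ν i` for the coordinates `y^i`,
where `ν i` has no constant term. It is given by the Taylor expansion
`f(Y) = ∑ N, 1 / N! ∑ ν^{i_N} ⋯ ν^{i_1} φ^*(∂_{i_1} ⋯ ∂_{i_N} f)`. -/
noncomputable def taylor (φ : SuperMorphism M₁ M₂) (c : M₂.Coord) {V : Opens M₂.pt}
    (hV : V ≤ c.dom) {U : Opens M₁.pt} (hU : U ≤ Opens.comap φ.base V) {r : ℕ} {τ : Fin r → Bool}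
    (Y : Fin M₂.dim → SSer (M₁.O U) τ) (f : M₂.O V) : SSer (M₁.O U) τ :=
  SSer.orderSum fun N => ((N.factorial : ℝ)⁻¹) • ∑ w : Fin N → Fin M₂.dim,
    ((List.ofFn w).reverse.map fun i => Y i - SSer.C τ (φ.pullTo hU (c.coord hV i))).prod *
      SSer.C τ (φ.pullTo hU ((List.ofFn w).foldr (fun i g => c.pd hV i g) f))

/-- The functions `y^i = (-1)^ĩ ∂S/∂q_i`. -/
noncomputable def yOf {U : Opens M₁.pt} (S : SSer (M₁.O U) M₂.par) (i : Fin M₂.dim) :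
    SSer (M₁.O U) M₂.par :=
  (-1 : ℝ) ^ (if M₂.par i then 1 else 0) • SSer.deriv i S

/-- An `s`-shifted thick morphism `M₁ ⇸ M₂`. It is given, for every coordinate system on `M₂`, by
an even generating function `S(x, q) = S^0(x) + φ^i(x) q_i + ⋯` of weight `s`, a formal power series
in the momenta `q i` (`= X i`) of weights `-w(y^i) + s`, where `y^i = φ^i(x)` is a morphism
`φ : M₁ → M₂` (the support). Under a change of coordinates `q'_b = (∂y^i/∂y'^b) q_i` and
`S'(x, q') - y'^b q'_b = S(x, q) - y^i q_i`, where `y^i = (-1)^ĩ ∂S/∂q_i`, `y'^b = y'^b(y)`. -/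
structure ThickMorphism (M₁ M₂ : GradedSupermanifold) (s : ℤ) where
  φ : SuperMorphism M₁ M₂
  S : ∀ c : M₂.Coord, SSer (M₁.O (Opens.comap φ.base c.dom)) M₂.par
  even : ∀ c, (S c).IsEven
  weight : ∀ c, M₁.SerHasWeight (fun i => s - c.wt i) (S c) s
  support : ∀ c i, SSer.coeff (Finsupp.single i 1) (S c) = φ.pull c.dom (c.coord le_rfl i)
  change : ∀ c c' : M₂.Coord,
    let U := Opens.comap φ.base (c.dom ⊓ c'.dom)
    let S₁ : SSer (M₁.O U) M₂.par := M₁.sres (Opens.comap_mono φ.base inf_le_left) (S c)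
    let S₂ : SSer (M₁.O U) M₂.par := M₁.sres (Opens.comap_mono φ.base inf_le_right) (S c')
    let ψ : M₂.O (c.dom ⊓ c'.dom) → SSer (M₁.O U) M₂.par :=
      taylor φ c inf_le_left le_rfl (yOf S₁)
    let q : Fin M₂.dim → SSer (M₁.O U) M₂.par := SSer.X _ M₂.par
    let q' : Fin M₂.dim → SSer (M₁.O U) M₂.par := fun b =>
      ∑ i, ψ (c'.pd inf_le_right b (c.coord inf_le_left i)) * q i
    S₂.subst (SSer.C M₂.par) q' - ∑ b, ψ (c'.coord inf_le_right b) * q' b =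
      S₁ - ∑ i, yOf S₁ i * q i

/-- The Hamilton-Jacobi equation `H₁(x, ∂S/∂x) = H₂((-1)^ĩ ∂S/∂q_i, q)` in all coordinate systems.
(The left-hand side is the sum over the fibre degrees of `H₁`. This sum is finite in every
coefficient if `S^0 = 0`; in general it is part of the condition that it is locally finite.) -/
def ThickMorphism.HamiltonJacobi {k s : ℤ} (H₁ : MasterHamiltonian M₁ k)
    (H₂ : MasterHamiltonian M₂ k) (Φ : ThickMorphism M₁ M₂ s) : Prop :=
  ∀ (c₁ : M₁.Coord) (c₂ : M₂.Coord),
    let U := c₁.dom ⊓ Opens.comap Φ.φ.base c₂.dom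
    let S : SSer (M₁.O U) M₂.par := M₁.sres inf_le_right (Φ.S c₂)
    M₁.IsLocSumSer (hamJacobi H₁ c₁ inf_le_left S)
      ((H₂.H c₂).subst (taylor Φ.φ c₂ le_rfl inf_le_right (yOf S)) (SSer.X _ M₂.par))

/-- `f = Φ^* g`, for `g` a function on `M₂` depending on parameters: for all coordinates on `M₂`,
`f(x) = g(y) + S(x, q) - y^i q_i`, where `y^i = (-1)^ĩ ∂S/∂q_i(x, q)` and `q_i = ∂g/∂y^i(y)`. -/
def ThickMorphism.IsPullback {s : ℤ} (Φ : ThickMorphism M₁ M₂ s) {r : ℕ} {τ : Fin r → Bool}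
    (g : SSer M₂.Fun τ) (f : SSer M₁.Fun τ) : Prop :=
  ∀ c : M₂.Coord, ∃ y q : Fin M₂.dim → SSer (M₁.O (Opens.comap Φ.φ.base c.dom)) τ,
    (∀ i, y i = (yOf (Φ.S c) i).subst (SSer.C τ) q) ∧
    (∀ i, q i = (SSer.map (c.pd le_rfl i) (M₂.sres le_top g)).subst
      (taylor Φ.φ c le_rfl le_rfl y) (SSer.X _ τ)) ∧
    M₁.sres le_top f =
      (M₂.sres le_top g : SSer (M₂.O c.dom) τ).subst (taylor Φ.φ c le_rfl le_rfl y) (SSer.X _ τ) +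
        (Φ.S c).subst (SSer.C τ) q - ∑ i, y i * q i

end Thick

/-! ### Formal maps, brackets and `L_∞`-morphisms -/

/-- A family of multilinear maps `V^n → W`, `n ≥ 0`, of parity `e`, symmetric in the super sense.
For `e = false` these are the Taylor coefficients of a formal map of supermanifolds `V → W`, and for
`e = true` and `V = W` those of an odd formal vector field on `V`, i.e. a sequence of odd symmetric
brackets. -/
structure SymFamily (V W : Type) [Ring V] [Algebra ℝ V] [SuperAlgebra V] [Ring W] [Algebra ℝ W]
    [SuperAlgebra W] (e : Bool) where
  map : ∀ n, MultilinearMap ℝ (fun _ : Fin n => V) W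
  parity : ∀ n v, SuperAlgebra.inv (map n v) =
    (if e then (-1 : ℝ) else 1) • map n (fun j => SuperAlgebra.inv (v j))
  symm : ∀ n (p : Fin n → Bool) (v : Fin n → V), (∀ j, HasParity (p j) (v j)) →
    ∀ (i : ℕ) (h : i + 1 < n),
      map n (v ∘ Equiv.swap ⟨i, by omega⟩ ⟨i + 1, h⟩) =
        (if p ⟨i, by omega⟩ && p ⟨i + 1, h⟩ then (-1 : ℝ) else 1) • map n v

/-- The family has weight `d`, as a family of maps from `V[s]` to `W[s]`, where `V` and `W` are
the functions on `M` and `M'`, and where an element of weight `w + s` has weight `w` in the shifted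
space. -/
def SymFamily.HasShiftedWeight {M M' : GradedSupermanifold} {e : Bool}
    (F : SymFamily M.Fun M'.Fun e) (s d : ℤ) : Prop :=
  ∀ n (w : Fin n → ℤ) (v : Fin n → M.Fun), (∀ j, M.HasWeight (v j) (w j + s)) →
    M'.HasWeight (F.map n v) (∑ j, w j + d + s)

/-- `B` are the brackets `{f_1, …, f_n} = (…(H, f_1), …, f_n)|_M` generated by `H`. -/
def IsDerivedBrackets {M : GradedSupermanifold} {k : ℤ} (H : MasterHamiltonian M k)
    (B : SymFamily M.Fun M.Fun true) : Prop :=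
  ∀ n (v : Fin n → M.Fun) (c : M.Coord),
    M.res le_top (B.map n v) = SSer.coeff 0
      ((List.ofFn v).foldl (fun F f => poisson c F (SSer.C M.par (M.res le_top f))) (H.H c))

/-- The Koszul sign of the rearrangement of `v_1, …, v_n`, of parities `p`, by increasing labels
`l`, where the order is kept among elements with the same label. -/
noncomputable def koszul {n : ℕ} (p : Fin n → Bool) (l : Fin n → ℕ) : ℝ :=
  ∏ i, ∏ j, if i < j ∧ l j < l i ∧ p i = true ∧ p j = true then -1 else 1

/-- The elements of the tuple `v` with index in `I`, in their order. -/
def subTuple {n : ℕ} {V : Type} (v : Fin n → V) (I : Finset (Fin n)) : Fin I.card → V :=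
  fun j => v (I.orderEmbOfFin rfl j)

/-- `F` is an `L_∞`-morphism from the brackets `B₂` to the brackets `B₁`, equivalently a formal
`Q`-morphism for the corresponding formal vector fields: for homogeneous `v_1, …, v_n`, `n ≥ 0`,
`∑ ± F(B₂(v_I), v_J) = ∑ 1 / r! ∑ ± B₁(F(v_{K_1}), …, F(v_{K_r}))`,
where the first sum is over `I ⊔ J = {1, …, n}` and the second one is over `r` and all
`K_1 ⊔ ⋯ ⊔ K_r = {1, …, n}`, where the `K_b` may be empty. (The second sum is finite if the 0-ary
component of `F` is zero; otherwise it is part of the condition that it is locally finite.) -/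
def IsLInfMorphism {M₁ M₂ : GradedSupermanifold} (B₂ : SymFamily M₂.Fun M₂.Fun true)
    (B₁ : SymFamily M₁.Fun M₁.Fun true) (F : SymFamily M₂.Fun M₁.Fun false) : Prop :=
  ∀ n (p : Fin n → Bool) (v : Fin n → M₂.Fun), (∀ j, HasParity (p j) (v j)) →
    M₁.IsLocSum
      (fun r => ((r.factorial : ℝ)⁻¹) • ∑ κ : Fin n → Fin r, koszul p (fun j => κ j) •
        B₁.map r (fun b => F.map _ (subTuple v (Finset.univ.filter fun j => κ j = b))))
      (∑ I : Finset (Fin n), koszul p (fun j => if j ∈ I then 0 else 1) •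
        F.map (Iᶜ.card + 1) (Fin.cons (B₂.map _ (subTuple v I)) (subTuple v Iᶜ)))

/-- The Jacobi identities `∑ ± B(B(v_I), v_J) = 0` of an `L_∞`-structure (in its odd symmetric
form), where the sum is over `I ⊔ J = {1, …, n}`, `n ≥ 0`; equivalently, the odd formal vector field
with Taylor coefficients `B` is homological. -/
def SymFamily.Jacobi {M : GradedSupermanifold} (B : SymFamily M.Fun M.Fun true) : Prop :=
  ∀ n (p : Fin n → Bool) (v : Fin n → M.Fun), (∀ j, HasParity (p j) (v j)) →
    ∑ I : Finset (Fin n), koszul p (fun j => if j ∈ I then 0 else 1) •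
      B.map (Iᶜ.card + 1) (Fin.cons (B.map _ (subTuple v I)) (subTuple v Iᶜ)) = 0

/-! ### The nonlinear pullback as a formal map -/

/-- A formal point of the supermanifold of functions on `M`, over formal parameters of parities `τ`:
an even function depending on the parameters, which vanishes if the parameters are zero. -/
def IsFormalPoint {M : GradedSupermanifold} {r : ℕ} {τ : Fin r → Bool} (g : SSer M.Fun τ) : Prop :=
  g.IsEven ∧ SSer.coeff 0 g = 0

namespace ThickMorphism
variable {M₁ M₂ : GradedSupermanifold} {s : ℤ}

/-- `Φ^*` is a well-defined formal map from the supermanifold of functions on `M₂`, shifted by `s`,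
to that of functions on `M₁`: every formal point `g` has a unique image `f = Φ^* g`, which is even,
and which has weight `s` if `g` has weight `s` (with respect to any weights of the parameters). -/
def PullbackWellDefined (Φ : ThickMorphism M₁ M₂ s) : Prop :=
  ∀ (r : ℕ) (τ : Fin r → Bool) (g : SSer M₂.Fun τ), IsFormalPoint g →
    ∃ f : SSer M₁.Fun τ, Φ.IsPullback g f ∧ (∀ f', Φ.IsPullback g f' → f' = f) ∧ f.IsEven ∧
      ∀ u : Fin r → ℤ, M₂.SerHasWeight u g s → M₁.SerHasWeight u f s

/-- `Φ^*` maps the Hamilton-Jacobi vector field `Q₂` of `H₂` to `Q₁` of `H₁`: for every odd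
parameter `ε`, `Φ^*(g + Q₂(g) ε) = Φ^*(g) + Q₁(Φ^*(g)) ε`. -/
def IsFormalQMorphism {k : ℤ} (Φ : ThickMorphism M₁ M₂ s) (H₁ : MasterHamiltonian M₁ k)
    (H₂ : MasterHamiltonian M₂ k) : Prop :=
  ∀ (r : ℕ) (τ : Fin r → Bool) (g : SSer M₂.Fun τ) (f : SSer M₁.Fun τ),
    IsFormalPoint g → Φ.IsPullback g f →
    ∃ (h₂ : SSer M₂.Fun τ) (h₁ : SSer M₁.Fun τ),
      IsHamJacobiValue H₂ g h₂ ∧ IsHamJacobiValue H₁ f h₁ ∧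
      ∀ ε, τ ε = true → Φ.IsPullback (g + h₂ * SSer.X _ τ ε) (f + h₁ * SSer.X _ τ ε)

/-- `F` are the Taylor coefficients of the formal map `Φ^*`: up to the sign that arises from the
reordering of parameters, `F_n(v_1, …, v_n)` is the coefficient of `t_1 ⋯ t_n` in
`Φ^*(v_1 t_1 + ⋯ + v_n t_n)`, where `t_j` has the parity of `v_j`. -/
def IsTaylorOfPullback (Φ : ThickMorphism M₁ M₂ s) (F : SymFamily M₂.Fun M₁.Fun false) : Prop :=
  ∀ n (p : Fin n → Bool) (v : Fin n → M₂.Fun), (∀ j, HasParity (p j) (v j)) →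
    ∀ f : SSer M₁.Fun p, Φ.IsPullback (∑ j, SSer.C p (v j) * SSer.X _ p j) f →
      SSer.coeff (∑ j, Finsupp.single j 1) f = koszul p (fun j => n - j) • F.map n v

end ThickMorphism

/-! For a formal point `g` the equations of the pullback are a fixed point problem for the momenta:
`q = (∂g/∂y)(y)`, where `y = ± ∂S/∂q (x, q)`. Since `g` vanishes together with the parameters, a
change of `q` in order `N` (in the parameters) changes the right-hand side only in order `N + 1`
(`solOp_contract`). Hence over every chart of `M₂` there is exactly one solution. The transformation
law of `S` carries solutions to solutions with the same value (`IsGoodSol.change`), so the local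
values glue.

The heart of the matter is that `f = g(y) + S(x, q) - y q` is a critical value: by the two equations
its variations in `y` and in `q` cancel. A derivation therefore only sees the explicit dependence of
`g` and `S` on the variables (`IsGoodSol.pval_der`). This is used for three kinds of derivations.
The weight field gives the weight of `f`. A parameter derivative gives `∂f/∂t = (∂g/∂t)(y)`, so that
the tangent map of the pullback at `g` is the substitution `h ↦ h(y)`, which is even a homomorphism.
A derivative along `M₁` gives `∂f/∂x = (∂S/∂x)(x, q(x))`. Inserting `q = q(x)` into the
Hamilton-Jacobi equation of `S` yields `H₁(x, ∂f/∂x) = H₂(y, q)` with `q = (∂g/∂y)(y)`; that is,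
`Q_{H₁}(f)` is the image of `Q_{H₂}(g)` under the tangent map (`isHamJacobiValue_dir`). With the
expansion of a formal map in an odd parameter (`FormalMap.val_add_mul_X`) this is the formal
`Q`-morphism property.

The `L_∞` statements are the coefficients of `t_1 ⋯ t_n` of such identities at the formal point `∑
v_j t_j`. The structure `FormalMap` records what this needs: values, derivatives, and naturality
under changes of parameters. The coefficient is linear in `v_i` because one derivative in `t_i`
turns `v_i` into a direction (`coeff_dir_lin_update`), and it is symmetric because parameters may be
permuted. A derivative along a vector field expands into sums over `I ⊔ J` (`coeff_chi_dir_val`),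
and the part of degree `r` of `H(x, ∂f/∂x)` expands into `r`-fold derived brackets
(`coeff_chi_substDeg`). The Jacobi identities are the coefficients of the vanishing derivative of
`Q_H` along itself (`IsFP.evd_ev`): the second derivatives of `g` are symmetric, the products of
momentum derivatives of the odd `H` are antisymmetric, and what remains is the master equation.

Two uniqueness principles support the calculus. On the analytic side, a derivation along a morphism
that kills the coordinates is zero (`SuperMorphism.der_eq_zero`); this follows from Hadamard's lemma
and an induction on the order in the odd coordinates, and it gives the chain rules, the commutation
of partial derivatives and the coordinate form of the weight field. On the formal side polynomials
are dense, so that continuous homomorphisms or derivations of power series agree as soon as they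
agree on constants and variables (`hom_ext`, `der_ext`). -/

set_option linter.unusedSectionVars false

/-! ### Signs and parities -/

/-- The sign `-1` of an odd, `1` of an even parity. -/
def sgn (e : Bool) : ℝ := if e then -1 else 1

@[simp] theorem sgn_false : sgn false = 1 := rfl
@[simp] theorem sgn_true : sgn true = -1 := rfl
theorem sgn_mul (e f : Bool) : sgn e * sgn f = sgn (e ^^ f) := by cases e <;> cases f <;> simp
@[simp] theorem sgn_mul_self (e : Bool) : sgn e * sgn e = 1 := by cases e <;> simp
theorem neg_one_pow_ite (e : Bool) : (-1 : ℝ) ^ (if e = true then 1 else 0) = sgn e := by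
  cases e <;> simp
theorem neg_one_pow_eq_sgn (n : ℕ) : (-1 : ℝ) ^ n = sgn n.bodd := by
  induction n with
  | zero => simp
  | succ n ih => rw [pow_succ, ih, Nat.bodd_succ]; cases n.bodd <;> simp

section Parity
variable {A : Type*} [Ring A] [Algebra ℝ A] [SuperAlgebra A]

/-- The power of the parity involution with the given parity as exponent. -/
noncomputable def pinv (e : Bool) : A →ₐ[ℝ] A := if e then SuperAlgebra.inv else AlgHom.id ℝ A

@[simp] theorem pinv_false (a : A) : pinv false a = a := rfl
theorem pinv_true (a : A) : pinv true a = SuperAlgebra.inv a := rfl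
theorem pinv_pinv (e f : Bool) (a : A) : pinv e (pinv f a) = pinv (e ^^ f) a := by
  cases e <;> cases f <;> simp [pinv_true, SuperAlgebra.inv_inv]
@[simp] theorem pinv_self (e : Bool) (a : A) : pinv e (pinv e a) = a := by simp [pinv_pinv]
theorem pinv_comm (e f : Bool) (a : A) : pinv e (pinv f a) = pinv f (pinv e a) := by
  rw [pinv_pinv, pinv_pinv, Bool.xor_comm]
theorem inv_iterate (n : ℕ) (a : A) : SuperAlgebra.inv^[n] a = pinv n.bodd a := by
  induction n with
  | zero => simp
  | succ n ih =>
    rw [Function.iterate_succ_apply', ih, ← pinv_true, pinv_pinv, Nat.bodd_succ]; simp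
theorem inv_iterate_ite (e : Bool) (a : A) :
    SuperAlgebra.inv^[if e = true then 1 else 0] a = pinv e a := by cases e <;> rfl

theorem hasParity_iff {e : Bool} {a : A} : HasParity e a ↔ SuperAlgebra.inv a = sgn e • a := by
  cases e <;> simp [HasParity]
theorem HasParity.pinv_eq {e : Bool} {a : A} (h : HasParity e a) (f : Bool) :
    pinv f a = sgn (f && e) • a := by
  cases f
  · simp
  · simpa [pinv_true] using hasParity_iff.1 h
theorem HasParity.mul {e f : Bool} {a b : A} (ha : HasParity e a) (hb : HasParity f b) :
    HasParity (e ^^ f) (a * b) := by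
  rw [hasParity_iff] at *
  rw [map_mul, ha, hb, smul_mul_smul_comm, sgn_mul]
theorem HasParity.add {e : Bool} {a b : A} (ha : HasParity e a) (hb : HasParity e b) :
    HasParity e (a + b) := by
  rw [hasParity_iff] at *; rw [map_add, ha, hb, smul_add]
theorem HasParity.sub {e : Bool} {a b : A} (ha : HasParity e a) (hb : HasParity e b) :
    HasParity e (a - b) := by
  rw [hasParity_iff] at *; rw [map_sub, ha, hb, smul_sub]
theorem HasParity.smul {e : Bool} {a : A} (c : ℝ) (ha : HasParity e a) : HasParity e (c • a) := by
  rw [hasParity_iff] at *; rw [map_smul, ha, smul_comm]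
theorem HasParity.zero {e : Bool} : HasParity e (0 : A) := by
  rw [hasParity_iff]; simp
theorem HasParity.one : HasParity false (1 : A) := by
  rw [hasParity_iff]; simp
theorem HasParity.sum {e : Bool} {κ : Type*} {s : Finset κ} {a : κ → A}
    (h : ∀ i ∈ s, HasParity e (a i)) : HasParity e (∑ i ∈ s, a i) := by
  rw [hasParity_iff, map_sum, Finset.smul_sum]
  exact Finset.sum_congr rfl fun i hi => hasParity_iff.1 (h i hi)
theorem HasParity.pinv {e : Bool} {a : A} (ha : HasParity e a) (f : Bool) :
    HasParity e (pinv f a) := by rw [ha.pinv_eq]; exact ha.smul _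

/-- The component of parity `e`. -/
noncomputable def parPart (e : Bool) : A →ₗ[ℝ] A :=
  (2⁻¹ : ℝ) • (LinearMap.id + sgn e • (SuperAlgebra.inv : A →ₐ[ℝ] A).toLinearMap)
theorem parPart_apply (e : Bool) (a : A) :
    parPart e a = (2⁻¹ : ℝ) • (a + sgn e • SuperAlgebra.inv a) := rfl
theorem parPart_hasParity (e : Bool) (a : A) : HasParity e (parPart e a) := by
  rw [hasParity_iff, parPart_apply, map_smul, map_add, map_smul, SuperAlgebra.inv_inv,
    smul_comm (sgn e), smul_add (sgn e), smul_smul (sgn e) (sgn e), sgn_mul_self, one_smul, add_comm]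
theorem parPart_add (a : A) : parPart false a + parPart true a = a := by
  simp only [parPart_apply, sgn_false, sgn_true]; module
theorem HasParity.parPart {e : Bool} {a : A} (h : HasParity e a) (f : Bool) :
    parPart f a = if f = e then a else 0 := by
  rw [parPart_apply, hasParity_iff.1 h, smul_smul]
  cases f <;> cases e <;> simp <;> module

/-- The sign rule for an inhomogeneous factor: splitting `b` into its parity components shows that
the involution inserts the right sign in each of them. This avoids case distinctions on the parity
of `b` later on. -/
theorem HasParity.comm {e : Bool} {a : A} (ha : HasParity e a) (b : A) :
    a * b = _root_.pinv e b * a := by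
  cases e
  · exact SuperAlgebra.even_comm a b (by simpa [hasParity_iff] using ha)
  · have hb := parPart_add b
    have h0 := parPart_hasParity false b
    have h1 := parPart_hasParity true b
    rw [← hb, mul_add, map_add, add_mul, h0.pinv_eq, h1.pinv_eq,
      SuperAlgebra.odd_comm a (_root_.parPart true b) (by simpa [hasParity_iff] using ha)
        (by simpa [hasParity_iff] using h1),
      ← SuperAlgebra.even_comm (_root_.parPart false b) a (by simpa [hasParity_iff] using h0)]
    simp
theorem HasParity.comm' {e : Bool} {a : A} (ha : HasParity e a) (b : A) :
    b * a = a * _root_.pinv e b := by rw [ha.comm, pinv_self]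
theorem HasParity.comm_sgn {e f : Bool} {a b : A} (ha : HasParity e a) (hb : HasParity f b) :
    a * b = sgn (e && f) • (b * a) := by rw [ha.comm, hb.pinv_eq, smul_mul_assoc]
theorem HasParity.sq_odd {a : A} (ha : HasParity true a) : a * a = 0 := by
  have h := ha.comm_sgn ha
  simp only [Bool.and_self, sgn_true, neg_smul, one_smul] at h
  have h2 : (2 : ℝ) • (a * a) = 0 := by
    rw [two_smul]; nth_rw 1 [h]; simp
  exact (smul_eq_zero.1 h2).resolve_left two_ne_zero

end Parity

/-- A homomorphism that preserves parities. -/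
def IsSuper {A B : Type*} [Ring A] [Algebra ℝ A] [SuperAlgebra A] [Ring B] [Algebra ℝ B]
    [SuperAlgebra B] (f : A →ₐ[ℝ] B) : Prop := ∀ a, f (SuperAlgebra.inv a) = SuperAlgebra.inv (f a)

section Hom
variable {A B D : Type*} [Ring A] [Algebra ℝ A] [SuperAlgebra A] [Ring B] [Algebra ℝ B]
  [SuperAlgebra B] [Ring D] [Algebra ℝ D] [SuperAlgebra D]

theorem IsSuper.pinv {f : A →ₐ[ℝ] B} (hf : IsSuper f) (e : Bool) (a : A) :
    f (pinv e a) = _root_.pinv e (f a) := by cases e; exacts [rfl, hf a]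
theorem IsSuper.hasParity {f : A →ₐ[ℝ] B} (hf : IsSuper f) {e : Bool} {a : A}
    (h : HasParity e a) : HasParity e (f a) := by
  rw [hasParity_iff] at *; rw [← hf, h, map_smul]
theorem IsSuper.id : IsSuper (AlgHom.id ℝ A) := fun _ => rfl
theorem IsSuper.comp {f : B →ₐ[ℝ] D} {g : A →ₐ[ℝ] B} (hf : IsSuper f) (hg : IsSuper g) :
    IsSuper (f.comp g) := fun a => by simp [hg a, hf (g a)]

/-- `D` is a (left) superderivation of parity `e` along the homomorphism `θ`. -/
structure IsDer (θ : A →ₐ[ℝ] B) (e : Bool) (D : A →ₗ[ℝ] B) : Prop where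
  leib : ∀ a b, D (a * b) = D a * θ b + pinv e (θ a) * D b
  par : ∀ a, D (SuperAlgebra.inv a) = sgn e • SuperAlgebra.inv (D a)

namespace IsDer
variable {θ : A →ₐ[ℝ] B} {e : Bool} {D₁ D₂ : A →ₗ[ℝ] B}

theorem map_one (h : IsDer θ e D₁) : D₁ 1 = 0 := by
  have := h.leib 1 1
  simpa using this
theorem map_algebraMap (h : IsDer θ e D₁) (c : ℝ) : D₁ (algebraMap ℝ A c) = 0 := by
  rw [Algebra.algebraMap_eq_smul_one, map_smul, h.map_one, smul_zero]
theorem zero : IsDer θ e (0 : A →ₗ[ℝ] B) := ⟨fun _ _ => by simp, fun _ => by simp⟩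
theorem add (h₁ : IsDer θ e D₁) (h₂ : IsDer θ e D₂) : IsDer θ e (D₁ + D₂) :=
  ⟨fun a b => by simp only [LinearMap.add_apply, h₁.leib, h₂.leib]; noncomm_ring,
   fun a => by simp only [LinearMap.add_apply, h₁.par, h₂.par, map_add, smul_add]⟩
theorem smul (h₁ : IsDer θ e D₁) (c : ℝ) : IsDer θ e (c • D₁) :=
  ⟨fun a b => by
    simp only [LinearMap.smul_apply, h₁.leib, smul_add, smul_mul_assoc, mul_smul_comm],
   fun a => by simp only [LinearMap.smul_apply, h₁.par, map_smul, smul_comm c]⟩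
theorem sub (h₁ : IsDer θ e D₁) (h₂ : IsDer θ e D₂) : IsDer θ e (D₁ - D₂) := by
  have := h₁.add (h₂.smul (-1))
  have h3 : D₁ - D₂ = D₁ + (-1 : ℝ) • D₂ := by module
  rwa [h3]
theorem sum {κ : Type*} {s : Finset κ} {D : κ → A →ₗ[ℝ] B} (h : ∀ i ∈ s, IsDer θ e (D i)) :
    IsDer θ e (∑ i ∈ s, D i) := by
  classical
  induction s using Finset.induction_on with
  | empty => simpa using zero
  | insert i s hi ih =>
    rw [Finset.sum_insert hi]
    exact (h i (by simp)).add (ih fun j hj => h j (by simp [hj]))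
theorem mulLeft (h : IsDer θ e D₁) {f : Bool} {b : B} (hb : HasParity f b) :
    IsDer θ (f ^^ e) ((LinearMap.mulLeft ℝ b).comp D₁) :=
  ⟨fun a c => by
    simp only [LinearMap.comp_apply, LinearMap.mulLeft_apply, h.leib, mul_add, ← mul_assoc]
    rw [hb.comm (pinv e (θ a)), pinv_pinv],
   fun a => by
    simp only [LinearMap.comp_apply, LinearMap.mulLeft_apply, h.par, map_mul, hasParity_iff.1 hb,
      mul_smul_comm, smul_mul_assoc, smul_smul]
    rw [← sgn_mul, mul_comm (sgn f), mul_assoc, sgn_mul_self, mul_one]⟩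
theorem post (h : IsDer θ e D₁) {η : B →ₐ[ℝ] D} (hη : IsSuper η) :
    IsDer (η.comp θ) e (η.toLinearMap.comp D₁) :=
  ⟨fun a c => by simp [h.leib, hη.pinv], fun a => by simp [h.par, hη _]⟩
theorem pre (h : IsDer θ e D₁) {η : D →ₐ[ℝ] A} (hη : IsSuper η) :
    IsDer (θ.comp η) e (D₁.comp η.toLinearMap) :=
  ⟨fun a c => by simp [h.leib], fun a => by simp [h.par, hη _]⟩
theorem pinv_apply (h : IsDer θ e D₁) (f : Bool) (a : A) :
    D₁ (pinv f a) = sgn (f && e) • pinv f (D₁ a) := by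
  cases f
  · simp
  · simpa [pinv_true] using h.par a
theorem hasParity (h : IsDer θ e D₁) {f : Bool} {a : A} (ha : HasParity f a) :
    HasParity (e ^^ f) (D₁ a) := by
  have h1 := h.par a
  rw [hasParity_iff.1 ha, map_smul] at h1
  rw [hasParity_iff, ← sgn_mul, ← smul_smul, h1, smul_smul, sgn_mul_self, one_smul]

end IsDer
end Hom

/-- The supercommutator of two superderivations is a superderivation. -/
theorem IsDer.comm {A : Type*} [Ring A] [Algebra ℝ A] [SuperAlgebra A] {e f : Bool}
    {D₁ D₂ : A →ₗ[ℝ] A} (h₁ : IsDer (AlgHom.id ℝ A) e D₁) (h₂ : IsDer (AlgHom.id ℝ A) f D₂) :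
    IsDer (AlgHom.id ℝ A) (e ^^ f) (D₁ ∘ₗ D₂ - sgn (e && f) • D₂ ∘ₗ D₁) := by
  refine ⟨fun a b => ?_, fun a => ?_⟩
  · simp only [LinearMap.sub_apply, LinearMap.comp_apply, LinearMap.smul_apply, h₁.leib, h₂.leib,
      map_add, AlgHom.id_apply, h₁.pinv_apply, h₂.pinv_apply, pinv_pinv]
    rw [Bool.xor_comm f e, Bool.and_comm f e]
    simp only [smul_add, smul_mul_assoc, smul_smul, sub_mul, mul_sub, mul_smul_comm, sgn_mul_self,
      one_smul]
    abel
  · simp only [LinearMap.sub_apply, LinearMap.comp_apply, LinearMap.smul_apply, h₁.par, h₂.par,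
      map_smul, map_sub, smul_sub, smul_smul, ← sgn_mul]
    ring_nf

/-! ### Power series: the parity grading and the filtration by order -/

namespace SSer
section
variable {A : Type*} [Ring A] [Algebra ℝ A] [SuperAlgebra A] {ι : Type*} [Fintype ι]
  [LinearOrder ι] {π : ι → Bool}

noncomputable instance : Module ℝ (SSer A π) := Algebra.toModule

theorem coeff_of_not_adm {m : ι →₀ ℕ} (h : ¬ Adm π m) (F : SSer A π) : coeff m F = 0 := F.2 m h

/-- The coefficient as a linear map. -/
def coeffL (m : ι →₀ ℕ) : SSer A π →ₗ[ℝ] A where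
  toFun := coeff m
  map_add' := coeff_add m
  map_smul' := coeff_smul m
theorem coeff_sub (m : ι →₀ ℕ) (F G : SSer A π) : coeff m (F - G) = coeff m F - coeff m G :=
  map_sub (coeffL m) F G
theorem coeff_sum {κ : Type*} (s : Finset κ) (F : κ → SSer A π) (m : ι →₀ ℕ) :
    coeff m (∑ i ∈ s, F i) = ∑ i ∈ s, coeff m (F i) := map_sum (coeffL m) F s

theorem adm_zero : Adm π 0 := fun _ _ => Nat.zero_le _
theorem adm_single (i : ι) : Adm π (Finsupp.single i 1) := fun j _ => by
  classical
  rw [Finsupp.single_apply]; split <;> omega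

theorem coeff_C (a : A) (m : ι →₀ ℕ) [Decidable (m = 0)] :
    coeff m (C π a) = if m = 0 then a else 0 := by
  by_cases h : Adm π m
  · rw [C, coeff_mk h]; congr
  · rw [coeff_of_not_adm h, if_neg]; rintro rfl; exact h adm_zero
theorem coeff_X (i : ι) (m : ι →₀ ℕ) [Decidable (m = Finsupp.single i 1)] :
    coeff m (X A π i) = if m = Finsupp.single i 1 then 1 else 0 := by
  by_cases h : Adm π m
  · rw [X, coeff_mk h]; congr
  · rw [coeff_of_not_adm h, if_neg]; rintro rfl; exact h (adm_single i)
theorem coeff_map {B : Type*} [Ring B] [Algebra ℝ B] [SuperAlgebra B] {f : A → B} (h0 : f 0 = 0) (F : SSer A π)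
    (m : ι →₀ ℕ) : coeff m (map f F) = f (coeff m F) := by
  by_cases h : Adm π m
  · rw [map, coeff_mk h]
  · rw [coeff_of_not_adm h, coeff_of_not_adm h, h0]

/-- The coefficientwise application of a linear map. -/
noncomputable def mapL {B : Type*} [Ring B] [Algebra ℝ B] [SuperAlgebra B] (f : A →ₗ[ℝ] B) :
    SSer A π →ₗ[ℝ] SSer B π where
  toFun := map f
  map_add' F G := ext fun m _ => by simp [coeff_map, coeff_add]
  map_smul' c F := ext fun m _ => by simp [coeff_map, coeff_smul]
theorem coeff_mapL {B : Type*} [Ring B] [Algebra ℝ B] [SuperAlgebra B] (f : A →ₗ[ℝ] B) (F : SSer A π)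
    (m : ι →₀ ℕ) : coeff m (mapL f F) = f (coeff m F) := coeff_map (map_zero f) F m

/-- The series of order at least `N`. -/
def ordGE (A : Type*) [Ring A] [Algebra ℝ A] [SuperAlgebra A] (π : ι → Bool) (N : ℕ) : Submodule ℝ (SSer A π) where
  carrier := {F | ∀ m, m.degree < N → coeff m F = 0}
  add_mem' := fun ha hb m hm => by rw [coeff_add, ha m hm, hb m hm, add_zero]
  zero_mem' := fun _ _ => rfl
  smul_mem' := fun c a ha m hm => by rw [coeff_smul, ha m hm, smul_zero]
theorem ordGE_zero (F : SSer A π) : F ∈ ordGE A π 0 := fun m hm => absurd hm (by omega)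
theorem ordGE_anti {M N : ℕ} (h : M ≤ N) {F : SSer A π} (hF : F ∈ ordGE A π N) :
    F ∈ ordGE A π M := fun m hm => hF m (by omega)
-- The filtration by order is separated, because every exponent has finite degree. All arguments by
-- successive approximation end here.
theorem eq_zero_of_ordGE {F : SSer A π} (h : ∀ N, F ∈ ordGE A π N) : F = 0 :=
  ext fun m _ => h (m.degree + 1) m (by omega)
theorem eq_of_ordGE {F G : SSer A π} (h : ∀ N, F - G ∈ ordGE A π N) : F = G :=
  sub_eq_zero.1 (eq_zero_of_ordGE h)
theorem degree_eq_zero_iff' {m : ι →₀ ℕ} : m.degree = 0 ↔ m = 0 := Finsupp.degree_eq_zero_iff m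
theorem mem_ordGE_one {F : SSer A π} : F ∈ ordGE A π 1 ↔ coeff 0 F = 0 := by
  refine ⟨fun h => h 0 (by simp), fun h m hm => ?_⟩
  rw [degree_eq_zero_iff'.1 (by omega : m.degree = 0), h]
theorem mapL_ordGE {B : Type*} [Ring B] [Algebra ℝ B] [SuperAlgebra B] (f : A →ₗ[ℝ] B) {N : ℕ} {F : SSer A π}
    (h : F ∈ ordGE A π N) : mapL f F ∈ ordGE B π N := fun m hm => by
  rw [coeff_mapL, h m hm, map_zero]

/-- `orderSum` is a sum in the topology given by the filtration. -/
theorem orderSum_sub_mem {F : ℕ → SSer A π} (h : ∀ N, F N ∈ ordGE A π N) {M N : ℕ} (hMN : N ≤ M) :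
    orderSum F - ∑ i ∈ Finset.range M, F i ∈ ordGE A π N := by
  intro m hm
  rw [coeff_sub, coeff_sum]
  by_cases ha : Adm π m
  · rw [orderSum, coeff_mk ha, sub_eq_zero]
    refine Finset.sum_subset (fun i hi => ?_) (fun i _ hi => ?_)
    · simp only [Finset.mem_range] at *; omega
    · exact h i m (by simpa using hi)
  · simp [coeff_of_not_adm ha]
theorem orderSum_add (F G : ℕ → SSer A π) :
    orderSum (fun N => F N + G N) = orderSum F + orderSum G := ext fun m h => by
  simp only [orderSum, coeff_add, coeff_mk h, Finset.sum_add_distrib]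
theorem orderSum_smul (c : ℝ) (F : ℕ → SSer A π) :
    orderSum (fun N => c • F N) = c • orderSum F := ext fun m h => by
  simp only [orderSum, coeff_smul, coeff_mk h, Finset.smul_sum]
theorem orderSum_mem {F : ℕ → SSer A π} {N : ℕ} (h : ∀ i, F i ∈ ordGE A π N) :
    orderSum F ∈ ordGE A π N := fun m hm => by
  by_cases ha : Adm π m
  · rw [orderSum, coeff_mk ha]
    exact Finset.sum_eq_zero fun i _ => h i m hm
  · exact coeff_of_not_adm ha _

end

section Mul
variable {A : Type*} [Ring A] [Algebra ℝ A] [SuperAlgebra A]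
  {ι : Type*} [Fintype ι] [LinearOrder ι] {π : ι → Bool}

/-- The parity of the monomial `X ^ m`. -/
def opar (π : ι → Bool) (m : ι →₀ ℕ) : Bool := (oddDeg π m).bodd
@[simp] theorem opar_zero : opar π 0 = false := by simp [opar, oddDeg_zero]
theorem opar_add (m n : ι →₀ ℕ) : opar π (m + n) = (opar π m ^^ opar π n) := by
  simp [opar, oddDeg_add]
theorem oddDeg_single (i : ι) (c : ℕ) :
    oddDeg π (Finsupp.single i c) = if π i then c else 0 := by
  rw [oddDeg, Finset.sum_eq_single i]
  · simp
  · intro j _ hj; simp [Finsupp.single_apply, hj.symm]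
  · simp
theorem opar_single (i : ι) : opar π (Finsupp.single i 1) = π i := by
  rw [opar, oddDeg_single]; cases π i <;> simp

theorem coeff_mul' {k : ι →₀ ℕ} (h : Adm π k) (F G : SSer A π) :
    coeff k (F * G) = ∑ x ∈ Finset.HasAntidiagonal.antidiagonal k,
      (-1 : ℝ) ^ crossings π x.1 x.2 • (coeff x.1 F * pinv (opar π x.1) (coeff x.2 G)) := by
  rw [coeff_mul h]
  simp only [inv_iterate, opar]
theorem coeff_zero_mul (F G : SSer A π) : coeff 0 (F * G) = coeff 0 F * coeff 0 G := by
  rw [coeff_mul' adm_zero]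
  simp [crossings_zero_left]
theorem coeff_zero_one : coeff 0 (1 : SSer A π) = 1 := by
  rw [coeff_one adm_zero, if_pos rfl]

theorem mul_ordGE {M N : ℕ} {F G : SSer A π} (hF : F ∈ ordGE A π M) (hG : G ∈ ordGE A π N) :
    F * G ∈ ordGE A π (M + N) := fun m hm => by
  by_cases ha : Adm π m
  · rw [coeff_mul' ha]
    refine Finset.sum_eq_zero fun x hx => ?_
    have hd : x.1.degree + x.2.degree = m.degree := by
      rw [← Finset.HasAntidiagonal.mem_antidiagonal.1 hx, map_add]
    rcases lt_or_ge x.1.degree M with h | h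
    · rw [hF _ h]; simp
    · rw [hG _ (by omega)]; simp
  · exact coeff_of_not_adm ha _
theorem mul_ordGE_left {N : ℕ} {F : SSer A π} (hF : F ∈ ordGE A π N) (G : SSer A π) :
    F * G ∈ ordGE A π N := by simpa using mul_ordGE hF (ordGE_zero G)
theorem mul_ordGE_right {N : ℕ} {F : SSer A π} (hF : F ∈ ordGE A π N) (G : SSer A π) :
    G * F ∈ ordGE A π N := by simpa using mul_ordGE (ordGE_zero G) hF
theorem mul_sub_mul_mem {N : ℕ} {F F' G G' : SSer A π} (hF : F - F' ∈ ordGE A π N)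
    (hG : G - G' ∈ ordGE A π N) : F * G - F' * G' ∈ ordGE A π N := by
  have : F * G - F' * G' = (F - F') * G + F' * (G - G') := by noncomm_ring
  rw [this]
  exact add_mem (mul_ordGE_left hF _) (mul_ordGE_right hG _)

theorem coeff_inv (m : ι →₀ ℕ) (F : SSer A π) :
    coeff m (inv F) = sgn (opar π m) • SuperAlgebra.inv (coeff m F) := by
  by_cases h : Adm π m
  · rw [inv, coeff_mk h, neg_one_pow_eq_sgn, opar]
  · simp [coeff_of_not_adm h]

/-- A pair of odd factors, one from each monomial, is out of order in exactly one of the two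
products. Pairs with equal index do not occur because an admissible exponent contains an odd
variable at most once. -/
theorem crossings_add_comm {m n : ι →₀ ℕ} (h : Adm π (m + n)) :
    ((crossings π m n + crossings π n m).bodd) = (opar π m && opar π n) := by
  have h1 : crossings π m n + crossings π n m = oddDeg π m * oddDeg π n := by
    rw [oddDeg, oddDeg, Finset.sum_mul_sum]
    unfold crossings
    rw [Finset.sum_comm (f := fun i j => if j < i ∧ π i = true ∧ π j = true then n i * m j else 0),
      ← Finset.sum_add_distrib]
    refine Finset.sum_congr rfl fun i _ => ?_
    rw [← Finset.sum_add_distrib]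
    refine Finset.sum_congr rfl fun j _ => ?_
    rcases lt_trichotomy i j with hij | rfl | hij
    · cases hi : π i <;> cases hj : π j <;> simp [hij, hij.le, mul_comm]
    · cases hi : π i
      · simp
      · have := h i hi
        simp only [Finsupp.add_apply] at this
        rcases Nat.eq_zero_or_pos (m i) with h0 | h0
        · simp [h0]
        · simp [show n i = 0 by omega]
    · cases hi : π i <;> cases hj : π j <;> simp [hij, hij.le, mul_comm]
  rw [h1, Nat.bodd_mul]; rfl
theorem neg_one_pow_crossings_comm {m n : ι →₀ ℕ} (h : Adm π (m + n)) :
    (-1 : ℝ) ^ crossings π n m = sgn (opar π m && opar π n) * (-1 : ℝ) ^ crossings π m n := by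
  have := crossings_add_comm h
  rw [← this, ← neg_one_pow_eq_sgn, pow_add]
  have h2 : ((-1 : ℝ) ^ crossings π m n) * (-1) ^ crossings π m n = 1 := by
    rw [← pow_add, ← two_mul]; simp
  linear_combination -(-1 : ℝ) ^ crossings π n m * h2

theorem hasParity_coeff {F : SSer A π} {e : Bool} (h : inv F = sgn e • F) (m : ι →₀ ℕ) :
    HasParity (e ^^ opar π m) (coeff m F) := by
  have h1 := congrArg (coeff m) h
  rw [coeff_inv, coeff_smul] at h1
  rw [hasParity_iff, ← sgn_mul, mul_comm, ← smul_smul, ← h1, smul_smul, sgn_mul_self, one_smul]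

/-- The summands are matched by exchanging the two exponents; the signs from sorting, from moving
monomials past coefficients, and from commuting coefficients combine to the parity sign. It is
phrased through `inv` since the superalgebra structure on series is built from it. -/
theorem super_comm_aux {F : SSer A π} {e : Bool} (h : inv F = sgn e • F) (G : SSer A π) :
    F * G = (if e then inv G else G) * F := by
  refine ext fun k hk => ?_
  rw [coeff_mul' hk, coeff_mul' hk, ← Finset.sum_equiv (Equiv.prodComm _ _)
    (s := Finset.HasAntidiagonal.antidiagonal k) (fun x => by simp [add_comm]) (fun x _ => rfl)]
  refine Finset.sum_congr rfl fun x hx => ?_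
  rw [Finset.HasAntidiagonal.mem_antidiagonal] at hx
  have hF := hasParity_coeff h x.2
  have h1 : coeff x.1 (if e = true then inv G else G) =
      sgn (e && opar π x.1) • pinv e (coeff x.1 G) := by
    cases e
    · simp
    · simp [coeff_inv, pinv_true]
  simp only [Equiv.prodComm_apply, Prod.fst_swap, Prod.snd_swap]
  rw [neg_one_pow_crossings_comm (hx ▸ hk), h1, hF.pinv_eq, hF.comm, pinv_pinv,
    Bool.xor_assoc, Bool.xor_self, Bool.xor_false, smul_mul_assoc, mul_smul_comm]
  simp only [smul_smul]
  congr 1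
  generalize opar π x.1 = s
  generalize opar π x.2 = t
  cases e <;> cases s <;> cases t <;> simp

noncomputable instance : SuperAlgebra (SSer A π) where
  inv :=
    { toFun := inv
      map_one' := ext fun m h => by
        rw [coeff_inv, coeff_one h]
        by_cases hm : m = 0
        · subst hm; simp
        · simp [hm]
      map_zero' := ext fun m h => by simp [coeff_inv, coeff_zero]
      map_add' := fun F G => ext fun m h => by simp [coeff_inv, coeff_add]
      map_mul' := fun F G => ext fun m h => by
        rw [coeff_inv, coeff_mul' h, coeff_mul' h, map_sum, Finset.smul_sum]
        refine Finset.sum_congr rfl fun x hx => ?_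
        rw [← Finset.HasAntidiagonal.mem_antidiagonal.1 hx, opar_add, coeff_inv, coeff_inv, map_smul, map_mul,
          map_smul, smul_mul_smul_comm, sgn_mul, ← pinv_true, ← pinv_true, ← pinv_true, pinv_comm,
          smul_comm]
      commutes' := fun c => ext fun m h => by
        rw [Algebra.algebraMap_eq_smul_one, coeff_inv, coeff_smul, coeff_one h]
        by_cases hm : m = 0
        · subst hm; simp
        · simp [hm] }
  inv_inv F := ext fun m h => by
    change coeff m (inv (inv F)) = _
    rw [coeff_inv, coeff_inv, map_smul, SuperAlgebra.inv_inv, smul_smul, sgn_mul_self, one_smul]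
  even_comm F G h := by simpa using super_comm_aux (e := false) (F := F) (by simpa using h) G
  odd_comm F G hF hG := by
    have h1 := super_comm_aux (e := true) (F := F) (by simpa using hF) G
    rw [if_pos rfl] at h1
    rw [h1]
    exact (congrArg (· * F) hG).trans (neg_mul _ _)

theorem inv_def (F : SSer A π) : SuperAlgebra.inv F = inv F := rfl
theorem hasParity_iff_coeff {e : Bool} {F : SSer A π} :
    HasParity e F ↔ ∀ m, Adm π m → HasParity (e ^^ opar π m) (coeff m F) := by
  rw [hasParity_iff]
  refine ⟨fun h m _ => hasParity_coeff h m, fun h => ext fun m hm => ?_⟩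
  rw [inv_def, coeff_inv, hasParity_iff.1 (h m hm), coeff_smul, smul_smul, ← sgn_mul]
  cases e <;> cases opar π m <;> simp
theorem coeff_pinv (e : Bool) (m : ι →₀ ℕ) (F : SSer A π) :
    coeff m (pinv e F) = sgn (e && opar π m) • pinv e (coeff m F) := by
  cases e
  · simp
  · exact (coeff_inv m F).trans (by simp [pinv_true])
theorem pinv_ordGE {N : ℕ} {F : SSer A π} (e : Bool) (h : F ∈ ordGE A π N) :
    pinv e F ∈ ordGE A π N := fun m hm => by simp [coeff_pinv, h m hm]
theorem isEven_iff {F : SSer A π} : F.IsEven ↔ HasParity false F := by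
  rw [hasParity_iff]; simp [IsEven, inv_def]
theorem isOdd_iff {F : SSer A π} : F.IsOdd ↔ HasParity true F := by
  rw [hasParity_iff]; simp [IsOdd, inv_def]

end Mul
end SSer

/-! ### The Leibniz rule for left partial derivatives -/

namespace SSer
section Leibniz
variable {A : Type*} [Ring A] [Algebra ℝ A] [SuperAlgebra A]
  {ι : Type*} [Fintype ι] [LinearOrder ι] {π : ι → Bool}

theorem crossings_single_left (i : ι) (n : ι →₀ ℕ) : crossings π (Finsupp.single i 1) n =
    if π i then oddDeg π (n.filter (· < i)) else 0 := by
  rw [crossings, Finset.sum_eq_single i]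
  · cases hi : π i
    · simp
    · rw [if_pos rfl, oddDeg]
      refine Finset.sum_congr rfl fun j _ => ?_
      by_cases h : j < i <;> cases hj : π j <;> simp [h]
  · intro j _ hj; simp [hj.symm]
  · simp
theorem crossings_single_right (i : ι) (m : ι →₀ ℕ) : crossings π m (Finsupp.single i 1) =
    if π i then oddDeg π (m.filter (i < ·)) else 0 := by
  rw [crossings, Finset.sum_comm, Finset.sum_eq_single i]
  · cases hi : π i
    · simp
    · rw [if_pos rfl, oddDeg]
      refine Finset.sum_congr rfl fun j _ => ?_
      by_cases h : i < j <;> cases hj : π j <;> simp [h]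
  · intro j _ hj; simp [hj.symm]
  · simp
theorem oddDeg_split (i : ι) (m : ι →₀ ℕ) : oddDeg π m =
    oddDeg π (m.filter (· < i)) + (if π i then m i else 0) + oddDeg π (m.filter (i < ·)) := by
  have h1 : (if π i then m i else 0) = ∑ j, if π j then (if j = i then m j else 0) else 0 := by
    rw [Finset.sum_eq_single i]
    · simp
    · intro j _ hj; simp [hj]
    · simp
  rw [h1, oddDeg, oddDeg, oddDeg, ← Finset.sum_add_distrib, ← Finset.sum_add_distrib]
  refine Finset.sum_congr rfl fun j _ => ?_
  rcases lt_trichotomy j i with h | rfl | h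
  · cases π j <;> simp [h, h.ne, h.le]
  · cases π j <;> simp
  · cases π j <;> simp [h, h.ne', h.le]

theorem neg_one_pow_crossings_single_left (i : ι) (n : ι →₀ ℕ) :
    (-1 : ℝ) ^ crossings π (Finsupp.single i 1) n =
      sgn (π i && opar π (n.filter (· < i))) := by
  rw [crossings_single_left, neg_one_pow_eq_sgn]
  cases π i <;> simp [opar]
-- Sorting `X i` in from the right crosses the odd factors with index above `i`. Their number has
-- the parity of the total minus those below `i`, which is the form in which `deriv` carries its
-- sign; this needs that an odd `X i` does not yet occur.
theorem neg_one_pow_crossings_single_right (i : ι) (m : ι →₀ ℕ) (h : π i = true → m i = 0) :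
    (-1 : ℝ) ^ crossings π m (Finsupp.single i 1) =
      sgn (π i && opar π (m.filter (· < i))) * sgn (π i && opar π m) := by
  rw [crossings_single_right, neg_one_pow_eq_sgn]
  cases hi : π i
  · simp
  · simp only [Bool.true_and, opar]
    rw [oddDeg_split i m, h hi]
    simp only [Nat.bodd_add, Nat.bodd_zero, ite_self, Bool.xor_false, if_true]
    generalize (oddDeg π (m.filter (· < i))).bodd = s
    generalize (oddDeg π (m.filter (i < ·))).bodd = t
    cases s <;> cases t <;> simp

theorem coeff_deriv (i : ι) (m : ι →₀ ℕ) (F : SSer A π) : coeff m (deriv i F) =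
    (sgn (π i && opar π (m.filter (· < i))) * ((m i : ℝ) + 1)) •
      pinv (π i) (coeff (m + Finsupp.single i 1) F) := by
  by_cases h : Adm π m
  · rw [deriv, coeff_mk h, inv_iterate_ite, neg_one_pow_eq_sgn]
    cases π i <;> simp [opar]
  · rw [coeff_of_not_adm h, coeff_of_not_adm fun h' => h (adm_left h')]; simp

/-- The weight `x.1 i` kills the pairs whose first exponent does not contain `i`, and the other
pairs are shifts of pairs for `k`. This is how a factor `k i + 1` from differentiation is
distributed over a product. -/
theorem sum_antidiagonal_shift_left {M : Type*} [AddCommGroup M] [Module ℝ M] (k : ι →₀ ℕ) (i : ι)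
    (f : (ι →₀ ℕ) × (ι →₀ ℕ) → M) :
    ∑ x ∈ (Finset.HasAntidiagonal.antidiagonal (k + Finsupp.single i 1) :
      Finset ((ι →₀ ℕ) × (ι →₀ ℕ))), (x.1 i : ℝ) • f x =
      ∑ x ∈ Finset.HasAntidiagonal.antidiagonal k,
        ((x.1 i : ℝ) + 1) • f (x.1 + Finsupp.single i 1, x.2) := by
  have hinj : Function.Injective (fun x : (ι →₀ ℕ) × (ι →₀ ℕ) =>
      (x.1 + Finsupp.single i 1, x.2)) := by
    rintro ⟨a, b⟩ ⟨c, d⟩ h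
    simp only [Prod.mk.injEq, add_left_inj] at h
    exact Prod.ext h.1 h.2
  have h2 := Finset.sum_image (f := fun x => (x.1 i : ℝ) • f x)
    (s := Finset.HasAntidiagonal.antidiagonal k) (hinj.injOn)
  simp only [Finsupp.add_apply, Finsupp.single_eq_same, Nat.cast_add, Nat.cast_one] at h2
  rw [← h2]
  symm
  refine Finset.sum_subset (fun x hx => ?_) (fun x hx hx' => ?_)
  · obtain ⟨y, hy, rfl⟩ := Finset.mem_image.1 hx
    rw [Finset.HasAntidiagonal.mem_antidiagonal] at *
    rw [← hy]; exact add_right_comm _ _ _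
  · rcases Nat.eq_zero_or_pos (x.1 i) with h | h
    · simp [h]
    · refine absurd (Finset.mem_image.2 ⟨(x.1 - Finsupp.single i 1, x.2), ?_, ?_⟩) hx'
      all_goals
        have h3 : x.1 - Finsupp.single i 1 + Finsupp.single i 1 = x.1 :=
          tsub_add_cancel_of_le (Finsupp.single_le_iff.2 h)
      · rw [Finset.HasAntidiagonal.mem_antidiagonal] at *
        rw [← h3, add_right_comm] at hx
        exact add_right_cancel hx
      · simp [h3]
theorem sum_antidiagonal_shift_right {M : Type*} [AddCommGroup M] [Module ℝ M] (k : ι →₀ ℕ) (i : ι)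
    (f : (ι →₀ ℕ) × (ι →₀ ℕ) → M) :
    ∑ x ∈ (Finset.HasAntidiagonal.antidiagonal (k + Finsupp.single i 1) :
      Finset ((ι →₀ ℕ) × (ι →₀ ℕ))), (x.2 i : ℝ) • f x =
      ∑ x ∈ Finset.HasAntidiagonal.antidiagonal k,
        ((x.2 i : ℝ) + 1) • f (x.1, x.2 + Finsupp.single i 1) := by
  have h := sum_antidiagonal_shift_left k i (fun x => f x.swap)
  rw [← Finset.sum_equiv (Equiv.prodComm _ _)
    (s := Finset.HasAntidiagonal.antidiagonal (k + Finsupp.single i 1))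
    (t := Finset.HasAntidiagonal.antidiagonal (k + Finsupp.single i 1))
    (f := fun x : (ι →₀ ℕ) × (ι →₀ ℕ) => (x.1 i : ℝ) • f x.swap)
    (fun x => by simp [add_comm]) (fun x _ => rfl), h]
  exact Finset.sum_equiv (Equiv.prodComm _ _) (fun x => by simp [add_comm]) (fun x _ => rfl)

theorem filter_add_single_lt (m : ι →₀ ℕ) (i : ι) :
    (m + Finsupp.single i 1).filter (· < i) = m.filter (· < i) := by
  rw [Finsupp.filter_add, Finsupp.filter_single_of_neg, add_zero]; exact lt_irrefl i

/-- The factor `k i + 1` is the sum of the exponents of `X i` in the two factors, which gives the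
two terms of the product rule; the rest is a comparison of signs. -/
theorem deriv_mul (i : ι) (F G : SSer A π) :
    deriv i (F * G) = deriv i F * G + pinv (π i) F * deriv i G := by
  set lo : (ι →₀ ℕ) → Bool := fun m => π i && opar π (m.filter (· < i)) with hlo
  have lo_add : ∀ m n, sgn (lo (m + n)) = sgn (lo m) * sgn (lo n) := fun m n => by
    simp only [hlo, Finsupp.filter_add, opar_add, sgn_mul]
    cases π i <;> simp
  have lo_single : ∀ m, lo (m + Finsupp.single i 1) = lo m := fun m => by
    simp only [hlo, filter_add_single_lt]
  refine ext fun k hk => ?_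
  rw [coeff_add, coeff_mul' hk, coeff_mul' hk, ← Finset.sum_add_distrib]
  by_cases hk' : Adm π (k + Finsupp.single i 1)
  · rw [coeff_deriv, coeff_mul' hk']
    have h1 : ∀ f : (ι →₀ ℕ) × (ι →₀ ℕ) → A,
        ((k i : ℝ) + 1) • ∑ x ∈ Finset.HasAntidiagonal.antidiagonal (k + Finsupp.single i 1), f x =
        ∑ x ∈ Finset.HasAntidiagonal.antidiagonal k,
          (((x.1 i : ℝ) + 1) • f (x.1 + Finsupp.single i 1, x.2) +
           ((x.2 i : ℝ) + 1) • f (x.1, x.2 + Finsupp.single i 1)) := by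
      intro f
      rw [Finset.sum_add_distrib, ← sum_antidiagonal_shift_left, ← sum_antidiagonal_shift_right,
        ← Finset.sum_add_distrib, Finset.smul_sum]
      refine Finset.sum_congr rfl fun x hx => ?_
      rw [Finset.HasAntidiagonal.mem_antidiagonal] at hx
      have := DFunLike.congr_fun hx i
      simp only [Finsupp.add_apply, Finsupp.single_eq_same] at this
      rw [← add_smul]; congr 1; exact_mod_cast this.symm
    rw [map_sum, mul_smul, h1, Finset.smul_sum]
    refine Finset.sum_congr rfl fun x hx => ?_
    rw [Finset.HasAntidiagonal.mem_antidiagonal] at hx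
    rw [coeff_deriv, coeff_deriv, coeff_pinv, smul_add]
    congr 1
    · simp only [crossings_add_left, pow_add, neg_one_pow_crossings_single_left, opar_add,
        opar_single, ← hx]
      rw [show (π i && opar π ((x.1 + x.2).filter (· < i))) = lo (x.1 + x.2) from rfl, lo_add,
        show (π i && opar π (x.1.filter (· < i))) = lo x.1 from rfl,
        show (π i && opar π (x.2.filter (· < i))) = lo x.2 from rfl]
      simp only [map_smul, map_mul, smul_smul, pinv_pinv, smul_mul_assoc]
      rw [Bool.xor_comm (opar π x.1), ← Bool.xor_assoc, Bool.xor_self, Bool.false_xor]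
      congr 1
      linear_combination (sgn (lo x.1) * ((x.1 i : ℝ) + 1) * (-1) ^ crossings π x.1 x.2) *
        sgn_mul_self (lo x.2)
    · have h0 : π i = true → x.1 i = 0 := fun hi => by
        have := hk' i hi
        simp only [← hx, Finsupp.add_apply, Finsupp.single_eq_same] at this; omega
      simp only [crossings_add_right, pow_add, neg_one_pow_crossings_single_right i x.1 h0, ← hx]
      rw [show (π i && opar π ((x.1 + x.2).filter (· < i))) = lo (x.1 + x.2) from rfl, lo_add,
        show (π i && opar π (x.1.filter (· < i))) = lo x.1 from rfl,
        show (π i && opar π (x.2.filter (· < i))) = lo x.2 from rfl]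
      simp only [map_smul, map_mul, smul_smul, pinv_pinv, smul_mul_assoc, mul_smul_comm]
      rw [Bool.xor_comm (opar π x.1)]
      congr 1
      linear_combination (sgn (lo x.2) * ((x.2 i : ℝ) + 1) * (-1) ^ crossings π x.1 x.2 *
        sgn (π i && opar π x.1)) * sgn_mul_self (lo x.1)
  -- Here `i` is odd and `X ^ k` already contains `X i`, so the left side vanishes. On the right `X
  -- i` must sit in the factor that is not differentiated, and the two sums, reindexed, cancel
  -- termwise.
  · rw [coeff_deriv, coeff_of_not_adm hk', map_zero, smul_zero]
    have hi : π i = true ∧ k i = 1 := by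
      simp only [Adm, not_forall, not_le] at hk'
      obtain ⟨j, hj, hj'⟩ := hk'
      have h1 := hk j hj
      by_cases hji : j = i
      · subst hji
        simp only [Finsupp.add_apply, Finsupp.single_eq_same] at hj'
        exact ⟨hj, by omega⟩
      · simp only [Finsupp.add_apply, Finsupp.single_apply, if_neg (Ne.symm hji)] at hj'; omega
    obtain ⟨hi, hki⟩ := hi
    obtain ⟨k', rfl⟩ : ∃ k', k = k' + Finsupp.single i 1 :=
      ⟨k - Finsupp.single i 1, (tsub_add_cancel_of_le (Finsupp.single_le_iff.2 hki.ge)).symm⟩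
    have hd : ∀ (F : SSer A π) (m : ι →₀ ℕ), m i ≠ 0 → coeff m (deriv i F) = 0 := fun F m hm => by
      rw [coeff_deriv, coeff_of_not_adm, map_zero, smul_zero]
      intro h
      have := h i hi
      simp only [Finsupp.add_apply, Finsupp.single_eq_same] at this; omega
    have h1 : ∀ x : (ι →₀ ℕ) × (ι →₀ ℕ),
        x ∈ Finset.HasAntidiagonal.antidiagonal (k' + Finsupp.single i 1) →
        x.1 i + x.2 i = 1 := fun x hx => by
      rw [Finset.HasAntidiagonal.mem_antidiagonal] at hx
      rw [← hki, ← hx]; rfl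
    have e1 : ∀ (f : (ι →₀ ℕ) × (ι →₀ ℕ) → A), (∀ x, x.1 i ≠ 0 → f x = 0) →
        ∑ x ∈ Finset.HasAntidiagonal.antidiagonal (k' + Finsupp.single i 1), f x =
        ∑ x ∈ Finset.HasAntidiagonal.antidiagonal k',
          ((x.2 i : ℝ) + 1) • f (x.1, x.2 + Finsupp.single i 1) := fun f hf => by
      rw [← sum_antidiagonal_shift_right]
      refine Finset.sum_congr rfl fun x hx => ?_
      rcases Nat.eq_zero_or_pos (x.1 i) with h0 | h0
      · have : x.2 i = 1 := by have := h1 x hx; omega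
        rw [this, Nat.cast_one, one_smul]
      · rw [hf _ h0.ne', smul_zero]
    have e2 : ∀ (f : (ι →₀ ℕ) × (ι →₀ ℕ) → A), (∀ x, x.2 i ≠ 0 → f x = 0) →
        ∑ x ∈ Finset.HasAntidiagonal.antidiagonal (k' + Finsupp.single i 1), f x =
        ∑ x ∈ Finset.HasAntidiagonal.antidiagonal k',
          ((x.1 i : ℝ) + 1) • f (x.1 + Finsupp.single i 1, x.2) := fun f hf => by
      rw [← sum_antidiagonal_shift_left]
      refine Finset.sum_congr rfl fun x hx => ?_
      rcases Nat.eq_zero_or_pos (x.2 i) with h0 | h0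
      · have : x.1 i = 1 := by have := h1 x hx; omega
        rw [this, Nat.cast_one, one_smul]
      · rw [hf _ h0.ne', smul_zero]
    rw [Finset.sum_add_distrib, e1 _ fun x hx => by rw [hd _ _ hx]; simp,
      e2 _ fun x hx => by rw [hd _ _ hx]; simp, ← Finset.sum_add_distrib]
    symm
    refine Finset.sum_eq_zero fun x hx => ?_
    rw [Finset.HasAntidiagonal.mem_antidiagonal] at hx
    have hx0 : x.1 i = 0 ∧ x.2 i = 0 := by
      have := DFunLike.congr_fun hx i
      simp only [Finsupp.add_apply, Finsupp.single_eq_same] at this hki; omega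
    simp only [coeff_deriv, coeff_pinv, crossings_add_left, crossings_add_right, pow_add,
      neg_one_pow_crossings_single_left,
      neg_one_pow_crossings_single_right i x.1 (fun _ => hx0.1), hx0.1, hx0.2, hi, opar_add,
      opar_single, Bool.true_and, smul_mul_assoc, mul_smul_comm, map_smul, smul_smul, pinv_pinv,
      Bool.xor_true, Bool.not_not]
    rw [← add_smul]
    refine smul_eq_zero_of_left ?_ _
    generalize opar π x.1 = s
    generalize opar π (x.1.filter (· < i)) = t
    generalize opar π (x.2.filter (· < i)) = u
    cases s <;> cases t <;> cases u <;> norm_num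
end Leibniz
end SSer

/-! ### Constants, monomials and truncation -/

namespace SSer
section Monomials
variable {A : Type*} [Ring A] [Algebra ℝ A] [SuperAlgebra A]
  {ι : Type*} [Fintype ι] [LinearOrder ι] {π : ι → Bool}

theorem coeff_C_mul (a : A) (F : SSer A π) (m : ι →₀ ℕ) : coeff m (C π a * F) = a * coeff m F := by
  by_cases h : Adm π m
  · rw [coeff_mul' h, Finset.sum_eq_single (0, m)]
    · simp [crossings_zero_left, coeff_C]
    · rintro ⟨x, y⟩ hx hne
      rw [Finset.HasAntidiagonal.mem_antidiagonal] at hx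
      have : x ≠ 0 := by rintro rfl; exact hne (by simpa using hx)
      simp [coeff_C, this]
    · intro h; exact absurd (by simp) h
  · simp [coeff_of_not_adm h]
theorem coeff_mul_C (a : A) (F : SSer A π) (m : ι →₀ ℕ) :
    coeff m (F * C π a) = coeff m F * pinv (opar π m) a := by
  by_cases h : Adm π m
  · rw [coeff_mul' h, Finset.sum_eq_single (m, 0)]
    · simp [crossings_zero_right, coeff_C]
    · rintro ⟨x, y⟩ hx hne
      rw [Finset.HasAntidiagonal.mem_antidiagonal] at hx
      have : y ≠ 0 := by rintro rfl; exact hne (by simpa using hx)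
      simp [coeff_C, this]
    · intro h; exact absurd (by simp) h
  · simp [coeff_of_not_adm h]

/-- The constant series, as a homomorphism. -/
noncomputable def CHom (π : ι → Bool) : A →ₐ[ℝ] SSer A π where
  toFun := C π
  map_one' := rfl
  map_zero' := ext fun m _ => by simp [coeff_C, coeff_zero]
  map_add' a b := ext fun m _ => by
    rw [coeff_add, coeff_C, coeff_C, coeff_C]; split <;> simp
  map_mul' a b := ext fun m _ => by rw [coeff_C_mul, coeff_C, coeff_C]; split <;> simp
  commutes' c := ext fun m h => by
    rw [Algebra.algebraMap_eq_smul_one, Algebra.algebraMap_eq_smul_one, coeff_smul, coeff_C,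
      coeff_one h]
    split <;> simp
@[simp] theorem CHom_apply (a : A) : CHom π a = C π a := rfl
theorem C_zero : C π (0 : A) = 0 := map_zero (CHom π)
theorem C_mul (a b : A) : C π (a * b) = C π a * C π b := map_mul (CHom π) a b
theorem C_add (a b : A) : C π (a + b) = C π a + C π b := map_add (CHom π) a b
theorem C_smul (c : ℝ) (a : A) : C π (c • a) = c • C π a := map_smul (CHom π) c a
theorem C_sum {κ : Type*} (s : Finset κ) (a : κ → A) : C π (∑ i ∈ s, a i) = ∑ i ∈ s, C π (a i) :=
  map_sum (CHom π) a s
theorem CHom_isSuper : IsSuper (CHom π : A →ₐ[ℝ] SSer A π) := fun a => ext fun m _ => by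
  rw [inv_def, coeff_inv, CHom_apply, CHom_apply, coeff_C, coeff_C]
  split
  · next h => subst h; simp
  · simp
theorem pinv_C (e : Bool) (a : A) : pinv e (C π a) = C π (pinv e a) := (CHom_isSuper.pinv e a).symm
theorem hasParity_C {e : Bool} {a : A} (h : HasParity e a) : HasParity e (C π a) :=
  CHom_isSuper.hasParity h
theorem coeff_zero_C (a : A) : coeff 0 (C π a) = a := by simp [coeff_C]
theorem C_injective : Function.Injective (C π : A → SSer A π) := fun a b h => by
  rw [← coeff_zero_C (π := π) a, h, coeff_zero_C]

open Classical in
/-- The monomial `X ^ m` (zero if it is not admissible). -/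
noncomputable def mono (A : Type*) [Ring A] [Algebra ℝ A] {ι : Type*} (π : ι → Bool) (m : ι →₀ ℕ) :
    SSer A π := mk π (fun k => if k = m then 1 else 0)
theorem coeff_mono {k : ι →₀ ℕ} (h : Adm π k) (m : ι →₀ ℕ) [Decidable (k = m)] :
    coeff k (mono A π m) = if k = m then 1 else 0 := by rw [mono, coeff_mk h]; congr
theorem mono_of_not_adm {m : ι →₀ ℕ} (h : ¬ Adm π m) : mono A π m = 0 := ext fun k hk => by
  rw [coeff_mono hk, if_neg, coeff_zero]; rintro rfl; exact h hk
theorem mono_zero : mono A π 0 = 1 := ext fun k hk => by rw [coeff_mono hk, coeff_one hk]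
theorem X_eq_mono (i : ι) : X A π i = mono A π (Finsupp.single i 1) := rfl
theorem coeff_C_mul_mono {k : ι →₀ ℕ} (h : Adm π k) (m : ι →₀ ℕ) [Decidable (k = m)] (a : A) :
    coeff k (C π a * mono A π m) = if k = m then a else 0 := by
  rw [coeff_C_mul, coeff_mono h]; split <;> simp
theorem hasParity_mono (m : ι →₀ ℕ) : HasParity (opar π m) (mono A π m) :=
  hasParity_iff_coeff.2 fun k hk => by
    rw [coeff_mono hk]
    split
    · next h => subst h; simpa using HasParity.one
    · exact HasParity.zero
theorem hasParity_X (i : ι) : HasParity (π i) (X A π i) := by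
  rw [X_eq_mono, ← opar_single (π := π) i]; exact hasParity_mono _
theorem coeff_zero_X (i : ι) : coeff 0 (X A π i) = 0 := by
  rw [coeff_X, if_neg]; exact (Finsupp.single_ne_zero.2 one_ne_zero).symm

theorem mono_mul_mono (m n : ι →₀ ℕ) :
    mono A π m * mono A π n = (-1 : ℝ) ^ crossings π m n • mono A π (m + n) := ext fun k hk => by
  rw [coeff_mul' hk, coeff_smul, coeff_mono hk]
  by_cases h : k = m + n
  · subst h
    rw [if_pos rfl, Finset.sum_eq_single (m, n)]
    · rw [coeff_mono (adm_left hk), coeff_mono (adm_right hk)]; simp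
    · rintro ⟨x, y⟩ hx hne
      rw [Finset.HasAntidiagonal.mem_antidiagonal] at hx
      have hk' := hx ▸ hk
      rw [coeff_mono (adm_left hk'), coeff_mono (adm_right hk')]
      by_cases h1 : x = m
      · subst h1
        have : y ≠ n := by rintro rfl; exact hne rfl
        simp [this]
      · simp [h1]
    · intro h; exact absurd (by simp) h
  · rw [if_neg h, smul_zero]
    refine Finset.sum_eq_zero fun x hx => ?_
    rw [Finset.HasAntidiagonal.mem_antidiagonal] at hx
    have hk' := hx ▸ hk
    rw [coeff_mono (adm_left hk'), coeff_mono (adm_right hk')]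
    by_cases h1 : x.1 = m
    · have : x.2 ≠ n := by rintro rfl; exact h (by rw [← hx, h1])
      simp [this]
    · simp [h1]
theorem X_mul_mono (j : ι) (m : ι →₀ ℕ) : X A π j * mono A π m =
    (-1 : ℝ) ^ crossings π (Finsupp.single j 1) m • mono A π (m + Finsupp.single j 1) := by
  rw [X_eq_mono, mono_mul_mono, add_comm]
theorem neg_one_pow_mul_self (n : ℕ) : (-1 : ℝ) ^ n * (-1) ^ n = 1 := by
  rw [← pow_add, ← two_mul]; simp
theorem mono_add_single (j : ι) (m : ι →₀ ℕ) : mono A π (m + Finsupp.single j 1) =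
    (-1 : ℝ) ^ crossings π (Finsupp.single j 1) m • (X A π j * mono A π m) := by
  rw [X_mul_mono, smul_smul, neg_one_pow_mul_self, one_smul]

theorem mono_induction {P : (ι →₀ ℕ) → Prop} (h0 : P 0)
    (hs : ∀ j m, P m → P (m + Finsupp.single j 1)) (m : ι →₀ ℕ) : P m := by
  induction hd : m.degree generalizing m with
  | zero => rw [degree_eq_zero_iff'.1 hd]; exact h0
  | succ d ih =>
    have hm : m ≠ 0 := by rintro rfl; simp at hd
    obtain ⟨j, hj⟩ := Finsupp.ne_iff.1 hm
    have h : m - Finsupp.single j 1 + Finsupp.single j 1 = m :=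
      tsub_add_cancel_of_le (Finsupp.single_le_iff.2 (Nat.one_le_iff_ne_zero.2 hj))
    rw [← h]
    refine hs _ _ (ih _ ?_)
    rw [← h, map_add, Finsupp.degree_single] at hd
    omega

/-- The exponents of degree less than `N`. -/
def expLT (ι : Type*) [Fintype ι] [DecidableEq ι] (N : ℕ) : Finset (ι →₀ ℕ) :=
  (Finset.range N).biUnion fun d => Finset.finsuppAntidiag Finset.univ d
theorem mem_finsuppAntidiag_univ {N : ℕ} {m : ι →₀ ℕ} :
    m ∈ Finset.finsuppAntidiag Finset.univ N ↔ m.degree = N := by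
  rw [Finset.mem_finsuppAntidiag]
  simp [Finsupp.degree_eq_sum]
theorem mem_expLT {N : ℕ} {m : ι →₀ ℕ} : m ∈ expLT ι N ↔ m.degree < N := by
  simp [expLT, Finsupp.degree_eq_sum]

/-- There are finitely many variables, so a truncation is a finite sum: polynomials are dense for
the filtration. -/
theorem sub_trunc_mem (N : ℕ) (F : SSer A π) :
    F - ∑ m ∈ expLT ι N, C π (coeff m F) * mono A π m ∈ ordGE A π N := fun k hk => by
  by_cases h : Adm π k
  · rw [coeff_sub, coeff_sum, Finset.sum_eq_single k]
    · rw [coeff_C_mul_mono h, if_pos rfl, sub_self]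
    · intro m _ hm; rw [coeff_C_mul_mono h, if_neg hm.symm]
    · intro h'; exact absurd (mem_expLT.2 hk) h'
  · exact coeff_of_not_adm h _

end Monomials

/-! ### Continuity for the filtration by order -/

section Continuity
variable {A B D : Type*} [Ring A] [Algebra ℝ A] [SuperAlgebra A] [Ring B] [Algebra ℝ B]
  [SuperAlgebra B] [Ring D] [Algebra ℝ D] [SuperAlgebra D]
  {ι κ μ : Type*} [Fintype ι] [LinearOrder ι] [Fintype κ] [LinearOrder κ] [Fintype μ]
  [LinearOrder μ] {π : ι → Bool} {τ : κ → Bool} {σ : μ → Bool}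

/-- Continuity of a linear map, for the filtrations by order. -/
def Cont (L : SSer A π →ₗ[ℝ] SSer B τ) : Prop :=
  ∀ N, ∃ M, ∀ F ∈ ordGE A π M, L F ∈ ordGE B τ N
theorem Cont.comp {L : SSer B τ →ₗ[ℝ] SSer D σ} {L' : SSer A π →ₗ[ℝ] SSer B τ} (h : Cont L)
    (h' : Cont L') : Cont (L ∘ₗ L') := fun N => by
  obtain ⟨M, hM⟩ := h N
  obtain ⟨M', hM'⟩ := h' M
  exact ⟨M', fun F hF => hM _ (hM' F hF)⟩
theorem Cont.add {L L' : SSer A π →ₗ[ℝ] SSer B τ} (h : Cont L) (h' : Cont L') :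
    Cont (L + L') := fun N => by
  obtain ⟨M, hM⟩ := h N
  obtain ⟨M', hM'⟩ := h' N
  exact ⟨max M M', fun F hF => add_mem (hM _ (ordGE_anti (le_max_left _ _) hF))
    (hM' _ (ordGE_anti (le_max_right _ _) hF))⟩
theorem Cont.smul {L : SSer A π →ₗ[ℝ] SSer B τ} (h : Cont L) (c : ℝ) : Cont (c • L) := fun N => by
  obtain ⟨M, hM⟩ := h N
  exact ⟨M, fun F hF => Submodule.smul_mem _ c (hM F hF)⟩
theorem Cont.sub {L L' : SSer A π →ₗ[ℝ] SSer B τ} (h : Cont L) (h' : Cont L') :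
    Cont (L - L') := by
  have h3 : L - L' = L + (-1 : ℝ) • L' := by module
  rw [h3]; exact h.add (h'.smul _)
theorem Cont.sum {α : Type*} (s : Finset α) {L : α → SSer A π →ₗ[ℝ] SSer B τ}
    (h : ∀ i ∈ s, Cont (L i)) : Cont (∑ i ∈ s, L i) := by
  classical
  induction s using Finset.induction_on with
  | empty => exact fun N => ⟨0, fun F _ => zero_mem _⟩
  | insert i s hi ih =>
    rw [Finset.sum_insert hi]
    exact (h i (by simp)).add (ih fun j hj => h j (by simp [hj]))
theorem Cont.of_ord {L : SSer A π →ₗ[ℝ] SSer B τ}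
    (h : ∀ N, ∀ F ∈ ordGE A π N, L F ∈ ordGE B τ N) : Cont L := fun N => ⟨N, h N⟩
theorem cont_mapL (f : A →ₗ[ℝ] B) : Cont (mapL f : SSer A π →ₗ[ℝ] SSer B π) :=
  Cont.of_ord fun _ _ h => mapL_ordGE f h

end Continuity

/-! ### Maps determined by constants and variables; derivations of power series -/

section Ext
variable {A B D : Type*} [Ring A] [Algebra ℝ A] [SuperAlgebra A] [Ring B] [Algebra ℝ B]
  [SuperAlgebra B] [Ring D] [Algebra ℝ D] [SuperAlgebra D]
  {ι κ μ : Type*} [Fintype ι] [LinearOrder ι] [Fintype κ] [LinearOrder κ] [Fintype μ]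
  [LinearOrder μ] {π : ι → Bool} {τ : κ → Bool} {σ : μ → Bool}

theorem cont_pinv (e : Bool) : Cont (pinv e : SSer A π →ₐ[ℝ] SSer A π).toLinearMap :=
  Cont.of_ord fun _ _ h => pinv_ordGE e h
theorem cont_mulLeft (b : SSer B τ) : Cont (LinearMap.mulLeft ℝ b) :=
  Cont.of_ord fun _ _ h => mul_ordGE_right h b
theorem cont_mulRight (b : SSer B τ) : Cont (LinearMap.mulRight ℝ b) :=
  Cont.of_ord fun _ _ h => mul_ordGE_left h b

/-- Polynomials are dense and the filtration is separated. Identities between continuous operations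
on power series are thereby reduced to single terms `a X ^ m`. -/
theorem linear_ext {L : SSer A π →ₗ[ℝ] SSer B τ} (hL : Cont L)
    (h : ∀ a m, Adm π m → L (C π a * mono A π m) = 0) (F : SSer A π) : L F = 0 := by
  refine eq_zero_of_ordGE fun N => ?_
  obtain ⟨M, hM⟩ := hL N
  have h1 := hM _ (sub_trunc_mem M F)
  rw [map_sub, map_sum, Finset.sum_eq_zero, sub_zero] at h1
  · exact h1
  · intro m _
    by_cases hm : Adm π m
    · exact h _ m hm
    · simp [mono_of_not_adm hm]

/-- The product rule propagates vanishing from the variables to monomials and from there to terms `a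
X ^ m`; density does the rest. -/
theorem der_ext {θ : SSer A π →ₐ[ℝ] SSer B τ} {e : Bool} {L : SSer A π →ₗ[ℝ] SSer B τ}
    (hL : IsDer θ e L) (hc : Cont L) (hC : ∀ a, L (C π a) = 0) (hX : ∀ i, L (X A π i) = 0)
    (F : SSer A π) : L F = 0 := by
  have h1 : ∀ m, L (mono A π m) = 0 := fun m => by
    induction m using mono_induction with
    | h0 => rw [mono_zero]; exact hL.map_one
    | hs j m ih => rw [mono_add_single, map_smul, hL.leib, ih, hX]; simp
  exact linear_ext hc (fun a m _ => by rw [hL.leib, hC, h1]; simp) F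

theorem der_ext' {θ : SSer A π →ₐ[ℝ] SSer B τ} {e : Bool} {L L' : SSer A π →ₗ[ℝ] SSer B τ}
    (hL : IsDer θ e L) (hL' : IsDer θ e L') (hc : Cont L) (hc' : Cont L')
    (hC : ∀ a, L (C π a) = L' (C π a)) (hX : ∀ i, L (X A π i) = L' (X A π i))
    (F : SSer A π) : L F = L' F :=
  sub_eq_zero.1 (der_ext (hL.sub hL') (hc.sub hc') (fun a => sub_eq_zero.2 (hC a))
    (fun i => sub_eq_zero.2 (hX i)) F)

theorem hom_ext {θ θ' : SSer A π →ₐ[ℝ] SSer B τ} (hc : Cont θ.toLinearMap)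
    (hc' : Cont θ'.toLinearMap) (hC : ∀ a, θ (C π a) = θ' (C π a))
    (hX : ∀ i, θ (X A π i) = θ' (X A π i)) (F : SSer A π) : θ F = θ' F := by
  have h1 : ∀ m, θ (mono A π m) = θ' (mono A π m) := fun m => by
    induction m using mono_induction with
    | h0 => rw [mono_zero, map_one, map_one]
    | hs j m ih => rw [mono_add_single, map_smul, map_smul, map_mul, map_mul, ih, hX]
  exact sub_eq_zero.1 (linear_ext (hc.sub hc') (fun a m _ => by
    simp [map_mul, hC, h1]) F)

/-- Application of a homomorphism to the coefficients. -/
noncomputable def mapHom (f : A →ₐ[ℝ] B) (hf : IsSuper f) (π : ι → Bool) :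
    SSer A π →ₐ[ℝ] SSer B π :=
  AlgHom.ofLinearMap (mapL f.toLinearMap)
    (ext fun m h => by
      rw [coeff_mapL, coeff_one h, coeff_one h]
      split <;> simp)
    (fun F G => ext fun m h => by
      rw [coeff_mapL, coeff_mul' h, coeff_mul' h, map_sum]
      refine Finset.sum_congr rfl fun x _ => ?_
      rw [map_smul, coeff_mapL, coeff_mapL, AlgHom.toLinearMap_apply, map_mul, hf.pinv]; rfl)
theorem coeff_mapHom (f : A →ₐ[ℝ] B) (hf : IsSuper f) (F : SSer A π) (m : ι →₀ ℕ) :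
    coeff m (mapHom f hf π F) = f (coeff m F) := coeff_mapL f.toLinearMap F m
theorem mapHom_isSuper (f : A →ₐ[ℝ] B) (hf : IsSuper f) : IsSuper (mapHom f hf π) := fun F =>
  ext fun m _ => by
    rw [coeff_mapHom, inv_def, inv_def, coeff_inv, coeff_inv, map_smul, hf, coeff_mapHom]
theorem mapL_C {E : Type*} [Ring E] [Algebra ℝ E] [SuperAlgebra E] (f : A →ₗ[ℝ] E) (a : A) :
    mapL f (C π a) = C π (f a) := ext fun m _ => by
  rw [coeff_mapL, coeff_C, coeff_C]; split <;> simp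
theorem mapHom_C (f : A →ₐ[ℝ] B) (hf : IsSuper f) (a : A) : mapHom f hf π (C π a) = C π (f a) :=
  mapL_C f.toLinearMap a
theorem mapHom_X (f : A →ₐ[ℝ] B) (hf : IsSuper f) (i : ι) : mapHom f hf π (X A π i) = X B π i :=
  ext fun m _ => by rw [coeff_mapHom, coeff_X, coeff_X]; split <;> simp
theorem cont_mapHom (f : A →ₐ[ℝ] B) (hf : IsSuper f) : Cont (mapHom f hf π).toLinearMap :=
  cont_mapL f.toLinearMap

theorem isDer_mapL {θ : A →ₐ[ℝ] B} (hθ : IsSuper θ) {e : Bool} {D : A →ₗ[ℝ] B} (hD : IsDer θ e D) :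
    IsDer (mapHom θ hθ π) e (mapL D) where
  leib F G := ext fun m h => by
    rw [coeff_add, coeff_mapL, coeff_mul' h, coeff_mul' h, coeff_mul' h, map_sum,
      ← Finset.sum_add_distrib]
    refine Finset.sum_congr rfl fun x _ => ?_
    rw [map_smul, hD.leib, ← smul_add, coeff_mapL, coeff_mapL, coeff_mapHom, coeff_pinv,
      coeff_mapHom, hD.pinv_apply, hθ.pinv, smul_mul_assoc, mul_smul_comm, Bool.and_comm]
  par F := ext fun m h => by
    rw [coeff_mapL, inv_def, coeff_inv, map_smul, hD.par, coeff_smul, inv_def, coeff_inv,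
      coeff_mapL, smul_comm]
theorem isDer_mapL_id {e : Bool} {D : A →ₗ[ℝ] A} (hD : IsDer (AlgHom.id ℝ A) e D) :
    IsDer (AlgHom.id ℝ (SSer A π)) e (mapL D) := by
  have h := isDer_mapL (π := π) IsSuper.id hD
  have h2 : mapHom (AlgHom.id ℝ A) IsSuper.id π = AlgHom.id ℝ (SSer A π) :=
    AlgHom.ext fun F => ext fun m _ => by rw [coeff_mapHom]; rfl
  rwa [h2] at h
theorem mapL_X {θ : A →ₐ[ℝ] B} {e : Bool} {D : A →ₗ[ℝ] B} (hD : IsDer θ e D) (i : ι) :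
    mapL D (X A π i) = 0 := ext fun m _ => by
  rw [coeff_mapL, coeff_X, coeff_zero]
  split
  · exact hD.map_one
  · simp

/-- The partial derivative as a linear map. -/
noncomputable def derivL (i : ι) : SSer A π →ₗ[ℝ] SSer A π where
  toFun := deriv i
  map_add' F G := ext fun m _ => by simp only [coeff_deriv, coeff_add, map_add, smul_add]
  map_smul' c F := ext fun m _ => by
    simp only [coeff_deriv, coeff_smul, map_smul, RingHom.id_apply, smul_comm c]
@[simp] theorem derivL_apply (i : ι) (F : SSer A π) : derivL i F = deriv i F := rfl
theorem isDer_derivL (i : ι) : IsDer (AlgHom.id ℝ (SSer A π)) (π i) (derivL i) where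
  leib F G := deriv_mul i F G
  par F := ext fun m _ => by
    rw [derivL_apply, derivL_apply, coeff_deriv, inv_def, inv_def, coeff_smul, coeff_inv, coeff_inv,
      coeff_deriv, opar_add, opar_single, map_smul, map_smul, ← pinv_true, ← pinv_true, pinv_comm,
      smul_smul, smul_smul, smul_smul, ← sgn_mul]
    congr 1; ring
theorem deriv_ordGE (i : ι) {N : ℕ} {F : SSer A π} (h : F ∈ ordGE A π (N + 1)) :
    deriv i F ∈ ordGE A π N := fun m hm => by
  rw [coeff_deriv, h _ (by rw [map_add, Finsupp.degree_single]; omega), map_zero, smul_zero]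
theorem cont_derivL (i : ι) : Cont (derivL i : SSer A π →ₗ[ℝ] SSer A π) :=
  fun N => ⟨N + 1, fun _ h => deriv_ordGE i h⟩
theorem deriv_C (i : ι) (a : A) : deriv i (C π a) = 0 := ext fun m _ => by
  rw [coeff_deriv, coeff_C, if_neg, map_zero, smul_zero, coeff_zero]
  intro h
  have := DFunLike.congr_fun h i
  simp at this
theorem deriv_X (i j : ι) : deriv i (X A π j) = if i = j then 1 else 0 := ext fun m h => by
  rw [coeff_deriv, coeff_X]
  by_cases hij : i = j
  · subst hij
    simp only [add_eq_right, if_true, coeff_one h]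
    by_cases hm : m = 0
    · subst hm; simp [show Finsupp.filter (· < i) (0 : ι →₀ ℕ) = 0 from Finsupp.filter_zero _]
    · simp [hm]
  · rw [if_neg hij, if_neg, map_zero, smul_zero, coeff_zero]
    intro h
    have := DFunLike.congr_fun h i
    simp [Finsupp.single_apply, Ne.symm hij] at this

/-- The derivation that multiplies `X ^ m` by `∑ i, m i * u i`. -/
noncomputable def wtL (u : ι → ℝ) : SSer A π →ₗ[ℝ] SSer A π where
  toFun F := mk π fun m => (∑ i, (m i : ℝ) * u i) • coeff m F
  map_add' F G := ext fun m h => by simp only [coeff_mk h, coeff_add, smul_add]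
  map_smul' c F := ext fun m h => by
    simp only [coeff_mk h, coeff_smul, RingHom.id_apply, smul_comm c]
theorem coeff_wtL (u : ι → ℝ) (F : SSer A π) (m : ι →₀ ℕ) :
    coeff m (wtL u F) = (∑ i, (m i : ℝ) * u i) • coeff m F := by
  by_cases h : Adm π m
  · exact coeff_mk h _
  · rw [coeff_of_not_adm h, coeff_of_not_adm h, smul_zero]
theorem isDer_wtL (u : ι → ℝ) : IsDer (AlgHom.id ℝ (SSer A π)) false (wtL u) where
  leib F G := ext fun m h => by
    rw [coeff_add, coeff_wtL, coeff_mul' h, AlgHom.id_apply, AlgHom.id_apply, coeff_mul' h,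
      coeff_mul' h, Finset.smul_sum, ← Finset.sum_add_distrib]
    refine Finset.sum_congr rfl fun x hx => ?_
    rw [Finset.HasAntidiagonal.mem_antidiagonal] at hx
    rw [coeff_wtL, coeff_wtL, pinv_false, map_smul, smul_mul_assoc, mul_smul_comm, ← smul_add,
      ← add_smul, ← Finset.sum_add_distrib, smul_comm, ← hx]
    simp [add_mul]
  par F := ext fun m h => by
    rw [coeff_wtL, inv_def, coeff_inv, sgn_false, one_smul, inv_def, coeff_inv, coeff_wtL, map_smul,
      smul_comm]
theorem wtL_ordGE (u : ι → ℝ) {N : ℕ} {F : SSer A π} (h : F ∈ ordGE A π N) :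
    wtL u F ∈ ordGE A π N := fun m hm => by rw [coeff_wtL, h m hm, smul_zero]
theorem cont_wtL (u : ι → ℝ) : Cont (wtL u : SSer A π →ₗ[ℝ] SSer A π) :=
  Cont.of_ord fun _ _ h => wtL_ordGE u h
theorem wtL_C (u : ι → ℝ) (a : A) : wtL u (C π a) = 0 := ext fun m _ => by
  rw [coeff_wtL, coeff_C, coeff_zero]
  split
  · next h => subst h; simp
  · simp
theorem wtL_X (u : ι → ℝ) (i : ι) : wtL u (X A π i) = u i • X A π i := ext fun m _ => by
  rw [coeff_wtL, coeff_smul, coeff_X]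
  split
  · next h =>
    subst h
    rw [Finset.sum_eq_single i]
    · simp
    · intro j _ hj; simp [Finsupp.single_apply, hj.symm]
    · simp
  · simp
-- Euler's identity: both sides are even derivations that kill constants and scale each `X i` by `u
-- i`.
theorem wtL_eq_sum (u : ι → ℝ) (F : SSer A π) :
    wtL u F = ∑ i, u i • (X A π i * deriv i F) := by
  have hd : ∀ i, IsDer (AlgHom.id ℝ (SSer A π)) false
      (u i • (LinearMap.mulLeft ℝ (X A π i)).comp (derivL i)) := fun i => by
    have := ((isDer_derivL (A := A) (π := π) i).mulLeft (hasParity_X i)).smul (u i)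
    rwa [Bool.xor_self] at this
  have := der_ext' (isDer_wtL u) (IsDer.sum (s := Finset.univ) fun i _ => hd i) (cont_wtL u)
    (Cont.sum _ fun i _ => ((cont_mulLeft _).comp (cont_derivL i)).smul _)
    (fun a => by simp [wtL_C, deriv_C])
    (fun i => by simp [wtL_X, deriv_X, LinearMap.sum_apply, Finset.sum_ite_eq']) F
  rw [this]; simp [LinearMap.sum_apply]

/-- The derivation that multiplies `X ^ m` by the degree of `m`. -/
noncomputable def degL : SSer A π →ₗ[ℝ] SSer A π := wtL fun _ => 1
theorem coeff_degL (F : SSer A π) (m : ι →₀ ℕ) :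
    coeff m (degL F) = (m.degree : ℝ) • coeff m F := by
  rw [degL, coeff_wtL, Finsupp.degree_eq_sum]; simp
/-- A series without constant term has at least the order of its degree derivative. -/
theorem mem_ordGE_of_degL {N : ℕ} {F : SSer A π} (h0 : coeff 0 F = 0)
    (h : degL F ∈ ordGE A π N) : F ∈ ordGE A π N := fun m hm => by
  by_cases hm0 : m = 0
  · rw [hm0, h0]
  · have h1 := h m hm
    rw [coeff_degL] at h1
    refine (smul_eq_zero.1 h1).resolve_left ?_
    exact_mod_cast fun h => hm0 (degree_eq_zero_iff'.1 h)
theorem degL_mem {F : SSer A π} : degL F ∈ ordGE A π 1 := mem_ordGE_one.2 (by simp [coeff_degL])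

end Ext
end SSer

/-! ### Substitution of series without constant term -/

namespace SSer
section Subst
variable {A B D : Type*} [Ring A] [Algebra ℝ A] [SuperAlgebra A] [Ring B] [Algebra ℝ B]
  [SuperAlgebra B] [Ring D] [Algebra ℝ D] [SuperAlgebra D]
  {n r r' : ℕ} {π : Fin n → Bool} {τ : Fin r → Bool} {σ : Fin r' → Bool}

/-- The ordered product `z ^ m`. -/
noncomputable def zpow {R : Type*} [Ring R] (z : Fin n → R) (m : Fin n →₀ ℕ) : R :=
  (List.ofFn fun i => z i ^ m i).prod

theorem zpow_zero' {R : Type*} [Ring R] (z : Fin n → R) : zpow z 0 = 1 := by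
  simp [zpow]
theorem map_zpow {R R' : Type*} [Ring R] [Ring R'] [Algebra ℝ R] [Algebra ℝ R'] (f : R →ₐ[ℝ] R')
    (z : Fin n → R) (m : Fin n →₀ ℕ) : f (zpow z m) = zpow (fun i => f (z i)) m := by
  rw [zpow, map_list_prod, List.map_ofFn, zpow]; simp [Function.comp_def]

/-- Induction over increasing lists: `z j` travels to its own place and passes only factors of
smaller index, which are the odd pairs that `crossings` counts. -/
theorem zpow_aux {R : Type*} [Ring R] [Algebra ℝ R] [SuperAlgebra R] {z : Fin n → R}
    (hz : ∀ i, HasParity (π i) (z i)) (m : Fin n →₀ ℕ) (j : Fin n) (l : List (Fin n))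
    (hl : l.Pairwise (· < ·)) (hj : j ∈ l) :
    z j * (l.map fun i => z i ^ m i).prod =
      (-1 : ℝ) ^ (l.map fun i => if i < j ∧ π j = true ∧ π i = true then m i else 0).sum •
        (l.map fun i => z i ^ (m + Finsupp.single j 1 : Fin n →₀ ℕ) i).prod := by
  induction l with
  | nil => simp at hj
  | cons h l ih =>
    rw [List.pairwise_cons] at hl
    rw [List.map_cons, List.map_cons, List.map_cons, List.prod_cons, List.prod_cons, List.sum_cons]
    by_cases hjh : j = h
    · subst hjh
      have h1 : ∀ i ∈ l, i ≠ j ∧ ¬ i < j := fun i hi => ⟨(hl.1 i hi).ne', (hl.1 i hi).not_gt⟩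
      rw [List.map_congr_left (g := fun _ => 0) (f := fun i =>
        if i < j ∧ π j = true ∧ π i = true then m i else 0) fun i hi => if_neg fun h => (h1 i hi).2 h.1,
        List.map_congr_left (f := fun i => z i ^ (m + Finsupp.single j 1 : Fin n →₀ ℕ) i)
          (g := fun i => z i ^ m i) fun i hi => by
            simp [Finsupp.single_apply, (h1 i hi).1.symm]]
      simp [← mul_assoc, pow_succ']
    · have hjl : j ∈ l := (List.mem_cons.1 hj).resolve_left hjh
      have hlt := hl.1 j hjl
      have h2 : pinv (π j) (z h ^ m h) =
          (-1 : ℝ) ^ (if h < j ∧ π j = true ∧ π h = true then m h else 0) • z h ^ m h := by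
        rw [map_pow, (hz h).pinv_eq, smul_pow]
        cases π j <;> cases π h <;> simp [hlt]
      rw [← mul_assoc, (hz j).comm, h2, mul_assoc, ih hl.2 hjl, pow_add, mul_smul_comm,
        smul_mul_assoc, smul_smul, mul_comm]
      simp [Finsupp.single_apply, hjh]

theorem mul_zpow' {R : Type*} [Ring R] [Algebra ℝ R] [SuperAlgebra R] {z : Fin n → R}
    (hz : ∀ i, HasParity (π i) (z i)) (j : Fin n) (m : Fin n →₀ ℕ) :
    z j * zpow z m =
      (-1 : ℝ) ^ crossings π (Finsupp.single j 1) m • zpow z (m + Finsupp.single j 1) := by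
  have h := zpow_aux hz m j (List.finRange n) (List.pairwise_lt_finRange n) (List.mem_finRange j)
  rw [zpow, zpow, List.ofFn_eq_map, List.ofFn_eq_map, h, ← Fin.sum_univ_def]
  congr 2
  symm
  rw [crossings, Finset.sum_eq_single j]
  · refine Finset.sum_congr rfl fun i _ => ?_
    simp
  · intro i _ hi; simp [hi.symm]
  · simp

theorem zpow_of_not_adm {R : Type*} [Ring R] [Algebra ℝ R] [SuperAlgebra R] {z : Fin n → R}
    (hz : ∀ i, HasParity (π i) (z i)) {m : Fin n →₀ ℕ} (h : ¬ Adm π m) : zpow z m = 0 := by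
  simp only [Adm, not_forall, not_le] at h
  obtain ⟨i, hi, hm⟩ := h
  refine List.prod_eq_zero (List.mem_ofFn.2 ⟨i, ?_⟩)
  have := hz i
  rw [hi] at this
  obtain ⟨k, hk⟩ := Nat.exists_eq_add_of_lt hm
  rw [hk, show 1 + k + 1 = 2 + k by omega, pow_add, pow_two, this.sq_odd, zero_mul]

theorem zpow_X (m : Fin n →₀ ℕ) : zpow (X A π) m = mono A π m := by
  induction m using mono_induction with
  | h0 => rw [zpow_zero', mono_zero]
  | hs j m ih =>
    rw [mono_add_single, ← ih, mul_zpow' (fun i => hasParity_X i), smul_smul, neg_one_pow_mul_self,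
      one_smul]

theorem list_prod_sub_mem {N : ℕ} {α : Type*} (l : List α) (f g : α → SSer B τ)
    (h : ∀ a ∈ l, f a - g a ∈ ordGE B τ N) : (l.map f).prod - (l.map g).prod ∈ ordGE B τ N := by
  induction l with
  | nil => simp
  | cons a l ih =>
    rw [List.map_cons, List.map_cons, List.prod_cons, List.prod_cons]
    exact mul_sub_mul_mem (h a (by simp)) (ih fun b hb => h b (by simp [hb]))
theorem pow_sub_pow_mem {N : ℕ} {F G : SSer B τ} (h : F - G ∈ ordGE B τ N) (k : ℕ) :
    F ^ k - G ^ k ∈ ordGE B τ N := by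
  induction k with
  | zero => simp
  | succ k ih => rw [pow_succ, pow_succ]; exact mul_sub_mul_mem ih h
theorem zpow_sub_zpow_mem {N : ℕ} {z z' : Fin n → SSer B τ} (h : ∀ i, z i - z' i ∈ ordGE B τ N)
    (m : Fin n →₀ ℕ) : zpow z m - zpow z' m ∈ ordGE B τ N := by
  rw [zpow, zpow, List.ofFn_eq_map, List.ofFn_eq_map]
  exact list_prod_sub_mem _ _ _ fun i _ => pow_sub_pow_mem (h i) _
theorem pow_mem_ordGE {F : SSer B τ} (h : coeff 0 F = 0) (k : ℕ) : F ^ k ∈ ordGE B τ k := by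
  induction k with
  | zero => exact ordGE_zero _
  | succ k ih => rw [pow_succ]; exact mul_ordGE ih (mem_ordGE_one.2 h)
theorem zpow_mem {z : Fin n → SSer B τ} (h : ∀ i, coeff 0 (z i) = 0) (m : Fin n →₀ ℕ) :
    zpow z m ∈ ordGE B τ m.degree := by
  have : ∀ l : List (Fin n), (l.map fun i => z i ^ m i).prod ∈ ordGE B τ (l.map m).sum := by
    intro l
    induction l with
    | nil => exact ordGE_zero _
    | cons a l ih =>
      rw [List.map_cons, List.map_cons, List.prod_cons, List.sum_cons]
      exact mul_ordGE (pow_mem_ordGE (h a) _) ih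
  rw [Finsupp.degree_eq_sum, Fin.sum_univ_def, zpow, List.ofFn_eq_map]
  exact this _

theorem substDeg_eq (ρ : A → SSer B τ) (z : Fin n → SSer B τ) (F : SSer A π) (N : ℕ) :
    substDeg ρ z F N =
      ∑ m ∈ Finset.finsuppAntidiag Finset.univ N, ρ (coeff m F) * zpow z m := rfl
theorem substDeg_mem (ρ : A → SSer B τ) {z : Fin n → SSer B τ} (h : ∀ i, coeff 0 (z i) = 0)
    (F : SSer A π) (N : ℕ) : substDeg ρ z F N ∈ ordGE B τ N := by
  rw [substDeg_eq]
  refine sum_mem fun m hm => ?_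
  rw [← mem_finsuppAntidiag_univ.1 hm]
  exact mul_ordGE_right (zpow_mem h m) _
theorem substDeg_eq_zero {ρ : A → SSer B τ} (hρ : ρ 0 = 0) (z : Fin n → SSer B τ)
    {F : SSer A π} {N M : ℕ} (hF : F ∈ ordGE A π M) (hN : N < M) : substDeg ρ z F N = 0 := by
  rw [substDeg_eq]
  refine Finset.sum_eq_zero fun m hm => ?_
  rw [hF m (by rwa [mem_finsuppAntidiag_univ.1 hm]), hρ, zero_mul]
theorem subst_mem {ρ : A → SSer B τ} (hρ : ρ 0 = 0) {z : Fin n → SSer B τ}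
    (h : ∀ i, coeff 0 (z i) = 0) {N : ℕ} {F : SSer A π} (hF : F ∈ ordGE A π N) :
    subst ρ z F ∈ ordGE B τ N := orderSum_mem fun i => by
  rcases lt_or_ge i N with hi | hi
  · rw [substDeg_eq_zero hρ z hF hi]; exact zero_mem _
  · exact ordGE_anti hi (substDeg_mem ρ h F i)
theorem coeff_zero_subst (ρ : A → SSer B τ) (z : Fin n → SSer B τ) (F : SSer A π) :
    coeff 0 (subst ρ z F) = coeff 0 (ρ (coeff 0 F)) := by
  rw [subst, orderSum, coeff_mk adm_zero]
  simp [substDeg_eq, zpow_zero']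

/-- Congruence of substitutions modulo the filtration. -/
theorem subst_sub_subst_mem {ρ ρ' : A → SSer B τ} {z z' : Fin n → SSer B τ} (F : SSer A π) {N : ℕ}
    (h : ∀ i, z i - z' i ∈ ordGE B τ N) (hρ : ∀ m, ρ (coeff m F) - ρ' (coeff m F) ∈ ordGE B τ N) :
    subst ρ z F - subst ρ' z' F ∈ ordGE B τ N := fun m hm => by
  by_cases ha : Adm π 0 ∧ Adm τ m
  · rw [coeff_sub, subst, subst, orderSum, orderSum, coeff_mk ha.2, coeff_mk ha.2,
      ← Finset.sum_sub_distrib]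
    refine Finset.sum_eq_zero fun k _ => ?_
    rw [← coeff_sub]
    refine (?_ : substDeg ρ z F k - substDeg ρ' z' F k ∈ ordGE B τ N) m hm
    rw [substDeg_eq, substDeg_eq, ← Finset.sum_sub_distrib]
    exact sum_mem fun m _ => mul_sub_mul_mem (hρ m) (zpow_sub_zpow_mem h m)
  · exact coeff_of_not_adm (fun h' => ha ⟨adm_zero, h'⟩) _

theorem orderSum_single {F : ℕ → SSer B τ} {d : ℕ} (h : ∀ N, N ≠ d → F N = 0)
    (hd : F d ∈ ordGE B τ d) : orderSum F = F d := ext fun m hm => by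
  rw [orderSum, coeff_mk hm]
  by_cases hmd : d ≤ m.degree
  · rw [Finset.sum_eq_single d]
    · intro b _ hb; rw [h b hb, coeff_zero]
    · intro h'; exact absurd (Finset.mem_range.2 (by omega)) h'
  · rw [hd m (by omega)]
    refine Finset.sum_eq_zero fun b hb => ?_
    rw [h b (by rw [Finset.mem_range] at hb; omega), coeff_zero]

section Hom
variable {ρ : A →ₐ[ℝ] SSer B τ} {z : Fin n → SSer B τ}

/-- The substitution as a linear map. -/
noncomputable def substL (ρ : A →ₐ[ℝ] SSer B τ) (z : Fin n → SSer B τ) :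
    SSer A π →ₗ[ℝ] SSer B τ where
  toFun := subst ρ z
  map_add' F G := by
    simp only [subst, ← orderSum_add]
    congr 1; funext N
    simp only [substDeg_eq, coeff_add, map_add, add_mul, Finset.sum_add_distrib]
  map_smul' c F := by
    simp only [subst, RingHom.id_apply, ← orderSum_smul]
    congr 1; funext N
    simp only [substDeg_eq, coeff_smul, map_smul, smul_mul_assoc, Finset.smul_sum]

theorem cont_substL (h0 : ∀ i, coeff 0 (z i) = 0) :
    Cont (substL ρ z : SSer A π →ₗ[ℝ] SSer B τ) :=
  Cont.of_ord fun _ _ h => subst_mem (map_zero ρ) h0 h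

theorem subst_C_mul_mono (h0 : ∀ i, coeff 0 (z i) = 0) (a : A) {m : Fin n →₀ ℕ} (hm : Adm π m) :
    subst ρ z (C π a * mono A π m) = ρ a * zpow z m := by
  have h1 : substDeg ρ z (C π a * mono A π m) m.degree = ρ a * zpow z m := by
    rw [substDeg_eq, Finset.sum_eq_single m]
    · rw [coeff_C_mul_mono hm, if_pos rfl]
    · intro k _ hk
      by_cases hk' : Adm π k
      · rw [coeff_C_mul_mono hk', if_neg hk, map_zero, zero_mul]
      · rw [coeff_of_not_adm hk', map_zero, zero_mul]
    · intro h; exact absurd (mem_finsuppAntidiag_univ.2 rfl) h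
  rw [subst, orderSum_single (d := m.degree), h1]
  · intro N hN
    rw [substDeg_eq]
    refine Finset.sum_eq_zero fun k hk => ?_
    rw [mem_finsuppAntidiag_univ] at hk
    by_cases hk' : Adm π k
    · rw [coeff_C_mul_mono hk', if_neg (by rintro rfl; exact hN hk.symm), map_zero, zero_mul]
    · rw [coeff_of_not_adm hk', map_zero, zero_mul]
  · exact substDeg_mem _ h0 _ _

theorem subst_C_mul (h0 : ∀ i, coeff 0 (z i) = 0) (a : A) (F : SSer A π) :
    subst ρ z (C π a * F) = ρ a * subst ρ z F := by
  refine sub_eq_zero.1 (linear_ext (L := (substL ρ z).comp (LinearMap.mulLeft ℝ (C π a)) -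
    (LinearMap.mulLeft ℝ (ρ a)).comp (substL ρ z))
    (((cont_substL h0).comp (cont_mulLeft _)).sub ((cont_mulLeft _).comp (cont_substL h0)))
    (fun b m hm => sub_eq_zero.2 ?_) F)
  change subst ρ z (C π a * (C π b * mono A π m)) = ρ a * subst ρ z (C π b * mono A π m)
  rw [← mul_assoc, ← C_mul, subst_C_mul_mono h0 _ hm, subst_C_mul_mono h0 _ hm, map_mul, mul_assoc]

variable (hρ : IsSuper ρ) (hz : ∀ i, HasParity (π i) (z i)) (h0 : ∀ i, coeff 0 (z i) = 0)
include hρ hz h0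

theorem subst_X_mul (j : Fin n) (F : SSer A π) :
    subst ρ z (X A π j * F) = z j * subst ρ z F := by
  refine sub_eq_zero.1 (linear_ext (L := (substL ρ z).comp (LinearMap.mulLeft ℝ (X A π j)) -
    (LinearMap.mulLeft ℝ (z j)).comp (substL ρ z))
    (((cont_substL h0).comp (cont_mulLeft _)).sub ((cont_mulLeft _).comp (cont_substL h0)))
    (fun b m hm => sub_eq_zero.2 ?_) F)
  change subst ρ z (X A π j * (C π b * mono A π m)) = z j * subst ρ z (C π b * mono A π m)
  rw [← mul_assoc, (hasParity_X j).comm, pinv_C, mul_assoc, X_mul_mono, mul_smul_comm,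
    subst_C_mul_mono h0 _ hm, ← mul_assoc, (hz j).comm, mul_assoc, mul_zpow' hz, mul_smul_comm]
  refine (map_smul (substL ρ z) _ _).trans ?_
  congr 1
  change subst ρ z _ = _
  by_cases h : Adm π (m + Finsupp.single j 1)
  · rw [subst_C_mul_mono h0 _ h, hρ.pinv]
  · rw [mono_of_not_adm h, zpow_of_not_adm hz h, mul_zero, mul_zero]
    exact map_zero (substL ρ z)

/-- Multiplicativity is built up from left factors: constants, single variables, monomials by
induction, and then arbitrary series by density. The parities of the `z i` enter through the
matching of signs when a variable is sorted into a monomial. -/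
theorem subst_mul (F G : SSer A π) : subst ρ z (F * G) = subst ρ z F * subst ρ z G := by
  have h1 : ∀ m, Adm π m → ∀ G, subst ρ z (mono A π m * G) = zpow z m * subst ρ z G := fun m => by
    induction m using mono_induction with
    | h0 => intro _ G; rw [mono_zero, zpow_zero', one_mul, one_mul]
    | hs j m ih =>
      intro hm G
      rw [mono_add_single, smul_mul_assoc, mul_assoc]
      refine (map_smul (substL ρ z) _ _).trans ?_
      change _ • subst ρ z _ = _
      rw [subst_X_mul hρ hz h0, ih (adm_left hm), ← mul_assoc, mul_zpow' hz, smul_mul_assoc,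
        smul_smul, neg_one_pow_mul_self, one_smul]
  refine sub_eq_zero.1 (linear_ext (L := (substL ρ z).comp (LinearMap.mulRight ℝ G) -
    (LinearMap.mulRight ℝ (subst ρ z G)).comp (substL ρ z))
    (((cont_substL h0).comp (cont_mulRight _)).sub ((cont_mulRight _).comp (cont_substL h0)))
    (fun b m hm => sub_eq_zero.2 ?_) F)
  change subst ρ z (C π b * mono A π m * G) = subst ρ z (C π b * mono A π m) * subst ρ z G
  rw [mul_assoc, subst_C_mul h0, h1 m hm, subst_C_mul_mono h0 _ hm, mul_assoc]

omit hρ hz in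
theorem subst_C (a : A) : subst ρ z (C π a) = ρ a := by
  have := subst_C_mul_mono (π := π) (ρ := ρ) h0 a adm_zero
  rwa [mono_zero, mul_one, zpow_zero', mul_one] at this
theorem subst_X (i : Fin n) : subst ρ z (X A π i) = z i := by
  have h1 : (1 : SSer A π) = C π 1 := rfl
  rw [← mul_one (X A π i), subst_X_mul hρ hz h0, h1, subst_C h0, map_one, mul_one]

end Hom

/-- The substitution as a homomorphism. -/
noncomputable def substHom (ρ : A →ₐ[ℝ] SSer B τ) (z : Fin n → SSer B τ) (hρ : IsSuper ρ)
    (hz : ∀ i, HasParity (π i) (z i)) (h0 : ∀ i, coeff 0 (z i) = 0) : SSer A π →ₐ[ℝ] SSer B τ :=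
  AlgHom.ofLinearMap (substL ρ z)
    ((subst_C h0 (1 : A)).trans (map_one ρ)) (subst_mul hρ hz h0)

section
variable {ρ : A →ₐ[ℝ] SSer B τ} {z : Fin n → SSer B τ} (hρ : IsSuper ρ)
  (hz : ∀ i, HasParity (π i) (z i)) (h0 : ∀ i, coeff 0 (z i) = 0)
theorem cont_substHom : Cont (substHom (π := π) ρ z hρ hz h0).toLinearMap := cont_substL h0
theorem substHom_C (a : A) : substHom ρ z hρ hz h0 (C π a) = ρ a := subst_C h0 a
theorem substHom_X (i : Fin n) : substHom ρ z hρ hz h0 (X A π i) = z i := subst_X hρ hz h0 i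
theorem substHom_isSuper : IsSuper (substHom (π := π) ρ z hρ hz h0) := by
  intro F
  have h := hom_ext (θ := (substHom (π := π) ρ z hρ hz h0).comp (pinv true))
    (θ' := (pinv true).comp (substHom (π := π) ρ z hρ hz h0))
    (by rw [AlgHom.comp_toLinearMap]; exact (cont_substHom hρ hz h0).comp (cont_pinv true))
    (by rw [AlgHom.comp_toLinearMap]; exact (cont_pinv true).comp (cont_substHom hρ hz h0))
    (fun a => by
      rw [AlgHom.comp_apply, AlgHom.comp_apply, pinv_C, substHom_C, substHom_C]
      exact hρ.pinv true a)
    (fun i => by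
      rw [AlgHom.comp_apply, AlgHom.comp_apply, (hasParity_X i).pinv_eq, map_smul, substHom_X,
        (hz i).pinv_eq]) F
  simpa only [AlgHom.comp_apply, pinv_true] using h

/-- The chain rule. -/
theorem chain_rule {e : Bool} {D : SSer B τ →ₗ[ℝ] SSer B τ}
    (hD : IsDer (AlgHom.id ℝ _) e D) (hDc : Cont D) {L : SSer A π →ₗ[ℝ] SSer B τ}
    (hL : IsDer (substHom ρ z hρ hz h0) e L) (hLc : Cont L) (hLC : ∀ a, L (C π a) = D (ρ a))
    (hLX : ∀ i, L (X A π i) = 0) (F : SSer A π) :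
    D (subst ρ z F) = L F + ∑ i, D (z i) * subst ρ z (deriv i F) := by
  have h1 : ∀ i, IsDer (substHom ρ z hρ hz h0) e
      ((LinearMap.mulLeft ℝ (D (z i))).comp
        ((substHom ρ z hρ hz h0).toLinearMap.comp (derivL i))) := fun i => by
    have := ((isDer_derivL i).post (substHom_isSuper hρ hz h0)).mulLeft (hD.hasParity (hz i))
    rwa [Bool.xor_assoc, Bool.xor_self, Bool.xor_false] at this
  -- Both sides are derivations along the substitution. On constants they agree since `L` carries
  -- the dependence through the coefficients, on variables since `L` kills them and `∂ X_j / ∂ X_i`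
  -- is a Kronecker symbol.
  have h2 := der_ext' (L := D.comp (substHom ρ z hρ hz h0).toLinearMap)
    (L' := L + ∑ i, (LinearMap.mulLeft ℝ (D (z i))).comp
        ((substHom ρ z hρ hz h0).toLinearMap.comp (derivL i)))
    (hD.pre (substHom_isSuper hρ hz h0)) (hL.add (IsDer.sum fun i _ => h1 i))
    (hDc.comp (cont_substHom hρ hz h0))
    (hLc.add (Cont.sum _ fun i _ => (cont_mulLeft _).comp
      ((cont_substHom hρ hz h0).comp (cont_derivL i))))
    (fun a => by
      simp [LinearMap.add_apply, LinearMap.sum_apply, deriv_C, hLC, substHom_C])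
    (fun i => by
      simp only [LinearMap.comp_apply, AlgHom.toLinearMap_apply, substHom_X, LinearMap.add_apply,
        hLX, zero_add, LinearMap.sum_apply, derivL_apply, deriv_X, LinearMap.mulLeft_apply]
      rw [Finset.sum_eq_single i]
      · rw [if_pos rfl, map_one, mul_one]
      · intro j _ hj; rw [if_neg hj, map_zero, mul_zero]
      · simp) F
  rw [LinearMap.add_apply, LinearMap.sum_apply] at h2
  exact h2
end

theorem substDeg_nat {A' B' : Type*} [Ring A'] [Algebra ℝ A'] [SuperAlgebra A'] [Ring B']
    [Algebra ℝ B'] [SuperAlgebra B'] {ρ : A → SSer B τ} {ρ' : A' → SSer B' σ}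
    (η : SSer B τ →ₐ[ℝ] SSer B' σ) (f : A →ₗ[ℝ] A')
    (h : ∀ a, ρ' (f a) = η (ρ a)) (z : Fin n → SSer B τ) (F : SSer A π) (N : ℕ) :
    substDeg ρ' (fun i => η (z i)) (mapL f F) N = η (substDeg ρ z F N) := by
  rw [substDeg_eq, substDeg_eq, map_sum]
  refine Finset.sum_congr rfl fun m _ => ?_
  rw [coeff_mapL, h, map_mul, map_zpow]

end Subst

/-- A linear map that does not lower the order is continuous and commutes with the partial sums,
hence with their limit. -/
theorem orderSum_map {A B : Type*} [Ring A] [Algebra ℝ A] [SuperAlgebra A] [Ring B] [Algebra ℝ B]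
    [SuperAlgebra B] {ι κ : Type*} [Fintype ι] [LinearOrder ι] [Fintype κ] [LinearOrder κ]
    {π : ι → Bool} {τ : κ → Bool} {L : SSer A π →ₗ[ℝ] SSer B τ}
    (hL : ∀ N, ∀ F ∈ ordGE A π N, L F ∈ ordGE B τ N) {F : ℕ → SSer A π}
    (hF : ∀ N, F N ∈ ordGE A π N) : L (orderSum F) = orderSum fun N => L (F N) := by
  refine eq_of_ordGE fun N => ?_
  have h1 := hL N _ (orderSum_sub_mem hF le_rfl)
  have h2 := orderSum_sub_mem (fun N => hL N _ (hF N)) (le_refl N)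
  rw [map_sub, map_sum] at h1
  have := sub_mem h1 h2
  simpa using this

end SSer

/-! ### Coordinates on a superalgebra and the Taylor expansion -/

/-- A system of coordinates on a superalgebra: elements `y i` and superderivations `∂ / ∂ y i`. -/
structure CoordSys (B : Type*) [Ring B] [Algebra ℝ B] [SuperAlgebra B] {n : ℕ}
    (π : Fin n → Bool) where
  y : Fin n → B
  d : Fin n → B →ₗ[ℝ] B
  y_par : ∀ i, HasParity (π i) (y i)
  d_der : ∀ i, IsDer (AlgHom.id ℝ B) (π i) (d i)
  d_y : ∀ i j, d i (y j) = if i = j then 1 else 0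
  d_comm : ∀ i j b, d i (d j b) = sgn (π i && π j) • d j (d i b)

/-- The chain rule for a change of coordinates. -/
def CoordSys.ChainRule {B : Type*} [Ring B] [Algebra ℝ B] [SuperAlgebra B] {n : ℕ}
    {π : Fin n → Bool} (cs cs' : CoordSys B π) : Prop :=
  ∀ i f, cs.d i f = ∑ b, cs.d i (cs'.y b) * cs'.d b f

namespace SSer
section Taylor
variable {A B : Type*} [Ring A] [Algebra ℝ A] [SuperAlgebra A] [Ring B] [Algebra ℝ B]
  [SuperAlgebra B] {n r : ℕ} {π : Fin n → Bool} {τ : Fin r → Bool}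

/-- The term of degree `N` of the Taylor expansion, up to `N!`. -/
noncomputable def tayN (cs : CoordSys B π) (φ : B →ₐ[ℝ] A) (ν : Fin n → SSer A τ) :
    ℕ → B →ₗ[ℝ] SSer A τ
  | 0 => (CHom τ).toLinearMap ∘ₗ φ.toLinearMap
  | N + 1 => ∑ i, (LinearMap.mulLeft ℝ (ν i)) ∘ₗ (tayN cs φ ν N) ∘ₗ (cs.d i)

/-- The Taylor expansion at `φ`. -/
noncomputable def tay (cs : CoordSys B π) (φ : B →ₐ[ℝ] A) (Y : Fin n → SSer A τ) (f : B) :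
    SSer A τ :=
  orderSum fun N => (N.factorial : ℝ)⁻¹ • tayN cs φ (fun i => Y i - C τ (φ (cs.y i))) N f

variable (cs : CoordSys B π) (φ : B →ₐ[ℝ] A)

theorem tayN_zero (ν : Fin n → SSer A τ) (f : B) : tayN cs φ ν 0 f = C τ (φ f) := rfl
theorem tayN_succ (ν : Fin n → SSer A τ) (N : ℕ) (f : B) :
    tayN cs φ ν (N + 1) f = ∑ i, ν i * tayN cs φ ν N (cs.d i f) := by
  simp [tayN, LinearMap.sum_apply]

/-- The recursion splits off the last letter of a word: it is the derivative that is applied to `f`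
before the others, and after reversal its increment stands leftmost. -/
theorem tayN_eq_sum_words (ν : Fin n → SSer A τ) (N : ℕ) (f : B) :
    ∑ w : Fin N → Fin n, ((List.ofFn w).reverse.map ν).prod *
      C τ (φ ((List.ofFn w).foldr (fun i g => cs.d i g) f)) = tayN cs φ ν N f := by
  induction N generalizing f with
  | zero => simp [tayN_zero]
  | succ N ih =>
    rw [tayN_succ, ← (Fin.snocEquiv fun _ : Fin (N + 1) => Fin n).sum_comp,
      Fintype.sum_prod_type]
    refine Finset.sum_congr rfl fun i _ => ?_
    rw [← ih, Finset.mul_sum]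
    refine Finset.sum_congr rfl fun w _ => ?_
    have : List.ofFn ((Fin.snocEquiv fun _ : Fin (N + 1) => Fin n) (i, w)) =
        List.ofFn w ++ [i] := by
      rw [List.ofFn_succ', List.concat_eq_append]
      simp [Fin.snocEquiv]
    rw [this]
    simp [mul_assoc]

theorem tayN_mem {ν : Fin n → SSer A τ} (hν : ∀ i, ν i ∈ ordGE A τ 1) (N : ℕ) (f : B) :
    tayN cs φ ν N f ∈ ordGE A τ N := by
  induction N generalizing f with
  | zero => exact ordGE_zero _
  | succ N ih =>
    rw [tayN_succ, add_comm]
    exact sum_mem fun i _ => mul_ordGE (hν i) (ih _)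
theorem tayN_sub_mem {ν ν' : Fin n → SSer A τ} {M : ℕ} (h : ∀ i, ν i - ν' i ∈ ordGE A τ M) (N : ℕ)
    (f : B) : tayN cs φ ν N f - tayN cs φ ν' N f ∈ ordGE A τ M := by
  induction N generalizing f with
  | zero => rw [tayN_zero, tayN_zero, sub_self]; exact zero_mem _
  | succ N ih =>
    rw [tayN_succ, tayN_succ, ← Finset.sum_sub_distrib]
    exact sum_mem fun i _ => mul_sub_mul_mem (h i) (ih _)
theorem tay_sub_mem {Y Y' : Fin n → SSer A τ} {M : ℕ} (h : ∀ i, Y i - Y' i ∈ ordGE A τ M)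
    (f : B) : tay cs φ Y f - tay cs φ Y' f ∈ ordGE A τ M := by
  intro m hm
  by_cases ha : Adm τ m
  · rw [tay, tay, orderSum, orderSum, coeff_sub, coeff_mk ha, coeff_mk ha,
      ← Finset.sum_sub_distrib]
    refine Finset.sum_eq_zero fun k _ => ?_
    rw [← coeff_sub, ← smul_sub]
    exact Submodule.smul_mem _ _ (tayN_sub_mem cs φ (fun i => by
      rw [sub_sub_sub_cancel_right]; exact h i) k f) m hm
  · exact coeff_of_not_adm ha _

theorem tayN_add_single_one (ν : Fin n → SSer A τ) (N : ℕ) : tayN cs φ ν (N + 1) 1 = 0 := by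
  rw [tayN_succ]
  refine Finset.sum_eq_zero fun i _ => ?_
  rw [(cs.d_der i).map_one, map_zero, mul_zero]

/-- The functions `Y i` extend the functions `φ (y i)` and have their parities. -/
structure Extends (cs : CoordSys B π) (φ : B →ₐ[ℝ] A) (Y : Fin n → SSer A τ) : Prop where
  par : ∀ i, HasParity (π i) (Y i)
  zero : ∀ i, coeff 0 (Y i) = φ (cs.y i)

variable {cs φ} (hφ : IsSuper φ) {Y : Fin n → SSer A τ} (hY : Extends cs φ Y)

theorem Extends.sub_mem (hY : Extends cs φ Y) (i : Fin n) :
    Y i - C τ (φ (cs.y i)) ∈ ordGE A τ 1 :=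
  mem_ordGE_one.2 (by rw [coeff_sub, hY.zero, coeff_zero_C, sub_self])

include hφ in
theorem Extends.sub_par (hY : Extends cs φ Y) (i : Fin n) :
    HasParity (π i) (Y i - C τ (φ (cs.y i))) :=
  (hY.par i).sub (hasParity_C (hφ.hasParity (cs.y_par i)))

/-- The partial sums of the Taylor expansion. -/
noncomputable def tayP (cs : CoordSys B π) (φ : B →ₐ[ℝ] A) (Y : Fin n → SSer A τ) (M : ℕ) (f : B) :
    SSer A τ :=
  ∑ N ∈ Finset.range M,
    (N.factorial : ℝ)⁻¹ • tayN cs φ (fun i => Y i - C τ (φ (cs.y i))) N f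

include hY in
theorem tay_term_mem (f : B) (N : ℕ) :
    (N.factorial : ℝ)⁻¹ • tayN cs φ (fun i => Y i - C τ (φ (cs.y i))) N f ∈ ordGE A τ N :=
  Submodule.smul_mem _ _ (tayN_mem cs φ hY.sub_mem N f)
include hY in
theorem tay_sub_tayP_mem (M : ℕ) (f : B) : tay cs φ Y f - tayP cs φ Y M f ∈ ordGE A τ M :=
  orderSum_sub_mem (tay_term_mem hY f) le_rfl

include hφ in
-- The product rule on `N` increments gives `N` equal contributions, since increments and partial
-- derivatives can be permuted with the same sign. The second sum is the variation of the base
-- point, which by `hDφ` obeys the chain rule.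
theorem tayN_der {e : Bool} {D : SSer A τ →ₗ[ℝ] SSer A τ} (hD : IsDer (AlgHom.id ℝ _) e D)
    (hDφ : ∀ b, D (C τ (φ b)) = ∑ i, D (C τ (φ (cs.y i))) * C τ (φ (cs.d i b)))
    {ν : Fin n → SSer A τ} (hν : ∀ i, HasParity (π i) (ν i)) (N : ℕ) (f : B) :
    D (tayN cs φ ν N f) =
      ∑ i, (D (ν i) * (N : ℝ) • tayN cs φ ν (N - 1) (cs.d i f)) +
      ∑ i, D (C τ (φ (cs.y i))) * tayN cs φ ν N (cs.d i f) := by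
  induction N generalizing f with
  | zero => simp [tayN_zero, hDφ f]
  | succ N ih =>
    -- Moving `ν j` past `x i` and interchanging `cs.d i` with `cs.d j` produce signs that cancel
    -- against the sign in `pinv e (ν j)`; this is where the parity of `x i` is needed.
    have key : ∀ (j : Fin n) (x : Fin n → SSer A τ) (p : Fin n → Bool)
        (hx : ∀ i, HasParity (e ^^ π i) (x i)) (T : B →ₗ[ℝ] SSer A τ),
        pinv e (ν j) * ∑ i, x i * T (cs.d i (cs.d j f)) =
        ∑ i, x i * (ν j * T (cs.d j (cs.d i f))) := by
      intro j x p hx T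
      rw [Finset.mul_sum]
      refine Finset.sum_congr rfl fun i _ => ?_
      rw [← mul_assoc, ← mul_assoc, (hν j).pinv_eq, smul_mul_assoc, (hν j).comm_sgn (hx i),
        cs.d_comm, map_smul]
      simp only [smul_mul_assoc, mul_smul_comm, smul_smul]
      convert one_smul ℝ _ using 2
      cases e <;> cases π i <;> cases π j <;> simp
    rw [tayN_succ, map_sum]
    simp only [hD.leib, AlgHom.id_apply, ih, mul_add, Finset.sum_add_distrib]
    rw [← add_assoc]
    congr 1
    · have h1 : ∀ j, pinv e (ν j) * ∑ i, D (ν i) * (N : ℝ) •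
            tayN cs φ ν (N - 1) (cs.d i (cs.d j f)) =
          ∑ i, D (ν i) * (ν j * (N : ℝ) • tayN cs φ ν (N - 1) (cs.d j (cs.d i f))) := fun j =>
        key j (fun i => D (ν i)) π (fun i => hD.hasParity (hν i)) ((N : ℝ) • tayN cs φ ν (N - 1))
      rw [Finset.sum_congr rfl fun j _ => h1 j, Finset.sum_comm, ← Finset.sum_add_distrib]
      refine Finset.sum_congr rfl fun i _ => ?_
      rw [← Finset.mul_sum, ← mul_add]
      congr 1
      rw [Nat.add_sub_cancel, Nat.cast_add, Nat.cast_one, add_smul, one_smul, add_comm]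
      congr 1
      rcases N with _ | N
      · simp
      · rw [Nat.add_sub_cancel, tayN_succ, Finset.smul_sum]
        simp only [mul_smul_comm]
    · have h1 : ∀ j, pinv e (ν j) * ∑ i, D (C τ (φ (cs.y i))) *
            tayN cs φ ν N (cs.d i (cs.d j f)) =
          ∑ i, D (C τ (φ (cs.y i))) * (ν j * tayN cs φ ν N (cs.d j (cs.d i f))) := fun j =>
        key j (fun i => D (C τ (φ (cs.y i)))) π
          (fun i => hD.hasParity (hasParity_C (hφ.hasParity (cs.y_par i)))) _
      rw [Finset.sum_congr rfl fun j _ => h1 j, Finset.sum_comm]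
      refine Finset.sum_congr rfl fun i _ => ?_
      rw [← Finset.mul_sum, tayN_succ]

include hφ hY in
-- The sum telescopes: the increment part in degree `N + 1` and the base point part in degree `N`
-- combine to `D (Y i)`, because `1/(N+1)!` times `N + 1` is `1/N!`. Only the base point part of the
-- top degree is left over.
theorem tayP_der {e : Bool} {D : SSer A τ →ₗ[ℝ] SSer A τ} (hD : IsDer (AlgHom.id ℝ _) e D)
    (hDφ : ∀ b, D (C τ (φ b)) = ∑ i, D (C τ (φ (cs.y i))) * C τ (φ (cs.d i b))) (M : ℕ) (f : B) :
    D (tayP cs φ Y (M + 1) f) = ∑ i, D (Y i) * tayP cs φ Y M (cs.d i f) +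
      ∑ i, D (C τ (φ (cs.y i))) * ((M.factorial : ℝ)⁻¹ •
        tayN cs φ (fun i => Y i - C τ (φ (cs.y i))) M (cs.d i f)) := by
  have h := tayN_der hφ hD hDφ (hY.sub_par hφ)
  set ν := fun i => Y i - C τ (φ (cs.y i)) with hν
  have h1 : tayP cs φ Y (M + 1) f =
      ∑ N ∈ Finset.range (M + 1), (N.factorial : ℝ)⁻¹ • tayN cs φ ν N f := rfl
  have h2 : ∀ M f, tayP cs φ Y M f =
      ∑ N ∈ Finset.range M, (N.factorial : ℝ)⁻¹ • tayN cs φ ν N f := fun _ _ => rfl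
  have h3 : ∀ i, D (Y i) = D (ν i) + D (C τ (φ (cs.y i))) := fun i => by
    rw [← map_add, hν]; simp
  rw [h1]
  induction M with
  | zero =>
    rw [Finset.sum_range_one, Nat.factorial_zero, Nat.cast_one, inv_one, one_smul, h]
    simp [h2]
  | succ M ih =>
    rw [Finset.sum_range_succ, map_add, ih rfl, map_smul, h]
    have h4 : ∀ i, tayP cs φ Y (M + 1) (cs.d i f) = tayP cs φ Y M (cs.d i f) +
        (M.factorial : ℝ)⁻¹ • tayN cs φ ν M (cs.d i f) := fun i => by
      rw [h2, Finset.sum_range_succ, ← h2]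
    have h5 : ((M + 1).factorial : ℝ)⁻¹ * ((M + 1 : ℕ) : ℝ) = (M.factorial : ℝ)⁻¹ := by
      rw [Nat.factorial_succ]; push_cast
      field_simp
    simp only [h4, mul_add, Finset.sum_add_distrib, smul_add, Finset.smul_sum, mul_smul_comm,
      smul_smul, Nat.add_sub_cancel]
    simp only [h5, h3, add_mul, Finset.sum_add_distrib, smul_add]
    abel

include hφ hY in
/-- The chain rule for the Taylor expansion. -/
theorem tay_der {e : Bool} {D : SSer A τ →ₗ[ℝ] SSer A τ} (hD : IsDer (AlgHom.id ℝ _) e D)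
    (hDc : Cont D)
    (hDφ : ∀ b, D (C τ (φ b)) = ∑ i, D (C τ (φ (cs.y i))) * C τ (φ (cs.d i b))) (f : B) :
    D (tay cs φ Y f) = ∑ i, D (Y i) * tay cs φ Y (cs.d i f) := by
  refine eq_of_ordGE fun N => ?_
  obtain ⟨M, hM⟩ := hDc N
  -- At least `M`, so that continuity of `D` controls the tail, and at least `N`, so that the
  -- left-over term of `tayP_der` has order `N`.
  set K := max M N
  have h1 : D (tay cs φ Y f - tayP cs φ Y (K + 1) f) ∈ ordGE A τ N :=
    hM _ (ordGE_anti (by omega) (tay_sub_tayP_mem hY (K + 1) f))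
  have h2 : ∑ i, D (Y i) * (tay cs φ Y (cs.d i f) - tayP cs φ Y K (cs.d i f)) ∈ ordGE A τ N :=
    sum_mem fun i _ => mul_ordGE_right
      (ordGE_anti (le_max_right _ _) (tay_sub_tayP_mem hY K _)) _
  have h3 : ∑ i, D (C τ (φ (cs.y i))) * ((K.factorial : ℝ)⁻¹ •
        tayN cs φ (fun i => Y i - C τ (φ (cs.y i))) K (cs.d i f)) ∈ ordGE A τ N :=
    sum_mem fun i _ => mul_ordGE_right
      (ordGE_anti (le_max_right _ _) (tay_term_mem hY _ K)) _
  rw [map_sub, tayP_der hφ hY hD hDφ] at h1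
  have h4 := add_mem (sub_mem h1 h2) h3
  simp only [mul_sub, Finset.sum_sub_distrib] at h4
  convert h4 using 1
  abel

include hφ hY in
theorem degL_tay (f : B) : degL (tay cs φ Y f) = ∑ i, degL (Y i) * tay cs φ Y (cs.d i f) :=
  tay_der hφ hY (isDer_wtL _) (cont_wtL _) (fun b => by simp [wtL_C]) f

theorem tay_add (f g : B) : tay cs φ Y (f + g) = tay cs φ Y f + tay cs φ Y g := by
  simp only [tay, map_add, smul_add, orderSum_add]
theorem tay_smul (c : ℝ) (f : B) : tay cs φ Y (c • f) = c • tay cs φ Y f := by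
  simp only [tay, map_smul, ← orderSum_smul, smul_comm c]
theorem coeff_zero_tay (f : B) : coeff 0 (tay cs φ Y f) = φ f := by
  rw [tay, orderSum, coeff_mk adm_zero]
  simp [tayN_zero, coeff_smul, coeff_zero_C]
theorem tay_zero : tay cs φ Y 0 = 0 := by
  have := tay_smul (cs := cs) (φ := φ) (Y := Y) 0 0
  simpa using this
theorem tay_sum {κ : Type*} (s : Finset κ) (f : κ → B) :
    tay cs φ Y (∑ i ∈ s, f i) = ∑ i ∈ s, tay cs φ Y (f i) := by
  classical
  induction s using Finset.induction_on with
  | empty => simp [tay_zero]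
  | insert i s hi ih => rw [Finset.sum_insert hi, Finset.sum_insert hi, tay_add, ih]

include hφ hY in
theorem tay_inv (f : B) : tay cs φ Y (SuperAlgebra.inv f) = SuperAlgebra.inv (tay cs φ Y f) := by
  have h1 : ∀ N f, tayN cs φ (fun i => Y i - C τ (φ (cs.y i))) N (SuperAlgebra.inv f) =
      SuperAlgebra.inv (tayN cs φ (fun i => Y i - C τ (φ (cs.y i))) N f) := by
    intro N
    induction N with
    | zero => intro f; rw [tayN_zero, tayN_zero, hφ, ← CHom_apply, CHom_isSuper]; rfl
    | succ N ih =>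
      intro f
      rw [tayN_succ, tayN_succ, map_sum]
      refine Finset.sum_congr rfl fun i _ => ?_
      rw [(cs.d_der i).par, map_smul, ih, map_mul, hasParity_iff.1 (hY.sub_par hφ i),
        smul_mul_assoc, mul_smul_comm]
  have h2 := orderSum_map (L := (pinv true : SSer A τ →ₐ[ℝ] SSer A τ).toLinearMap)
    (fun N F h => pinv_ordGE true h) (tay_term_mem hY f)
  rw [tay, tay]
  simp only [h1]
  refine Eq.trans ?_ h2.symm
  congr 1
  funext N
  rw [map_smul]; rfl

include hφ hY in
theorem tay_pinv (e : Bool) (f : B) : tay cs φ Y (pinv e f) = pinv e (tay cs φ Y f) := by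
  cases e; exacts [rfl, tay_inv hφ hY f]

include hφ hY in
-- No binomial formula is needed. By the chain rule, `degL` of the defect of multiplicativity is a
-- combination of defects for derivatives of `f` and `g`, with coefficients `degL (Y i)` of positive
-- order. As the constant term of the defect vanishes, its order increases step by step, so the
-- defect is zero.
theorem tay_mul (f g : B) : tay cs φ Y (f * g) = tay cs φ Y f * tay cs φ Y g := by
  have h : ∀ N f g, tay cs φ Y (f * g) - tay cs φ Y f * tay cs φ Y g ∈ ordGE A τ N := by
    intro N
    induction N with
    | zero => exact fun f g => ordGE_zero _
    | succ N ih =>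
      intro f g
      refine mem_ordGE_of_degL ?_ ?_
      · rw [coeff_sub, coeff_zero_mul, coeff_zero_tay, coeff_zero_tay, coeff_zero_tay, map_mul,
          sub_self]
      · have h1 : degL (tay cs φ Y (f * g) - tay cs φ Y f * tay cs φ Y g) =
            ∑ i, degL (Y i) *
              ((tay cs φ Y (cs.d i f * g) - tay cs φ Y (cs.d i f) * tay cs φ Y g) +
               (tay cs φ Y (pinv (π i) f * cs.d i g) -
                  tay cs φ Y (pinv (π i) f) * tay cs φ Y (cs.d i g))) := by
          have h2 : degL (tay cs φ Y f * tay cs φ Y g) =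
              degL (tay cs φ Y f) * tay cs φ Y g + tay cs φ Y f * degL (tay cs φ Y g) :=
            (isDer_wtL (A := A) (π := τ) _).leib _ _
          rw [map_sub, h2, degL_tay hφ hY, degL_tay hφ hY, degL_tay hφ hY, Finset.sum_mul,
            Finset.mul_sum, ← Finset.sum_add_distrib, ← Finset.sum_sub_distrib]
          refine Finset.sum_congr rfl fun i _ => ?_
          have hp : HasParity (π i) (degL (Y i)) := by
            have := (isDer_wtL (A := A) (π := τ) fun _ => 1).hasParity (hY.par i)
            rwa [Bool.false_xor] at this
          rw [(cs.d_der i).leib, tay_add, ← mul_assoc (tay cs φ Y f), hp.comm', tay_pinv hφ hY,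
            AlgHom.id_apply, AlgHom.id_apply]
          noncomm_ring
        rw [h1, add_comm N 1]
        exact sum_mem fun i _ => mul_ordGE degL_mem (add_mem (ih _ _) (ih _ _))
  exact eq_of_ordGE fun N => h N f g

/-- The Taylor expansion as a homomorphism. -/
noncomputable def tayHom (cs : CoordSys B π) (φ : B →ₐ[ℝ] A) (Y : Fin n → SSer A τ)
    (hφ : IsSuper φ) (hY : Extends cs φ Y) : B →ₐ[ℝ] SSer A τ :=
  AlgHom.ofLinearMap ⟨⟨tay cs φ Y, tay_add⟩, tay_smul⟩
    (by
      change tay cs φ Y 1 = 1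
      rw [tay, orderSum_single (d := 0)]
      · rw [tayN_zero, map_one]; simp; rfl
      · intro N hN
        obtain ⟨N, rfl⟩ := Nat.exists_eq_succ_of_ne_zero hN
        rw [Nat.succ_eq_add_one, tayN_add_single_one, smul_zero]
      · exact ordGE_zero _)
    (tay_mul hφ hY)
theorem tayHom_apply (f : B) : tayHom cs φ Y hφ hY f = tay cs φ Y f := rfl
theorem tayHom_isSuper : IsSuper (tayHom cs φ Y hφ hY) := tay_inv hφ hY

include hY in
-- The partial derivatives of a coordinate are constants, so its Taylor series stops after the
-- linear term.
theorem tay_y (j : Fin n) : tay cs φ Y (cs.y j) = Y j := by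
  have h1 : ∀ N, tayN cs φ (fun i => Y i - C τ (φ (cs.y i))) (N + 2) (cs.y j) = 0 := fun N => by
    rw [tayN_succ]
    refine Finset.sum_eq_zero fun i _ => ?_
    rw [cs.d_y]
    split
    · rw [tayN_add_single_one, mul_zero]
    · rw [map_zero, mul_zero]
  have h2 : tayP cs φ Y 2 (cs.y j) = Y j := by
    rw [tayP, Finset.sum_range_succ, Finset.sum_range_one, tayN_zero, tayN_succ,
      Finset.sum_eq_single j]
    · rw [cs.d_y, if_pos rfl, tayN_zero, map_one, show C τ (1 : A) = 1 from rfl]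
      simp
    · intro i _ hi; rw [cs.d_y, if_neg hi, map_zero, mul_zero]
    · simp
  refine eq_of_ordGE fun N => ?_
  have h3 := tay_sub_tayP_mem hY (N + 2) (cs.y j)
  have h4 : tayP cs φ Y (N + 2) (cs.y j) = Y j := by
    rw [← h2, tayP, tayP, add_comm N 2, Finset.sum_range_add, add_eq_left]
    exact Finset.sum_eq_zero fun k _ => by rw [add_comm 2 k, h1, smul_zero]
  rw [h4] at h3
  exact ordGE_anti (by omega) h3

/-- The Taylor expansion does not depend on the coordinates. -/
theorem tay_change {cs' : CoordSys B π} (hc : cs.ChainRule cs')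
    (hY' : Extends cs' φ (fun b => tay cs φ Y (cs'.y b))) (hφ : IsSuper φ) (hY : Extends cs φ Y)
    (f : B) : tay cs' φ (fun b => tay cs φ Y (cs'.y b)) f = tay cs φ Y f := by
  have h : ∀ N f, tay cs' φ (fun b => tay cs φ Y (cs'.y b)) f - tay cs φ Y f ∈ ordGE A τ N := by
    intro N
    induction N with
    | zero => exact fun f => ordGE_zero _
    | succ N ih =>
      intro f
      refine mem_ordGE_of_degL (by rw [coeff_sub, coeff_zero_tay, coeff_zero_tay, sub_self]) ?_
      -- As for multiplicativity: the difference for `f` is expressed by the differences for its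
      -- derivatives `cs'.d b f`, multiplied by factors of positive order.
      have h1 : degL (tay cs' φ (fun b => tay cs φ Y (cs'.y b)) f - tay cs φ Y f) =
          ∑ i, degL (Y i) * ∑ b, tay cs φ Y (cs.d i (cs'.y b)) *
            (tay cs' φ (fun b => tay cs φ Y (cs'.y b)) (cs'.d b f) - tay cs φ Y (cs'.d b f)) := by
        rw [map_sub, degL_tay hφ hY', degL_tay hφ hY]
        simp only [degL_tay hφ hY, hc _ f, tay_sum, tay_mul hφ hY, mul_sub, Finset.sum_sub_distrib,
          Finset.sum_mul, Finset.mul_sum, mul_assoc]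
        rw [Finset.sum_comm]
      rw [h1, add_comm N 1]
      exact sum_mem fun i _ => mul_ordGE degL_mem (sum_mem fun b _ => mul_ordGE_right (ih _) _)
  exact eq_of_ordGE fun N => h N f

theorem Extends.change (hφ : IsSuper φ) (hY : Extends cs φ Y) (cs' : CoordSys B π) :
    Extends cs' φ (fun b => tay cs φ Y (cs'.y b)) :=
  ⟨fun i => (tayHom_isSuper hφ hY).hasParity (cs'.y_par i), fun i => coeff_zero_tay _⟩

/-- Naturality of the Taylor expansion. -/
theorem tay_nat {A' B' : Type*} [Ring A'] [Algebra ℝ A'] [SuperAlgebra A'] [Ring B'] [Algebra ℝ B']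
    [SuperAlgebra B'] {r' : ℕ} {τ' : Fin r' → Bool} {cs' : CoordSys B' π} {φ' : B' →ₐ[ℝ] A'}
    (η : SSer A τ →ₐ[ℝ] SSer A' τ') (hη : ∀ N, ∀ F ∈ ordGE A τ N, η F ∈ ordGE A' τ' N)
    (s : B →ₗ[ℝ] B') (h : ∀ b, η (C τ (φ b)) = C τ' (φ' (s b)))
    (hs : ∀ i b, s (cs.d i b) = cs'.d i (s b)) (hy : ∀ i, s (cs.y i) = cs'.y i)
    (hY : ∀ i, coeff 0 (Y i) = φ (cs.y i)) (f : B) :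
    tay cs' φ' (fun i => η (Y i)) (s f) = η (tay cs φ Y f) := by
  have h1 : ∀ N f, tayN cs' φ' (fun i => η (Y i) - C τ' (φ' (cs'.y i))) N (s f) =
      η (tayN cs φ (fun i => Y i - C τ (φ (cs.y i))) N f) := by
    intro N
    induction N with
    | zero => intro f; rw [tayN_zero, tayN_zero, h]
    | succ N ih =>
      intro f
      rw [tayN_succ, tayN_succ, map_sum]
      refine Finset.sum_congr rfl fun i _ => ?_
      rw [← hs, ih, map_mul, map_sub, h, hy]
  have h2 := orderSum_map (L := η.toLinearMap) hη
    (F := fun N => (N.factorial : ℝ)⁻¹ • tayN cs φ (fun i => Y i - C τ (φ (cs.y i))) N f)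
    (fun N => Submodule.smul_mem _ _ (tayN_mem cs φ (fun i => mem_ordGE_one.2 (by
      rw [coeff_sub, hY, coeff_zero_C, sub_self])) N f))
  refine Eq.trans ?_ h2.symm
  rw [tay]
  congr 1
  funext N
  rw [h1, AlgHom.toLinearMap_apply, map_smul]

end Taylor
end SSer

/-! ### The pullback in one coordinate system -/

namespace SSer

theorem subst_nat {A B A' B' : Type*} [Ring A] [Algebra ℝ A] [SuperAlgebra A] [Ring B] [Algebra ℝ B]
    [SuperAlgebra B] [Ring A'] [Algebra ℝ A'] [SuperAlgebra A'] [Ring B']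
    [Algebra ℝ B'] [SuperAlgebra B'] {n r r' : ℕ} {π : Fin n → Bool} {τ : Fin r → Bool}
    {σ : Fin r' → Bool} {ρ : A → SSer B τ} {ρ' : A' → SSer B' σ}
    (η : SSer B τ →ₐ[ℝ] SSer B' σ) (hη : ∀ N, ∀ F ∈ ordGE B τ N, η F ∈ ordGE B' σ N)
    (f : A →ₗ[ℝ] A') (h : ∀ a, ρ' (f a) = η (ρ a)) {z : Fin n → SSer B τ}
    (h0 : ∀ i, coeff 0 (z i) = 0) (F : SSer A π) :
    subst ρ' (fun i => η (z i)) (mapL f F) = η (subst ρ z F) := by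
  have := orderSum_map (L := η.toLinearMap) hη (F := substDeg ρ z F) (substDeg_mem ρ h0 F)
  refine Eq.trans ?_ this.symm
  rw [subst]
  congr 1
  funext N
  exact substDeg_nat η f h z F N

section Pullback
variable {A B : Type*} [Ring A] [Algebra ℝ A] [SuperAlgebra A] [Ring B] [Algebra ℝ B]
  [SuperAlgebra B] {n r : ℕ} {π : Fin n → Bool} {τ : Fin r → Bool}

/-- The functions `y i = ± ∂S / ∂q i`. -/
noncomputable def yo (S : SSer A π) (i : Fin n) : SSer A π := sgn (π i) • deriv i S

/-- `S` is an even generating function with support `φ`. -/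
structure IsThick (cs : CoordSys B π) (φ : B →ₐ[ℝ] A) (S : SSer A π) : Prop where
  par : HasParity false S
  supp : ∀ i, coeff (Finsupp.single i 1) S = φ (cs.y i)

/-- The expression `g(y)`. -/
noncomputable def hat (cs : CoordSys B π) (φ : B →ₐ[ℝ] A) (Y : Fin n → SSer A τ) (g : SSer B τ) :
    SSer A τ := subst (tay cs φ Y) (X A τ) g

/-- `y`, `q` solve the equations that define the pullback of `g`. -/
structure IsSol (cs : CoordSys B π) (φ : B →ₐ[ℝ] A) (S : SSer A π) (g : SSer B τ)
    (y q : Fin n → SSer A τ) : Prop where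
  hy : ∀ i, y i = subst (C τ) q (yo S i)
  hq : ∀ i, q i = hat cs φ y (mapL (cs.d i) g)

/-- The value of the pullback. -/
noncomputable def pval (cs : CoordSys B π) (φ : B →ₐ[ℝ] A) (S : SSer A π) (g : SSer B τ)
    (y q : Fin n → SSer A τ) : SSer A τ :=
  hat cs φ y g + subst (C τ) q S - ∑ i, y i * q i

variable {cs : CoordSys B π} {φ : B →ₐ[ℝ] A} (hφ : IsSuper φ) {S : SSer A π}

theorem HasParity.deriv {F : SSer A τ} {e : Bool} (h : HasParity e F) (i : Fin r) :
    HasParity (τ i ^^ e) (deriv i F) := (isDer_derivL i).hasParity h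

theorem yo_par (hS : IsThick cs φ S) (i : Fin n) : HasParity (π i) (yo S i) := by
  have := ((isDer_derivL i).hasParity hS.par).smul (sgn (π i))
  rwa [Bool.xor_false] at this

include hφ in
theorem IsThick.extends (hS : IsThick cs φ S) : Extends cs φ (yo S) := by
  refine ⟨yo_par hS, fun i => ?_⟩
  rw [yo, coeff_smul, coeff_deriv, zero_add, hS.supp,
    (hφ.hasParity (cs.y_par i)).pinv_eq, smul_smul, smul_smul,
    show Finsupp.filter (· < i) (0 : Fin n →₀ ℕ) = 0 from Finsupp.filter_zero _]
  simp

theorem IsSol.q_zero {g : SSer B τ} {y q : Fin n → SSer A τ} (h : IsSol cs φ S g y q)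
    (hg : coeff 0 g = 0) (i : Fin n) : coeff 0 (q i) = 0 := by
  rw [h.hq, hat, coeff_zero_subst, coeff_mapL, hg, map_zero, tay_zero, coeff_zero]

include hφ in
theorem extends_of_q (hS : IsThick cs φ S) {q : Fin n → SSer A τ}
    (hq : ∀ i, HasParity (π i) (q i)) (h0 : ∀ i, coeff 0 (q i) = 0) :
    Extends cs φ (fun i => subst (C τ) q (yo S i)) := by
  refine ⟨fun i => ?_, fun i => ?_⟩
  · exact (substHom_isSuper (ρ := CHom τ) CHom_isSuper hq h0).hasParity (yo_par hS i)
  · rw [coeff_zero_subst, coeff_zero_C, (hS.extends hφ).zero]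

/-- `g ↦ g(y)` as a homomorphism. -/
noncomputable def hatHom (cs : CoordSys B π) (φ : B →ₐ[ℝ] A) (Y : Fin n → SSer A τ)
    (hφ : IsSuper φ) (hY : Extends cs φ Y) : SSer B τ →ₐ[ℝ] SSer A τ :=
  substHom (tayHom cs φ Y hφ hY) (X A τ) (tayHom_isSuper hφ hY) hasParity_X coeff_zero_X

theorem hatHom_apply {Y : Fin n → SSer A τ} (hY : Extends cs φ Y) (g : SSer B τ) :
    hatHom cs φ Y hφ hY g = hat cs φ Y g := rfl
theorem hatHom_isSuper {Y : Fin n → SSer A τ} (hY : Extends cs φ Y) :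
    IsSuper (hatHom cs φ Y hφ hY) := substHom_isSuper _ _ _
theorem cont_hatHom {Y : Fin n → SSer A τ} (hY : Extends cs φ Y) :
    Cont (hatHom cs φ Y hφ hY).toLinearMap := cont_substHom _ _ _
theorem hatHom_C {Y : Fin n → SSer A τ} (hY : Extends cs φ Y) (b : B) :
    hatHom cs φ Y hφ hY (C τ b) = tay cs φ Y b := substHom_C _ _ _ b
theorem hatHom_X {Y : Fin n → SSer A τ} (hY : Extends cs φ Y) (i : Fin r) :
    hatHom cs φ Y hφ hY (X B τ i) = X A τ i := substHom_X _ _ _ i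

/-! #### Existence and uniqueness of solutions -/

/-- The fixed point operator for `q`. -/
noncomputable def solOp (cs : CoordSys B π) (φ : B →ₐ[ℝ] A) (S : SSer A π) (g : SSer B τ)
    (q : Fin n → SSer A τ) : Fin n → SSer A τ := fun i =>
  hat cs φ (fun j => subst (C τ) q (yo S j)) (mapL (cs.d i) g)

theorem IsSol.fix {g : SSer B τ} {y q : Fin n → SSer A τ} (h : IsSol cs φ S g y q) :
    solOp cs φ S g q = q := by
  funext i
  rw [solOp, ← funext h.hy, ← h.hq]

/-- The constant term of `F` does not contribute, and every other term carries at least one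
parameter, which raises the order of the difference by one. This is the source of the contraction.
-/
theorem subst_X_sub_mem {ρ ρ' : B → SSer A τ} (hρ : ρ 0 = 0) (hρ' : ρ' 0 = 0) {F : SSer B τ}
    (hF : coeff 0 F = 0) {N : ℕ} (h : ∀ b, ρ b - ρ' b ∈ ordGE A τ N) :
    subst ρ (X A τ) F - subst ρ' (X A τ) F ∈ ordGE A τ (N + 1) := fun m hm => by
  by_cases ha : Adm τ m
  · rw [coeff_sub, subst, subst, orderSum, orderSum, coeff_mk ha, coeff_mk ha,
      ← Finset.sum_sub_distrib]
    refine Finset.sum_eq_zero fun k _ => ?_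
    rw [← coeff_sub]
    refine (?_ : substDeg ρ _ F k - substDeg ρ' _ F k ∈ ordGE A τ (N + 1)) m hm
    rw [substDeg_eq, substDeg_eq, ← Finset.sum_sub_distrib]
    refine sum_mem fun m _ => ?_
    rw [← sub_mul]
    by_cases h0 : m = 0
    · subst h0; rw [hF, hρ, hρ', sub_self, zero_mul]; exact zero_mem _
    · have h1 : 1 ≤ m.degree := Nat.one_le_iff_ne_zero.2 fun h => h0 (degree_eq_zero_iff'.1 h)
      exact mul_ordGE (h _) (ordGE_anti h1 (zpow_mem coeff_zero_X m))
  · exact coeff_of_not_adm ha _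

/-- `y` depends on `q` without loss of order, and `∂g/∂y` has no constant term in the parameters, so
one order is gained. Existence and uniqueness of solutions both rest on this estimate. -/
theorem solOp_contract {g : SSer B τ} (hg : coeff 0 g = 0) {q q' : Fin n → SSer A τ} {N : ℕ}
    (h : ∀ i, q i - q' i ∈ ordGE A τ N) (i : Fin n) :
    solOp cs φ S g q i - solOp cs φ S g q' i ∈ ordGE A τ (N + 1) :=
  subst_X_sub_mem tay_zero tay_zero (by rw [coeff_mapL, hg, map_zero]) fun b =>
    tay_sub_mem cs φ (fun j => subst_sub_subst_mem _ h fun m => by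
      rw [sub_self]; exact zero_mem _) b

/-- Two fixed points of a contraction agree to every order. No parity of the solutions is assumed,
so uniqueness also serves to transfer properties from one constructed solution to all solutions. -/
theorem IsSol.unique {g : SSer B τ} (hg : coeff 0 g = 0) {y q y' q' : Fin n → SSer A τ}
    (h : IsSol cs φ S g y q) (h' : IsSol cs φ S g y' q') : y = y' ∧ q = q' := by
  have hq : q = q' := by
    have : ∀ N i, q i - q' i ∈ ordGE A τ N := by
      intro N
      induction N with
      | zero => exact fun i => ordGE_zero _
      | succ N ih =>
        intro i
        have := solOp_contract (cs := cs) (φ := φ) (S := S) hg ih i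
        rwa [h.fix, h'.fix] at this
    exact funext fun i => eq_of_ordGE fun N => this N i
  refine ⟨funext fun i => ?_, hq⟩
  rw [h.hy, h'.hy, hq]

include hφ in
-- Picard iteration from `0`. Each iterate has the right parities and no constant term, and both
-- properties concern single coefficients, so they pass to the limit.
theorem exists_isSol (hS : IsThick cs φ S) {g : SSer B τ} (hg : coeff 0 g = 0)
    (hgp : HasParity false g) :
    ∃ y q : Fin n → SSer A τ, IsSol cs φ S g y q ∧ (∀ i, HasParity (π i) (q i)) := by
  set T := solOp cs φ S g with hT
  set Q : ℕ → Fin n → SSer A τ := fun N => T^[N] 0 with hQ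
  have hQs : ∀ N, Q (N + 1) = T (Q N) := fun N => Function.iterate_succ_apply' _ _ _
  have h1 : ∀ N i, Q (N + 1) i - Q N i ∈ ordGE A τ N := by
    intro N
    induction N with
    | zero => exact fun i => ordGE_zero _
    | succ N ih =>
      intro i
      have h : T (Q (N + 1)) i - T (Q N) i ∈ ordGE A τ (N + 1) := solOp_contract hg ih i
      rwa [← hQs, ← hQs] at h
  have h2 : ∀ N k i, Q (N + k) i - Q N i ∈ ordGE A τ N := by
    intro N k i
    induction k with
    | zero => simp
    | succ k ih =>
      have := add_mem (ordGE_anti (Nat.le_add_right N k) (h1 (N + k) i)) ih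
      rwa [sub_add_sub_cancel] at this
  have hpar : ∀ N, (∀ i, HasParity (π i) (Q N i)) ∧ ∀ i, coeff 0 (Q N i) = 0 := by
    intro N
    induction N with
    | zero => exact ⟨fun i => HasParity.zero, fun i => rfl⟩
    | succ N ih =>
      rw [hQs]
      have hY := extends_of_q hφ hS ih.1 ih.2
      refine ⟨fun i => ?_, fun i => ?_⟩
      · have := (hatHom_isSuper hφ hY).hasParity ((isDer_mapL_id (cs.d_der i)).hasParity hgp)
        rwa [Bool.xor_false] at this
      · rw [hT, solOp, hat, coeff_zero_subst, coeff_mapL, hg, map_zero, tay_zero, coeff_zero]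
  -- Successive iterates `Q N` and `Q (N + 1)` differ in order `N`, so a coefficient of degree `d`
  -- no longer changes from `Q (d + 1)` on.
  set q : Fin n → SSer A τ := fun i => mk τ fun m => coeff m (Q (m.degree + 1) i) with hq
  have h3 : ∀ N i, q i - Q N i ∈ ordGE A τ N := by
    intro N i m hm
    by_cases ha : Adm τ m
    · obtain ⟨k, rfl⟩ := Nat.exists_eq_add_of_le (Nat.succ_le_of_lt hm)
      have := h2 (m.degree + 1) k i m (by omega)
      rw [coeff_sub, sub_eq_zero] at this
      rw [coeff_sub, hq, coeff_mk ha, ← this, sub_self]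
    · exact coeff_of_not_adm ha _
  have hfix : T q = q := by
    funext i
    refine eq_of_ordGE fun N => ?_
    have h4 := solOp_contract (cs := cs) (φ := φ) (S := S) hg (h3 N) i
    rw [← hT, ← hQs] at h4
    have := sub_mem h4 (h3 (N + 1) i)
    rw [sub_sub_sub_cancel_right] at this
    exact ordGE_anti (Nat.le_succ N) this
  refine ⟨fun i => subst (C τ) q (yo S i), q, ⟨fun i => rfl, fun i => ?_⟩, fun i => ?_⟩
  · exact (congrFun hfix i).symm
  · rw [hasParity_iff_coeff]
    intro m hm
    rw [hq, coeff_mk hm]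
    exact hasParity_iff_coeff.1 ((hpar _).1 i) m hm

/-- A solution with the parities and constant terms that it always has. -/
structure IsGoodSol (cs : CoordSys B π) (φ : B →ₐ[ℝ] A) (S : SSer A π) (g : SSer B τ)
    (y q : Fin n → SSer A τ) : Prop extends IsSol cs φ S g y q where
  qpar : ∀ i, HasParity (π i) (q i)
  qzero : ∀ i, coeff 0 (q i) = 0
  ext : Extends cs φ y

include hφ in
-- Parities and constant terms are consequences of the equations: the constructed solution has them,
-- and there is no other solution.
theorem IsSol.good (hS : IsThick cs φ S) {g : SSer B τ} (hg : coeff 0 g = 0)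
    (hgp : HasParity false g) {y q : Fin n → SSer A τ} (h : IsSol cs φ S g y q) :
    IsGoodSol cs φ S g y q := by
  obtain ⟨y', q', h', hp⟩ := exists_isSol hφ hS hg hgp
  obtain ⟨rfl, rfl⟩ := h.unique hg h'
  refine ⟨h, hp, h.q_zero hg, ?_⟩
  rw [funext h.hy]
  exact extends_of_q hφ hS hp (h.q_zero hg)

/-- `F(x, q) ↦ F(x, q(x))` as a homomorphism. -/
noncomputable def sigma {q : Fin n → SSer A τ} (hq : ∀ i, HasParity (π i) (q i))
    (h0 : ∀ i, coeff 0 (q i) = 0) : SSer A π →ₐ[ℝ] SSer A τ :=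
  substHom (CHom τ) q CHom_isSuper hq h0
theorem sigma_apply {q : Fin n → SSer A τ} (hq : ∀ i, HasParity (π i) (q i))
    (h0 : ∀ i, coeff 0 (q i) = 0) (F : SSer A π) : sigma hq h0 F = subst (C τ) q F := rfl
theorem sigma_ord {q : Fin n → SSer A τ} (hq : ∀ i, HasParity (π i) (q i))
    (h0 : ∀ i, coeff 0 (q i) = 0) (N : ℕ) (F : SSer A π) (hF : F ∈ ordGE A π N) :
    sigma hq h0 F ∈ ordGE A τ N := subst_mem C_zero h0 hF
theorem sigma_C {q : Fin n → SSer A τ} (hq : ∀ i, HasParity (π i) (q i))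
    (h0 : ∀ i, coeff 0 (q i) = 0) (a : A) : sigma hq h0 (C π a) = C τ a := substHom_C _ _ _ a
theorem sigma_X {q : Fin n → SSer A τ} (hq : ∀ i, HasParity (π i) (q i))
    (h0 : ∀ i, coeff 0 (q i) = 0) (i : Fin n) : sigma hq h0 (X A π i) = q i := substHom_X _ _ _ i

include hφ in
theorem IsGoodSol.pval_par (hS : IsThick cs φ S) {g : SSer B τ} {y q : Fin n → SSer A τ}
    (hgp : HasParity false g) (h : IsGoodSol cs φ S g y q) :
    HasParity false (pval cs φ S g y q) := by
  refine (((hatHom_isSuper hφ h.ext).hasParity hgp).add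
    ((substHom_isSuper (ρ := CHom τ) CHom_isSuper h.qpar h.qzero).hasParity hS.par)).sub
    (HasParity.sum fun i _ => ?_)
  have := (h.ext.par i).mul (h.qpar i)
  rwa [Bool.xor_self] at this

/-! #### Derivatives of the pullback -/

section Der
variable {e : Bool} {D : SSer A τ →ₗ[ℝ] SSer A τ}

include hφ in
-- `hDφ` asks that `D` obeys the chain rule on functions pulled back by `φ`. It is trivial for
-- parameter derivatives, holds for coordinate derivatives on `M₁`, and holds for the weight field
-- since `φ` preserves weights.
theorem hat_der {Y : Fin n → SSer A τ} (hY : Extends cs φ Y) (hD : IsDer (AlgHom.id ℝ _) e D)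
    (hDc : Cont D)
    (hDφ : ∀ b, D (C τ (φ b)) = ∑ i, D (C τ (φ (cs.y i))) * C τ (φ (cs.d i b))) (g : SSer B τ) :
    D (hat cs φ Y g) = ∑ i, D (Y i) * hat cs φ Y (mapL (cs.d i) g) +
      ∑ j, D (X A τ j) * hat cs φ Y (deriv j g) := by
  have h := chain_rule (ρ := tayHom cs φ Y hφ hY) (z := X A τ) (tayHom_isSuper hφ hY) hasParity_X
    coeff_zero_X hD hDc (L := ∑ i, (LinearMap.mulLeft ℝ (D (Y i))).comp
      ((hatHom cs φ Y hφ hY).toLinearMap.comp (mapL (cs.d i)))) ?_ ?_ ?_ ?_ g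
  · rw [LinearMap.sum_apply] at h
    exact h
  · refine IsDer.sum fun i _ => ?_
    have := ((isDer_mapL_id (π := τ) (cs.d_der i)).post (hatHom_isSuper hφ hY)).mulLeft
      (hD.hasParity (hY.par i))
    rw [Bool.xor_assoc, Bool.xor_self, Bool.xor_false] at this
    exact this
  · exact Cont.sum _ fun i _ => (cont_mulLeft _).comp ((cont_hatHom hφ hY).comp (cont_mapL _))
  · intro b
    rw [LinearMap.sum_apply, tayHom_apply, tay_der hφ hY hD hDc hDφ]
    refine Finset.sum_congr rfl fun i _ => ?_
    simp only [LinearMap.comp_apply, LinearMap.mulLeft_apply, mapL_C, AlgHom.toLinearMap_apply,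
      hatHom_C]
  · intro i
    rw [LinearMap.sum_apply]
    refine Finset.sum_eq_zero fun j _ => ?_
    simp only [LinearMap.comp_apply, mapL_X (cs.d_der j), map_zero]

theorem sigma_der {q : Fin n → SSer A τ} (hq : ∀ i, HasParity (π i) (q i))
    (h0 : ∀ i, coeff 0 (q i) = 0) (hD : IsDer (AlgHom.id ℝ _) e D) (hDc : Cont D)
    {Dc : A →ₗ[ℝ] A} (hDcd : IsDer (AlgHom.id ℝ A) e Dc) (hDC : ∀ a, D (C τ a) = C τ (Dc a))
    (F : SSer A π) : D (subst (C τ) q F) =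
      subst (C τ) q (mapL Dc F) + ∑ i, D (q i) * subst (C τ) q (deriv i F) :=
  chain_rule (ρ := CHom τ) CHom_isSuper hq h0 hD hDc
    (L := (sigma hq h0).toLinearMap.comp (mapL Dc))
    ((isDer_mapL_id hDcd).post (substHom_isSuper _ _ _))
    ((cont_substHom _ _ _).comp (cont_mapL _))
    (fun a => by
      simp only [LinearMap.comp_apply, mapL_C, AlgHom.toLinearMap_apply, sigma_C, CHom_apply, hDC])
    (fun i => by simp only [LinearMap.comp_apply, mapL_X hDcd, map_zero]) F

include hφ in
/-- The derivative of the pullback only involves the explicit dependence on the variables. -/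
theorem IsGoodSol.pval_der {g : SSer B τ} {y q : Fin n → SSer A τ} (h : IsGoodSol cs φ S g y q)
    (hD : IsDer (AlgHom.id ℝ _) e D) (hDc : Cont D)
    (hDφ : ∀ b, D (C τ (φ b)) = ∑ i, D (C τ (φ (cs.y i))) * C τ (φ (cs.d i b)))
    {Dc : A →ₗ[ℝ] A} (hDcd : IsDer (AlgHom.id ℝ A) e Dc) (hDC : ∀ a, D (C τ a) = C τ (Dc a)) :
    D (pval cs φ S g y q) =
      ∑ j, D (X A τ j) * hat cs φ y (deriv j g) + subst (C τ) q (mapL Dc S) := by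
  rw [pval, map_sub, map_add, hat_der hφ h.ext hD hDc hDφ, sigma_der h.qpar h.qzero hD hDc hDcd hDC,
    map_sum]
  -- Stationarity: with `q = (∂g/∂y)(y)` and `y = ± ∂S/∂q`, the two terms of the product rule are
  -- exactly the implicit variations of `g(y)` and of `S(x, q)`, so all of them cancel.
  have h1 : ∀ i, D (y i * q i) = D (y i) * hat cs φ y (mapL (cs.d i) g) +
      D (q i) * subst (C τ) q (deriv i S) := fun i => by
    rw [hD.leib, AlgHom.id_apply, AlgHom.id_apply, ← h.hq]
    congr 1
    rw [(h.ext.par i).pinv_eq, smul_mul_assoc,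
      (h.ext.par i).comm_sgn (hD.hasParity (h.qpar i)), smul_smul]
    have h2 : y i = sgn (π i) • subst (C τ) q (deriv i S) := by
      rw [h.hy, yo]; exact map_smul (sigma h.qpar h.qzero) _ _
    rw [h2, mul_smul_comm, smul_smul]
    convert one_smul ℝ _ using 2
    cases e <;> cases π i <;> simp
  rw [Finset.sum_congr rfl fun i _ => h1 i, Finset.sum_add_distrib]
  abel

end Der

include hφ in
-- The critical value principle for the total weight derivation. By Euler's identity the explicit
-- variation of `g` is `s g(y) - ∑ w y q` and that of `S` is `s S - ∑ (s - w) y q`; their sum is `s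
-- (g(y) + S - y q)`. The momenta must have weights `s - w` for this to work.
theorem IsGoodSol.pval_weight (hS : IsThick cs φ S) {g : SSer B τ} {y q : Fin n → SSer A τ}
    (h : IsGoodSol cs φ S g y q) {EA : A →ₗ[ℝ] A} {EB : B →ₗ[ℝ] B}
    (hEA : IsDer (AlgHom.id ℝ A) false EA) (hE : ∀ b, EA (φ b) = φ (EB b))
    {w : Fin n → ℝ} (hEB : ∀ b, EB b = ∑ i, w i • (cs.y i * cs.d i b)) {u : Fin r → ℝ} {s : ℝ}
    (hg : mapL EB g + wtL u g = s • g) (hSw : mapL EA S + wtL (fun i => s - w i) S = s • S) :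
    mapL EA (pval cs φ S g y q) + wtL u (pval cs φ S g y q) = s • pval cs φ S g y q := by
  have hD : IsDer (AlgHom.id ℝ _) false (mapL EA + wtL u : SSer A τ →ₗ[ℝ] SSer A τ) :=
    (isDer_mapL_id hEA).add (isDer_wtL u)
  have h1 := h.pval_der hφ hD ((cont_mapL _).add (cont_wtL _)) (fun b => by
    simp only [LinearMap.add_apply, wtL_C, mapL_C, add_zero, hE, ← C_mul, ← C_sum, ← map_mul,
      ← map_sum]
    congr 2
    rw [hEB]
    refine Finset.sum_congr rfl fun i _ => ?_
    rw [hEB, Finset.sum_eq_single i]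
    · rw [cs.d_y, if_pos rfl, mul_one, smul_mul_assoc]
    · intro j _ hj; rw [cs.d_y, if_neg hj, mul_zero, smul_zero]
    · simp) hEA (fun a => by simp [wtL_C, mapL_C])
  rw [LinearMap.add_apply] at h1
  rw [h1]
  have h2 : ∑ j, (mapL EA + wtL u : SSer A τ →ₗ[ℝ] SSer A τ) (X A τ j) * hat cs φ y (deriv j g) =
      s • hat cs φ y g - ∑ i, w i • (y i * q i) := by
    have h3 : wtL u g = s • g - ∑ i, w i • (C τ (cs.y i) * mapL (cs.d i) g) := by
      rw [← hg, add_comm, add_sub_assoc, left_eq_add, sub_eq_zero]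
      refine SSer.ext fun m _ => ?_
      simp only [coeff_mapL, hEB, coeff_sum, coeff_smul, coeff_C_mul]
    have h4 : hat cs φ y (wtL u g) =
        ∑ j, u j • (X A τ j * hat cs φ y (deriv j g)) := by
      rw [← hatHom_apply hφ h.ext, wtL_eq_sum, map_sum]
      refine Finset.sum_congr rfl fun j _ => ?_
      rw [map_smul, map_mul, hatHom_X]; rfl
    have h5 := congrArg (hatHom cs φ y hφ h.ext) h3
    rw [hatHom_apply, h4, map_sub, map_smul, map_sum] at h5
    simp only [map_smul, map_mul, hatHom_C, tay_y h.ext] at h5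
    simp only [hatHom_apply, ← h.hq] at h5
    rw [← h5]
    refine Finset.sum_congr rfl fun j _ => ?_
    rw [LinearMap.add_apply, mapL_X hEA, wtL_X, zero_add, smul_mul_assoc]
  have h6 : subst (C τ) q (mapL EA S) = s • subst (C τ) q S - ∑ i, (s - w i) • (y i * q i) := by
    have h3 : mapL EA S = s • S - ∑ i, (s - w i) • (X A π i * deriv i S) := by
      rw [← hSw, wtL_eq_sum, add_sub_cancel_right]
    have h5 := congrArg (sigma h.qpar h.qzero) h3
    simp only [map_sub, map_smul, map_sum, map_mul, sigma_X] at h5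
    simp only [sigma_apply] at h5
    rw [h5]
    congr 1
    refine Finset.sum_congr rfl fun i _ => ?_
    have h7 : subst (C τ) q (deriv i S) = sgn (π i) • y i := by
      have : y i = sgn (π i) • subst (C τ) q (deriv i S) := by
        rw [h.hy, yo]; exact map_smul (sigma h.qpar h.qzero) _ _
      rw [this, smul_smul, sgn_mul_self, one_smul]
    rw [h7, mul_smul_comm, (h.ext.par i).comm_sgn (h.qpar i), Bool.and_self]
  rw [h2, h6, pval]
  simp only [sub_smul, Finset.sum_sub_distrib, smul_sub, smul_add, Finset.smul_sum]
  abel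

end Pullback
end SSer

namespace SSer

/-! ### Change of coordinates -/

section Change
variable {A B : Type*} [Ring A] [Algebra ℝ A] [SuperAlgebra A] [Ring B] [Algebra ℝ B]
  [SuperAlgebra B] {n r : ℕ} {π : Fin n → Bool} {τ : Fin r → Bool}
  {cs cs' : CoordSys B π} {φ : B →ₐ[ℝ] A} (hφ : IsSuper φ) {S S' : SSer A π}

theorem _root_.CoordSys.ChainRule.inverse (h : cs.ChainRule cs') (i k : Fin n) :
    ∑ b, cs.d i (cs'.y b) * cs'.d b (cs.y k) = if i = k then 1 else 0 := by
  rw [← h, cs.d_y]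

/-- The momenta of the coordinates `cs'` in terms of those of `cs`. -/
noncomputable def momenta (cs cs' : CoordSys B π) (φ : B →ₐ[ℝ] A) (S : SSer A π) (b : Fin n) :
    SSer A π := ∑ i, tay cs φ (yo S) (cs'.d b (cs.y i)) * X A π i

/-- The generating functions `S` and `S'` are related by the change of coordinates. -/
def ThickChange (cs cs' : CoordSys B π) (φ : B →ₐ[ℝ] A) (S S' : SSer A π) : Prop :=
  subst (C π) (momenta cs cs' φ S) S' -
    ∑ b, tay cs φ (yo S) (cs'.y b) * momenta cs cs' φ S b = S - ∑ i, yo S i * X A π i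

include hφ in
theorem momenta_par (hS : IsThick cs φ S) (b : Fin n) :
    HasParity (π b) (momenta cs cs' φ S b) := by
  refine HasParity.sum fun i _ => ?_
  have := ((tayHom_isSuper hφ (hS.extends hφ)).hasParity
    ((cs'.d_der b).hasParity (cs.y_par i))).mul (hasParity_X (A := A) i)
  rwa [Bool.xor_assoc, Bool.xor_self, Bool.xor_false] at this

theorem momenta_zero (b : Fin n) : coeff 0 (momenta cs cs' φ S b) = 0 := by
  rw [momenta, coeff_sum]
  refine Finset.sum_eq_zero fun i _ => ?_
  rw [coeff_zero_mul, coeff_zero_X, mul_zero]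

theorem pinv_mul_pinv {a b : A} {x y j : Bool} (ha : HasParity (j ^^ x) a)
    (hb : HasParity (y ^^ j) b) :
    (sgn (j && x) • a) * pinv j b = sgn (x && y) • (b * a) := by
  rw [hb.pinv_eq, smul_mul_smul_comm, ha.comm_sgn hb, smul_smul, sgn_mul, sgn_mul]
  congr 2
  cases x <;> cases y <;> cases j <;> rfl

include hφ in
-- The transformation law of `S` differentiated in `q_j`. The terms with `∂y/∂q_j` cancel because
-- the new momenta satisfy `∑ (∂y'^b/∂y^i) q'_b = q_i`, and on the right `± y^j` cancels `∂S/∂q_j`.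
theorem ThickChange.sum_eq_zero (hS : IsThick cs φ S) (hS' : IsThick cs' φ S')
    (hc : cs.ChainRule cs') (h : ThickChange cs cs' φ S S') (j : Fin n) :
    ∑ b, deriv j (momenta cs cs' φ S b) * (subst (C π) (momenta cs cs' φ S) (deriv b S') -
      sgn (π b) • tay cs φ (yo S) (cs'.y b)) = 0 := by
  have hY := hS.extends hφ
  have hK := momenta_par (cs' := cs') hφ hS
  have hK0 := momenta_zero (cs := cs) (cs' := cs') (φ := φ) (S := S)
  have hψ : ∀ f, derivL j (tay cs φ (yo S) f) =
      ∑ i, deriv j (yo S i) * tay cs φ (yo S) (cs.d i f) := fun f =>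
    tay_der hφ hY (isDer_derivL j) (cont_derivL j) (fun b => by
      simp [derivL_apply, deriv_C]) f
  have h1 := congrArg (derivL j) h
  rw [map_sub, map_sub, sigma_der hK hK0 (isDer_derivL j) (cont_derivL j) (Dc := 0) IsDer.zero
    (fun a => by rw [derivL_apply, deriv_C]; exact C_zero.symm), map_sum, map_sum] at h1
  have h2 : subst (C π) (momenta cs cs' φ S) (mapL (0 : A →ₗ[ℝ] A) S') = 0 := by
    have : mapL (0 : A →ₗ[ℝ] A) S' = 0 := SSer.ext fun m _ => by rw [coeff_mapL]; rfl
    rw [this]; exact map_zero (sigma hK hK0)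
  have h3 : ∀ b, derivL j (tay cs φ (yo S) (cs'.y b) * momenta cs cs' φ S b) =
      (∑ i, deriv j (yo S i) * tay cs φ (yo S) (cs.d i (cs'.y b))) * momenta cs cs' φ S b +
      deriv j (momenta cs cs' φ S b) * sgn (π b) • tay cs φ (yo S) (cs'.y b) := fun b => by
    rw [(isDer_derivL j).leib, hψ]
    congr 1
    have h4 := (tayHom_isSuper hφ hY).hasParity (cs'.y_par b)
    rw [tayHom_apply] at h4
    rw [AlgHom.id_apply, h4.pinv_eq, smul_mul_assoc,
      h4.comm_sgn ((isDer_derivL j).hasParity (hK b)), smul_smul, mul_smul_comm, sgn_mul]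
    congr 2
    cases π j <;> cases π b <;> rfl
  have h5 : ∑ b, (∑ i, deriv j (yo S i) * tay cs φ (yo S) (cs.d i (cs'.y b))) *
      momenta cs cs' φ S b = ∑ i, deriv j (yo S i) * X A π i := by
    have h6 : ∀ i, ∑ b, tay cs φ (yo S) (cs.d i (cs'.y b)) * momenta cs cs' φ S b = X A π i := by
      intro i
      simp only [momenta, Finset.mul_sum, ← mul_assoc, ← tay_mul hφ hY]
      rw [Finset.sum_comm]
      simp only [← Finset.sum_mul, ← tay_sum, hc.inverse]
      rw [Finset.sum_eq_single i]
      · rw [if_pos rfl, ← tayHom_apply hφ hY, map_one, one_mul]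
      · intro k _ hk
        rw [if_neg (Ne.symm hk), tay_zero, zero_mul]
      · simp
    simp only [Finset.sum_mul, mul_assoc]
    rw [Finset.sum_comm]
    simp only [← Finset.mul_sum, h6]
  have h7 : ∑ i, derivL j (yo S i * X A π i) = (∑ i, deriv j (yo S i) * X A π i) + deriv j S := by
    simp only [(isDer_derivL j).leib, Finset.sum_add_distrib, derivL_apply, deriv_X,
      AlgHom.id_apply]
    congr 1
    rw [Finset.sum_eq_single j]
    · rw [if_pos rfl, mul_one, (yo_par hS j).pinv_eq, yo, smul_smul, Bool.and_self, sgn_mul_self,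
        one_smul]
    · intro k _ hk; rw [if_neg (Ne.symm hk), mul_zero]
    · simp
  rw [h2, zero_add, Finset.sum_congr rfl fun b _ => h3 b, Finset.sum_add_distrib, h5, h7] at h1
  simp only [mul_sub, Finset.sum_sub_distrib]
  simp only [derivL_apply] at h1
  have h8 : deriv j S - (∑ i, deriv j (yo S i) * X A π i + deriv j S) =
      0 - ∑ i, deriv j (yo S i) * X A π i := by abel
  rw [h8, sub_add_eq_sub_sub, sub_right_comm] at h1
  exact sub_left_injective h1

include hφ in
-- The preceding linear system has a matrix `∂q'_b/∂q_j` whose constant term is, up to signs, an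
-- invertible Jacobian. So a solution of order `N` has order `N + 1`, and the system only has the
-- zero solution. Thus the `y'` computed from `S'` at the new momenta is `y'(y)`.
theorem ThickChange.subst_yo (hS : IsThick cs φ S) (hS' : IsThick cs' φ S')
    (hc : cs.ChainRule cs') (hc' : cs'.ChainRule cs) (h : ThickChange cs cs' φ S S') (b : Fin n) :
    subst (C π) (momenta cs cs' φ S) (yo S' b) = tay cs φ (yo S) (cs'.y b) := by
  have hY := hS.extends hφ
  have hK := momenta_par (cs' := cs') hφ hS
  have hK0 := momenta_zero (cs := cs) (cs' := cs') (φ := φ) (S := S)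
  set Z : Fin n → SSer A π := fun b => subst (C π) (momenta cs cs' φ S) (deriv b S') -
      sgn (π b) • tay cs φ (yo S) (cs'.y b) with hZ
  have hsum := h.sum_eq_zero hφ hS hS' hc
  have hlead : ∀ j b, deriv j (momenta cs cs' φ S b) -
      C π (φ (pinv (π j) (cs'.d b (cs.y j)))) ∈ ordGE A π 1 := by
    intro j b
    rw [mem_ordGE_one, coeff_sub, coeff_zero_C, ← derivL_apply, momenta, map_sum, coeff_sum]
    rw [Finset.sum_eq_single j]
    · rw [(isDer_derivL j).leib, coeff_add, coeff_zero_mul, AlgHom.id_apply, coeff_zero_X, mul_zero,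
        zero_add, derivL_apply, deriv_X, if_pos rfl, mul_one, AlgHom.id_apply, ← tay_pinv hφ hY,
        coeff_zero_tay, sub_self]
    · intro k _ hk
      rw [(isDer_derivL j).leib, coeff_add, coeff_zero_mul, AlgHom.id_apply, coeff_zero_X, mul_zero,
        zero_add, derivL_apply, deriv_X, if_neg (Ne.symm hk), mul_zero, coeff_zero]
    · simp
  have hord : ∀ N b, Z b ∈ ordGE A π N := by
    intro N
    induction N with
    | zero => exact fun b => ordGE_zero _
    | succ N ih =>
      have h1 : ∀ j, ∑ b, C π (φ (pinv (π j) (cs'.d b (cs.y j)))) * Z b ∈ ordGE A π (N + 1) := by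
        intro j
        have h2 : ∑ b, C π (φ (pinv (π j) (cs'.d b (cs.y j)))) * Z b =
            -∑ b, (deriv j (momenta cs cs' φ S b) -
              C π (φ (pinv (π j) (cs'.d b (cs.y j))))) * Z b := by
          simp only [sub_mul, Finset.sum_sub_distrib]
          rw [hsum j, zero_sub, neg_neg]
        rw [h2, add_comm]
        exact neg_mem (sum_mem fun b _ => mul_ordGE (hlead j b) (ih b))
      intro c
      -- Contraction with the inverse Jacobian isolates `Z c`, up to sign, from the constant part of
      -- the system.
      have h3 : ∑ j, C π (φ (sgn (π j && π c) • cs.d j (cs'.y c))) *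
          ∑ b, C π (φ (pinv (π j) (cs'.d b (cs.y j)))) * Z b = sgn (π c) • Z c := by
        simp only [Finset.mul_sum, ← mul_assoc, ← C_mul, ← map_mul]
        rw [Finset.sum_comm]
        simp only [← Finset.sum_mul, ← C_sum, ← map_sum]
        have h4 : ∀ b, ∑ j, (sgn (π j && π c) • cs.d j (cs'.y c)) * pinv (π j) (cs'.d b (cs.y j)) =
            if b = c then algebraMap ℝ B (sgn (π c)) else 0 := by
          intro b
          have h5 : ∀ j, (sgn (π j && π c) • cs.d j (cs'.y c)) * pinv (π j) (cs'.d b (cs.y j)) =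
              sgn (π c && π b) • (cs'.d b (cs.y j) * cs.d j (cs'.y c)) := fun j =>
            pinv_mul_pinv ((cs.d_der j).hasParity (cs'.y_par c))
              ((cs'.d_der b).hasParity (cs.y_par j))
          rw [Finset.sum_congr rfl fun j _ => h5 j, ← Finset.smul_sum, hc'.inverse]
          split
          · next hbc => subst hbc; rw [Bool.and_self, Algebra.algebraMap_eq_smul_one]
          · rw [smul_zero]
        simp only [h4]
        rw [Finset.sum_eq_single c]
        · rw [if_pos rfl, Algebra.algebraMap_eq_smul_one, map_smul, map_one, C_smul, smul_mul_assoc]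
          congr 1
          exact one_mul _
        · intro b _ hb; rw [if_neg hb, map_zero, C_zero, zero_mul]
        · simp
      have h6 := (ordGE A π (N + 1)).sum_mem (t := Finset.univ)
        (f := fun j => C π (φ (sgn (π j && π c) • cs.d j (cs'.y c))) *
          ∑ b, C π (φ (pinv (π j) (cs'.d b (cs.y j)))) * Z b)
        fun j _ => mul_ordGE_right (h1 j) _
      rw [h3] at h6
      have h7 := Submodule.smul_mem _ (sgn (π c)) h6
      rwa [smul_smul, sgn_mul_self, one_smul] at h7
  have h8 := eq_zero_of_ordGE fun N => hord N b
  have h9 : subst (C π) (momenta cs cs' φ S) (yo S' b) =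
      sgn (π b) • subst (C π) (momenta cs cs' φ S) (deriv b S') := map_smul (sigma hK hK0) _ _
  rw [h9, sub_eq_zero.1 h8, smul_smul, sgn_mul_self, one_smul]

include hφ in
/-- The transformation of solutions under a change of coordinates. -/
theorem IsGoodSol.change (hS : IsThick cs φ S) (hS' : IsThick cs' φ S')
    (hc : cs.ChainRule cs') (hc' : cs'.ChainRule cs) (h : ThickChange cs cs' φ S S')
    {g : SSer B τ} {y q : Fin n → SSer A τ} (hs : IsGoodSol cs φ S g y q) :
    ∃ y' q', IsSol cs' φ S' g y' q' ∧ (∀ f, tay cs' φ y' f = tay cs φ y f) ∧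
      pval cs' φ S' g y' q' = pval cs φ S g y q := by
  have hY := hS.extends hφ
  have hK := momenta_par (cs' := cs') hφ hS
  have hK0 := momenta_zero (cs := cs) (cs' := cs') (φ := φ) (S := S)
  -- `σ` inserts the solution `q` for the momenta. It commutes with Taylor expansion and
  -- substitution, so identities between `S` and `S'` become identities for the solutions.
  set σ := sigma hs.qpar hs.qzero with hσ
  have hσy : (fun i => σ (yo S i)) = y := funext fun i => (hs.hy i).symm
  have hσt : ∀ f, σ (tay cs φ (yo S) f) = tay cs φ y f := fun f => by
    have := tay_nat (cs' := cs) (φ' := φ) σ (fun N F hF => sigma_ord _ _ N F hF) LinearMap.id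
      (fun b => sigma_C _ _ _) (fun _ _ => rfl) (fun _ => rfl) hY.zero f
    rw [hσy] at this
    exact this.symm
  set q' : Fin n → SSer A τ := fun b => ∑ i, tay cs φ y (cs'.d b (cs.y i)) * q i with hq'
  have hσK : (fun b => σ (momenta cs cs' φ S b)) = q' := by
    funext b
    rw [momenta, map_sum]
    refine Finset.sum_congr rfl fun i _ => ?_
    rw [map_mul, hσt, hσ, sigma_X]
  have hσs : ∀ F, σ (subst (C π) (momenta cs cs' φ S) F) = subst (C τ) q' F := fun F => by
    have := subst_nat (π := π) (ρ := C π) (ρ' := C τ) σ (fun N F hF => sigma_ord _ _ N F hF)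
      (LinearMap.id (M := A)) (fun a => (sigma_C _ _ _).symm) hK0 F
    rw [hσK] at this
    rw [← this]
    congr 1
    exact (SSer.ext fun m _ => by rw [coeff_mapL (π := π)]; rfl)
  have ht : ∀ f, tay cs' φ (fun b => tay cs φ y (cs'.y b)) f = tay cs φ y f :=
    tay_change hc (hs.ext.change hφ cs') hφ hs.ext
  have hhat : ∀ g : SSer B τ, hat cs' φ (fun b => tay cs φ y (cs'.y b)) g = hat cs φ y g :=
    fun g => by rw [hat, hat, funext ht]
  refine ⟨fun b => tay cs φ y (cs'.y b), q', ⟨fun b => ?_, fun b => ?_⟩, ht, ?_⟩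
  · rw [← hσs, h.subst_yo hφ hS hS' hc hc', hσt]
  · have h1 : mapL (cs'.d b) g = ∑ i, C τ (cs'.d b (cs.y i)) * mapL (cs.d i) g := by
      refine SSer.ext fun m _ => ?_
      simp only [coeff_mapL, coeff_sum, coeff_C_mul]
      exact hc' b _
    rw [hhat, h1, ← hatHom_apply hφ hs.ext, map_sum]
    refine Finset.sum_congr rfl fun i _ => ?_
    rw [map_mul, hatHom_C, hatHom_apply, ← hs.hq]
  · rw [pval, hhat, pval, add_sub_assoc, add_sub_assoc]
    congr 1
    have h1 := congrArg σ h
    rw [map_sub, hσs, map_sum, map_sub, map_sum] at h1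
    simp only [map_mul, hσt, fun b => congrFun hσK b, fun i => congrFun hσy i] at h1
    rw [h1, hσ, sigma_apply]
    simp only [sigma_X]

end Change

/-! ### Change of parameters -/

section Ren
variable {A A' : Type*} [Ring A] [Algebra ℝ A] [SuperAlgebra A] [Ring A'] [Algebra ℝ A']
  [SuperAlgebra A'] {r r' : ℕ} {τ : Fin r → Bool} {τ' : Fin r' → Bool}

/-- A map of parameters (some of which are set to zero) preserves parities. -/
def RenPar (τ : Fin r → Bool) (τ' : Fin r' → Bool) (e : Fin r → Option (Fin r')) : Prop :=
  ∀ j k, e j = some k → τ' k = τ j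

/-- The images of the parameters. -/
noncomputable def renX (A' : Type*) [Ring A'] [Algebra ℝ A'] (τ' : Fin r' → Bool)
    (e : Fin r → Option (Fin r')) (j : Fin r) : SSer A' τ' := (e j).elim 0 (X A' τ')

variable {a : A →ₐ[ℝ] A'} (ha : IsSuper a) {e : Fin r → Option (Fin r')} (he : RenPar τ τ' e)

include he in
theorem renX_par (j : Fin r) : HasParity (τ j) (renX A' τ' e j) := by
  rw [renX]
  cases h : e j with
  | none => exact HasParity.zero
  | some k => rw [← he j k h]; exact hasParity_X k

theorem renX_zero (j : Fin r) : coeff 0 (renX A' τ' e j) = 0 := by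
  rw [renX]
  cases e j with
  | none => rfl
  | some k => exact coeff_zero_X k

/-- The change of coefficients and parameters. -/
noncomputable def ren (a : A →ₐ[ℝ] A') (ha : IsSuper a) (e : Fin r → Option (Fin r'))
    (he : RenPar τ τ' e) : SSer A τ →ₐ[ℝ] SSer A' τ' :=
  substHom ((CHom τ').comp a) (renX A' τ' e) (CHom_isSuper.comp ha) (renX_par he) renX_zero

theorem ren_C (x : A) : ren a ha e he (C τ x) = C τ' (a x) := substHom_C _ _ _ x
theorem ren_X (j : Fin r) : ren a ha e he (X A τ j) = renX A' τ' e j := substHom_X _ _ _ j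
theorem ren_isSuper : IsSuper (ren a ha e he) := substHom_isSuper _ _ _
theorem cont_ren : Cont (ren a ha e he).toLinearMap := cont_substHom _ _ _
theorem ren_ord (N : ℕ) (F : SSer A τ) (hF : F ∈ ordGE A τ N) : ren a ha e he F ∈ ordGE A' τ' N :=
  subst_mem (map_zero _) renX_zero hF
theorem coeff_zero_ren (F : SSer A τ) : coeff 0 (ren a ha e he F) = a (coeff 0 F) :=
  (coeff_zero_subst _ _ F).trans (coeff_zero_C _)

theorem renPar_some : RenPar τ τ some := fun j k h => by rw [Option.some.inj h]

theorem ren_some (F : SSer A τ) : ren a ha some renPar_some F = mapHom a ha τ F :=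
  hom_ext (cont_ren ha _) (cont_mapHom a ha) (fun x => by rw [ren_C, mapHom_C])
    (fun i => by rw [ren_X, mapHom_X]; rfl) F

theorem ren_mapL {f : Bool} {D : A →ₗ[ℝ] A} {D' : A' →ₗ[ℝ] A'} (hD : IsDer (AlgHom.id ℝ A) f D)
    (hD' : IsDer (AlgHom.id ℝ A') f D') (h : ∀ x, a (D x) = D' (a x)) (F : SSer A τ) :
    ren a ha e he (mapL D F) = mapL D' (ren a ha e he F) :=
  der_ext' (L := (ren a ha e he).toLinearMap.comp (mapL D))
    (L' := (mapL D').comp (ren a ha e he).toLinearMap)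
    ((isDer_mapL_id hD).post (ren_isSuper ha he)) ((isDer_mapL_id hD').pre (ren_isSuper ha he))
    ((cont_ren ha he).comp (cont_mapL _)) ((cont_mapL _).comp (cont_ren ha he))
    (fun x => by simp only [LinearMap.comp_apply, mapL_C, AlgHom.toLinearMap_apply, ren_C, h])
    (fun i => by
      simp only [LinearMap.comp_apply, mapL_X hD, AlgHom.toLinearMap_apply, ren_X, map_zero]
      rw [renX]
      cases e i with
      | none => simp
      | some k => exact (mapL_X hD' k).symm) F

/-- Since `j` is the only parameter that is sent to `k`, no sum over several preimages appears; both
sides are derivations with the same values on constants and variables. -/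
theorem ren_deriv {j : Fin r} {k : Fin r'} (h : ∀ i, e i = some k ↔ i = j) (F : SSer A τ) :
    deriv k (ren a ha e he F) = ren a ha e he (deriv j F) := by
  have hk : τ' k = τ j := he j k ((h j).2 rfl)
  refine der_ext' (L := (derivL k).comp (ren a ha e he).toLinearMap)
    (L' := (ren a ha e he).toLinearMap.comp (derivL j)) (e := τ j)
    (hk ▸ (isDer_derivL k).pre (ren_isSuper ha he)) ((isDer_derivL j).post (ren_isSuper ha he))
    ((cont_derivL k).comp (cont_ren ha he)) ((cont_ren ha he).comp (cont_derivL j))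
    (fun x => ?_) (fun i => ?_) F
  · simp only [LinearMap.comp_apply, AlgHom.toLinearMap_apply, ren_C, derivL_apply, deriv_C,
      map_zero]
  · simp only [LinearMap.comp_apply, AlgHom.toLinearMap_apply, ren_X, derivL_apply, deriv_X, renX]
    by_cases hi : i = j
    · subst hi
      rw [(h i).2 rfl, if_pos rfl, map_one]
      exact (deriv_X k k).trans (if_pos rfl)
    · rw [if_neg (Ne.symm hi), map_zero]
      cases hei : e i with
      | none => exact map_zero (derivL k)
      | some l =>
        refine (deriv_X k l).trans (if_neg ?_)
        rintro rfl
        exact hi ((h i).1 hei)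

end Ren

section RenSol
variable {A B A' B' : Type*} [Ring A] [Algebra ℝ A] [SuperAlgebra A] [Ring B] [Algebra ℝ B]
  [SuperAlgebra B] [Ring A'] [Algebra ℝ A'] [SuperAlgebra A'] [Ring B'] [Algebra ℝ B']
  [SuperAlgebra B'] {n r r' : ℕ} {π : Fin n → Bool} {τ : Fin r → Bool} {τ' : Fin r' → Bool}
  {cs : CoordSys B π} {cs' : CoordSys B' π} {φ : B →ₐ[ℝ] A} {φ' : B' →ₐ[ℝ] A'}

/-- Restriction maps that are compatible with the coordinates and with the support maps. -/
structure ResCompat (cs : CoordSys B π) (cs' : CoordSys B' π) (φ : B →ₐ[ℝ] A) (φ' : B' →ₐ[ℝ] A')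
    (a : A →ₐ[ℝ] A') (b : B →ₐ[ℝ] B') : Prop where
  ha : IsSuper a
  hb : IsSuper b
  hd : ∀ i x, b (cs.d i x) = cs'.d i (b x)
  hy : ∀ i, b (cs.y i) = cs'.y i
  hφ : ∀ x, a (φ x) = φ' (b x)

variable {a : A →ₐ[ℝ] A'} {b : B →ₐ[ℝ] B'} (h : ResCompat cs cs' φ φ' a b)
  {e : Fin r → Option (Fin r')} (he : RenPar τ τ' e)

theorem ResCompat.id (cs : CoordSys B π) (φ : B →ₐ[ℝ] A) :
    ResCompat cs cs φ φ (AlgHom.id ℝ A) (AlgHom.id ℝ B) :=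
  ⟨IsSuper.id, IsSuper.id, fun _ _ => rfl, fun _ => rfl, fun _ => rfl⟩

include h in
theorem ResCompat.tay {Y : Fin n → SSer A τ} (hY : ∀ i, coeff 0 (Y i) = φ (cs.y i)) (f : B) :
    SSer.tay cs' φ' (fun i => ren a h.ha e he (Y i)) (b f) = ren a h.ha e he (SSer.tay cs φ Y f) :=
  tay_nat _ (ren_ord h.ha he) b.toLinearMap (fun x => by rw [ren_C, h.hφ]; rfl) h.hd h.hy hY f

include h in
theorem ResCompat.hat (hφ : IsSuper φ) (hφ' : IsSuper φ') {Y : Fin n → SSer A τ}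
    (hY : Extends cs φ Y) (g : SSer B τ) :
    SSer.hat cs' φ' (fun i => ren a h.ha e he (Y i)) (ren b h.hb e he g) =
      ren a h.ha e he (SSer.hat cs φ Y g) := by
  have hY' : Extends cs' φ' (fun i => ren a h.ha e he (Y i)) :=
    ⟨fun i => (ren_isSuper h.ha he).hasParity (hY.par i), fun i => by
      rw [coeff_zero_ren, hY.zero, h.hφ, h.hy]⟩
  refine hom_ext (θ := (hatHom cs' φ' _ hφ' hY').comp (ren b h.hb e he))
    (θ' := (ren a h.ha e he).comp (hatHom cs φ Y hφ hY)) ?_ ?_ (fun x => ?_) (fun i => ?_) g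
  · rw [AlgHom.comp_toLinearMap]; exact (cont_hatHom hφ' hY').comp (cont_ren _ _)
  · rw [AlgHom.comp_toLinearMap]; exact (cont_ren _ _).comp (cont_hatHom hφ hY)
  · rw [AlgHom.comp_apply, AlgHom.comp_apply, ren_C, hatHom_C, hatHom_C, h.tay he hY.zero]
  · rw [AlgHom.comp_apply, AlgHom.comp_apply, ren_X, hatHom_X, ren_X, renX, renX]
    cases e i with
    | none => exact map_zero _
    | some k => exact hatHom_X hφ' hY' k

include h in
/-- Naturality of solutions. -/
theorem IsGoodSol.ren (hφ : IsSuper φ) (hφ' : IsSuper φ') {S : SSer A π} {g : SSer B τ}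
    {y q : Fin n → SSer A τ} (hs : IsGoodSol cs φ S g y q) :
    IsGoodSol cs' φ' (mapL a.toLinearMap S) (ren b h.hb e he g)
      (fun i => SSer.ren a h.ha e he (y i)) (fun i => SSer.ren a h.ha e he (q i)) ∧
    pval cs' φ' (mapL a.toLinearMap S) (SSer.ren b h.hb e he g)
      (fun i => SSer.ren a h.ha e he (y i)) (fun i => SSer.ren a h.ha e he (q i)) =
      SSer.ren a h.ha e he (pval cs φ S g y q) := by
  have hsub : ∀ F : SSer A π, subst (C τ') (fun i => SSer.ren a h.ha e he (q i))
      (mapL a.toLinearMap F) = SSer.ren a h.ha e he (subst (C τ) q F) := fun F =>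
    subst_nat (ρ := C τ) (ρ' := C τ') _ (ren_ord h.ha he) a.toLinearMap
      (fun x => (ren_C h.ha he x).symm) hs.qzero F
  refine ⟨⟨⟨fun i => ?_, fun i => ?_⟩, fun i => ?_, fun i => ?_, ⟨fun i => ?_, fun i => ?_⟩⟩, ?_⟩
  · rw [hs.hy, ← hsub]
    congr 1
    refine SSer.ext fun m _ => ?_
    rw [coeff_mapL, yo, yo, coeff_smul, coeff_smul, map_smul]
    congr 1
    exact (coeff_mapHom a h.ha _ m).symm.trans (congrArg (coeff m) (by
      rw [← ren_some h.ha, ← ren_deriv (j := i) (k := i) h.ha renPar_some (fun j => by simp), ren_some]; rfl))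
  · rw [hs.hq, ← h.hat he hφ hφ' hs.ext, ren_mapL h.hb he (cs.d_der i) (cs'.d_der i) (h.hd i)]
  · exact (ren_isSuper h.ha he).hasParity (hs.qpar i)
  · rw [coeff_zero_ren, hs.qzero, map_zero]
  · exact (ren_isSuper h.ha he).hasParity (hs.ext.par i)
  · rw [coeff_zero_ren, hs.ext.zero, h.hφ, h.hy]
  · rw [pval, pval, hsub, h.hat he hφ hφ' hs.ext, map_sub, map_add, map_sum]
    simp only [map_mul]

end RenSol
end SSer

/-! ### Hadamard's lemma -/

section Hadamard
open MeasureTheory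
variable {E : Type*} [NormedAddCommGroup E] [NormedSpace ℝ E]

/-- The integral is written as a convolution of an indicator function with a parameter-dependent
function, evaluated at `0`. A bump function equal to `1` on `[-1, 1]` supplies compact support
without changing the integrand, and the sign in `-s` undoes the reflection of the convolution. -/
theorem contDiff_integral_segment {G : E → ℝ} (hG : ContDiff ℝ ∞ G) (y : E) :
    ContDiff ℝ ∞ fun z => ∫ t in Set.Ioc (0 : ℝ) 1, G (y + t • (z - y)) := by
  let b : ContDiffBump (0 : ℝ) := ⟨1, 2, one_pos, one_lt_two⟩
  let g : E → ℝ → ℝ := fun z s => b s * G (y + (-s) • (z - y))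
  have hg : ContDiffOn ℝ ∞ ↿g (Set.univ ×ˢ Set.univ) := by
    have h1 : ContDiff ℝ ∞ fun p : E × ℝ => b p.2 * G (y + (-p.2) • (p.1 - y)) := by
      refine (b.contDiff.comp contDiff_snd).mul (hG.comp ?_)
      exact contDiff_const.add (contDiff_snd.neg.smul (contDiff_fst.sub contDiff_const))
    exact h1.contDiffOn
  have h := contDiffOn_convolution_right_with_param (μ := volume) (n := ⊤)
    (f := Set.indicator (Set.Ioc (0 : ℝ) 1) 1)
    (ContinuousLinearMap.mul ℝ ℝ) isOpen_univ (isCompact_closedBall (0 : ℝ) 2) (g := g)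
    (fun p x _ hx => by
      have : b x = 0 := b.zero_of_le_dist (by
        rw [Metric.mem_closedBall, not_le] at hx; exact hx.le)
      simp [g, this])
    ((integrable_indicator_iff measurableSet_Ioc).2
      (integrableOn_const (by simp))).locallyIntegrable hg
  rw [Set.univ_prod_univ, contDiffOn_univ] at h
  have h2 : ContDiff ℝ ∞ fun z : E => (z, (0 : ℝ)) := contDiff_id.prodMk contDiff_const
  convert h.comp h2 using 1
  funext z
  rw [Function.comp_apply, convolution_def, ← integral_indicator measurableSet_Ioc]
  refine integral_congr_ae (Filter.Eventually.of_forall fun t => ?_)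
  by_cases ht : t ∈ Set.Ioc (0 : ℝ) 1
  · have : b (-t) = 1 := b.one_of_mem_closedBall (by
      simpa [abs_of_pos ht.1] using ht.2)
    simp [ht, g, this]
  · simp [ht]

/-- Hadamard's lemma. -/
theorem hadamard {ι : Type*} [Fintype ι] {F : (ι → ℝ) → ℝ} (hF : ContDiff ℝ ∞ F) (y : ι → ℝ) :
    ∃ g : ι → (ι → ℝ) → ℝ, (∀ i, ContDiff ℝ ∞ (g i)) ∧
      ∀ z, F z = F y + ∑ i, (z i - y i) * g i z := by
  classical
  have hd : ∀ v, ContDiff ℝ ∞ fun z => fderiv ℝ F z v := fun v =>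
    (hF.fderiv_right (m := ∞) (by simp)).clm_apply contDiff_const
  refine ⟨fun i z => ∫ t in Set.Ioc (0 : ℝ) 1, fderiv ℝ F (y + t • (z - y)) (Pi.single i 1),
    fun i => contDiff_integral_segment (hd _) y, fun z => ?_⟩
  have hc : ∀ v, Continuous fun t : ℝ => fderiv ℝ F (y + t • (z - y)) v := fun v =>
    (hd v).continuous.comp (by fun_prop)
  have h1 : ∀ t : ℝ, HasDerivAt (fun t : ℝ => F (y + t • (z - y)))
      (fderiv ℝ F (y + t • (z - y)) (z - y)) t := fun t => by
    have h2 : HasDerivAt (fun t : ℝ => y + t • (z - y)) (z - y) t := by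
      simpa using ((hasDerivAt_id t).smul_const (z - y)).const_add y
    exact ((hF.differentiable (by simp)).differentiableAt.hasFDerivAt).comp_hasDerivAt t h2
  have h3 := intervalIntegral.integral_eq_sub_of_hasDerivAt (a := 0) (b := 1)
    (fun t _ => h1 t) ((hc _).intervalIntegrable _ _)
  have h4 : ∀ L : (ι → ℝ) →L[ℝ] ℝ, L (z - y) = ∑ i, (z i - y i) * L (Pi.single i 1) := fun L => by
    conv_lhs => rw [← Finset.univ_sum_single (z - y), map_sum]
    refine Finset.sum_congr rfl fun i _ => ?_
    rw [← smul_eq_mul, ← map_smul]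
    congr 1
    rw [← Pi.single_smul, smul_eq_mul, mul_one]; rfl
  rw [intervalIntegral.integral_of_le zero_le_one] at h3
  simp only [h4, one_smul, zero_smul, add_zero, add_sub_cancel] at h3
  rw [integral_finset_sum] at h3
  · simp only [integral_const_mul] at h3
    linarith
  · intro i _
    exact ((hc _).continuousOn.integrableOn_Icc.mono_set Set.Ioc_subset_Icc_self).const_mul _

end Hadamard

/-! ### Derivatives of smooth functions in a chart -/

namespace smoothFun
variable {X E : Type*} [TopologicalSpace X] [NormedAddCommGroup E] [NormedSpace ℝ E]
  {χ : OpenPartialHomeomorph X E}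

theorem pinv_eq {W : Opens X} (e : Bool) (f : smoothFun χ W) : pinv e f = f := by cases e <;> rfl

/-- Restriction as a homomorphism. -/
def resHom {W V : Opens X} (h : V ≤ W) : smoothFun χ W →ₐ[ℝ] smoothFun χ V where
  toFun := res h
  map_one' := rfl
  map_mul' _ _ := rfl
  map_zero' := rfl
  map_add' _ _ := rfl
  commutes' _ := rfl

theorem resHom_isSuper {W V : Opens X} (h : V ≤ W) : IsSuper (resHom (χ := χ) h) := fun _ => rfl

/-- The derivative depends on the germ only, so any smooth local representative of `f` may be used;
the extension by zero in `inCoord` is harmless. -/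
theorem dir_apply {W : Opens X} (hW : W ≤ srcOpens χ) (v : E) (f : smoothFun χ W) (x : W)
    {F : E → ℝ} (h : ∀ᶠ z : W in nhds x, f.1 z = F (χ z)) :
    (dir hW v f).1 x = fderiv ℝ F (χ x) v := by
  change fderiv ℝ (inCoord f) (χ x) v = _
  rw [(inCoord_eventuallyEq hW f x h).fderiv_eq]

theorem dir_add {W : Opens X} (hW : W ≤ srcOpens χ) (v : E) (f g : smoothFun χ W) :
    dir hW v (f + g) = dir hW v f + dir hW v g := by
  refine Subtype.ext (funext fun x => ?_)
  obtain ⟨F, hF, hF'⟩ := f.2 x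
  obtain ⟨G, hG, hG'⟩ := g.2 x
  have h := dir_apply hW v (f + g) x (F := fun u => F u + G u) (by
    filter_upwards [hF', hG'] with z h1 h2
    rw [← h1, ← h2]; rfl)
  rw [fderiv_fun_add (hF.differentiableAt (by simp)) (hG.differentiableAt (by simp))] at h
  rw [h, add_apply, ← dir_apply hW v f x hF', ← dir_apply hW v g x hG']
  rfl

theorem dir_mul {W : Opens X} (hW : W ≤ srcOpens χ) (v : E) (f g : smoothFun χ W) :
    dir hW v (f * g) = dir hW v f * g + f * dir hW v g := by
  refine Subtype.ext (funext fun x => ?_)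
  obtain ⟨F, hF, hF'⟩ := f.2 x
  obtain ⟨G, hG, hG'⟩ := g.2 x
  have h := dir_apply hW v (f * g) x (F := fun u => F u * G u) (by
    filter_upwards [hF', hG'] with z h1 h2
    rw [← h1, ← h2]; rfl)
  rw [fderiv_fun_mul (hF.differentiableAt (by simp)) (hG.differentiableAt (by simp))] at h
  rw [h]
  change _ = (dir hW v f).1 x * g.1 x + f.1 x * (dir hW v g).1 x
  rw [dir_apply hW v f x hF', dir_apply hW v g x hG', hF'.self_of_nhds, hG'.self_of_nhds]
  simp only [add_apply, smul_apply, smul_eq_mul]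
  ring

theorem dir_ofLin {W : Opens X} (hW : W ≤ srcOpens χ) (v : E) (l : E →L[ℝ] ℝ) :
    dir hW v (ofLin χ W l) = algebraMap ℝ _ (l v) := by
  refine Subtype.ext (funext fun x => ?_)
  rw [dir_apply hW v _ x (F := l) (Filter.Eventually.of_forall fun _ => rfl), l.fderiv]
  rfl

theorem dir_algebraMap {W : Opens X} (hW : W ≤ srcOpens χ) (v : E) (r : ℝ) :
    dir hW v (algebraMap ℝ (smoothFun χ W) r) = 0 := by
  refine Subtype.ext (funext fun x => ?_)
  rw [dir_apply hW v _ x (F := fun _ => r) (Filter.Eventually.of_forall fun _ => rfl)]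
  simp

theorem dir_res {W V : Opens X} (hW : W ≤ srcOpens χ) (h : V ≤ W) (v : E) (f : smoothFun χ W) :
    dir (h.trans hW) v (res h f) = res h (dir hW v f) := by
  refine Subtype.ext (funext fun x => ?_)
  obtain ⟨F, hF, hF'⟩ := f.2 ⟨x, h x.2⟩
  have hc : Filter.Tendsto (fun z : V => (⟨z, h z.2⟩ : W)) (nhds x) (nhds ⟨x, h x.2⟩) :=
    (Continuous.subtype_mk continuous_subtype_val _).tendsto _
  rw [dir_apply (h.trans hW) v _ x (F := F) (hc.eventually hF')]
  exact (dir_apply hW v f ⟨x, h x.2⟩ hF').symm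

/-- The derivative as a linear map. -/
noncomputable def dirL {W : Opens X} (hW : W ≤ srcOpens χ) (v : E) :
    smoothFun χ W →ₗ[ℝ] smoothFun χ W where
  toFun := dir hW v
  map_add' := dir_add hW v
  map_smul' r f := by
    rw [Algebra.smul_def, dir_mul, dir_algebraMap, zero_mul, zero_add, RingHom.id_apply,
      Algebra.smul_def]

theorem isDer_dirL {W : Opens X} (hW : W ≤ srcOpens χ) (v : E) :
    IsDer (AlgHom.id ℝ (smoothFun χ W)) false (dirL hW v) :=
  ⟨fun f g => dir_mul hW v f g, fun f => (one_smul ℝ (dir hW v f)).symm⟩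

/-- The smooth function given by a smooth function of the coordinates. -/
def ofSmooth (χ : OpenPartialHomeomorph X E) (W : Opens X) {F : E → ℝ} (hF : ContDiff ℝ ∞ F) :
    smoothFun χ W :=
  ⟨fun x => F (χ x), fun _ => ⟨F, hF.contDiffAt, Filter.Eventually.of_forall fun _ => rfl⟩⟩

end smoothFun

/-! ### Charts -/

namespace Chart
open SSer
variable {X : SuperSpace} {n : ℕ} {π : Fin n → Bool} (c : Chart X π)

theorem iso_isSuper {W : Opens X.pt} (hW : W ≤ c.dom) :
    IsSuper (c.iso W hW).toAlgHom := fun f => c.iso_inv W hW f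

theorem symm_inv {W : Opens X.pt} (hW : W ≤ c.dom) (F) :
    (c.iso W hW).symm (SuperAlgebra.inv F) = SuperAlgebra.inv ((c.iso W hW).symm F) := by
  apply (c.iso W hW).injective
  rw [AlgEquiv.apply_symm_apply, c.iso_inv, AlgEquiv.apply_symm_apply]; rfl

theorem symm_isSuper {W : Opens X.pt} (hW : W ≤ c.dom) :
    IsSuper (c.iso W hW).symm.toAlgHom := fun f => c.symm_inv hW f

theorem res_symm {W V : Opens X.pt} (hW : W ≤ c.dom) (h : V ≤ W) (F) :
    X.res h ((c.iso W hW).symm F) = (c.iso V (h.trans hW)).symm (SSer.map (smoothFun.res h) F) := by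
  apply (c.iso V (h.trans hW)).injective
  rw [AlgEquiv.apply_symm_apply, c.iso_res _ _ hW h, AlgEquiv.apply_symm_apply]

theorem coord_par {W : Opens X.pt} (hW : W ≤ c.dom) (i : Fin n) : HasParity (π i) (c.coord hW i) := by
  rw [coord]
  refine (c.symm_isSuper hW).hasParity ?_
  split
  · next h => rw [h]; exact hasParity_C rfl
  · next h => rw [Bool.not_eq_false] at h; rw [h]; exact hasParity_X (π := allOdd π) _

theorem coord_res {W V : Opens X.pt} (hW : W ≤ c.dom) (h : V ≤ W) (i : Fin n) :
    X.res h (c.coord hW i) = c.coord (h.trans hW) i := by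
  rw [coord, coord, res_symm]
  congr 1
  split
  · exact mapHom_C (smoothFun.resHom h) (smoothFun.resHom_isSuper h) _
  · exact mapHom_X (smoothFun.resHom h) (smoothFun.resHom_isSuper h) _

/-- The partial derivative of a series of smooth functions. -/
noncomputable def serPd {W : Opens X.pt} (hW : W ≤ c.dom) (i : Fin n) :
    SSer (smoothFun c.body W) (allOdd π) →ₗ[ℝ] SSer (smoothFun c.body W) (allOdd π) :=
  if h : π i = false then mapL (smoothFun.dirL hW (Pi.single ⟨i, h⟩ 1))
  else derivL ⟨i, by simpa using h⟩

theorem isDer_serPd {W : Opens X.pt} (hW : W ≤ c.dom) (i : Fin n) :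
    IsDer (AlgHom.id ℝ _) (π i) (c.serPd hW i) := by
  rw [serPd]
  split
  · next h => rw [h]; exact isDer_mapL_id (smoothFun.isDer_dirL hW _)
  · next h => rw [Bool.not_eq_false] at h; rw [h]; exact isDer_derivL (π := allOdd π) _

/-- The partial derivative as a linear map. -/
noncomputable def pdL {W : Opens X.pt} (hW : W ≤ c.dom) (i : Fin n) : X.O W →ₗ[ℝ] X.O W :=
  (c.iso W hW).symm.toLinearMap ∘ₗ c.serPd hW i ∘ₗ (c.iso W hW).toLinearMap

theorem pdL_apply {W : Opens X.pt} (hW : W ≤ c.dom) (i : Fin n) (f : X.O W) :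
    c.pdL hW i f = c.pd hW i f := by
  simp only [pdL, pd, serPd, LinearMap.comp_apply, AlgEquiv.toLinearMap_apply]
  congr 1
  split <;> rfl

theorem iso_pdL {W : Opens X.pt} (hW : W ≤ c.dom) (i : Fin n) (f : X.O W) :
    c.iso W hW (c.pdL hW i f) = c.serPd hW i (c.iso W hW f) := by
  simp [pdL]

theorem isDer_pdL {W : Opens X.pt} (hW : W ≤ c.dom) (i : Fin n) :
    IsDer (AlgHom.id ℝ (X.O W)) (π i) (c.pdL hW i) := by
  have h := c.isDer_serPd hW i
  refine ⟨fun a b => (c.iso W hW).injective ?_, fun a => (c.iso W hW).injective ?_⟩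
  · have hp := (c.iso_isSuper hW).pinv (π i) a
    change c.iso W hW (pinv (π i) a) = pinv (π i) (c.iso W hW a) at hp
    rw [iso_pdL, map_mul, h.leib, map_add, map_mul, map_mul, iso_pdL, iso_pdL, AlgHom.id_apply,
      AlgHom.id_apply, AlgHom.id_apply, AlgHom.id_apply, hp]
  · rw [iso_pdL, c.iso_inv, map_smul, c.iso_inv, iso_pdL]
    exact h.par _

theorem serPd_res {W V : Opens X.pt} (hW : W ≤ c.dom) (h : V ≤ W) (i : Fin n) (F) :
    SSer.map (smoothFun.res h) (c.serPd hW i F) =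
      c.serPd (h.trans hW) i (SSer.map (smoothFun.res h) F) := by
  have h0 : smoothFun.res (χ := c.body) h 0 = 0 := rfl
  refine SSer.ext fun m hm => ?_
  rw [serPd, serPd, coeff_map h0]
  split
  · next hi =>
    rw [coeff_mapL, coeff_mapL, coeff_map h0]
    exact (smoothFun.dir_res hW h _ _).symm
  · next hi =>
    rw [derivL_apply, derivL_apply, coeff_deriv, coeff_deriv, coeff_map h0, smoothFun.pinv_eq,
      smoothFun.pinv_eq]
    exact map_smul (smoothFun.resHom h) _ _

theorem pdL_res {W V : Opens X.pt} (hW : W ≤ c.dom) (h : V ≤ W) (i : Fin n) (f : X.O W) :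
    X.res h (c.pdL hW i f) = c.pdL (h.trans hW) i (X.res h f) := by
  apply (c.iso V (h.trans hW)).injective
  rw [c.iso_res _ _ hW h, iso_pdL, iso_pdL, serPd_res, c.iso_res _ _ hW h]

theorem pdL_coord {W : Opens X.pt} (hW : W ≤ c.dom) (i j : Fin n) :
    c.pdL hW i (c.coord hW j) = if i = j then 1 else 0 := by
  apply (c.iso W hW).injective
  rw [iso_pdL, coord, AlgEquiv.apply_symm_apply, serPd]
  by_cases hi : π i = false <;> by_cases hj : π j = false
  · rw [dif_pos hi, dif_pos hj, mapL_C]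
    refine (congrArg (C _) (smoothFun.dir_ofLin hW _ _)).trans ?_
    rw [ContinuousLinearMap.proj_apply, Pi.single_apply]
    by_cases hij : i = j
    · subst hij; rw [if_pos rfl, if_pos rfl, map_one, map_one]; rfl
    · rw [if_neg (fun h => hij (congrArg Subtype.val h).symm), if_neg hij, map_zero, C_zero, map_zero]
  · rw [dif_pos hi, dif_neg hj, mapL_X (smoothFun.isDer_dirL hW _),
      if_neg (by rintro rfl; exact hj hi), map_zero]
  · rw [dif_neg hi, dif_pos hj, derivL_apply, deriv_C, if_neg (by rintro rfl; exact hi hj), map_zero]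
  · rw [dif_neg hi, dif_neg hj, derivL_apply, deriv_X]
    by_cases hij : i = j
    · subst hij; rw [if_pos rfl, if_pos rfl, map_one]
    · rw [if_neg (fun h => hij (congrArg Subtype.val h)), if_neg hij, map_zero]

end Chart

/-! ### Derivations along morphisms are determined by their values on coordinates -/

namespace SSer

/-- In the lowest degree of `G` only the constant term of `F` contributes. This lets a factor that
vanishes at a point kill the leading coefficient there. -/
theorem coeff_mul_of_ordGE {A : Type*} [Ring A] [Algebra ℝ A] [SuperAlgebra A] {ι : Type*}
    [Fintype ι] [LinearOrder ι] {π : ι → Bool} {F G : SSer A π} {m : ι →₀ ℕ}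
    (hG : G ∈ ordGE A π m.degree) : coeff m (F * G) = coeff 0 F * coeff m G := by
  have h1 : F - C π (coeff 0 F) ∈ ordGE A π 1 :=
    mem_ordGE_one.2 (by rw [coeff_sub, coeff_zero_C, sub_self])
  have h2 := mul_ordGE h1 hG m (by omega)
  rwa [sub_mul, coeff_sub, coeff_C_mul, sub_eq_zero] at h2

theorem ordGE_eq_zero_of_odd {A : Type*} [Ring A] [Algebra ℝ A] [SuperAlgebra A] {ι : Type*}
    [Fintype ι] [LinearOrder ι] {π : ι → Bool} (hπ : ∀ i, π i = true) {F : SSer A π}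
    (hF : F ∈ ordGE A π (Fintype.card ι + 1)) : F = 0 :=
  SSer.ext fun m hm => hF m (Nat.lt_succ_of_le (by
    rw [Finsupp.degree_eq_sum]
    refine (Finset.sum_le_sum fun i _ => hm i (hπ i)).trans ?_
    simp))

end SSer

/-- The last clause, vanishing near every point that is not the image of a point of `V`, makes a
smooth function on `V` times the bump extend smoothly by zero to the whole coordinate space. -/
theorem exists_bump {X E : Type*} [TopologicalSpace X] [NormedAddCommGroup E] [NormedSpace ℝ E]
    [FiniteDimensional ℝ E] (χ : OpenPartialHomeomorph X E) {V : Opens X} (hV : V ≤ srcOpens χ)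
    {x : X} (hx : x ∈ V) :
    ∃ (b : E → ℝ) (W : Opens X), ContDiff ℝ ∞ b ∧ W ≤ V ∧ x ∈ W ∧ (∀ z ∈ W, b (χ z) = 1) ∧
      (∀ z ∈ χ.source, z ∉ V → b (χ z) = 0) ∧
      ∀ u, (¬ ∃ z ∈ V, χ z = u) → ∀ᶠ v in nhds u, b v = 0 := by
  have hT : IsOpen (χ.target ∩ χ.symm ⁻¹' (V : Set X)) := χ.symm.isOpen_inter_preimage V.isOpen
  have hxs : x ∈ χ.source := hV hx
  obtain ⟨ρ, hρ, hb⟩ := Metric.isOpen_iff.1 hT (χ x) ⟨χ.map_source hxs, by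
    rw [Set.mem_preimage, χ.left_inv hxs]; exact hx⟩
  let b : ContDiffBump (χ x) := ⟨ρ / 4, ρ / 2, by linarith, by linarith⟩
  have hball : Metric.closedBall (χ x) (ρ / 2) ⊆ χ.target ∩ χ.symm ⁻¹' (V : Set X) :=
    (Metric.closedBall_subset_ball (by linarith)).trans hb
  have hW : IsOpen (χ.source ∩ χ ⁻¹' Metric.ball (χ x) (ρ / 4)) :=
    χ.isOpen_inter_preimage Metric.isOpen_ball
  refine ⟨b, ⟨_, hW⟩, b.contDiff, ?_, ⟨hxs, Metric.mem_ball_self (by linarith)⟩, ?_, ?_, ?_⟩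
  · rintro z ⟨hz, hz'⟩
    have := (hb (Metric.ball_subset_ball (by linarith) hz')).2
    rwa [Set.mem_preimage, χ.left_inv hz] at this
  · rintro z ⟨hz, hz'⟩
    exact b.one_of_mem_closedBall (Metric.ball_subset_closedBall hz')
  · intro z hz hzV
    refine b.zero_of_le_dist (le_of_not_ge fun h => hzV ?_)
    have := (hball h).2
    rwa [Set.mem_preimage, χ.left_inv hz] at this
  · intro u hu
    have h1 : u ∉ Metric.closedBall (χ x) (ρ / 2) := fun h =>
      hu ⟨χ.symm u, (hball h).2, χ.right_inv (hball h).1⟩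
    filter_upwards [Metric.isClosed_closedBall.isOpen_compl.mem_nhds h1] with v hv
    exact b.zero_of_le_dist (le_of_not_ge fun h => hv h)

/-- Hadamard's lemma for smooth functions in a chart. -/
theorem smoothFun.hadamard {X : Type*} {ι : Type*} [Fintype ι] [TopologicalSpace X]
    (χ : OpenPartialHomeomorph X (ι → ℝ)) {V : Opens X} (hV : V ≤ srcOpens χ)
    (u : smoothFun χ V) {y : X} (hy : y ∈ V) :
    ∃ (a : ℝ) (g : ι → smoothFun χ V) (W : Opens X), W ≤ V ∧ y ∈ W ∧
      ∀ z : V, z.1 ∈ W → u.1 z = a + ∑ i, (χ z i - χ y i) * (g i).1 z := by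
  obtain ⟨b, W, hb, hW, hyW, hb1, -, hb0⟩ := exists_bump χ hV hy
  have hF : ContDiff ℝ ∞ fun v => b v * smoothFun.inCoord u v := by
    refine contDiff_iff_contDiffAt.2 fun v => ?_
    by_cases h : ∃ z ∈ V, χ z = v
    · obtain ⟨z, hz, rfl⟩ := h
      obtain ⟨F, hF, hF'⟩ := u.2 ⟨z, hz⟩
      exact hb.contDiffAt.mul
        (hF.congr_of_eventuallyEq (smoothFun.inCoord_eventuallyEq hV u ⟨z, hz⟩ hF'))
    · refine (contDiffAt_const (c := (0 : ℝ))).congr_of_eventuallyEq ?_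
      filter_upwards [hb0 v h] with w hw
      rw [hw, zero_mul]
  obtain ⟨g, hg, h⟩ := _root_.hadamard hF (χ y)
  refine ⟨b (χ y) * smoothFun.inCoord u (χ y), fun i => smoothFun.ofSmooth χ V (hg i), W, hW, hyW,
    fun z hz => ?_⟩
  obtain ⟨F, hF, hF'⟩ := u.2 z
  have h1 := (smoothFun.inCoord_eventuallyEq hV u z hF').eq_of_nhds
  rw [hF'.self_of_nhds, ← h1]
  have := h (χ z)
  rwa [hb1 z hz, one_mul] at this

namespace Chart
open SSer
variable {X : SuperSpace} {n : ℕ} {π : Fin n → Bool} (c : Chart X π)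

/-- A function of the even coordinates. -/
noncomputable def evenFun {W : Opens X.pt} (hW : W ≤ c.dom) : smoothFun c.body W →ₐ[ℝ] X.O W :=
  (c.iso W hW).symm.toAlgHom.comp (CHom (allOdd π))

theorem res_evenFun {W V : Opens X.pt} (hW : W ≤ c.dom) (h : V ≤ W) (u : smoothFun c.body W) :
    X.res h (c.evenFun hW u) = c.evenFun (h.trans hW) (smoothFun.res h u) :=
  (c.res_symm hW h _).trans (congrArg _ (mapHom_C (smoothFun.resHom h) (smoothFun.resHom_isSuper h) u))

theorem evenFun_par {W : Opens X.pt} (hW : W ≤ c.dom) (u : smoothFun c.body W) :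
    HasParity false (c.evenFun hW u) :=
  (c.symm_isSuper hW).hasParity (hasParity_C rfl)

theorem evenFun_coord {W : Opens X.pt} (hW : W ≤ c.dom) (i : {i : Fin n // π i = false}) :
    c.evenFun hW (smoothFun.ofLin c.body W (ContinuousLinearMap.proj i)) = c.coord hW i := by
  rw [coord, dif_pos i.2]; rfl

/-- The value of a function at a point. -/
noncomputable def val {W : Opens X.pt} (hW : W ≤ c.dom) (x : W) (f : X.O W) : ℝ :=
  (coeff 0 (c.iso W hW f)).1 x

theorem val_mul {W : Opens X.pt} (hW : W ≤ c.dom) (x : W) (f g : X.O W) :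
    c.val hW x (f * g) = c.val hW x f * c.val hW x g := by
  rw [val, map_mul, coeff_zero_mul]; rfl

theorem val_sub {W : Opens X.pt} (hW : W ≤ c.dom) (x : W) (f g : X.O W) :
    c.val hW x (f - g) = c.val hW x f - c.val hW x g := by
  rw [val, map_sub, coeff_sub]; rfl

theorem val_algebraMap {W : Opens X.pt} (hW : W ≤ c.dom) (x : W) (r : ℝ) :
    c.val hW x (algebraMap ℝ _ r) = r := by
  rw [val, Algebra.algebraMap_eq_smul_one, map_smul, map_one, coeff_smul, coeff_zero_one]
  exact mul_one r

theorem val_res {W V : Opens X.pt} (hW : W ≤ c.dom) (h : V ≤ W) (x : V) (f : X.O W) :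
    c.val (h.trans hW) x (X.res h f) = c.val hW ⟨x, h x.2⟩ f := by
  rw [val, c.iso_res _ _ hW h]
  exact congrArg (fun u : smoothFun c.body V => u.1 x)
    (coeff_map (f := smoothFun.res (χ := c.body) h) rfl _ 0)

end Chart

namespace SuperMorphism
open SSer
variable {M₁ M₂ : GradedSupermanifold} (φ : SuperMorphism M₁ M₂)

theorem pullTo_res {V W : Opens M₂.pt} {U : Opens M₁.pt} (h : W ≤ V)
    (hU : U ≤ Opens.comap φ.base W) (f : M₂.O V) :
    φ.pullTo hU (M₂.res h f) = φ.pullTo (hU.trans (Opens.comap_mono φ.base h)) f := by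
  simp only [pullTo, AlgHom.comp_apply]
  rw [φ.pull_res h]
  exact M₁.res_res _ _ _

theorem res_pullTo {V : Opens M₂.pt} {U U' : Opens M₁.pt} (hU : U ≤ Opens.comap φ.base V)
    (h : U' ≤ U) (f : M₂.O V) :
    M₁.res h (φ.pullTo hU f) = φ.pullTo (h.trans hU) f := by
  simp only [pullTo, AlgHom.comp_apply]
  rw [M₁.res_res]

theorem pullTo_isSuper {V : Opens M₂.pt} {U : Opens M₁.pt} (hU : U ≤ Opens.comap φ.base V) :
    IsSuper (φ.pullTo hU) := fun f => by
  simp only [pullTo, AlgHom.comp_apply]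
  rw [φ.pull_inv, M₁.res_inv]

variable {n₁ n₂ : ℕ} {π₁ : Fin n₁ → Bool} {π₂ : Fin n₂ → Bool}

/-- The base map and the pullback of a morphism are separate data, and this ties them together. If
the value `μ` of the pulled back coordinate differed from the coordinate of `φ(x)`, then `y^i - μ`
would be invertible near `φ(x)`, hence so would be its pullback, which has value zero at `x`. -/
theorem val_pullTo_coord (c₁ : Chart M₁.toSuperSpace π₁) (c₂ : Chart M₂.toSuperSpace π₂)
    {V : Opens M₂.pt} (hV : V ≤ c₂.dom) {U : Opens M₁.pt} (hU : U ≤ Opens.comap φ.base V)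
    (hU₁ : U ≤ c₁.dom) (x : U) (i : {i : Fin n₂ // π₂ i = false}) :
    c₁.val hU₁ x (φ.pullTo hU (c₂.coord hV i)) = c₂.body (φ.base x) i := by
  by_contra hne
  set μ := c₁.val hU₁ x (φ.pullTo hU (c₂.coord hV i)) with hμ
  have hopen : IsOpen (c₂.body.source ∩ c₂.body ⁻¹' {u | u i ≠ μ}) :=
    c₂.body.isOpen_inter_preimage (isOpen_ne_fun (continuous_apply i) continuous_const)
  let W : Opens M₂.pt := V ⊓ ⟨_, hopen⟩
  have hW : W ≤ V := inf_le_left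
  have hxW : φ.base x ∈ W := ⟨hU x.2, hV (hU x.2), Ne.symm hne⟩
  let v : smoothFun c₂.body W := ⟨fun z => (c₂.body z i - μ)⁻¹, fun z =>
    ⟨fun u => (u i - μ)⁻¹, (((contDiff_apply ℝ ℝ i).sub contDiff_const).contDiffAt).inv
      (sub_ne_zero.2 z.2.2.2), Filter.Eventually.of_forall fun _ => rfl⟩⟩
  have hv : (smoothFun.ofLin c₂.body W (ContinuousLinearMap.proj i) - algebraMap ℝ _ μ) * v = 1 :=
    Subtype.ext (funext fun z => mul_inv_cancel₀ (sub_ne_zero.2 z.2.2.2))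
  have h1 := congrArg (c₂.evenFun (hW.trans hV)) hv
  rw [map_mul, map_sub, Chart.evenFun_coord, map_one, AlgHom.commutes, ← c₂.coord_res hV hW] at h1
  have hU' : U ⊓ Opens.comap φ.base W ≤ Opens.comap φ.base W := inf_le_right
  have h2 := congrArg (φ.pullTo hU') h1
  rw [map_mul, map_sub, AlgHom.commutes, map_one, φ.pullTo_res,
    ← φ.res_pullTo hU (inf_le_left : U ⊓ Opens.comap φ.base W ≤ U)] at h2
  have h3 := congrArg (c₁.val (inf_le_left.trans hU₁) ⟨x, x.2, hxW⟩) h2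
  rw [Chart.val_mul, Chart.val_sub, Chart.val_res c₁ hU₁, Chart.val_algebraMap, ← hμ, sub_self, zero_mul,
    ← map_one (algebraMap ℝ _), Chart.val_algebraMap] at h3
  exact zero_ne_one h3

section Der
variable {φ} {c : Chart M₂.toSuperSpace π₂} {V : Opens M₂.pt} {hV : V ≤ c.dom} {U : Opens M₁.pt}
  {hU : U ≤ Opens.comap φ.base V} {e : Bool} {D : M₂.O V →ₗ[ℝ] M₁.O U}

/-- Derivations are local. -/
theorem der_local (hD : IsDer (φ.pullTo hU) e D) {u : smoothFun c.body V} {W : Opens M₂.pt}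
    (hWV : W ≤ V) (hu : ∀ z : V, z.1 ∈ W → u.1 z = 0) {x : M₁.pt} (hx : x ∈ U)
    (hxW : φ.base x ∈ W) :
    ∃ (U' : Opens M₁.pt) (h : U' ≤ U), x ∈ U' ∧ M₁.res h (D (c.evenFun hV u)) = 0 := by
  obtain ⟨b, W₁, hb, hW₁, hxW₁, hb1, hb0, -⟩ := exists_bump c.body (hWV.trans hV) hxW
  -- `D` is applied to `b u = 0`. Near `x`, where `b` pulls back to `1` and `u` to `0`, the product
  -- rule leaves only `D u`.
  have h1 : smoothFun.ofSmooth c.body V hb * u = 0 := by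
    refine Subtype.ext (funext fun z => ?_)
    change b (c.body z) * u.1 z = 0
    by_cases hz : z.1 ∈ W
    · rw [hu z hz, mul_zero]
    · rw [hb0 z (hV z.2) hz, zero_mul]
  have hU₁ : U ⊓ Opens.comap φ.base W₁ ≤ Opens.comap φ.base W₁ := inf_le_right
  refine ⟨U ⊓ Opens.comap φ.base W₁, inf_le_left, ⟨hx, hxW₁⟩, ?_⟩
  have h2 := congrArg D (congrArg (c.evenFun hV) h1)
  rw [map_mul, hD.leib, map_zero, map_zero,
    ((φ.pullTo_isSuper hU).hasParity (c.evenFun_par hV _)).pinv_eq, Bool.and_false, sgn_false,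
    one_smul] at h2
  have hle : W₁ ≤ V := hW₁.trans hWV
  have h3 : φ.pullTo hU₁ (M₂.res hle (c.evenFun hV u)) = 0 := by
    rw [c.res_evenFun hV hle]
    have : smoothFun.res hle u = 0 := Subtype.ext (funext fun z => hu ⟨z, hle z.2⟩ (hW₁ z.2))
    rw [this, map_zero, map_zero]
  have h4 : φ.pullTo hU₁ (M₂.res hle (c.evenFun hV (smoothFun.ofSmooth c.body V hb))) = 1 := by
    rw [c.res_evenFun hV hle]
    have : smoothFun.res hle (smoothFun.ofSmooth c.body V hb) = 1 :=
      Subtype.ext (funext fun z => hb1 z z.2)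
    rw [this, map_one, map_one]
  have h5 := congrArg (M₁.res (inf_le_left : U ⊓ Opens.comap φ.base W₁ ≤ U)) h2
  rw [map_add, map_mul, map_mul, φ.res_pullTo, φ.res_pullTo] at h5
  rw [φ.pullTo_res] at h3 h4
  rw [h3, h4, mul_zero, zero_add, one_mul, map_zero] at h5
  exact h5

/-- By Hadamard's lemma `u = a + ∑ (y^i - y^i(φ x)) g_i` near `φ(x)`, so `D u` is near `x` a
combination of the `D g_i` with coefficients vanishing at `x`. If all `D g` have order `k` in the
odd coordinates, the coefficients of degree `k` of `D u` vanish at `x`. As `x` is arbitrary, the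
order rises to `k + 1`. -/
theorem der_evenFun_mem (hD : IsDer (φ.pullTo hU) e D) (h : ∀ i, D (c.coord hV i) = 0)
    (c₁ : Chart M₁.toSuperSpace π₁) (k : ℕ) (u : smoothFun c.body V) :
    c₁.iso (U ⊓ c₁.dom) inf_le_right (M₁.res inf_le_left (D (c.evenFun hV u))) ∈
      ordGE _ (allOdd π₁) k := by
  induction k generalizing u with
  | zero => exact ordGE_zero _
  | succ k ih =>
    intro m hm
    rcases (Nat.lt_succ_iff_lt_or_eq.1 hm) with hm | hm
    · exact ih u m hm
    refine Subtype.ext (funext fun x => ?_)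
    obtain ⟨a, g, W, hW, hyW, hg⟩ := smoothFun.hadamard c.body hV u (hU x.2.1)
    set y := c.body (φ.base x) with hy
    set s : smoothFun c.body V := algebraMap ℝ _ a +
      ∑ i, (smoothFun.ofLin c.body V (ContinuousLinearMap.proj i) - algebraMap ℝ _ (y i)) * g i
      with hs
    obtain ⟨U', hU', hxU', hr⟩ := der_local hD (u := u - s) hW (fun z hz => by
      have h1 : s.1 z = a + ∑ i, (c.body z i - y i) * (g i).1 z := by
        have h2 : (∑ i, (smoothFun.ofLin c.body V (ContinuousLinearMap.proj i) -
            algebraMap ℝ _ (y i)) * g i).1 z = ∑ i, (c.body z i - y i) * (g i).1 z := by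
          rw [AddSubmonoidClass.coe_finset_sum, Finset.sum_apply]; rfl
        rw [← h2]; rfl
      change u.1 z - s.1 z = 0
      rw [h1, hg z hz, sub_self]) x.2.1 hyW
    have hDs : D (c.evenFun hV s) = ∑ i, φ.pullTo hU (c.coord hV i.1 - algebraMap ℝ _ (y i)) *
        D (c.evenFun hV (g i)) := by
      rw [hs, map_add, map_add, map_sum, map_sum, AlgHom.commutes, hD.map_algebraMap, zero_add]
      refine Finset.sum_congr rfl fun i _ => ?_
      have h1 : HasParity false (c.coord hV i.1 - algebraMap ℝ _ (y i)) := by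
        rw [← c.evenFun_coord hV i, ← AlgHom.commutes (c.evenFun hV), ← map_sub]
        exact c.evenFun_par hV _
      rw [map_mul, map_sub, c.evenFun_coord, AlgHom.commutes, hD.leib, map_sub D, h,
        hD.map_algebraMap, sub_zero, zero_mul, zero_add,
        ((φ.pullTo_isSuper hU).hasParity h1).pinv_eq, Bool.and_false, sgn_false, one_smul]
    have hU₂ : U' ⊓ c₁.dom ≤ U ⊓ c₁.dom := inf_le_inf_right _ hU'
    have hUU : U ⊓ c₁.dom ≤ U := inf_le_left
    have key : M₁.res (hU₂.trans hUU) (D (c.evenFun hV u)) = M₁.res hU₂ (∑ i : {i // π₂ i = false},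
        φ.pullTo (hUU.trans hU) (c.coord hV i.1 - algebraMap ℝ _ (y i)) *
        M₁.res hUU (D (c.evenFun hV (g i)))) := by
      have h1 := congrArg (M₁.res (inf_le_left : U' ⊓ c₁.dom ≤ U')) hr
      rw [map_zero, M₁.res_res, map_sub, map_sub, map_sub, sub_eq_zero, hDs] at h1
      rw [h1, map_sum, map_sum]
      refine Finset.sum_congr rfl fun i _ => ?_
      rw [map_mul, map_mul, φ.res_pullTo, φ.res_pullTo, M₁.res_res]
    have hx' : (x : M₁.pt) ∈ U' ⊓ c₁.dom := ⟨hxU', x.2.2⟩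
    have h0 : smoothFun.res (χ := c₁.body) hU₂ 0 = 0 := rfl
    have h2 := congrArg (c₁.iso (U' ⊓ c₁.dom) inf_le_right) key
    rw [← M₁.res_res hUU hU₂, c₁.iso_res _ _ inf_le_right hU₂,
      c₁.iso_res _ _ inf_le_right hU₂] at h2
    have h3 := congrArg (coeff m) h2
    rw [coeff_map h0, coeff_map h0] at h3
    have h4 := congrFun (congrArg Subtype.val h3) ⟨x, hx'⟩
    refine Eq.trans (h4 : (coeff m _ : smoothFun c₁.body _).1 x = _) ?_
    change (coeff m (c₁.iso (U ⊓ c₁.dom) inf_le_right _) : smoothFun c₁.body _).1 x = 0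
    rw [map_sum, coeff_sum, AddSubmonoidClass.coe_finset_sum, Finset.sum_apply]
    refine Finset.sum_eq_zero fun i _ => ?_
    rw [map_mul, coeff_mul_of_ordGE (hm ▸ ih (g i))]
    change c₁.val inf_le_right x _ * _ = 0
    rw [map_sub, Chart.val_sub, AlgHom.commutes, Chart.val_algebraMap, val_pullTo_coord, sub_self,
      zero_mul]

/-- A derivation along a morphism that vanishes on the coordinates is zero. -/
theorem der_eq_zero (hD : IsDer (φ.pullTo hU) e D) (h : ∀ i, D (c.coord hV i) = 0) (f : M₂.O V) :
    D f = 0 := by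
  have h1 : ∀ u, D (c.evenFun hV u) = 0 := fun u => by
    refine M₁.eq_of_locally_eq _ _ fun x hx => ?_
    obtain ⟨c₁, hc₁⟩ := M₁.exists_chart x
    refine ⟨U ⊓ c₁.dom, inf_le_left, ⟨hx, hc₁⟩, ?_⟩
    apply (c₁.iso (U ⊓ c₁.dom) inf_le_right).injective
    rw [map_zero, map_zero]
    exact eq_zero_of_ordGE fun k => der_evenFun_mem hD h c₁.toChart k u
  -- Series in no variables are their constant terms, so `der_ext` applies with values in `M₁.O U`.
  -- Continuity is automatic: a series in finitely many odd variables of large order is zero.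
  let τ : Fin 0 → Bool := fun _ => false
  have h2 := der_ext (θ := (CHom τ).comp ((φ.pullTo hU).comp (c.iso V hV).symm.toAlgHom)) (e := e)
    (L := (CHom τ).toLinearMap.comp (D.comp (c.iso V hV).symm.toAlgHom.toLinearMap))
    ((hD.pre (c.symm_isSuper hV)).post CHom_isSuper)
    (fun N => ⟨_, fun F hF => by rw [ordGE_eq_zero_of_odd (fun _ => rfl) hF, map_zero]; exact zero_mem _⟩)
    (fun u => by
      have := h1 u
      simp only [LinearMap.comp_apply]
      exact (congrArg _ this).trans (map_zero _))
    (fun i => by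
      have := h i.1
      rw [Chart.coord, dif_neg (by simp [i.2])] at this
      simp only [LinearMap.comp_apply]
      exact (congrArg _ this).trans (map_zero _)) (c.iso V hV f)
  have h3 : C τ (D f) = C τ 0 := by
    rw [C_zero, ← h2]
    simp only [LinearMap.comp_apply]
    refine congrArg (C τ) (congrArg D ?_)
    exact ((c.iso V hV).symm_apply_apply f).symm
  exact C_injective h3

end Der
end SuperMorphism

/-! ### Coordinates on graded supermanifolds -/

namespace GradedSupermanifold
open SSer
variable (M : GradedSupermanifold)

/-- The identity morphism. -/
def idMor : SuperMorphism M M where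
  base := ContinuousMap.id _
  pull _ := AlgHom.id ℝ _
  pull_inv _ _ := rfl
  pull_res _ _ := rfl

theorem idMor_pullTo {V : Opens M.pt} (h : V ≤ Opens.comap M.idMor.base V) :
    M.idMor.pullTo h = AlgHom.id ℝ (M.O V) :=
  AlgHom.ext fun f => M.res_refl f

variable {M}

theorem res_isSuper {U V : Opens M.pt} (h : V ≤ U) : IsSuper (M.res h) := fun f => M.res_inv h f

theorem der_ext {n : ℕ} {π : Fin n → Bool} {c : Chart M.toSuperSpace π} {V : Opens M.pt}
    (hV : V ≤ c.dom) {e : Bool} {D D' : M.O V →ₗ[ℝ] M.O V} (hD : IsDer (AlgHom.id ℝ _) e D)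
    (hD' : IsDer (AlgHom.id ℝ _) e D') (h : ∀ i, D (c.coord hV i) = D' (c.coord hV i))
    (f : M.O V) : D f = D' f := by
  have hle : V ≤ Opens.comap M.idMor.base V := fun _ h => h
  have h1 := SuperMorphism.der_eq_zero (φ := M.idMor) (c := c) (hV := hV) (U := V)
    (hU := hle) (e := e) (D := D - D') (by
      rw [idMor_pullTo]
      exact hD.sub hD')
    (fun i => by rw [LinearMap.sub_apply, h, sub_self]) f
  rwa [LinearMap.sub_apply, sub_eq_zero] at h1

/-- The coordinates of a chart. -/
noncomputable def sys {n : ℕ} {π : Fin n → Bool} (c : Chart M.toSuperSpace π) {V : Opens M.pt}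
    (hV : V ≤ c.dom) : CoordSys (M.O V) π where
  y := c.coord hV
  d := c.pdL hV
  y_par := c.coord_par hV
  d_der := c.isDer_pdL hV
  d_y := c.pdL_coord hV
  d_comm i j b := by
    -- The supercommutator is a derivation, and it kills the coordinates because their partial
    -- derivatives are constant.
    have h := ((c.isDer_pdL hV i).comm (c.isDer_pdL hV j))
    have h1 := der_ext hV h IsDer.zero (fun k => by
      simp only [LinearMap.sub_apply, LinearMap.comp_apply, LinearMap.smul_apply, c.pdL_coord hV,
        LinearMap.zero_apply]
      have h2 : ∀ i (p : Prop) [Decidable p], c.pdL hV i (if p then 1 else 0) = 0 := fun i p _ => by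
        split
        · exact (c.isDer_pdL hV i).map_one
        · exact map_zero _
      rw [h2, h2, smul_zero, sub_zero]) b
    simpa [sub_eq_zero] using h1

theorem chainRule {n : ℕ} {π : Fin n → Bool} (c : Chart M.toSuperSpace π)
    (c' : Chart M.toSuperSpace π) {V : Opens M.pt} (hV : V ≤ c.dom) (hV' : V ≤ c'.dom) :
    (sys c hV).ChainRule (sys c' hV') := fun i f => by
  have h := der_ext (D := (sys c hV).d i)
    (D' := ∑ b, (LinearMap.mulLeft ℝ ((sys c hV).d i ((sys c' hV').y b))).comp ((sys c' hV').d b))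
    hV' ((sys c hV).d_der i) (IsDer.sum fun b _ => by
      have := ((sys c' hV').d_der b).mulLeft
        (((sys c hV).d_der i).hasParity ((sys c' hV').y_par b))
      rwa [Bool.xor_assoc, Bool.xor_self, Bool.xor_false] at this) (fun k => by
      change _ = (∑ b, _ : M.O V →ₗ[ℝ] M.O V) ((sys c' hV').y k)
      rw [LinearMap.sum_apply, Finset.sum_eq_single k]
      · rw [LinearMap.comp_apply, (sys c' hV').d_y, if_pos rfl]; exact (mul_one _).symm
      · intro b _ hb
        rw [LinearMap.comp_apply, (sys c' hV').d_y, if_neg hb]; exact mul_zero _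
      · simp) f
  rw [h, LinearMap.sum_apply]; rfl

theorem isDer_euler (U : Opens M.pt) : IsDer (AlgHom.id ℝ _) false (M.euler U) :=
  ⟨fun f g => M.euler_mul U f g, fun f => by rw [M.euler_inv, sgn_false, one_smul]⟩

theorem HasWeight.res {U V : Opens M.pt} (h : V ≤ U) {f : M.O U} {k : ℤ} (hf : M.HasWeight f k) :
    M.HasWeight (M.res h f) k := by
  have h1 : M.euler U f = (k : ℝ) • f := hf
  change M.euler V _ = _
  rw [M.euler_res, h1, map_smul]

theorem euler_coord (c : M.Coord) {V : Opens M.pt} (hV : V ≤ c.dom) (i : Fin M.dim) :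
    M.euler V (c.coord hV i) = (c.wt i : ℝ) • c.coord hV i := by
  have := HasWeight.res hV (c.coord_weight i)
  rw [c.coord_res] at this
  exact this

/-- Both sides are even derivations, and the coordinates of a graded chart are eigenfunctions of the
weight field. -/
theorem euler_eq (c : M.Coord) {V : Opens M.pt} (hV : V ≤ c.dom) (f : M.O V) :
    M.euler V f = ∑ i, (c.wt i : ℝ) • ((sys c.toChart hV).y i * (sys c.toChart hV).d i f) := by
  have h := der_ext (D := M.euler V) (D' := ∑ i, (c.wt i : ℝ) • (LinearMap.mulLeft ℝ
      ((sys c.toChart hV).y i)).comp ((sys c.toChart hV).d i)) hV (isDer_euler V)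
    (IsDer.sum fun i _ => by
      have := (((sys c.toChart hV).d_der i).mulLeft ((sys c.toChart hV).y_par i)).smul (c.wt i : ℝ)
      rwa [Bool.xor_self] at this) (fun k => by
      rw [euler_coord]
      change _ = (∑ b, _ : M.O V →ₗ[ℝ] M.O V) ((sys c.toChart hV).y k)
      rw [LinearMap.sum_apply, Finset.sum_eq_single k]
      · rw [LinearMap.smul_apply, LinearMap.comp_apply, (sys c.toChart hV).d_y, if_pos rfl,
          LinearMap.mulLeft_apply, mul_one]; rfl
      · intro b _ hb
        rw [LinearMap.smul_apply, LinearMap.comp_apply, (sys c.toChart hV).d_y, if_neg hb, map_zero,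
          smul_zero]
      · simp) f
  rw [h, LinearMap.sum_apply]; rfl

/-- The weight condition on all coefficients becomes one eigenvalue equation for an even derivation
of the series algebra, to which the critical value principle can be applied. -/
theorem serHasWeight_iff {U : Opens M.pt} {n : ℕ} {π : Fin n → Bool} (u : Fin n → ℤ)
    (F : SSer (M.O U) π) (k : ℤ) : M.SerHasWeight u F k ↔
      mapL (M.euler U) F + wtL (fun i => (u i : ℝ)) F = (k : ℝ) • F := by
  have h1 : ∀ m, M.HasWeight (coeff m F) (k - ∑ i, (m i : ℤ) * u i) ↔
      coeff m (mapL (M.euler U) F + wtL (fun i => (u i : ℝ)) F) = coeff m ((k : ℝ) • F) := by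
    intro m
    rw [coeff_add, coeff_mapL, coeff_wtL, coeff_smul, ← eq_sub_iff_add_eq, ← sub_smul]
    change _ = _ ↔ _
    push_cast
    rfl
  refine ⟨fun h => SSer.ext fun m _ => (h1 m).1 (h m), fun h m => (h1 m).2 (by rw [h])⟩

theorem sres_eq {U V : Opens M.pt} (h : V ≤ U) {n : ℕ} {π : Fin n → Bool} (F : SSer (M.O U) π) :
    M.sres h F = mapL (M.res h).toLinearMap F := rfl

theorem coeff_sres {U V : Opens M.pt} (h : V ≤ U) {n : ℕ} {π : Fin n → Bool} (F : SSer (M.O U) π)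
    (m : Fin n →₀ ℕ) : coeff m (M.sres h F) = M.res h (coeff m F) :=
  coeff_mapL (M.res h).toLinearMap F m

theorem sres_sres {U V W : Opens M.pt} (h : V ≤ U) (h' : W ≤ V) {n : ℕ} {π : Fin n → Bool}
    (F : SSer (M.O U) π) : M.sres h' (M.sres h F) = M.sres (h'.trans h) F :=
  SSer.ext fun m _ => by rw [coeff_sres, coeff_sres, coeff_sres, M.res_res]

theorem sres_refl {U : Opens M.pt} {n : ℕ} {π : Fin n → Bool} (F : SSer (M.O U) π) :
    M.sres le_rfl F = F :=
  SSer.ext fun m _ => by rw [coeff_sres, M.res_refl]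

/-- Restriction of series as a homomorphism. -/
noncomputable def sresHom {U V : Opens M.pt} (h : V ≤ U) {n : ℕ} (π : Fin n → Bool) :
    SSer (M.O U) π →ₐ[ℝ] SSer (M.O V) π := ren (M.res h) (res_isSuper h) some renPar_some

theorem sresHom_apply {U V : Opens M.pt} (h : V ≤ U) {n : ℕ} {π : Fin n → Bool}
    (F : SSer (M.O U) π) : sresHom h π F = M.sres h F := ren_some _ F

theorem SerHasWeight.sres {U V : Opens M.pt} (h : V ≤ U) {n : ℕ} {π : Fin n → Bool} {u : Fin n → ℤ}
    {F : SSer (M.O U) π} {k : ℤ} (hF : M.SerHasWeight u F k) : M.SerHasWeight u (M.sres h F) k :=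
  fun m => by rw [coeff_sres]; exact HasWeight.res h (hF m)

theorem ser_ext {U : Opens M.pt} {n : ℕ} {π : Fin n → Bool} {F G : SSer (M.O U) π}
    (h : ∀ x ∈ U, ∃ (W : Opens M.pt) (hW : W ≤ U), x ∈ W ∧ M.sres hW F = M.sres hW G) : F = G :=
  SSer.ext fun m _ => M.eq_of_locally_eq _ _ fun x hx => by
    obtain ⟨W, hW, hxW, h⟩ := h x hx
    exact ⟨W, hW, hxW, by rw [← coeff_sres, ← coeff_sres, h]⟩

theorem exists_glue {I : Type} (U : I → Opens M.pt) (hU : ∀ x, ∃ i, x ∈ U i) {n : ℕ}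
    {π : Fin n → Bool} (F : ∀ i, SSer (M.O (U i)) π)
    (h : ∀ i j, M.sres (inf_le_left : U i ⊓ U j ≤ U i) (F i) = M.sres inf_le_right (F j)) :
    ∃ G : SSer M.Fun π, ∀ i, M.sres le_top G = F i := by
  have hle : ⊤ ≤ iSup U := fun x _ => Opens.mem_iSup.2 (hU x)
  have h1 : ∀ m, ∃ g : M.O (iSup U), ∀ i, M.res (le_iSup U i) g = coeff m (F i) := fun m =>
    M.glue U (fun i => coeff m (F i)) fun i j => by rw [← coeff_sres, h, coeff_sres]
  choose g hg using h1
  refine ⟨SSer.mk π fun m => M.res hle (g m), fun i => SSer.ext fun m hm => ?_⟩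
  rw [coeff_sres, coeff_mk hm, M.res_res, hg]

end GradedSupermanifold

/-! ### Thick morphisms in coordinates -/

open SSer GradedSupermanifold

namespace SuperMorphism
variable {M₁ M₂ : GradedSupermanifold} (φ : SuperMorphism M₁ M₂) {n₁ n₂ : ℕ}
  {π₁ : Fin n₁ → Bool} {π₂ : Fin n₂ → Bool} {V : Opens M₂.pt} {U : Opens M₁.pt}

/-- The chain rule for the pullback. -/
theorem pd_pullTo (c₁ : Chart M₁.toSuperSpace π₁) (c₂ : Chart M₂.toSuperSpace π₂)
    (hV : V ≤ c₂.dom) (hU : U ≤ Opens.comap φ.base V) (hU₁ : U ≤ c₁.dom) (a : Fin n₁) (f : M₂.O V) :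
    c₁.pdL hU₁ a (φ.pullTo hU f) = ∑ i, c₁.pdL hU₁ a (φ.pullTo hU (c₂.coord hV i)) *
      φ.pullTo hU (c₂.pdL hV i f) := by
  have h := der_eq_zero (φ := φ) (c := c₂) (hV := hV) (hU := hU) (e := π₁ a)
    (D := (c₁.pdL hU₁ a).comp (φ.pullTo hU).toLinearMap -
      ∑ i, (LinearMap.mulLeft ℝ (c₁.pdL hU₁ a (φ.pullTo hU (c₂.coord hV i)))).comp
        ((φ.pullTo hU).toLinearMap.comp (c₂.pdL hV i)))
    (((c₁.isDer_pdL hU₁ a).pre (φ.pullTo_isSuper hU)).sub (IsDer.sum fun i _ => by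
      have := ((c₂.isDer_pdL hV i).post (φ.pullTo_isSuper hU)).mulLeft
        ((c₁.isDer_pdL hU₁ a).hasParity ((φ.pullTo_isSuper hU).hasParity (c₂.coord_par hV i)))
      rwa [Bool.xor_assoc, Bool.xor_self, Bool.xor_false] at this)) (fun k => by
      rw [LinearMap.sub_apply, LinearMap.sum_apply, Finset.sum_eq_single k]
      · simp only [LinearMap.comp_apply, c₂.pdL_coord, if_pos, AlgHom.toLinearMap_apply, map_one,
          LinearMap.mulLeft_apply, mul_one, sub_self]
      · intro b _ hb
        simp only [LinearMap.comp_apply, c₂.pdL_coord, if_neg hb, map_zero]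
      · simp) f
  rw [LinearMap.sub_apply, sub_eq_zero, LinearMap.sum_apply] at h
  exact h

theorem euler_pullTo (c₂ : M₂.Coord) (hV : V ≤ c₂.dom) (hU : U ≤ Opens.comap φ.base V)
    (h : ∀ i, M₁.HasWeight (φ.pullTo hU (c₂.coord hV i)) (c₂.wt i)) (f : M₂.O V) :
    M₁.euler U (φ.pullTo hU f) = φ.pullTo hU (M₂.euler V f) := by
  have h1 := der_eq_zero (φ := φ) (c := c₂.toChart) (hV := hV) (hU := hU) (e := false)
    (D := (M₁.euler U).comp (φ.pullTo hU).toLinearMap -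
      (φ.pullTo hU).toLinearMap.comp (M₂.euler V))
    (((isDer_euler U).pre (φ.pullTo_isSuper hU)).sub ((isDer_euler V).post (φ.pullTo_isSuper hU)))
    (fun k => by
      have h2 : M₁.euler U (φ.pullTo hU (c₂.coord hV k)) = _ := h k
      simp only [LinearMap.sub_apply, LinearMap.comp_apply, AlgHom.toLinearMap_apply, h2,
        euler_coord, map_smul, sub_self]) f
  rwa [LinearMap.sub_apply, sub_eq_zero] at h1

theorem resCompat (c : Chart M₂.toSuperSpace π₂) {V' : Opens M₂.pt} {U' : Opens M₁.pt}
    (hV : V ≤ c.dom) (hV' : V' ≤ V) (hU : U ≤ Opens.comap φ.base V) (hU' : U' ≤ U)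
    (h : U' ≤ Opens.comap φ.base V') :
    ResCompat (sys c hV) (sys c (hV'.trans hV)) (φ.pullTo hU) (φ.pullTo h) (M₁.res hU')
      (M₂.res hV') :=
  ⟨res_isSuper hU', res_isSuper hV', fun i x => c.pdL_res hV hV' i x, fun i => c.coord_res hV hV' i,
    fun x => by rw [res_pullTo, pullTo_res]⟩

theorem taylor_eq (c : M₂.Coord) (hV : V ≤ c.dom) (hU : U ≤ Opens.comap φ.base V) {r : ℕ}
    {τ : Fin r → Bool} (Y : Fin M₂.dim → SSer (M₁.O U) τ) :
    taylor φ c hV hU Y = tay (sys c.toChart hV) (φ.pullTo hU) Y := by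
  funext f
  rw [taylor, tay]
  congr 1
  funext N
  rw [← tayN_eq_sum_words]
  have : (fun i g => c.pd hV i g) = fun i g => (sys c.toChart hV).d i g :=
    funext fun i => funext fun g => (c.pdL_apply hV i g).symm
  rw [this]
  rfl

end SuperMorphism

theorem yOf_eq {M₁ M₂ : GradedSupermanifold} {U : Opens M₁.pt} (S : SSer (M₁.O U) M₂.par) :
    yOf S = yo S := by
  funext i
  rw [yOf, yo, neg_one_pow_ite]

theorem map_pd_eq {M : GradedSupermanifold} (c : M.Coord) {V : Opens M.pt} (hV : V ≤ c.dom) {r : ℕ}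
    {τ : Fin r → Bool} (i : Fin M.dim) (g : SSer (M.O V) τ) :
    SSer.map (c.pd hV i) g = mapL ((sys c.toChart hV).d i) g := by
  have : c.pd hV i = c.pdL hV i := funext fun f => (c.pdL_apply hV i f).symm
  rw [this]; rfl

theorem sres_mapL_d {M : GradedSupermanifold} (c : M.Coord) {V V' : Opens M.pt} (hV : V ≤ c.dom)
    (h : V' ≤ V) {r : ℕ} {τ : Fin r → Bool} (i : Fin M.dim) (g : SSer (M.O V) τ) :
    M.sres h (mapL ((sys c.toChart hV).d i) g) =
      mapL ((sys c.toChart (h.trans hV)).d i) (M.sres h g) :=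
  SSer.ext fun m _ => by
    rw [coeff_sres, coeff_mapL, coeff_mapL, coeff_sres]; exact c.pdL_res hV h i _

namespace ThickMorphism
variable {M₁ M₂ : GradedSupermanifold} {s : ℤ} (Φ : ThickMorphism M₁ M₂ s)

theorem isThick (c : M₂.Coord) {V : Opens M₂.pt} {U : Opens M₁.pt} (hV : V ≤ c.dom)
    (hU : U ≤ Opens.comap Φ.φ.base V) :
    IsThick (sys c.toChart hV) (Φ.φ.pullTo hU)
      (M₁.sres (hU.trans (Opens.comap_mono Φ.φ.base hV)) (Φ.S c)) := by
  refine ⟨?_, fun i => ?_⟩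
  · rw [← sresHom_apply]
    exact (ren_isSuper _ _).hasParity (isEven_iff.1 (Φ.even c))
  · rw [coeff_sres, Φ.support]
    refine Eq.trans ?_ (congrArg (Φ.φ.pullTo hU) (c.coord_res le_rfl hV i))
    rw [Φ.φ.pullTo_res]; rfl

/-- The support need not be assumed to preserve weights: `S` has weight `s` and `q_i` has weight `s
- w(y^i)`, so the linear coefficient `φ^* y^i` has weight `w(y^i)`. -/
theorem coord_weight (c : M₂.Coord) {V : Opens M₂.pt} {U : Opens M₁.pt} (hV : V ≤ c.dom)
    (hU : U ≤ Opens.comap Φ.φ.base V) (i : Fin M₂.dim) :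
    M₁.HasWeight (Φ.φ.pullTo hU (c.coord hV i)) (c.wt i) := by
  have h := HasWeight.res (hU.trans (Opens.comap_mono Φ.φ.base hV))
    (Φ.weight c (Finsupp.single i 1))
  rw [Φ.support] at h
  have h1 : s - ∑ j, ((Finsupp.single i 1 : Fin M₂.dim →₀ ℕ) j : ℤ) * (s - c.wt j) = c.wt i := by
    rw [Finset.sum_eq_single i]
    · simp
    · intro j _ hj; simp [Finsupp.single_eq_of_ne hj]
    · simp
  rw [h1] at h
  have h2 : Φ.φ.pullTo hU (c.coord hV i) = M₁.res (hU.trans (Opens.comap_mono Φ.φ.base hV))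
      (Φ.φ.pull c.dom (c.coord le_rfl i)) := by
    rw [← c.coord_res le_rfl hV, Φ.φ.pullTo_res]; rfl
  rwa [h2]

/-- The functions `y`, `q` that define the pullback of `g`, on `U`. -/
abbrev IsSolAt (c : M₂.Coord) {V : Opens M₂.pt} {U : Opens M₁.pt} (hV : V ≤ c.dom)
    (hU : U ≤ Opens.comap Φ.φ.base V) {r : ℕ} {τ : Fin r → Bool} (g : SSer M₂.Fun τ)
    (y q : Fin M₂.dim → SSer (M₁.O U) τ) : Prop :=
  IsGoodSol (sys c.toChart hV) (Φ.φ.pullTo hU)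
    (M₁.sres (hU.trans (Opens.comap_mono Φ.φ.base hV)) (Φ.S c)) (M₂.sres le_top g) y q

/-- The value of the pullback of `g`, on `U`. -/
noncomputable abbrev valAt (c : M₂.Coord) {V : Opens M₂.pt} {U : Opens M₁.pt} (hV : V ≤ c.dom)
    (hU : U ≤ Opens.comap Φ.φ.base V) {r : ℕ} {τ : Fin r → Bool} (g : SSer M₂.Fun τ)
    (y q : Fin M₂.dim → SSer (M₁.O U) τ) : SSer (M₁.O U) τ :=
  pval (sys c.toChart hV) (Φ.φ.pullTo hU)
    (M₁.sres (hU.trans (Opens.comap_mono Φ.φ.base hV)) (Φ.S c)) (M₂.sres le_top g) y q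

variable {Φ}
variable {c c' : M₂.Coord} {V V' : Opens M₂.pt} {U U' : Opens M₁.pt} {hV : V ≤ c.dom}
  {hU : U ≤ Opens.comap Φ.φ.base V} {r : ℕ} {τ : Fin r → Bool} {g : SSer M₂.Fun τ}
  {y q : Fin M₂.dim → SSer (M₁.O U) τ}

theorem sres_par (hg : IsFormalPoint g) : HasParity false (M₂.sres (le_top : V ≤ ⊤) g) := by
  rw [← sresHom_apply]; exact (ren_isSuper _ _).hasParity (isEven_iff.1 hg.1)

theorem coeff_zero_sres (hg : IsFormalPoint g) : coeff 0 (M₂.sres (le_top : V ≤ ⊤) g) = 0 := by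
  rw [coeff_sres, hg.2, map_zero]

theorem exists_isSolAt (Φ : ThickMorphism M₁ M₂ s) (c : M₂.Coord) (hV : V ≤ c.dom)
    (hU : U ≤ Opens.comap Φ.φ.base V) (hg : IsFormalPoint g) : ∃ y q, Φ.IsSolAt c hV hU g y q := by
  obtain ⟨y, q, h, -⟩ := exists_isSol (Φ.φ.pullTo_isSuper hU) (Φ.isThick c hV hU)
    (coeff_zero_sres hg) (sres_par hg)
  exact ⟨y, q, h.good (Φ.φ.pullTo_isSuper hU) (Φ.isThick c hV hU) (coeff_zero_sres hg) (sres_par hg)⟩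

/-- Restriction of solutions. -/
theorem IsSolAt.res (h : Φ.IsSolAt c hV hU g y q) (hV' : V' ≤ V) (hU' : U' ≤ U)
    (hUV : U' ≤ Opens.comap Φ.φ.base V') :
    Φ.IsSolAt c (hV'.trans hV) hUV g (fun i => M₁.sres hU' (y i)) (fun i => M₁.sres hU' (q i)) ∧
    Φ.valAt c (hV'.trans hV) hUV g (fun i => M₁.sres hU' (y i)) (fun i => M₁.sres hU' (q i)) =
      M₁.sres hU' (Φ.valAt c hV hU g y q) := by
  have h1 := IsGoodSol.ren (Φ.φ.resCompat c.toChart hV hV' hU hU' hUV) renPar_some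
    (Φ.φ.pullTo_isSuper hU) (Φ.φ.pullTo_isSuper hUV) h
  simp only [ren_some] at h1
  have h2 : ∀ {n : ℕ} {π : Fin n → Bool} (F : SSer (M₁.O U) π),
      mapHom (M₁.res hU') (res_isSuper hU') π F = M₁.sres hU' F := fun F => rfl
  have h3 : ∀ {n : ℕ} {π : Fin n → Bool} (F : SSer (M₂.O V) π),
      mapHom (M₂.res hV') (res_isSuper hV') π F = M₂.sres hV' F := fun F => rfl
  simp only [h2, h3, sres_sres, ← sres_eq] at h1
  exact h1

theorem thickChange (Φ : ThickMorphism M₁ M₂ s) (c c' : M₂.Coord) :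
    ThickChange (sys c.toChart (V := c.dom ⊓ c'.dom) inf_le_left) (sys c'.toChart inf_le_right)
      (Φ.φ.pullTo le_rfl) (M₁.sres (Opens.comap_mono Φ.φ.base inf_le_left) (Φ.S c))
      (M₁.sres (Opens.comap_mono Φ.φ.base inf_le_right) (Φ.S c')) := by
  have h := Φ.change c c'
  simp only [Φ.φ.taylor_eq, yOf_eq, ← Chart.pdL_apply] at h
  exact h

theorem IsSolAt.change {c c' : M₂.Coord} {g : SSer M₂.Fun τ} (hg : IsFormalPoint g)
    {y q y' q' : Fin M₂.dim → SSer (M₁.O (Opens.comap Φ.φ.base (c.dom ⊓ c'.dom))) τ}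
    (h : Φ.IsSolAt c (V := c.dom ⊓ c'.dom) inf_le_left le_rfl g y q)
    (h' : Φ.IsSolAt c' (V := c.dom ⊓ c'.dom) inf_le_right le_rfl g y' q') :
    (∀ f, tay (sys c'.toChart (V := c.dom ⊓ c'.dom) inf_le_right) (Φ.φ.pullTo le_rfl) y' f =
      tay (sys c.toChart inf_le_left) (Φ.φ.pullTo le_rfl) y f) ∧
    Φ.valAt c' (V := c.dom ⊓ c'.dom) inf_le_right le_rfl g y' q' =
      Φ.valAt c (V := c.dom ⊓ c'.dom) inf_le_left le_rfl g y q := by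
  obtain ⟨y₁, q₁, h₁, h2, h3⟩ := IsGoodSol.change (Φ.φ.pullTo_isSuper _)
    (Φ.isThick c (V := c.dom ⊓ c'.dom) inf_le_left le_rfl)
    (Φ.isThick c' (V := c.dom ⊓ c'.dom) inf_le_right le_rfl) (chainRule _ _ _ _)
    (chainRule _ _ _ _) (Φ.thickChange c c') h
  obtain ⟨rfl, rfl⟩ := IsSol.unique (coeff_zero_sres hg) h₁ h'.toIsSol
  exact ⟨h2, h3⟩

/-- The definition of the pullback does not ask for parities or vanishing constant terms of `y` and
`q`; for a formal point these hold automatically by `IsSol.good`. -/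
theorem isPullback_iff (hg : IsFormalPoint g) {f : SSer M₁.Fun τ} :
    Φ.IsPullback g f ↔ ∀ c : M₂.Coord, ∃ y q, Φ.IsSolAt c le_rfl le_rfl g y q ∧
      M₁.sres le_top f = Φ.valAt c le_rfl le_rfl g y q := by
  refine forall_congr' fun c => exists_congr fun y => exists_congr fun q => ?_
  simp only [Φ.φ.taylor_eq, yOf_eq, map_pd_eq]
  have hS : M₁.sres (le_refl (Opens.comap Φ.φ.base c.dom)) (Φ.S c) = Φ.S c := sres_refl _
  have h1 := Φ.isThick c le_rfl le_rfl
  constructor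
  · rintro ⟨h2, h3, h4⟩
    have h5 : IsSol (sys c.toChart le_rfl) (Φ.φ.pullTo le_rfl)
      (M₁.sres (le_refl (Opens.comap Φ.φ.base c.dom)) (Φ.S c)) (M₂.sres le_top g) y q := by
      rw [hS]; exact ⟨h2, h3⟩
    refine ⟨h5.good (Φ.φ.pullTo_isSuper _) h1 (coeff_zero_sres hg) (sres_par hg), ?_⟩
    rw [h4, valAt, hS]; rfl
  · rintro ⟨h2, h3⟩
    have h4 := h2.toIsSol
    rw [hS] at h4
    refine ⟨h4.hy, h4.hq, ?_⟩
    rw [h3, valAt, hS]; rfl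

/-- The values of the pullback on open subsets. -/
theorem IsPullback.valAt (hg : IsFormalPoint g) {f : SSer M₁.Fun τ} (hf : Φ.IsPullback g f)
    (h : Φ.IsSolAt c hV hU g y q) : M₁.sres le_top f = Φ.valAt c hV hU g y q := by
  obtain ⟨y', q', h', h2⟩ := (isPullback_iff hg).1 hf c
  obtain ⟨h3, h4⟩ := h'.res hV (hU.trans (Opens.comap_mono Φ.φ.base hV)) hU
  obtain ⟨rfl, rfl⟩ := IsSol.unique (coeff_zero_sres hg) h.toIsSol h3.toIsSol
  rw [h4, ← h2, sres_sres]

theorem mem_cover (Φ : ThickMorphism M₁ M₂ s) (x : M₁.pt) :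
    ∃ c : M₂.Coord, x ∈ Opens.comap Φ.φ.base c.dom := M₂.exists_chart (Φ.φ.base x)

theorem ser_ext_cover (Φ : ThickMorphism M₁ M₂ s) {F G : SSer M₁.Fun τ}
    (h : ∀ c : M₂.Coord, M₁.sres (le_top : Opens.comap Φ.φ.base c.dom ≤ ⊤) F = M₁.sres le_top G) :
    F = G :=
  ser_ext fun x _ => by
    obtain ⟨c, hc⟩ := Φ.mem_cover x
    exact ⟨_, le_top, hc, h c⟩

/-- The values from two charts are compared over the overlap: both solutions are restricted to it,
and the change of coordinates carries one to the other by uniqueness. -/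
theorem exists_isPullback (Φ : ThickMorphism M₁ M₂ s) (hg : IsFormalPoint g) :
    ∃ f, Φ.IsPullback g f := by
  have h1 := fun c : M₂.Coord => exists_isSolAt Φ c le_rfl le_rfl hg
  choose y q h using h1
  obtain ⟨f, hf⟩ := exists_glue (fun c : M₂.Coord => Opens.comap Φ.φ.base c.dom) Φ.mem_cover
    (fun c => Φ.valAt c le_rfl le_rfl g (y c) (q c)) fun c c' => by
      obtain ⟨h3, h4⟩ := (h c).res (V' := c.dom ⊓ c'.dom) inf_le_left
        (Opens.comap_mono Φ.φ.base inf_le_left) le_rfl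
      obtain ⟨h3', h4'⟩ := (h c').res (V' := c.dom ⊓ c'.dom) inf_le_right
        (Opens.comap_mono Φ.φ.base inf_le_right) le_rfl
      have h5 := (h3.change hg h3').2
      rw [h4, h4'] at h5
      exact h5.symm
  exact ⟨f, (isPullback_iff hg).2 fun c => ⟨y c, q c, h c, hf c⟩⟩

theorem IsPullback.unique (hg : IsFormalPoint g) {f f' : SSer M₁.Fun τ} (hf : Φ.IsPullback g f)
    (hf' : Φ.IsPullback g f') : f = f' :=
  Φ.ser_ext_cover fun c => by
    obtain ⟨y, q, h⟩ := exists_isSolAt Φ c le_rfl le_rfl hg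
    rw [hf.valAt hg h, hf'.valAt hg h]

theorem IsPullback.even (hg : IsFormalPoint g) {f : SSer M₁.Fun τ} (hf : Φ.IsPullback g f) :
    HasParity false f := by
  change SuperAlgebra.inv f = f
  refine Φ.ser_ext_cover fun c => ?_
  obtain ⟨y, q, h⟩ := exists_isSolAt Φ c le_rfl le_rfl hg
  have h1 := h.pval_par (Φ.φ.pullTo_isSuper _) (Φ.isThick c le_rfl le_rfl) (sres_par hg)
  rw [← sresHom_apply, sresHom, ren_isSuper, ← sresHom, sresHom_apply, hf.valAt hg h]
  exact h1

theorem IsPullback.weight (hg : IsFormalPoint g) {f : SSer M₁.Fun τ} (hf : Φ.IsPullback g f)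
    {u : Fin r → ℤ} (hu : M₂.SerHasWeight u g s) : M₁.SerHasWeight u f s := by
  rw [serHasWeight_iff]
  refine Φ.ser_ext_cover fun c => ?_
  obtain ⟨y, q, h⟩ := exists_isSolAt Φ c le_rfl le_rfl hg
  have h1 := h.pval_weight (Φ.φ.pullTo_isSuper _) (Φ.isThick c le_rfl le_rfl) (isDer_euler _)
    (Φ.φ.euler_pullTo c le_rfl le_rfl (Φ.coord_weight c le_rfl le_rfl))
    (w := fun i => (c.wt i : ℝ)) (euler_eq c le_rfl) (u := fun i => (u i : ℝ)) (s := (s : ℝ))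
    ((serHasWeight_iff u _ s).1 (SerHasWeight.sres le_top hu)) (by
      have := (serHasWeight_iff _ _ s).1 (SerHasWeight.sres le_rfl (Φ.weight c))
      simpa using this)
  have h2 : _ = pval _ _ _ _ y q := hf.valAt hg h
  rw [← h2] at h1
  have h3 : M₁.sres le_top (mapL (M₁.euler ⊤) f) =
      mapL (M₁.euler _) (M₁.sres (le_top : Opens.comap Φ.φ.base c.dom ≤ ⊤) f) :=
    SSer.ext fun m _ => by
      rw [coeff_sres, coeff_mapL, coeff_mapL, coeff_sres, M₁.euler_res]
  have h4 : M₁.sres le_top (wtL (fun i => (u i : ℝ)) f) =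
      wtL (fun i => (u i : ℝ)) (M₁.sres (le_top : Opens.comap Φ.φ.base c.dom ≤ ⊤) f) :=
    SSer.ext fun m _ => by
      rw [coeff_sres, coeff_wtL, coeff_wtL, coeff_sres, map_smul]
  rw [sres_eq, map_add, ← sres_eq, ← sres_eq, h3, h4, h1, sres_eq, sres_eq, map_smul]

theorem pullbackWellDefined (Φ : ThickMorphism M₁ M₂ s) : Φ.PullbackWellDefined :=
  fun r τ g hg => by
    obtain ⟨f, hf⟩ := exists_isPullback Φ hg
    exact ⟨f, hf, fun f' hf' => hf'.unique hg hf, isEven_iff.2 (hf.even hg),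
      fun u hu => hf.weight hg hu⟩

end ThickMorphism

/-! ### Formal maps as functors of formal points -/

namespace SSer

section Ren
variable {A : Type*} [Ring A] [Algebra ℝ A] [SuperAlgebra A] {r r' r'' : ℕ} {τ : Fin r → Bool}
  {τ' : Fin r' → Bool} {τ'' : Fin r'' → Bool}

/-- The change of parameters. -/
noncomputable def renP (A : Type*) [Ring A] [Algebra ℝ A] [SuperAlgebra A]
    (e : Fin r → Option (Fin r')) (he : RenPar τ τ' e) : SSer A τ →ₐ[ℝ] SSer A τ' :=
  ren (AlgHom.id ℝ A) IsSuper.id e he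

variable {e : Fin r → Option (Fin r')} (he : RenPar τ τ' e)

theorem renP_C (x : A) : renP A e he (C τ x) = C τ' x := ren_C _ _ _
theorem renP_X (j : Fin r) : renP A e he (X A τ j) = renX A τ' e j := ren_X _ _ _
theorem renP_isSuper : IsSuper (renP A e he) := ren_isSuper _ _
theorem coeff_zero_renP (F : SSer A τ) : coeff 0 (renP A e he F) = coeff 0 F := coeff_zero_ren _ _ F
theorem cont_renP : Cont (renP A e he).toLinearMap := cont_ren _ _

theorem renP_ext {θ : SSer A τ →ₐ[ℝ] SSer A τ'} (hc : Cont θ.toLinearMap)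
    (hC : ∀ a, θ (C τ a) = C τ' a) (hX : ∀ j, θ (X A τ j) = renX A τ' e j) (F : SSer A τ) :
    renP A e he F = θ F :=
  hom_ext (cont_renP he) hc (fun a => by rw [renP_C, hC]) (fun j => by rw [renP_X, hX]) F

theorem renP_comp {e' : Fin r' → Option (Fin r'')} (he' : RenPar τ' τ'' e')
    (h : RenPar τ τ'' fun j => (e j).bind e') (F : SSer A τ) :
    renP A e' he' (renP A e he F) = renP A (fun j => (e j).bind e') h F := by
  refine (renP_ext h (θ := (renP A e' he').comp (renP A e he)) ?_ (fun a => ?_) (fun j => ?_) F).symm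
  · rw [AlgHom.comp_toLinearMap]; exact (cont_renP he').comp (cont_renP he)
  · rw [AlgHom.comp_apply, renP_C, renP_C]
  · rw [AlgHom.comp_apply, renP_X, renX, renX]
    cases e j with
    | none => exact map_zero _
    | some k => exact renP_X he' k

theorem renP_some (F : SSer A τ) : renP A some renPar_some F = F :=
  renP_ext renPar_some (θ := AlgHom.id ℝ _) (fun N => ⟨N, fun _ h => h⟩) (fun _ => rfl)
    (fun _ => rfl) F

theorem renP_congr {e e' : Fin r → Option (Fin r')} (h : e = e') (he : RenPar τ τ' e)
    (he' : RenPar τ τ' e') (F : SSer A τ) : renP A e he F = renP A e' he' F := by subst h; rfl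

theorem deriv_renP_eq_zero {e : Fin r → Option (Fin r')} (he : RenPar τ τ' e) {k : Fin r'}
    (h : ∀ j, e j ≠ some k) (F : SSer A τ) : deriv k (renP A e he F) = 0 :=
  SSer.der_ext (θ := renP A e he) (L := (derivL k).comp (renP A e he).toLinearMap)
    ((isDer_derivL k).pre (renP_isSuper he)) ((cont_derivL k).comp (cont_renP he))
    (fun a => by
      rw [LinearMap.comp_apply, AlgHom.toLinearMap_apply, renP_C, derivL_apply, deriv_C])
    (fun i => by
      rw [LinearMap.comp_apply, AlgHom.toLinearMap_apply, renP_X, renX]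
      cases hi : e i with
      | none => exact map_zero _
      | some l =>
        refine (deriv_X k l).trans (if_neg ?_)
        rintro rfl
        exact h i hi) F

open Classical in
/-- The parameters in `K` are set to zero. -/
noncomputable def killE (K : Finset (Fin r)) (j : Fin r) : Option (Fin r) :=
  if j ∈ K then none else some j

theorem renPar_killE (K : Finset (Fin r)) : RenPar τ τ (killE K) := fun j k h => by
  rw [killE] at h
  split at h
  · cases h
  · rw [Option.some.inj h]

/-- The substitution of zero for the parameters in `K`. -/
noncomputable def kill (A : Type*) [Ring A] [Algebra ℝ A] [SuperAlgebra A] (τ : Fin r → Bool)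
    (K : Finset (Fin r)) : SSer A τ →ₐ[ℝ] SSer A τ := renP A (killE K) (renPar_killE K)

theorem kill_mono (K : Finset (Fin r)) (m : Fin r →₀ ℕ) :
    kill A τ K (mono A τ m) = if ∀ s ∈ K, m s = 0 then mono A τ m else 0 := by
  rw [← zpow_X, map_zpow, zpow, zpow]
  split
  · next h =>
    congr 2
    funext j
    rw [kill, renP_X, renX, killE]
    split
    · next hj => rw [h j hj, pow_zero, pow_zero]
    · rfl
  · next h =>
    push Not at h
    obtain ⟨s, hs, h⟩ := h
    refine List.prod_eq_zero (List.mem_ofFn.2 ⟨s, ?_⟩)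
    rw [kill, renP_X, renX, killE, if_pos hs]
    exact zero_pow h

theorem coeff_kill (K : Finset (Fin r)) (F : SSer A τ) (m : Fin r →₀ ℕ) :
    coeff m (kill A τ K F) = if ∀ s ∈ K, m s = 0 then coeff m F else 0 := by
  let L : SSer A τ →ₗ[ℝ] SSer A τ :=
    { toFun := fun F => SSer.mk τ fun m => if ∀ s ∈ K, m s = 0 then coeff m F else 0
      map_add' := fun F G => SSer.ext fun m hm => by
        rw [coeff_add, coeff_mk hm, coeff_mk hm, coeff_mk hm, coeff_add]; split <;> simp
      map_smul' := fun c F => SSer.ext fun m hm => by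
        rw [RingHom.id_apply, coeff_smul, coeff_mk hm, coeff_mk hm, coeff_smul]; split <;> simp }
  have hL : ∀ F m, coeff m (L F) = if ∀ s ∈ K, m s = 0 then coeff m F else 0 := fun F m => by
    by_cases hm : Adm τ m
    · exact coeff_mk hm _
    · rw [coeff_of_not_adm hm, coeff_of_not_adm hm]; simp
  have h := linear_ext (L := (kill A τ K).toLinearMap - L) ((cont_renP _).sub (Cont.of_ord
    fun N F hF m hm => by rw [hL, hF m hm]; simp)) (fun a m hm => by
      rw [LinearMap.sub_apply, sub_eq_zero, AlgHom.toLinearMap_apply, map_mul, kill_mono,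
        kill, renP_C]
      refine SSer.ext fun k hk => ?_
      classical
      rw [hL, coeff_C_mul_mono hk]
      by_cases hkm : k = m
      · subst hkm
        split
        · rw [coeff_C_mul_mono hk]
        · rw [mul_zero, coeff_zero]
      · rw [if_neg hkm, ite_self]
        split
        · rw [coeff_C_mul_mono hk, if_neg hkm]
        · rw [mul_zero, coeff_zero]) F
  rw [LinearMap.sub_apply, sub_eq_zero, AlgHom.toLinearMap_apply] at h
  rw [h, hL]

/-- The Taylor expansion in an odd variable, which stops after degree one. -/
theorem kill_add_X_mul_deriv {s : Fin r} (hs : τ s = true) (F : SSer A τ) :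
    kill A τ {s} F + X A τ s * deriv s F = F := by
  have h1 : X A τ s * deriv s F = wtL (fun i => if i = s then (1 : ℝ) else 0) F := by
    rw [wtL_eq_sum, Finset.sum_eq_single s]
    · rw [if_pos rfl, one_smul]
    · intro i _ hi; rw [if_neg hi, zero_smul]
    · simp
  rw [h1]
  refine SSer.ext fun m hm => ?_
  rw [coeff_add, coeff_kill, coeff_wtL]
  have h2 : ∑ i, (m i : ℝ) * (if i = s then (1 : ℝ) else 0) = m s := by simp
  rw [h2]
  simp only [Finset.mem_singleton, forall_eq]
  rcases Nat.le_one_iff_eq_zero_or_eq_one.1 (hm s hs) with h | h <;> simp [h]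

theorem X_mul_kill {s : Fin r} (hs : τ s = true) (F : SSer A τ) :
    X A τ s * kill A τ {s} F = X A τ s * F := by
  conv_rhs => rw [← kill_add_X_mul_deriv hs F, mul_add, ← mul_assoc,
    (hs ▸ hasParity_X s : HasParity true (X A τ s)).sq_odd, zero_mul, add_zero]

end Ren

/-- A formal point: an even element which vanishes if the parameters are zero. -/
def IsFP {V : Type*} [Ring V] [Algebra ℝ V] [SuperAlgebra V] {r : ℕ} {τ : Fin r → Bool}
    (g : SSer V τ) : Prop := HasParity false g ∧ coeff 0 g = 0

theorem IsFP.renP {V : Type*} [Ring V] [Algebra ℝ V] [SuperAlgebra V] {r r' : ℕ} {τ : Fin r → Bool}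
    {τ' : Fin r' → Bool} {g : SSer V τ} (hg : IsFP g) {e : Fin r → Option (Fin r')}
    (he : RenPar τ τ' e) : IsFP (renP V e he g) :=
  ⟨(renP_isSuper he).hasParity hg.1, by rw [coeff_zero_renP, hg.2]⟩

end SSer

open SSer

/-- A formal map of parity `e` (an odd one being an odd vector field), given by its values on
formal points and by its derivatives. -/
structure FormalMap (V W : Type) [Ring V] [Algebra ℝ V] [SuperAlgebra V] [Ring W] [Algebra ℝ W]
    [SuperAlgebra W] (e : Bool) where
  val : ∀ {r : ℕ} {τ : Fin r → Bool}, SSer V τ → SSer W τ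
  dir : ∀ {r : ℕ} {τ : Fin r → Bool}, SSer V τ → SSer V τ →ₗ[ℝ] SSer W τ
  val_par : ∀ {r : ℕ} {τ : Fin r → Bool} {g : SSer V τ}, IsFP g → HasParity e (val g)
  val_deriv : ∀ {r : ℕ} {τ : Fin r → Bool} {g : SSer V τ}, IsFP g → ∀ j,
    deriv j (val g) = dir g (deriv j g)
  dir_par : ∀ {r : ℕ} {τ : Fin r → Bool} {g : SSer V τ}, IsFP g → ∀ {f : Bool} {h : SSer V τ},
    HasParity f h → HasParity (f ^^ e) (dir g h)
  dir_X : ∀ {r : ℕ} {τ : Fin r → Bool} {g : SSer V τ}, IsFP g → ∀ (h : SSer V τ) j,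
    dir g (h * X V τ j) = sgn (e && τ j) • (dir g h * X W τ j)
  dir_ord : ∀ {r : ℕ} {τ : Fin r → Bool} {g : SSer V τ}, IsFP g → ∀ N, ∀ h ∈ ordGE V τ N,
    dir g h ∈ ordGE W τ N
  val_ren : ∀ {r r' : ℕ} {τ : Fin r → Bool} {τ' : Fin r' → Bool} {g : SSer V τ}, IsFP g →
    ∀ {e : Fin r → Option (Fin r')} (he : RenPar τ τ' e),
    renP W e he (val g) = val (renP V e he g)
  dir_ren : ∀ {r r' : ℕ} {τ : Fin r → Bool} {τ' : Fin r' → Bool} {g : SSer V τ}, IsFP g →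
    ∀ {e : Fin r → Option (Fin r')} (he : RenPar τ τ' e) (h : SSer V τ),
    renP W e he (dir g h) = dir (renP V e he g) (renP V e he h)

namespace FormalMap
variable {V W : Type} [Ring V] [Algebra ℝ V] [SuperAlgebra V] [Ring W] [Algebra ℝ W]
    [SuperAlgebra W]

theorem isFP_add_mul_X {r : ℕ} {τ : Fin r → Bool} {g h : SSer V τ} (hg : IsFP g)
    (hh : HasParity true h) {ε : Fin r} (hε : τ ε = true) : IsFP (g + h * X V τ ε) :=
  ⟨hg.1.add (hh.mul (hε ▸ hasParity_X ε : HasParity true (X V τ ε))), by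
    rw [coeff_add, hg.2, coeff_zero_mul, coeff_zero_X, mul_zero, add_zero]⟩

/-- The first order expansion of a formal map. -/
theorem val_add_mul_X (Φ : FormalMap V W false) {r : ℕ} {τ : Fin r → Bool} {g h : SSer V τ}
    (hg : IsFP g) (hh : HasParity true h) {ε : Fin r} (hε : τ ε = true) :
    Φ.val (g + h * X V τ ε) = Φ.val g + Φ.dir g h * X W τ ε := by
  -- Since `g` and `h` may themselves depend on `ε`, a new odd parameter `t` is placed at index `0`
  -- and `g + h t` is considered. `ι` includes the old parameters, `θ` sets `t = 0`, and `ρ` sets `t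
  -- = ε`.
  let τ' : Fin (r + 1) → Bool := Fin.cons true τ
  let ι : Fin r → Option (Fin (r + 1)) := fun j => some j.succ
  let θ : Fin (r + 1) → Option (Fin r) := Fin.cons none some
  let ρ : Fin (r + 1) → Option (Fin r) := Fin.cons (some ε) some
  have hι : RenPar τ τ' ι := fun j k h => by rw [← Option.some.inj h]; rfl
  have hθ : RenPar τ' τ θ := fun j k h => by
    cases j using Fin.cases with
    | zero => cases h
    | succ j => rw [← Option.some.inj h]; rfl
  have hρ : RenPar τ' τ ρ := fun j k h => by
    cases j using Fin.cases with
    | zero => rw [← Option.some.inj h]; exact hε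
    | succ j => rw [← Option.some.inj h]; rfl
  have hθι : ∀ {B : Type _} [Ring B] [Algebra ℝ B] [SuperAlgebra B] (F : SSer B τ),
      renP B θ hθ (renP B ι hι F) = F := fun F =>
    (renP_comp hι hθ (renPar_some) F).trans (renP_some F)
  have hρι : ∀ {B : Type _} [Ring B] [Algebra ℝ B] [SuperAlgebra B] (F : SSer B τ),
      renP B ρ hρ (renP B ι hι F) = F := fun F =>
    (renP_comp hι hρ (renPar_some) F).trans (renP_some F)
  have hk : (fun j => (θ j).bind ι) = killE (r := r + 1) {0} := by
    funext j
    cases j using Fin.cases with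
    | zero => rw [killE, if_pos (Finset.mem_singleton_self _)]; rfl
    | succ j => rw [killE, if_neg (by simp)]; rfl
  have hkill : ∀ {B : Type _} [Ring B] [Algebra ℝ B] [SuperAlgebra B] (F : SSer B τ'),
      kill B τ' {0} F = renP B ι hι (renP B θ hθ F) := fun {B} _ _ _ F => by
    have h3 : RenPar τ' τ' fun j => (θ j).bind ι := by rw [hk]; exact renPar_killE {0}
    rw [renP_comp hθ hι h3]
    exact renP_congr hk.symm _ _ F
  have h0 : τ' 0 = true := rfl
  have hh' := (renP_isSuper hι).hasParity hh
  have hgt := isFP_add_mul_X (hg.renP hι) hh' h0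
  set gt := renP V ι hι g + renP V ι hι h * X V τ' 0 with hgt'
  have hθg : renP V θ hθ gt = g := by
    rw [hgt', map_add, map_mul, hθι, renP_X]
    change g + _ * 0 = g
    rw [mul_zero, add_zero]
  have hρg : renP V ρ hρ gt = g + h * X V τ ε := by
    rw [hgt', map_add, map_mul, hρι, hρι, renP_X]; rfl
  have hd : deriv 0 gt = -renP V ι hι h := by
    have h2 : ∀ F : SSer V τ, deriv 0 (renP V ι hι F) = 0 := fun F =>
      deriv_renP_eq_zero hι (fun j h => Fin.succ_ne_zero j (Option.some.inj h)) F
    rw [hgt', ← derivL_apply, map_add, (isDer_derivL 0).leib, derivL_apply, derivL_apply, h2, h2,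
      zero_mul, zero_add, zero_add, AlgHom.id_apply, derivL_apply, deriv_X, if_pos rfl, mul_one,
      hh'.pinv_eq, h0]
    simp
  -- Expansion in `t`: the term without `t` is the value at `g`, and the coefficient of `t` is the
  -- derivative in the direction `-h`, evaluated at `t = 0`. The sign is undone when `t` is moved to
  -- the right.
  have h1 := kill_add_X_mul_deriv h0 (Φ.val gt)
  rw [hkill, Φ.val_ren hgt, hθg, Φ.val_deriv hgt, hd, map_neg, mul_neg, ← X_mul_kill h0, hkill,
    Φ.dir_ren hgt, hθg, hθι] at h1
  rw [← hρg, ← Φ.val_ren hgt, ← h1, map_add, hρι, map_neg, map_mul, hρι, renP_X]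
  congr 1
  change -(X W τ ε * _) = _
  have h2 : HasParity true (X W τ ε) := hε ▸ hasParity_X ε
  rw [h2.comm_sgn (Φ.dir_par hg hh)]
  simp

end FormalMap

/-! ### The pullback as a formal map -/

theorem isFormalPoint_iff {M : GradedSupermanifold} {r : ℕ} {τ : Fin r → Bool} {g : SSer M.Fun τ} :
    IsFormalPoint g ↔ IsFP g := and_congr isEven_iff Iff.rfl

theorem GradedSupermanifold.sres_renP {M : GradedSupermanifold} {U V : Opens M.pt} (h : V ≤ U)
    {r r' : ℕ} {τ : Fin r → Bool} {τ' : Fin r' → Bool} {e : Fin r → Option (Fin r')}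
    (he : RenPar τ τ' e) (F : SSer (M.O U) τ) :
    M.sres h (renP _ e he F) = renP _ e he (M.sres h F) := by
  simp only [← sresHom_apply]
  refine hom_ext (θ := (sresHom h τ').comp (renP _ e he)) (θ' := (renP _ e he).comp (sresHom h τ))
    ?_ ?_ (fun x => ?_) (fun i => ?_) F
  · rw [AlgHom.comp_toLinearMap]; exact (cont_ren _ _).comp (cont_renP he)
  · rw [AlgHom.comp_toLinearMap]; exact (cont_renP he).comp (cont_ren _ _)
  · rw [AlgHom.comp_apply, AlgHom.comp_apply, renP_C, sresHom, sresHom, ren_C, ren_C, renP_C]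
  · rw [AlgHom.comp_apply, AlgHom.comp_apply, renP_X, sresHom, sresHom, ren_X]
    have h1 : renX (M.O V) τ some i = X (M.O V) τ i := rfl
    rw [h1, renP_X, renX, renX]
    cases e i with
    | none => exact map_zero _
    | some k => exact ren_X _ _ k

theorem GradedSupermanifold.sres_deriv {M : GradedSupermanifold} {U V : Opens M.pt} (h : V ≤ U)
    {r : ℕ} {τ : Fin r → Bool} (j : Fin r) (F : SSer (M.O U) τ) :
    M.sres h (deriv j F) = deriv j (M.sres h F) := by
  rw [← sresHom_apply, ← sresHom_apply]
  exact (ren_deriv (j := j) (k := j) _ renPar_some (fun i => by simp) F).symm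

theorem GradedSupermanifold.sresHom_isSuper {M : GradedSupermanifold} {U V : Opens M.pt} (h : V ≤ U)
    {r : ℕ} (τ : Fin r → Bool) : IsSuper (M.sresHom h τ) := ren_isSuper _ _

theorem GradedSupermanifold.sresHom_X {M : GradedSupermanifold} {U V : Opens M.pt} (h : V ≤ U)
    {r : ℕ} (τ : Fin r → Bool) (j : Fin r) : sresHom h τ (X (M.O U) τ j) = X (M.O V) τ j :=
  ren_X _ _ j

namespace ThickMorphism
variable {M₁ M₂ : GradedSupermanifold} {s : ℤ} {Φ : ThickMorphism M₁ M₂ s}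
variable {c c' : M₂.Coord} {V V' : Opens M₂.pt} {U U' : Opens M₁.pt} {hV : V ≤ c.dom}
  {hU : U ≤ Opens.comap Φ.φ.base V} {r : ℕ} {τ : Fin r → Bool} {g : SSer M₂.Fun τ}
  {y q : Fin M₂.dim → SSer (M₁.O U) τ}

/-- The substitution of `y` for the coordinates, on `U`. -/
noncomputable abbrev hatAt (Φ : ThickMorphism M₁ M₂ s) (c : M₂.Coord) {V : Opens M₂.pt}
    {U : Opens M₁.pt} (hV : V ≤ c.dom) (hU : U ≤ Opens.comap Φ.φ.base V) {r : ℕ} {τ : Fin r → Bool}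
    (y : Fin M₂.dim → SSer (M₁.O U) τ) (h : SSer M₂.Fun τ) : SSer (M₁.O U) τ :=
  hat (sys c.toChart hV) (Φ.φ.pullTo hU) y (M₂.sres le_top h)

/-- The substitution of `y` for the coordinates, as a homomorphism. -/
noncomputable def IsSolAt.hatAtHom (hs : Φ.IsSolAt c hV hU g y q) :
    SSer M₂.Fun τ →ₐ[ℝ] SSer (M₁.O U) τ :=
  (hatHom (sys c.toChart hV) (Φ.φ.pullTo hU) y (Φ.φ.pullTo_isSuper hU) hs.ext).comp
    (sresHom le_top τ)

theorem IsSolAt.hatAt_eq (hs : Φ.IsSolAt c hV hU g y q) (h : SSer M₂.Fun τ) :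
    Φ.hatAt c hV hU y h = hs.hatAtHom h := by
  rw [IsSolAt.hatAtHom, AlgHom.comp_apply, sresHom_apply, hatHom_apply]

theorem IsSolAt.hatAt_res (hs : Φ.IsSolAt c hV hU g y q) (hV' : V' ≤ V) (hU' : U' ≤ U)
    (hUV : U' ≤ Opens.comap Φ.φ.base V') (h : SSer M₂.Fun τ) :
    Φ.hatAt c (hV'.trans hV) hUV (fun i => M₁.sres hU' (y i)) h =
      M₁.sres hU' (Φ.hatAt c hV hU y h) := by
  have h1 := (Φ.φ.resCompat c.toChart hV hV' hU hU' hUV).hat renPar_some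
    (Φ.φ.pullTo_isSuper hU) (Φ.φ.pullTo_isSuper hUV) hs.ext (M₂.sres le_top h)
  simp only [ren_some] at h1
  have h2 : ∀ {n : ℕ} {π : Fin n → Bool} (F : SSer (M₁.O U) π),
      mapHom (M₁.res hU') (res_isSuper hU') π F = M₁.sres hU' F := fun F => rfl
  have h3 : ∀ {n : ℕ} {π : Fin n → Bool} (F : SSer (M₂.O V) π),
      mapHom (M₂.res hV') (res_isSuper hV') π F = M₂.sres hV' F := fun F => rfl
  simp only [h2, h3, sres_sres] at h1
  exact h1

/-- `k` is the derivative of the pullback at `g` in the direction `h`. -/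
def IsDir (Φ : ThickMorphism M₁ M₂ s) (g h : SSer M₂.Fun τ) (k : SSer M₁.Fun τ) : Prop :=
  ∀ (c : M₂.Coord) (y q : Fin M₂.dim → SSer (M₁.O (Opens.comap Φ.φ.base c.dom)) τ),
    Φ.IsSolAt c le_rfl le_rfl g y q → M₁.sres le_top k = Φ.hatAt c le_rfl le_rfl y h

theorem IsDir.hatAt (hg : IsFormalPoint g) {h : SSer M₂.Fun τ} {k : SSer M₁.Fun τ}
    (hk : Φ.IsDir g h k) (hs : Φ.IsSolAt c hV hU g y q) :
    M₁.sres le_top k = Φ.hatAt c hV hU y h := by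
  obtain ⟨y', q', h'⟩ := exists_isSolAt Φ c le_rfl le_rfl hg
  obtain ⟨h3, -⟩ := h'.res hV (hU.trans (Opens.comap_mono Φ.φ.base hV)) hU
  have h4 := h'.hatAt_res hV (hU.trans (Opens.comap_mono Φ.φ.base hV)) hU h
  obtain ⟨rfl, rfl⟩ := IsSol.unique (coeff_zero_sres hg) hs.toIsSol h3.toIsSol
  rw [h4, ← hk c y' q' h', sres_sres]

theorem exists_isDir (Φ : ThickMorphism M₁ M₂ s) (hg : IsFormalPoint g) (h : SSer M₂.Fun τ) :
    ∃ k, Φ.IsDir g h k := by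
  have h1 := fun c : M₂.Coord => exists_isSolAt Φ c le_rfl le_rfl hg
  choose y q hs using h1
  obtain ⟨f, hf⟩ := exists_glue (fun c : M₂.Coord => Opens.comap Φ.φ.base c.dom) Φ.mem_cover
    (fun c => Φ.hatAt c le_rfl le_rfl (y c) h) fun c c' => by
      have h3 := ((hs c).res (V' := c.dom ⊓ c'.dom) inf_le_left
        (Opens.comap_mono Φ.φ.base inf_le_left) le_rfl).1
      have h4 := (hs c).hatAt_res (V' := c.dom ⊓ c'.dom) inf_le_left
        (Opens.comap_mono Φ.φ.base inf_le_left) le_rfl h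
      have h3' := ((hs c').res (V' := c.dom ⊓ c'.dom) inf_le_right
        (Opens.comap_mono Φ.φ.base inf_le_right) le_rfl).1
      have h4' := (hs c').hatAt_res (V' := c.dom ⊓ c'.dom) inf_le_right
        (Opens.comap_mono Φ.φ.base inf_le_right) le_rfl h
      have h5 := funext (h3.change hg h3').1
      refine h4.symm.trans (Eq.trans ?_ h4')
      rw [ThickMorphism.hatAt, ThickMorphism.hatAt, hat, hat, h5]
  refine ⟨f, fun c y' q' h' => ?_⟩
  obtain ⟨rfl, rfl⟩ := IsSol.unique (coeff_zero_sres hg) h'.toIsSol (hs c).toIsSol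
  exact hf c

theorem IsDir.ext (hg : IsFormalPoint g) {h : SSer M₂.Fun τ} {k k' : SSer M₁.Fun τ}
    (hk : Φ.IsDir g h k) (hk' : ∀ (c : M₂.Coord) y q, Φ.IsSolAt c le_rfl le_rfl g y q →
      M₁.sres le_top k' = Φ.hatAt c le_rfl le_rfl y h) : k' = k :=
  Φ.ser_ext_cover fun c => by
    obtain ⟨y, q, h⟩ := exists_isSolAt Φ c le_rfl le_rfl hg
    rw [hk c y q h, hk' c y q h]

/-- The derivative of the pullback at `g`. -/
noncomputable def dirHom (Φ : ThickMorphism M₁ M₂ s) (hg : IsFormalPoint g) :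
    SSer M₂.Fun τ →ₐ[ℝ] SSer M₁.Fun τ := by
  -- On each chart the derivative is the substitution `h ↦ h(y)`, so that the glued map is
  -- multiplicative and not only linear.
  let f := fun h => (Φ.exists_isDir hg h).choose
  have hf : ∀ h, Φ.IsDir g h (f h) := fun h => (Φ.exists_isDir hg h).choose_spec
  have hr : ∀ {U V : Opens M₁.pt} (h : V ≤ U) (F : SSer (M₁.O U) τ),
      M₁.sres h F = sresHom h τ F := fun h F => (sresHom_apply h F).symm
  exact AlgHom.ofLinearMap
    { toFun := f
      map_add' := fun h h' => ((hf _).ext hg fun c y q hs => by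
        rw [hs.hatAt_eq, map_add, ← hs.hatAt_eq, ← hs.hatAt_eq, hr, map_add, ← hr, ← hr, hf h c y q hs,
          hf h' c y q hs]).symm
      map_smul' := fun a h => ((hf _).ext hg fun c y q hs => by
        rw [RingHom.id_apply, hs.hatAt_eq, map_smul, ← hs.hatAt_eq, hr, map_smul, ← hr, hf h c y q hs]).symm }
    (((hf _).ext hg fun c y q hs => by rw [hs.hatAt_eq, map_one, hr, map_one]).symm)
    fun h h' => ((hf _).ext hg fun c y q hs => by
        change M₁.sres _ (f h * f h') = _
        rw [hs.hatAt_eq, map_mul, ← hs.hatAt_eq, ← hs.hatAt_eq, hr, map_mul, ← hr, ← hr, hf h c y q hs,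
          hf h' c y q hs]).symm

theorem dirHom_isDir (hg : IsFormalPoint g) (h : SSer M₂.Fun τ) :
    Φ.IsDir g h (Φ.dirHom hg h) := (Φ.exists_isDir hg h).choose_spec

theorem sres_dirHom (hg : IsFormalPoint g) (h : SSer M₂.Fun τ) (hs : Φ.IsSolAt c hV hU g y q) :
    M₁.sres le_top (Φ.dirHom hg h) = Φ.hatAt c hV hU y h := (dirHom_isDir hg h).hatAt hg hs

theorem eq_dirHom (hg : IsFormalPoint g) {h : SSer M₂.Fun τ} {k : SSer M₁.Fun τ}
    (hk : ∀ (c : M₂.Coord) y q, Φ.IsSolAt c le_rfl le_rfl g y q →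
      M₁.sres le_top k = Φ.hatAt c le_rfl le_rfl y h) : k = Φ.dirHom hg h :=
  (dirHom_isDir hg h).ext hg hk

theorem dirHom_isSuper (hg : IsFormalPoint g) : IsSuper (Φ.dirHom hg) := fun h => by
  symm
  refine eq_dirHom hg fun c y q hs => ?_
  have h1 : IsSuper hs.hatAtHom := (hatHom_isSuper _ _).comp (sresHom_isSuper _ _)
  rw [hs.hatAt_eq, h1, ← hs.hatAt_eq, ← sres_dirHom hg h hs, ← sresHom_apply, ← sresHom_apply]
  exact sresHom_isSuper _ _ _

theorem dirHom_X (hg : IsFormalPoint g) (j : Fin r) :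
    Φ.dirHom hg (X M₂.Fun τ j) = X M₁.Fun τ j := by
  symm
  refine eq_dirHom hg fun c y q hs => ?_
  rw [hs.hatAt_eq, IsSolAt.hatAtHom, AlgHom.comp_apply, ← sresHom_apply, sresHom_X, sresHom_X]
  exact (hatHom_X (Φ.φ.pullTo_isSuper _) hs.ext j).symm

theorem dirHom_ord (hg : IsFormalPoint g) (N : ℕ) (h : SSer M₂.Fun τ)
    (hh : h ∈ ordGE M₂.Fun τ N) : Φ.dirHom hg h ∈ ordGE M₁.Fun τ N := fun m hm =>
  M₁.eq_of_locally_eq _ _ fun x _ => by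
    obtain ⟨c, hc⟩ := Φ.mem_cover x
    obtain ⟨y, q, hs⟩ := exists_isSolAt Φ c le_rfl le_rfl hg
    refine ⟨_, le_top, hc, ?_⟩
    rw [← coeff_sres, sres_dirHom hg h hs, map_zero]
    exact subst_mem tay_zero coeff_zero_X (mapL_ordGE (M₂.res le_top).toLinearMap hh) m hm

/-- Naturality under changes of parameters. -/
theorem IsSolAt.renP (hs : Φ.IsSolAt c hV hU g y q) {r' : ℕ} {τ' : Fin r' → Bool}
    {e : Fin r → Option (Fin r')} (he : RenPar τ τ' e) :
    Φ.IsSolAt c hV hU (SSer.renP _ e he g) (fun i => SSer.renP _ e he (y i))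
      (fun i => SSer.renP _ e he (q i)) ∧
    Φ.valAt c hV hU (SSer.renP _ e he g) (fun i => SSer.renP _ e he (y i))
      (fun i => SSer.renP _ e he (q i)) = SSer.renP _ e he (Φ.valAt c hV hU g y q) := by
  have h1 := IsGoodSol.ren (ResCompat.id (sys c.toChart hV) (Φ.φ.pullTo hU)) he
    (Φ.φ.pullTo_isSuper hU) (Φ.φ.pullTo_isSuper hU) hs
  have h2 : ∀ {n : ℕ} {π : Fin n → Bool} (F : SSer (M₁.O U) π),
      mapL (AlgHom.id ℝ (M₁.O U)).toLinearMap F = F := fun F => SSer.ext fun m _ => coeff_mapL _ _ _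
  rw [h2] at h1
  rw [ThickMorphism.IsSolAt, ThickMorphism.valAt, sres_renP]
  exact h1

theorem IsPullback.renP (hg : IsFormalPoint g) {f : SSer M₁.Fun τ} (hf : Φ.IsPullback g f) {r' : ℕ}
    {τ' : Fin r' → Bool} {e : Fin r → Option (Fin r')} (he : RenPar τ τ' e) :
    Φ.IsPullback (SSer.renP _ e he g) (SSer.renP _ e he f) := by
  refine (isPullback_iff (isFormalPoint_iff.2 ((isFormalPoint_iff.1 hg).renP he))).2 fun c => ?_
  obtain ⟨y, q, hs, h⟩ := (isPullback_iff hg).1 hf c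
  obtain ⟨h1, h2⟩ := hs.renP he
  exact ⟨_, _, h1, by rw [sres_renP, h, h2]⟩

theorem dirHom_renP (hg : IsFormalPoint g) {r' : ℕ} {τ' : Fin r' → Bool}
    {e : Fin r → Option (Fin r')} (he : RenPar τ τ' e) (hg' : IsFormalPoint (SSer.renP _ e he g))
    (h : SSer M₂.Fun τ) :
    SSer.renP _ e he (Φ.dirHom hg h) = Φ.dirHom hg' (SSer.renP _ e he h) := by
  refine eq_dirHom hg' fun c y q hs => ?_
  obtain ⟨y', q', hs'⟩ := exists_isSolAt Φ c le_rfl le_rfl hg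
  obtain ⟨rfl, rfl⟩ := IsSol.unique (coeff_zero_sres hg') hs.toIsSol (hs'.renP he).1.toIsSol
  have h1 := (ResCompat.id (sys c.toChart le_rfl) (Φ.φ.pullTo le_rfl)).hat he
    (Φ.φ.pullTo_isSuper _) (Φ.φ.pullTo_isSuper _) hs'.ext (M₂.sres le_top h)
  rw [sres_renP, sres_dirHom hg h hs', ThickMorphism.hatAt, ThickMorphism.hatAt, sres_renP]
  exact h1.symm

/-- `S` does not depend on the parameters, so the critical value principle leaves only the explicit
derivative of `g`. This identifies `h ↦ h(y)` as the tangent map of the pullback. -/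
theorem IsPullback.deriv (hg : IsFormalPoint g) {f : SSer M₁.Fun τ} (hf : Φ.IsPullback g f)
    (j : Fin r) : SSer.deriv j f = Φ.dirHom hg (SSer.deriv j g) := by
  refine eq_dirHom hg fun c y q hs => ?_
  have h2 : _ = pval _ _ _ _ y q := hf.valAt hg hs
  rw [sres_deriv, h2]
  have hz : IsDer (AlgHom.id ℝ (M₁.O (Opens.comap Φ.φ.base c.dom))) (τ j) 0 := IsDer.zero
  refine (hs.pval_der (Φ.φ.pullTo_isSuper _) (isDer_derivL j) (cont_derivL j) (fun b => ?_)
    hz (fun a => ?_)).trans ?_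
  · simp [derivL_apply, deriv_C]
  · rw [derivL_apply, deriv_C]; exact C_zero.symm
  · have h3 : mapL (0 : M₁.O (Opens.comap Φ.φ.base c.dom) →ₗ[ℝ] _)
        (M₁.sres (le_refl (Opens.comap Φ.φ.base c.dom)) (Φ.S c)) = 0 :=
      SSer.ext fun m _ => coeff_mapL (π := M₂.par)
        (0 : M₁.O (Opens.comap Φ.φ.base c.dom) →ₗ[ℝ] M₁.O (Opens.comap Φ.φ.base c.dom)) _ m
    rw [h3, ← sigma_apply hs.qpar hs.qzero, map_zero, add_zero, Finset.sum_eq_single j]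
    · rw [derivL_apply, deriv_X, if_pos rfl, one_mul, ← sres_deriv]
    · intro i _ hi
      rw [derivL_apply, deriv_X, if_neg (by tauto), zero_mul]
    · simp

open Classical in
/-- The pullback as a formal map. -/
noncomputable def formalMap (Φ : ThickMorphism M₁ M₂ s) : FormalMap M₂.Fun M₁.Fun false where
  -- The value `0` away from formal points is a mere default; every axiom of `FormalMap` assumes
  -- `IsFP`.
  val g := if hg : IsFormalPoint g then (Φ.exists_isPullback hg).choose else 0
  dir g := if hg : IsFormalPoint g then (Φ.dirHom hg).toLinearMap else 0
  val_par {r τ g} hg := by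
    have hg' := isFormalPoint_iff.2 hg
    rw [dif_pos hg']
    exact (Φ.exists_isPullback hg').choose_spec.even hg'
  val_deriv {r τ g} hg j := by
    have hg' := isFormalPoint_iff.2 hg
    rw [dif_pos hg', dif_pos hg']
    exact (Φ.exists_isPullback hg').choose_spec.deriv hg' j
  dir_par {r τ g} hg f h hh := by
    rw [dif_pos (isFormalPoint_iff.2 hg), Bool.xor_false]
    exact (dirHom_isSuper (isFormalPoint_iff.2 hg)).hasParity hh
  dir_X {r τ g} hg h j := by
    rw [dif_pos (isFormalPoint_iff.2 hg), Bool.false_and, sgn_false, one_smul]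
    exact (map_mul (Φ.dirHom (isFormalPoint_iff.2 hg)) _ _).trans
      (congrArg _ (dirHom_X (isFormalPoint_iff.2 hg) j))
  dir_ord {r τ g} hg N h hh := by
    rw [dif_pos (isFormalPoint_iff.2 hg)]
    exact dirHom_ord (isFormalPoint_iff.2 hg) N h hh
  val_ren {r r' τ τ' g} hg e he := by
    have hg' := isFormalPoint_iff.2 hg
    have hg'' := isFormalPoint_iff.2 (hg.renP he)
    rw [dif_pos hg', dif_pos hg'']
    exact ((Φ.exists_isPullback hg').choose_spec.renP hg' he).unique hg''
      (Φ.exists_isPullback hg'').choose_spec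
  dir_ren {r r' τ τ' g} hg e he h := by
    have hg' := isFormalPoint_iff.2 hg
    have hg'' := isFormalPoint_iff.2 (hg.renP he)
    rw [dif_pos hg', dif_pos hg'']
    exact dirHom_renP hg' he hg'' h

theorem isPullback_val (Φ : ThickMorphism M₁ M₂ s) (hg : IsFormalPoint g) :
    Φ.IsPullback g (Φ.formalMap.val g) := by
  rw [formalMap]
  simp only [dif_pos hg]
  exact (Φ.exists_isPullback hg).choose_spec

theorem formalMap_dir (hg : IsFormalPoint g) (h : SSer M₂.Fun τ) :
    Φ.formalMap.dir g h = Φ.dirHom hg h := by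
  rw [formalMap]
  simp only [dif_pos hg]
  rfl

end ThickMorphism

/-! ### Hamilton-Jacobi vector fields as formal maps -/

namespace SSer

section Ham
variable {A A' : Type*} [Ring A] [Algebra ℝ A] [SuperAlgebra A] [Ring A'] [Algebra ℝ A']
  [SuperAlgebra A'] {n r r' : ℕ} {π : Fin n → Bool} {τ : Fin r → Bool} {τ' : Fin r' → Bool}

/-- The Hamiltonian `H(x, ∂g/∂x)`. -/
noncomputable def ev (cs : CoordSys A π) (H : SSer A π) (g : SSer A τ) : SSer A τ :=
  subst (C τ) (fun a => mapL (cs.d a) g) H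

/-- The derivative of `H(x, ∂g/∂x)` in the direction `w`. -/
noncomputable def evd (cs : CoordSys A π) (H : SSer A π) (g w : SSer A τ) : SSer A τ :=
  ∑ a, mapL (cs.d a) (pinv (π a) w) * ev cs (deriv a H) g

theorem IsFP.grad_par {g : SSer A τ} (hg : IsFP g) (cs : CoordSys A π) (a : Fin n) :
    HasParity (π a) (mapL (cs.d a) g) := by
  have := (isDer_mapL_id (π := τ) (cs.d_der a)).hasParity hg.1
  rwa [Bool.xor_false] at this

theorem IsFP.grad_zero {g : SSer A τ} (hg : IsFP g) (cs : CoordSys A π) (a : Fin n) :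
    coeff 0 (mapL (cs.d a) g) = 0 := by rw [coeff_mapL, hg.2, map_zero]

/-- The substitution of `∂g/∂x` for the momenta. -/
noncomputable def IsFP.evHom {g : SSer A τ} (hg : IsFP g) (cs : CoordSys A π) :
    SSer A π →ₐ[ℝ] SSer A τ := sigma (hg.grad_par cs) (hg.grad_zero cs)

theorem IsFP.evHom_apply {g : SSer A τ} (hg : IsFP g) (cs : CoordSys A π) (H : SSer A π) :
    hg.evHom cs H = ev cs H g := rfl

theorem IsFP.evHom_isSuper {g : SSer A τ} (hg : IsFP g) (cs : CoordSys A π) :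
    IsSuper (hg.evHom cs) :=
  substHom_isSuper CHom_isSuper (hg.grad_par cs) (hg.grad_zero cs)

theorem IsFP.ev_par {g : SSer A τ} (hg : IsFP g) (cs : CoordSys A π) {H : SSer A π} {e : Bool}
    (hH : HasParity e H) : HasParity e (ev cs H g) := (hg.evHom_isSuper cs).hasParity hH

theorem deriv_mapL_d (cs : CoordSys A π) (j : Fin r) (a : Fin n) (F : SSer A τ) :
    deriv j (mapL (cs.d a) F) = sgn (π a && τ j) • mapL (cs.d a) (deriv j F) :=
  SSer.ext fun m _ => by
    rw [coeff_smul, coeff_mapL, coeff_deriv, coeff_deriv, coeff_mapL, map_smul, smul_comm,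
      (cs.d_der a).pinv_apply]
    congr 1
    cases τ j <;> cases π a <;> simp

theorem mapL_zero_fun (F : SSer A π) : mapL (0 : A →ₗ[ℝ] A) F = 0 :=
  SSer.ext fun m _ => coeff_mapL (π := π) (0 : A →ₗ[ℝ] A) F m

theorem mapL_id_fun (F : SSer A π) : mapL (AlgHom.id ℝ A).toLinearMap F = F :=
  SSer.ext fun m _ => coeff_mapL (π := π) (AlgHom.id ℝ A).toLinearMap F m

theorem IsFP.deriv_ev {g : SSer A τ} (hg : IsFP g) (cs : CoordSys A π) (H : SSer A π) (j : Fin r) :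
    deriv j (ev cs H g) = evd cs H g (deriv j g) := by
  have hz : IsDer (AlgHom.id ℝ A) (τ j) 0 := IsDer.zero
  have h := sigma_der (hg.grad_par cs) (hg.grad_zero cs) (isDer_derivL j) (cont_derivL j) hz
    (fun a => by rw [derivL_apply, deriv_C]; exact C_zero.symm) H
  have h0 : subst (C τ) (fun a => mapL (cs.d a) g) (0 : SSer A π) = 0 := map_zero (hg.evHom cs)
  rw [mapL_zero_fun, h0, zero_add] at h
  refine h.trans (Finset.sum_congr rfl fun a _ => ?_)
  congr 1
  have h1 := hg.1.deriv j
  rw [Bool.xor_false] at h1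
  rw [derivL_apply, deriv_mapL_d, h1.pinv_eq, map_smul]

theorem evd_par {g : SSer A τ} (hg : IsFP g) (cs : CoordSys A π) {H : SSer A π} {e f : Bool}
    (hH : HasParity e H) {w : SSer A τ} (hw : HasParity f w) : HasParity (f ^^ e) (evd cs H g w) :=
  HasParity.sum fun a _ => by
    have := ((isDer_mapL_id (π := τ) (cs.d_der a)).hasParity (hw.pinv (π a))).mul
      (hg.ev_par cs (hH.deriv a))
    have h2 : ((π a ^^ f) ^^ (π a ^^ e)) = (f ^^ e) := by cases π a <;> cases f <;> cases e <;> rfl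
    rwa [h2] at this

theorem evd_mul_X {g : SSer A τ} (hg : IsFP g) (cs : CoordSys A π) {H : SSer A π} {e : Bool}
    (hH : HasParity e H) (w : SSer A τ) (j : Fin r) :
    evd cs H g (w * X A τ j) = sgn (e && τ j) • (evd cs H g w * X A τ j) := by
  rw [evd, evd, Finset.sum_mul, Finset.smul_sum]
  refine Finset.sum_congr rfl fun a _ => ?_
  have h1 : mapL (cs.d a) (pinv (π a) (w * X A τ j)) =
      sgn (π a && τ j) • (mapL (cs.d a) (pinv (π a) w) * X A τ j) := by
    rw [map_mul, (hasParity_X j).pinv_eq, mul_smul_comm, map_smul,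
      (isDer_mapL_id (cs.d_der a)).leib, mapL_X (cs.d_der a), mul_zero, add_zero]
    rfl
  rw [h1, smul_mul_assoc, mul_assoc, (hasParity_X j).comm_sgn (hg.ev_par cs (hH.deriv a)),
    mul_smul_comm, smul_smul, mul_assoc]
  congr 1
  cases π a <;> cases τ j <;> cases e <;> simp

theorem evd_ord (cs : CoordSys A π) (H : SSer A π) (g : SSer A τ) {N : ℕ} {w : SSer A τ}
    (hw : w ∈ ordGE A τ N) : evd cs H g w ∈ ordGE A τ N :=
  sum_mem fun a _ => mul_ordGE_left (mapL_ordGE _ (pinv_ordGE _ hw)) _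

theorem evd_add (cs : CoordSys A π) (H : SSer A π) (g w w' : SSer A τ) :
    evd cs H g (w + w') = evd cs H g w + evd cs H g w' := by
  simp only [evd, map_add, add_mul, Finset.sum_add_distrib]

theorem evd_smul (cs : CoordSys A π) (H : SSer A π) (g : SSer A τ) (x : ℝ) (w : SSer A τ) :
    evd cs H g (x • w) = x • evd cs H g w := by
  simp only [evd, map_smul, smul_mul_assoc, Finset.smul_sum]

section Nat
variable {cs : CoordSys A π} {cs' : CoordSys A' π} {a : A →ₐ[ℝ] A'} (ha : IsSuper a)
  (hd : ∀ i x, a (cs.d i x) = cs'.d i (a x)) {e : Fin r → Option (Fin r')} (he : RenPar τ τ' e)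

include hd in
/-- Naturality of the Hamiltonian under restrictions and changes of parameters. -/
theorem IsFP.ren_ev {g : SSer A τ} (hg : IsFP g) (H : SSer A π) :
    ren a ha e he (ev cs H g) = ev cs' (mapL a.toLinearMap H) (ren a ha e he g) := by
  rw [ev, ev]
  refine (subst_nat (ρ := C τ) (ρ' := C τ') (ren a ha e he) (ren_ord ha he) a.toLinearMap
      (fun x => (ren_C ha he x).symm) (hg.grad_zero cs) H).symm.trans ?_
  congr 1
  funext i
  exact ren_mapL ha he (cs.d_der i) (cs'.d_der i) (hd i) g

include ha in
theorem mapL_deriv (i : Fin n) (H : SSer A π) :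
    mapL a.toLinearMap (deriv i H) = deriv i (mapL a.toLinearMap H) := by
  have h : ∀ F : SSer A π, mapL a.toLinearMap F = ren a ha some renPar_some F := fun F =>
    (ren_some ha F).symm
  rw [h, h, ren_deriv (j := i) (k := i) ha renPar_some (fun j => by simp)]

include hd in
theorem IsFP.ren_evd {g : SSer A τ} (hg : IsFP g) (H : SSer A π) (w : SSer A τ) :
    ren a ha e he (evd cs H g w) =
      evd cs' (mapL a.toLinearMap H) (ren a ha e he g) (ren a ha e he w) := by
  rw [evd, evd, map_sum]
  refine Finset.sum_congr rfl fun i _ => ?_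
  rw [map_mul, hg.ren_ev ha hd he, mapL_deriv ha, ren_mapL ha he (cs.d_der i) (cs'.d_der i) (hd i),
    (ren_isSuper ha he).pinv]

end Nat

section Change
variable {cs cs' : CoordSys A π} (hc : cs.ChainRule cs')

include hc in
theorem mapL_d_change (a : Fin n) (g : SSer A τ) :
    mapL (cs.d a) g = ∑ b, C τ (cs.d a (cs'.y b)) * mapL (cs'.d b) g :=
  SSer.ext fun m _ => by
    rw [coeff_mapL, coeff_sum, hc]
    exact Finset.sum_congr rfl fun b _ => by rw [coeff_C_mul, coeff_mapL]

/-- The momenta in another coordinate system. -/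
noncomputable def newMomenta (cs cs' : CoordSys A π) (a : Fin n) : SSer A π :=
  ∑ b, C π (cs.d a (cs'.y b)) * X A π b

theorem coeff_zero_newMomenta (a : Fin n) : coeff 0 (newMomenta cs cs' a) = 0 := by
  rw [newMomenta, coeff_sum]
  exact Finset.sum_eq_zero fun b _ => by rw [coeff_C_mul, coeff_zero_X, mul_zero]

theorem newMomenta_par (a : Fin n) : HasParity (π a) (newMomenta cs cs' a) :=
  HasParity.sum fun b _ => by
    have := (hasParity_C (π := π) ((cs.d_der a).hasParity (cs'.y_par b))).mul (hasParity_X (A := A) b)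
    rwa [Bool.xor_assoc, Bool.xor_self, Bool.xor_false] at this

include hc in
theorem IsFP.ev_newMomenta {g : SSer A τ} (hg : IsFP g) (a : Fin n) :
    ev cs' (newMomenta cs cs' a) g = mapL (cs.d a) g := by
  rw [← hg.evHom_apply, newMomenta, map_sum, mapL_d_change hc]
  refine Finset.sum_congr rfl fun b _ => ?_
  rw [map_mul, IsFP.evHom, sigma_C, sigma_X]

include hc in
/-- Independence of the coordinates. -/
theorem IsFP.ev_change {g : SSer A τ} (hg : IsFP g) (F : SSer A π) :
    ev cs' (subst (C π) (newMomenta cs cs') F) g = ev cs F g := by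
  have h1 := subst_nat (ρ := C π) (ρ' := C τ) (hg.evHom cs') (sigma_ord _ _) LinearMap.id
      (fun x => (sigma_C _ _ x).symm) (coeff_zero_newMomenta (cs := cs) (cs' := cs')) F
  have h2 : mapL LinearMap.id F = F := SSer.ext fun m _ => coeff_mapL _ _ _
  rw [h2] at h1
  rw [← hg.evHom_apply, ← h1, ev]
  congr 1
  funext a
  rw [hg.evHom_apply, hg.ev_newMomenta hc]

theorem deriv_newMomenta (b : Fin n) (F : SSer A π) :
    deriv b (subst (C π) (newMomenta cs cs') F) =
      ∑ a, C π (pinv (π b) (cs.d a (cs'.y b))) * subst (C π) (newMomenta cs cs') (deriv a F) := by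
  have hz : IsDer (AlgHom.id ℝ A) (π b) 0 := IsDer.zero
  have h := sigma_der (newMomenta_par (cs := cs) (cs' := cs')) coeff_zero_newMomenta (isDer_derivL b)
    (cont_derivL b) hz (fun a => by rw [derivL_apply, deriv_C]; exact C_zero.symm) F
  have h0 : subst (C π) (newMomenta cs cs') (0 : SSer A π) = 0 :=
    map_zero (sigma newMomenta_par coeff_zero_newMomenta)
  rw [mapL_zero_fun, h0, zero_add] at h
  refine h.trans (Finset.sum_congr rfl fun a _ => ?_)
  congr 1
  rw [newMomenta, map_sum, Finset.sum_eq_single b]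
  · rw [(isDer_derivL b).leib, derivL_apply, deriv_C, zero_mul, zero_add, derivL_apply, deriv_X,
      if_pos rfl, mul_one, AlgHom.id_apply, pinv_C]
  · intro k _ hk
    rw [(isDer_derivL b).leib, derivL_apply, deriv_C, zero_mul, zero_add, derivL_apply, deriv_X,
      if_neg (by tauto), mul_zero]
  · simp

include hc in
-- Momentum derivatives transform with the transposed Jacobian, the derivatives of `w` with the
-- Jacobian itself; the two sums are the same double sum after the signs are matched.
theorem IsFP.evd_change {g : SSer A τ} (hg : IsFP g) (F : SSer A π) (w : SSer A τ) :
    evd cs' (subst (C π) (newMomenta cs cs') F) g w = evd cs F g w := by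
  have h1 : ∀ b, ev cs' (deriv b (subst (C π) (newMomenta cs cs') F)) g =
      ∑ a, C τ (pinv (π b) (cs.d a (cs'.y b))) * ev cs (deriv a F) g := fun b => by
    rw [deriv_newMomenta, ← hg.evHom_apply, map_sum]
    refine Finset.sum_congr rfl fun a _ => ?_
    rw [map_mul, IsFP.evHom, sigma_C, ← IsFP.evHom, hg.evHom_apply, hg.ev_change hc]; exact hg
  rw [evd, evd]
  simp only [h1, Finset.mul_sum]
  rw [Finset.sum_comm]
  refine Finset.sum_congr rfl fun a _ => ?_
  rw [mapL_d_change hc a, Finset.sum_mul]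
  refine Finset.sum_congr rfl fun b _ => ?_
  rw [← mul_assoc]
  congr 1
  have hu : HasParity (π a ^^ π b) (cs.d a (cs'.y b)) := (cs.d_der a).hasParity (cs'.y_par b)
  rw [hu.pinv_eq, C_smul, mul_smul_comm, HasParity.comm' (hasParity_C hu), ← mul_smul_comm]
  congr 1
  have h2 : pinv (π a) w = pinv (π a ^^ π b) (pinv (π b) w) := by
    rw [pinv_pinv, Bool.xor_assoc, Bool.xor_self, Bool.xor_false]
  rw [h2, (isDer_mapL_id (cs'.d_der b)).pinv_apply, Bool.and_comm,
    (isDer_mapL_id (cs'.d_der b)).pinv_apply, (isDer_mapL_id (cs'.d_der b)).pinv_apply]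

end Change
end Ham
end SSer

namespace GradedSupermanifold
variable {M : GradedSupermanifold} {k : ℤ} (H : MasterHamiltonian M k) {r : ℕ} {τ : Fin r → Bool}
  {g : SSer M.Fun τ}

/-- The value of the Hamiltonian vector field, on an open set. -/
noncomputable abbrev evAt (c : M.Coord) {V : Opens M.pt} (hV : V ≤ c.dom) (g : SSer M.Fun τ) :
    SSer (M.O V) τ := ev (sys c.toChart hV) (M.sres hV (H.H c)) (M.sres le_top g)

/-- The derivative of the Hamiltonian vector field, on an open set. -/
noncomputable abbrev evdAt (c : M.Coord) {V : Opens M.pt} (hV : V ≤ c.dom) (g w : SSer M.Fun τ) :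
    SSer (M.O V) τ :=
  evd (sys c.toChart hV) (M.sres hV (H.H c)) (M.sres le_top g) (M.sres le_top w)

theorem isFP_sres (hg : IsFP g) (V : Opens M.pt) : IsFP (M.sres (le_top : V ≤ ⊤) g) :=
  ⟨ThickMorphism.sres_par (isFormalPoint_iff.2 hg),
    ThickMorphism.coeff_zero_sres (isFormalPoint_iff.2 hg)⟩

theorem hamiltonian_par (c : M.Coord) {V : Opens M.pt} (hV : V ≤ c.dom) :
    HasParity true (M.sres hV (H.H c)) := by
  rw [← sresHom_apply]; exact (sresHom_isSuper _ _).hasParity (isOdd_iff.1 (H.odd c))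

theorem evAt_res (hg : IsFP g) (c : M.Coord) {V W : Opens M.pt} (hV : V ≤ c.dom) (h : W ≤ V) :
    M.sres h (evAt H c hV g) = evAt H c (h.trans hV) g := by
  have h1 := (isFP_sres hg V).ren_ev (cs := sys c.toChart hV) (cs' := sys c.toChart (h.trans hV))
    (res_isSuper h) (fun i x => c.pdL_res hV h i x) renPar_some (M.sres hV (H.H c))
  rw [← sres_eq, sres_sres] at h1
  rw [← sresHom_apply, sresHom, evAt, h1, ← sresHom, sresHom_apply, sres_sres]

theorem evdAt_res (hg : IsFP g) (c : M.Coord) {V W : Opens M.pt} (hV : V ≤ c.dom) (h : W ≤ V)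
    (w : SSer M.Fun τ) : M.sres h (evdAt H c hV g w) = evdAt H c (h.trans hV) g w := by
  have h1 := (isFP_sres hg V).ren_evd (cs := sys c.toChart hV) (cs' := sys c.toChart (h.trans hV))
    (res_isSuper h) (fun i x => c.pdL_res hV h i x) renPar_some (M.sres hV (H.H c))
    (M.sres le_top w)
  rw [← sres_eq, sres_sres] at h1
  rw [← sresHom_apply, sresHom, evdAt, h1, ← sresHom, sresHom_apply, sres_sres, sresHom_apply,
    sres_sres]

theorem hamiltonian_change (c c' : M.Coord) :
    subst (C M.par) (newMomenta (sys c.toChart (V := c.dom ⊓ c'.dom) inf_le_left)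
      (sys c'.toChart inf_le_right)) (M.sres inf_le_left (H.H c)) = M.sres inf_le_right (H.H c') := by
  rw [← H.change c c']
  congr 1
  funext a
  exact Finset.sum_congr rfl fun b _ => by rw [← Chart.pdL_apply]; rfl

theorem ser_ext_coord {F G : SSer M.Fun τ}
    (h : ∀ c : M.Coord, M.sres (le_top : c.dom ≤ ⊤) F = M.sres le_top G) : F = G :=
  ser_ext fun x _ => by
    obtain ⟨c, hc⟩ := M.exists_chart x
    exact ⟨_, le_top, hc, h c⟩

/-- Gluing over the charts of `M`: the law of transformation of `H` is made so that `H(x, ∂g/∂x)`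
does not depend on the coordinates. -/
theorem exists_ev (hg : IsFP g) : ∃ h : SSer M.Fun τ, ∀ c : M.Coord,
    M.sres le_top h = evAt H c le_rfl g :=
  exists_glue (fun c : M.Coord => c.dom) M.exists_chart (fun c => evAt H c le_rfl g) fun c c' => by
    rw [evAt_res H hg, evAt_res H hg, evAt, evAt, ← hamiltonian_change H c c',
      (isFP_sres hg _).ev_change (chainRule _ _ _ _)]

theorem exists_evd (hg : IsFP g) (w : SSer M.Fun τ) : ∃ h : SSer M.Fun τ, ∀ c : M.Coord,
    M.sres le_top h = evdAt H c le_rfl g w :=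
  exists_glue (fun c : M.Coord => c.dom) M.exists_chart (fun c => evdAt H c le_rfl g w)
    fun c c' => by
      rw [evdAt_res H hg, evdAt_res H hg, evdAt, evdAt, ← hamiltonian_change H c c',
        (isFP_sres hg _).evd_change (chainRule _ _ _ _)]

/-- The value of the Hamilton-Jacobi vector field. -/
noncomputable def hamVal (hg : IsFP g) : SSer M.Fun τ := (exists_ev H hg).choose

theorem sres_hamVal (hg : IsFP g) (c : M.Coord) {V : Opens M.pt} (hV : V ≤ c.dom) :
    M.sres le_top (hamVal H hg) = evAt H c hV g := by
  rw [← evAt_res H hg c le_rfl hV, ← (exists_ev H hg).choose_spec c, sres_sres]; rfl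

/-- The derivative of the Hamilton-Jacobi vector field. -/
noncomputable def hamDir (hg : IsFP g) : SSer M.Fun τ →ₗ[ℝ] SSer M.Fun τ where
  toFun w := (exists_evd H hg w).choose
  map_add' w w' := ser_ext_coord fun c => by
    have h := fun w => (exists_evd H hg w).choose_spec c
    rw [h, sres_eq le_top (_ + _), map_add, ← sres_eq, ← sres_eq, h, h, evdAt, sres_eq le_top (w + w'),
      map_add, evd_add]
    rfl
  map_smul' x w := ser_ext_coord fun c => by
    have h := fun w => (exists_evd H hg w).choose_spec c
    rw [h, sres_eq le_top (_ • _), map_smul, ← sres_eq, h, evdAt, sres_eq le_top (x • w),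
      map_smul, evd_smul]
    rfl

theorem sres_hamDir (hg : IsFP g) (w : SSer M.Fun τ) (c : M.Coord) {V : Opens M.pt} (hV : V ≤ c.dom) :
    M.sres le_top (hamDir H hg w) = evdAt H c hV g w := by
  rw [← evdAt_res H hg c le_rfl hV, ← (exists_evd H hg w).choose_spec c, sres_sres]; rfl

theorem hasParity_of_sres {F : SSer M.Fun τ} {e : Bool}
    (h : ∀ c : M.Coord, HasParity e (M.sres (le_top : c.dom ≤ ⊤) F)) : HasParity e F := by
  refine ser_ext_coord fun c => ?_
  have h1 := h c
  rw [← sresHom_apply] at h1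
  rw [← sresHom_apply, ← sresHom_apply, sresHom_isSuper, h1]
  cases e
  · rfl
  · exact (map_neg _ _).symm

theorem sres_mul {U V : Opens M.pt} (h : V ≤ U) (F G : SSer (M.O U) τ) :
    M.sres h (F * G) = M.sres h F * M.sres h G := by
  simp only [← sresHom_apply, map_mul]

theorem sres_X {U V : Opens M.pt} (h : V ≤ U) (j : Fin r) :
    M.sres h (X (M.O U) τ j) = X (M.O V) τ j := by rw [← sresHom_apply, sresHom_X]

open Classical in
/-- The Hamilton-Jacobi vector field as a formal map. -/
noncomputable def hamMap : FormalMap M.Fun M.Fun true where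
  val g := if hg : IsFP g then hamVal H hg else 0
  dir g := if hg : IsFP g then hamDir H hg else 0
  val_par {r τ g} hg := by
    rw [dif_pos hg]
    refine hasParity_of_sres fun c => ?_
    rw [sres_hamVal H hg c le_rfl]
    exact (isFP_sres hg _).ev_par _ (hamiltonian_par H c le_rfl)
  val_deriv {r τ g} hg j := by
    rw [dif_pos hg, dif_pos hg]
    refine ser_ext_coord fun c => ?_
    rw [sres_deriv, sres_hamVal H hg c le_rfl, sres_hamDir H hg _ c le_rfl, evAt,
      (isFP_sres hg _).deriv_ev, ← sres_deriv]
  dir_par {r τ g} hg f h hh := by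
    rw [dif_pos hg]
    refine hasParity_of_sres fun c => ?_
    rw [sres_hamDir H hg _ c le_rfl]
    refine evd_par (isFP_sres hg _) _ (hamiltonian_par H c le_rfl) ?_
    rw [← sresHom_apply]; exact (sresHom_isSuper _ _).hasParity hh
  dir_X {r τ g} hg h j := by
    rw [dif_pos hg]
    refine ser_ext_coord fun c => ?_
    rw [sres_hamDir H hg _ c le_rfl, sres_eq le_top (_ • _), map_smul, ← sres_eq, sres_mul, sres_X,
      sres_hamDir H hg _ c le_rfl, evdAt, sres_mul, sres_X, evd_mul_X (isFP_sres hg _) _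
        (hamiltonian_par H c le_rfl)]
  dir_ord {r τ g} hg N h hh := by
    rw [dif_pos hg]
    refine fun m hm => M.eq_of_locally_eq _ _ fun x _ => ?_
    obtain ⟨c, hc⟩ := M.exists_chart x
    refine ⟨_, le_top, hc, ?_⟩
    rw [← coeff_sres, sres_hamDir H hg _ c le_rfl, map_zero]
    exact evd_ord _ _ _ (mapL_ordGE (M.res le_top).toLinearMap hh) m hm
  val_ren {r r' τ τ' g} hg e he := by
    rw [dif_pos hg, dif_pos (hg.renP he)]
    refine ser_ext_coord fun c => ?_
    rw [sres_renP, sres_hamVal H hg c le_rfl, sres_hamVal H _ c le_rfl, evAt, evAt, sres_renP]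
    have h1 := (isFP_sres hg c.dom).ren_ev (cs := sys c.toChart le_rfl)
      (cs' := sys c.toChart le_rfl) IsSuper.id (fun i x => rfl) he (M.sres le_rfl (H.H c))
    rw [mapL_id_fun] at h1
    exact h1
  dir_ren {r r' τ τ' g} hg e he h := by
    rw [dif_pos hg, dif_pos (hg.renP he)]
    refine ser_ext_coord fun c => ?_
    rw [sres_renP, sres_hamDir H hg _ c le_rfl, sres_hamDir H _ _ c le_rfl, evdAt, evdAt, sres_renP,
      sres_renP]
    have h1 := (isFP_sres hg c.dom).ren_evd (cs := sys c.toChart le_rfl)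
      (cs' := sys c.toChart le_rfl) IsSuper.id (fun i x => rfl) he (M.sres le_rfl (H.H c))
      (M.sres le_top h)
    rw [mapL_id_fun] at h1
    exact h1

theorem hamMap_val (hg : IsFP g) : (hamMap H).val g = hamVal H hg := dif_pos hg

theorem hamMap_dir (hg : IsFP g) (w : SSer M.Fun τ) : (hamMap H).dir g w = hamDir H hg w := by
  rw [hamMap]; simp only [dif_pos hg]

/-- For a formal point `∂g/∂x` has no constant term, so that the part of fibre degree `N` has order
`N` and a given coefficient involves finitely many degrees. Local finiteness is then automatic. -/
theorem isLocSumSer_orderSum {U : Opens M.pt} {F : ℕ → SSer (M.O U) τ}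
    (hF : ∀ N, F N ∈ ordGE (M.O U) τ N) : M.IsLocSumSer F (orderSum F) := fun m x hx => by
  refine ⟨U, le_rfl, m.degree + 1, hx, fun N hN => ?_, ?_⟩
  · change M.res _ (coeff m (F N)) = 0
    rw [hF N m (by omega), map_zero]
  · by_cases hm : Adm τ m
    · rw [orderSum, coeff_mk hm, map_sum]
    · simp only [coeff_of_not_adm hm, map_zero, Finset.sum_const_zero]

theorem hamJacobi_eq (c : M.Coord) {U : Opens M.pt} (hU : U ≤ c.dom) (f : SSer (M.O U) τ) (N : ℕ) :
    hamJacobi H c hU f N = substDeg (C τ) (fun a => mapL ((sys c.toChart hU).d a) f)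
      (M.sres hU (H.H c)) N := by
  rw [hamJacobi]
  congr 1
  funext a
  exact map_pd_eq c hU a f

theorem isHamJacobiValue_hamMap (hg : IsFP g) : IsHamJacobiValue H g ((hamMap H).val g) := fun c => by
  have h : hamJacobi H c le_rfl (M.sres le_top g) = fun N => substDeg (C τ)
      (fun a => mapL ((sys c.toChart le_rfl).d a) (M.sres le_top g)) (M.sres le_rfl (H.H c)) N :=
    funext fun N => hamJacobi_eq H c le_rfl _ N
  rw [h, hamMap_val H hg, sres_hamVal H hg c le_rfl]
  exact isLocSumSer_orderSum (substDeg_mem _ ((isFP_sres hg _).grad_zero _) _)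

end GradedSupermanifold

/-! ### The formal `Q`-morphism -/

/-- The coefficients of the image under a homomorphism over `A`. -/
theorem SSer.coeff_hom {A : Type*} [Ring A] [Algebra ℝ A] [SuperAlgebra A] {n r : ℕ}
    {π : Fin n → Bool} {τ : Fin r → Bool} {θ : SSer A π →ₐ[ℝ] SSer A τ}
    (hθ : ∀ N, ∀ F ∈ ordGE A π N, θ F ∈ ordGE A τ N) (hC : ∀ a, θ (C π a) = C τ a)
    (m : Fin r →₀ ℕ) (F : SSer A π) : coeff m (θ F) = ∑ k ∈ expLT (Fin n) (m.degree + 1),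
      coeff k F * coeff m (θ (mono A π k)) := by
  have h := hθ _ _ (sub_trunc_mem (m.degree + 1) F) m (by omega)
  rw [map_sub, coeff_sub, sub_eq_zero, map_sum, coeff_sum] at h
  rw [h]
  exact Finset.sum_congr rfl fun k _ => by rw [map_mul, hC, coeff_C_mul]

/-! ### Locally finite sums of functions -/

namespace GradedSupermanifold
variable {M : GradedSupermanifold} {U : Opens M.pt}

theorem IsLocSum.mul_right {F : ℕ → M.O U} {f : M.O U} (h : M.IsLocSum F f) (b : M.O U) :
    M.IsLocSum (fun N => F N * b) (f * b) := fun x hx => by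
  obtain ⟨W, hW, N₀, hx, h1, h2⟩ := h x hx
  refine ⟨W, hW, N₀, hx, fun N hN => ?_, ?_⟩
  · rw [map_mul, h1 N hN, zero_mul]
  · simp only [map_mul, ← Finset.sum_mul, h2]

theorem IsLocSum.zero : M.IsLocSum (fun _ => (0 : M.O U)) 0 := fun x hx =>
  ⟨U, le_rfl, 0, hx, fun _ _ => map_zero _, by simp⟩

theorem isLocSum_witness {F : ℕ → M.O U} {f : M.O U} {W W' : Opens M.pt} {hW : W ≤ U} {N₀ N₁ : ℕ}
    (h1 : ∀ N, N₀ ≤ N → M.res hW (F N) = 0)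
    (h2 : ∑ N ∈ Finset.range N₀, M.res hW (F N) = M.res hW f) (h : W' ≤ W) (hN : N₀ ≤ N₁) :
    (∀ N, N₁ ≤ N → M.res (h.trans hW) (F N) = 0) ∧
      ∑ N ∈ Finset.range N₁, M.res (h.trans hW) (F N) = M.res (h.trans hW) f := by
  have h3 : ∀ N, N₀ ≤ N → M.res (h.trans hW) (F N) = 0 := fun N hN => by
    rw [← M.res_res hW h, h1 N hN, map_zero]
  refine ⟨fun N hN' => h3 N (hN.trans hN'), ?_⟩
  rw [← M.res_res hW h, ← h2, map_sum]
  simp only [M.res_res]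
  refine (Finset.sum_subset (Finset.range_mono hN) fun N _ hN' => h3 N ?_).symm
  simpa using hN'

theorem IsLocSum.add {F G : ℕ → M.O U} {f g : M.O U} (hF : M.IsLocSum F f) (hG : M.IsLocSum G g) :
    M.IsLocSum (fun N => F N + G N) (f + g) := fun x hx => by
  obtain ⟨W, hW, N₀, hxW, h1, h2⟩ := hF x hx
  obtain ⟨W', hW', N₀', hxW', h1', h2'⟩ := hG x hx
  obtain ⟨h3, h4⟩ := isLocSum_witness h1 h2 (inf_le_left : W ⊓ W' ≤ W) (le_max_left N₀ N₀')
  obtain ⟨h3', h4'⟩ := isLocSum_witness h1' h2' (inf_le_right : W ⊓ W' ≤ W') (le_max_right N₀ N₀')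
  refine ⟨W ⊓ W', inf_le_left.trans hW, max N₀ N₀', ⟨hxW, hxW'⟩, fun N hN => ?_, ?_⟩
  · rw [map_add, h3 N hN, h3' N hN, add_zero]
  · simp only [map_add, Finset.sum_add_distrib]
    rw [h4, h4']

theorem IsLocSum.sum {α : Type*} (s : Finset α) {F : α → ℕ → M.O U} {f : α → M.O U}
    (h : ∀ i ∈ s, M.IsLocSum (F i) (f i)) :
    M.IsLocSum (fun N => ∑ i ∈ s, F i N) (∑ i ∈ s, f i) := by
  classical
  induction s using Finset.induction_on with
  | empty => simpa using IsLocSum.zero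
  | insert i s hi ih =>
    simp only [Finset.sum_insert hi]
    exact (h i (Finset.mem_insert_self i s)).add
      (ih fun j hj => h j (Finset.mem_insert_of_mem hj))

/-- A property of a sum that can be checked locally. -/
theorem isLocSum_of_locally {F : ℕ → M.O U} {f : M.O U}
    (h : ∀ x ∈ U, ∃ (W : Opens M.pt) (hW : W ≤ U), x ∈ W ∧
      M.IsLocSum (fun N => M.res hW (F N)) (M.res hW f)) : M.IsLocSum F f := fun x hx => by
  obtain ⟨W, hW, hxW, h1⟩ := h x hx
  obtain ⟨W', hW', N₀, hx', h2, h3⟩ := h1 x hxW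
  simp only [M.res_res] at h2 h3
  exact ⟨W', hW'.trans hW, N₀, hx', h2, h3⟩

/-- By `coeff_hom`, a coefficient of the image is a finite combination of coefficients of the
argument, with multipliers independent of `N`. So local finiteness survives the insertion of `q`,
also when `S^0 ≠ 0` and the sum is not controlled by the order. -/
theorem IsLocSumSer.sigma {n r : ℕ} {π : Fin n → Bool} {τ : Fin r → Bool}
    {q : Fin n → SSer (M.O U) τ} (hq : ∀ i, HasParity (π i) (q i)) (h0 : ∀ i, coeff 0 (q i) = 0)
    {F : ℕ → SSer (M.O U) π} {f : SSer (M.O U) π} (h : M.IsLocSumSer F f) :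
    M.IsLocSumSer (fun N => SSer.sigma hq h0 (F N)) (SSer.sigma hq h0 f) := fun m => by
  have h1 := coeff_hom (θ := SSer.sigma hq h0) (sigma_ord hq h0) (sigma_C hq h0) m
  rw [funext fun N => h1 (F N), h1 f]
  exact IsLocSum.sum _ fun k _ => (h k).mul_right _

theorem sres_hamJacobi {k : ℤ} (H : MasterHamiltonian M k) (c : M.Coord) {V : Opens M.pt}
    (hU : U ≤ c.dom) (h : V ≤ U) {r : ℕ} {τ : Fin r → Bool} (f : SSer (M.O U) τ) (N : ℕ) :
    M.sres h (hamJacobi H c hU f N) = hamJacobi H c (h.trans hU) (M.sres h f) N := by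
  rw [hamJacobi_eq, hamJacobi_eq, ← sresHom_apply, ← substDeg_nat (ρ' := C τ) (sresHom h τ)
    (M.res h).toLinearMap (fun a => (ren_C _ _ a).symm), ← sres_eq, sres_sres]
  congr 1
  funext a
  rw [sresHom_apply, sres_mapL_d]

end GradedSupermanifold

namespace ThickMorphism
variable {M₁ M₂ : GradedSupermanifold} {s : ℤ} {Φ : ThickMorphism M₁ M₂ s} {r : ℕ}
  {τ : Fin r → Bool} {g : SSer M₂.Fun τ}

/-- The derivatives of the pullback along `M₁`. -/
theorem IsPullback.mapL_d (hg : IsFormalPoint g) {f : SSer M₁.Fun τ} (hf : Φ.IsPullback g f)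
    (c₁ : M₁.Coord) {c : M₂.Coord} {V : Opens M₂.pt} {U : Opens M₁.pt} {hV : V ≤ c.dom}
    {hU : U ≤ Opens.comap Φ.φ.base V} (hU₁ : U ≤ c₁.dom)
    {y q : Fin M₂.dim → SSer (M₁.O U) τ} (hs : Φ.IsSolAt c hV hU g y q) (a : Fin M₁.dim) :
    mapL ((sys c₁.toChart hU₁).d a) (M₁.sres le_top f) = subst (C τ) q
      (mapL ((sys c₁.toChart hU₁).d a)
        (M₁.sres (hU.trans (Opens.comap_mono Φ.φ.base hV)) (Φ.S c))) := by
  have h2 : _ = pval _ _ _ _ y q := hf.valAt hg hs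
  have hd := (sys c₁.toChart hU₁).d_der a
  rw [h2]
  -- A derivative along `M₁` sees no explicit dependence in `g`, which lives on `M₂`, so only
  -- `∂S/∂x` at `q = q(x)` remains.
  refine (hs.pval_der (Φ.φ.pullTo_isSuper _) (isDer_mapL_id hd) (cont_mapL _) (fun b => ?_)
    hd (fun a => mapL_C _ _)).trans ?_
  · simp only [mapL_C, ← C_mul, ← C_sum]
    exact congrArg _ (Φ.φ.pd_pullTo c₁.toChart c.toChart hV hU hU₁ a b)
  · rw [Finset.sum_eq_zero fun j _ => by rw [mapL_X hd, zero_mul], zero_add]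

/-- The pullback maps the value of the Hamilton-Jacobi vector field at `g` to that at `f`. -/
theorem isHamJacobiValue_dir {k : ℤ} {H₁ : MasterHamiltonian M₁ k} {H₂ : MasterHamiltonian M₂ k}
    (hΦ : Φ.HamiltonJacobi H₁ H₂) (hg : IsFormalPoint g) {f : SSer M₁.Fun τ}
    (hf : Φ.IsPullback g f) :
    IsHamJacobiValue H₁ f (Φ.dirHom hg (hamVal H₂ (isFormalPoint_iff.1 hg))) := by
  refine fun c₁ m => isLocSum_of_locally fun x hx => ?_
  obtain ⟨c, hc⟩ := Φ.mem_cover x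
  refine ⟨c₁.dom ⊓ Opens.comap Φ.φ.base c.dom, inf_le_left, ⟨hx, hc⟩, ?_⟩
  set U := c₁.dom ⊓ Opens.comap Φ.φ.base c.dom
  have hU : U ≤ Opens.comap Φ.φ.base c.dom := inf_le_right
  have hU₁ : U ≤ c₁.dom := inf_le_left
  obtain ⟨y, q, hs⟩ := exists_isSolAt Φ c le_rfl hU hg
  have hT := Φ.isThick c le_rfl hU
  have hφ := Φ.φ.pullTo_isSuper hU
  set S := M₁.sres (hU.trans (Opens.comap_mono Φ.φ.base le_rfl)) (Φ.S c) with hS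
  -- The Hamilton-Jacobi equation for `S` with the solution `q(x)` inserted for the momenta.
  have h1 := IsLocSumSer.sigma hs.qpar hs.qzero (hΦ c₁ c)
  -- Left side, degree by degree: inserting `q(x)` into `∂S/∂x` gives `∂f/∂x`.
  have h2 : ∀ N, M₁.sres hU₁ (hamJacobi H₁ c₁ le_rfl (M₁.sres le_top f) N) =
      sigma hs.qpar hs.qzero (hamJacobi H₁ c₁ hU₁ S N) := fun N => by
    rw [sres_hamJacobi, sres_sres, hamJacobi_eq, hamJacobi_eq,
      ← substDeg_nat (ρ' := C τ) (sigma hs.qpar hs.qzero) LinearMap.id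
        (fun a => (sigma_C _ _ a).symm)]
    have h3 : ∀ F : SSer (M₁.O U) M₁.par, mapL LinearMap.id F = F := fun F => mapL_id_fun F
    rw [h3]
    congr 1
    funext a
    exact hf.mapL_d hg c₁ hU₁ hs a
  -- Right side: `H₂(y, q)` with `q = (∂g/∂y)(y)` is `H₂(y, ∂g/∂y)` with the solution substituted
  -- for the coordinates, which is the tangent map applied to `Q_{H₂}(g)`.
  have h3 : sigma hs.qpar hs.qzero ((H₂.H c).subst (taylor Φ.φ c le_rfl hU (yOf S))
      (X _ M₂.par)) = M₁.sres le_top (Φ.dirHom hg (hamVal H₂ (isFormalPoint_iff.1 hg))) := by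
    have h4 : ∀ F : SSer (M₂.O c.dom) M₂.par, mapL LinearMap.id F = F := fun F => mapL_id_fun F
    rw [sres_dirHom hg _ hs, ThickMorphism.hatAt, sres_hamVal H₂ (isFormalPoint_iff.1 hg) c le_rfl,
      Φ.φ.taylor_eq, yOf_eq, ← hatHom_apply hφ hs.ext]
    have h5 := subst_nat (ρ := C τ) (ρ' := tay (sys c.toChart le_rfl) (Φ.φ.pullTo hU) y)
      (hatHom (sys c.toChart le_rfl) (Φ.φ.pullTo hU) y hφ hs.ext)
      (fun N F hF => subst_mem tay_zero coeff_zero_X hF) LinearMap.id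
      (fun b => (hatHom_C hφ hs.ext b).symm)
      ((isFP_sres (isFormalPoint_iff.1 hg) c.dom).grad_zero (sys c.toChart le_rfl))
      (M₂.sres le_rfl (H₂.H c))
    have h6 := subst_nat (ρ := tay (sys c.toChart le_rfl) (Φ.φ.pullTo hU) (yo S))
      (ρ' := tay (sys c.toChart le_rfl) (Φ.φ.pullTo hU) y)
      (sigma hs.qpar hs.qzero) (sigma_ord _ _) LinearMap.id (fun b => by
        have := tay_nat (cs := sys c.toChart le_rfl) (cs' := sys c.toChart le_rfl)
          (φ := Φ.φ.pullTo hU) (φ' := Φ.φ.pullTo hU) (sigma hs.qpar hs.qzero) (sigma_ord _ _)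
          LinearMap.id (fun b => sigma_C _ _ _) (fun _ _ => rfl) (fun _ => rfl)
          (hT.extends hφ).zero b
        rw [← this]
        congr 1
        funext i
        exact hs.hy i) coeff_zero_X (H₂.H c)
    rw [h4] at h5 h6
    refine h6.symm.trans (Eq.trans ?_ h5)
    rw [sres_refl]
    congr 1
    funext i
    rw [sigma_X, hs.hq i]; rfl
  simp only [← coeff_sres]
  have h4 := h1 m
  rw [h3] at h4
  simp only [h2, sres_sres]
  exact h4

/-- The first order expansion of the pullback has the tangent map as its linear term, and by
`isHamJacobiValue_dir` the tangent map sends `Q_{H₂}(g)` to `Q_{H₁}(f)`. -/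
theorem isFormalQMorphism {k : ℤ} {H₁ : MasterHamiltonian M₁ k} {H₂ : MasterHamiltonian M₂ k}
    (hΦ : Φ.HamiltonJacobi H₁ H₂) : Φ.IsFormalQMorphism H₁ H₂ := fun r τ g f hg hf => by
  have hg' := isFormalPoint_iff.1 hg
  refine ⟨hamVal H₂ hg', Φ.dirHom hg (hamVal H₂ hg'), ?_, isHamJacobiValue_dir hΦ hg hf,
    fun ε hε => ?_⟩
  · rw [← hamMap_val H₂ hg']; exact isHamJacobiValue_hamMap H₂ hg'
  · have hp : HasParity true (hamVal H₂ hg') := by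
      rw [← hamMap_val H₂ hg']; exact (hamMap H₂).val_par hg'
    have h1 := Φ.formalMap.val_add_mul_X hg' hp hε
    rw [formalMap_dir hg, (Φ.isPullback_val hg).unique hg hf] at h1
    rw [← h1]
    exact Φ.isPullback_val (isFormalPoint_iff.2 (FormalMap.isFP_add_mul_X hg' hp hε))

end ThickMorphism

/-! ### Square-free monomials and Koszul signs -/

namespace SSer
variable {ι : Type*} [DecidableEq ι]

/-- The exponent of the product of the variables in `S`. -/
noncomputable def chi (S : Finset ι) : ι →₀ ℕ := ∑ j ∈ S, Finsupp.single j 1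

theorem chi_apply (S : Finset ι) (i : ι) : chi S i = if i ∈ S then 1 else 0 := by
  rw [chi, Finsupp.finset_sum_apply]
  simp [Finsupp.single_apply]

theorem adm_chi {π : ι → Bool} (S : Finset ι) : Adm π (chi S) := fun i _ => by
  rw [chi_apply]; split <;> simp

theorem oddDeg_chi [Fintype ι] (π : ι → Bool) (S : Finset ι) :
    oddDeg π (chi S) = ∑ i ∈ S, if π i then 1 else 0 := by
  rw [oddDeg, ← Finset.sum_subset (Finset.subset_univ S)]
  · exact Finset.sum_congr rfl fun i hi => by rw [chi_apply, if_pos hi]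
  · intro i _ hi; rw [chi_apply, if_neg hi, ite_self]

/-- A product over pairs of signs of a sum of transposition numbers. -/
theorem neg_one_pow_crossings {n : ℕ} {π : Fin n → Bool} (m n : Fin n →₀ ℕ) : (-1 : ℝ) ^ crossings π m n =
      ∏ i, ∏ j, if j < i ∧ π i = true ∧ π j = true then (-1 : ℝ) ^ (m i * n j) else 1 := by
  simp only [crossings, ← Finset.prod_pow_eq_pow_sum]
  refine Finset.prod_congr rfl fun i _ => Finset.prod_congr rfl fun j _ => ?_
  split <;> simp

section Prod
variable {A : Type*} [Ring A] [Algebra ℝ A] [SuperAlgebra A] {n : ℕ} {τ : Fin n → Bool}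

/-- A product of monomials. -/
theorem prod_mono {r : ℕ} (k : Fin r → Fin n →₀ ℕ) :
    (List.ofFn fun b => mono A τ (k b)).prod =
      (∏ b, ∏ b', if b < b' then (-1 : ℝ) ^ crossings τ (k b) (k b') else 1) •
        mono A τ (∑ b, k b) := by
  induction r with
  | zero => simp [mono_zero]
  | succ r ih =>
    rw [List.ofFn_succ, List.prod_cons, ih, mul_smul_comm, mono_mul_mono, smul_smul, Fin.sum_univ_succ]
    congr 1
    have h1 : ∀ (s : Finset (Fin r)), crossings τ (k 0) (∑ b ∈ s, k b.succ) =
        ∑ b ∈ s, crossings τ (k 0) (k b.succ) := fun s => by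
      induction s using Finset.induction_on with
      | empty => simp [crossings_zero_right]
      | insert b s hb ih => rw [Finset.sum_insert hb, crossings_add_right, ih, Finset.sum_insert hb]
    rw [Fin.prod_univ_succ, Fin.prod_univ_succ, h1, ← Finset.prod_pow_eq_pow_sum, mul_comm]
    simp [Fin.prod_univ_succ]

/-- The monomials that belong to the parts of a partition. -/
theorem prod_mono_fiber {r : ℕ} (l : Fin n → Fin r) :
    (List.ofFn fun b => mono A τ (chi (Finset.univ.filter fun j => l j = b))).prod =
      koszul τ (fun j => l j) • mono A τ (chi Finset.univ) := by
  rw [prod_mono]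
  congr 1
  · simp only [neg_one_pow_crossings, chi_apply, Finset.mem_filter, Finset.mem_univ,
      true_and]
    rw [koszul]
    have h1 : ∀ b b' : Fin r, (if b < b' then ∏ i, ∏ j, if j < i ∧ τ i = true ∧ τ j = true then
        (-1 : ℝ) ^ ((if l i = b then 1 else 0) * if l j = b' then 1 else 0) else 1 else 1) =
        ∏ i, ∏ j, if l i = b then (if l j = b' then (if b < b' ∧ j < i ∧ τ i = true ∧ τ j = true then
          -1 else 1 : ℝ) else 1) else 1 := fun b b' => by
      split
      · next h =>
        refine Finset.prod_congr rfl fun i _ => Finset.prod_congr rfl fun j _ => ?_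
        simp only [h, true_and]
        split_ifs <;> simp
      · next h => simp [h]
    simp only [h1]
    have h2 : ∀ F : Fin r → Fin r → Fin n → Fin n → ℝ, ∏ b, ∏ b', ∏ i, ∏ j, F b b' i j =
        ∏ j, ∏ i, ∏ b, ∏ b', F b b' i j := fun F => by
      rw [Finset.prod_congr rfl fun b _ => Finset.prod_comm, Finset.prod_comm]
      rw [Finset.prod_congr rfl fun i _ => Finset.prod_congr rfl fun b _ => Finset.prod_comm,
        Finset.prod_congr rfl fun i _ => Finset.prod_comm, Finset.prod_comm]
    rw [h2]
    refine Finset.prod_congr rfl fun j _ => Finset.prod_congr rfl fun i _ => ?_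
    simp only [Finset.prod_ite_irrel, Finset.prod_const_one, Finset.prod_ite_eq, Finset.mem_univ,
      if_true]
    refine if_congr ?_ rfl rfl
    rw [Fin.lt_def]; tauto
  · refine congrArg _ (Finsupp.ext fun i => ?_)
    rw [Finsupp.finset_sum_apply, chi_apply, if_pos (Finset.mem_univ i), Finset.sum_eq_single (l i)]
    · rw [chi_apply, if_pos (by simp)]
    · intro b _ hb; rw [chi_apply, if_neg (by simpa using hb.symm)]
    · simp

theorem degree_chi {n : ℕ} (S : Finset (Fin n)) : (chi S).degree = S.card := by
  rw [Finsupp.degree_eq_sum]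
  simp [chi_apply]

/-- The coefficients after an injective change of parameters. -/
theorem coeff_renP_chi {r : ℕ} {σ : Fin r → Bool} {e : Fin r → Fin n} (he : Function.Injective e)
    (h : RenPar σ τ fun j => some (e j)) (F : SSer A σ) :
    coeff (chi (Finset.univ.image e)) (renP A (fun j => some (e j)) h F) =
      koszul σ (fun j => e j) • coeff (chi Finset.univ) F := by
  have hτ : ∀ j, τ (e j) = σ j := fun j => h j _ rfl
  have hm : ∀ k, renP A (fun j => some (e j)) h (mono A σ k) =
      (List.ofFn fun j => mono A τ (Finsupp.single (e j) 1) ^ k j).prod := fun k => by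
    rw [← zpow_X, map_zpow, zpow]
    congr 2
    funext j
    rw [renP_X]; rfl
  have hpow : ∀ (i : Fin n) (p : ℕ), ∃ c : ℝ, mono A τ (Finsupp.single i 1) ^ p =
      c • mono A τ (Finsupp.single i p) := fun i p => by
    induction p with
    | zero => exact ⟨1, by rw [pow_zero, Finsupp.single_zero, mono_zero, one_smul]⟩
    | succ p ih =>
      obtain ⟨c, hc⟩ := ih
      exact ⟨_, by rw [pow_succ, hc, smul_mul_assoc, mono_mul_mono, smul_smul, ← Finsupp.single_add]⟩
  -- Up to a scalar, the image of `X ^ k` is the monomial with its exponents moved along `e`. That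
  -- suffices to exclude every `k` but the square-free top one, for which `hu` computes the scalar.
  have hgen : ∀ (s : ℕ) (f : Fin s → Fin n) (k : Fin s → ℕ), ∃ c : ℝ,
      (List.ofFn fun j => mono A τ (Finsupp.single (f j) 1) ^ k j).prod =
        c • mono A τ (∑ j, Finsupp.single (f j) (k j)) := fun s f k => by
    choose c hc using fun j => hpow (f j) (k j)
    simp only [hc]
    induction s with
    | zero => exact ⟨1, by simp [mono_zero]⟩
    | succ s ih =>
      obtain ⟨c', hc'⟩ := ih (fun j => f j.succ) (fun j => k j.succ) (fun j => c j.succ)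
        fun j => hc j.succ
      exact ⟨_, by rw [List.ofFn_succ, List.prod_cons, hc', smul_mul_smul_comm, mono_mul_mono,
        smul_smul, Fin.sum_univ_succ]⟩
  have hval : ∀ (k : Fin r →₀ ℕ) j, (∑ j, Finsupp.single (e j) (k j)) (e j) = k j := fun k j => by
    rw [Finsupp.finset_sum_apply, Finset.sum_eq_single j]
    · rw [Finsupp.single_eq_same]
    · intro i _ hi; rw [Finsupp.single_eq_of_ne (he.ne hi.symm)]
    · simp
  have hu : coeff (chi (Finset.univ.image e))
      (renP A (fun j => some (e j)) h (mono A σ (chi Finset.univ))) =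
        algebraMap ℝ A (koszul σ fun j => e j) := by
    rw [hm]
    have h1 : (fun j => mono A τ (Finsupp.single (e j) 1) ^ (chi (Finset.univ : Finset (Fin r))) j) =
        fun j => mono A τ (Finsupp.single (e j) 1) := funext fun j => by
      rw [chi_apply, if_pos (Finset.mem_univ j), pow_one]
    have h2 : ∑ b, Finsupp.single (e b) 1 = chi (Finset.univ.image e) := by
      rw [chi, Finset.sum_image fun _ _ _ _ h => he h]
    rw [h1, prod_mono, h2, coeff_smul, coeff_mono (adm_chi _), if_pos rfl, Algebra.algebraMap_eq_smul_one]
    congr 1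
    rw [koszul]
    refine Finset.prod_congr rfl fun i _ => Finset.prod_congr rfl fun j _ => ?_
    rw [neg_one_pow_crossings, Finset.prod_eq_single (e i), Finset.prod_eq_single (e j)]
    · simp only [Finsupp.single_eq_same, hτ, mul_one, pow_one, Fin.lt_def]
      split_ifs <;> tauto
    · intro b _ hb; simp [Finsupp.single_eq_of_ne hb]
    · simp
    · intro b _ hb; simp [Finsupp.single_eq_of_ne hb]
    · simp
  rw [coeff_hom (θ := renP A (fun j => some (e j)) h) (fun N F hF => ren_ord IsSuper.id h N F hF)
    (renP_C h), Finset.sum_eq_single (chi Finset.univ), hu,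
    ← Algebra.commutes, ← Algebra.smul_def]
  · intro k _ hk
    obtain ⟨c, hc⟩ := hgen r e k
    rw [hm, hc, coeff_smul, coeff_mono (adm_chi _), if_neg, smul_zero, mul_zero]
    intro h'
    refine hk (Finsupp.ext fun j => ?_)
    rw [← hval k j, ← h', chi_apply, chi_apply, if_pos (Finset.mem_image_of_mem e (Finset.mem_univ j)),
      if_pos (Finset.mem_univ j)]
  · intro h'
    refine absurd (mem_expLT.2 ?_) h'
    rw [degree_chi, degree_chi, Finset.card_image_of_injective _ he]
    omega

end Prod

/-! #### Koszul signs -/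

/-- The sign of the reversal of `N` odd factors. -/
def theta (N : ℕ) : ℝ := (-1) ^ N.choose 2

theorem theta_add (a b : ℕ) : theta (a + b) = theta a * theta b * (-1) ^ (a * b) := by
  rw [theta, theta, theta, ← pow_add, ← pow_add]
  congr 1
  induction b with
  | zero => simp
  | succ b ih =>
    have h1 : ∀ m, (m + 1).choose 2 = m + m.choose 2 := fun m => by
      rw [Nat.choose_succ_succ' m 1, Nat.choose_one_right]
    rw [← add_assoc, h1, ih, h1]; ring

/-- The sign of the reversal of a tuple of parities `p`. -/
noncomputable def sg {n : ℕ} (p : Fin n → Bool) : ℝ := koszul p fun j => n - j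

/-- The labels `n - j` decrease, so every pair of odd indices is inverted and contributes a sign.
Hence the sign depends only on the number of odd entries. -/
theorem sg_eq {n : ℕ} (p : Fin n → Bool) : sg p = theta (oddDeg p (chi Finset.univ)) := by
  have h1 : ∀ {n : ℕ} (p : Fin n → Bool), sg p = ∏ i, ∏ j, if i < j ∧ p i = true ∧ p j = true then
      (-1 : ℝ) else 1 := fun {n} p => by
    rw [sg, koszul]
    refine Finset.prod_congr rfl fun i _ => Finset.prod_congr rfl fun j _ => if_congr ?_ rfl rfl
    constructor
    · rintro ⟨h1, -, h2⟩; exact ⟨h1, h2⟩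
    · rintro ⟨h1, h2⟩; exact ⟨h1, by have := j.2; rw [Fin.lt_def] at h1; omega, h2⟩
  rw [h1, oddDeg_chi]
  induction n with
  | zero => simp [theta]
  | succ n ih =>
    have h2 := ih (fun j => p j.succ)
    rw [Fin.prod_univ_succ, Fin.prod_univ_succ, Fin.sum_univ_succ, theta_add, ← h2]
    have h3 : theta (if p 0 = true then 1 else 0) = 1 := by split <;> simp [theta]
    rw [h3, one_mul, mul_comm]
    congr 1
    · refine Finset.prod_congr rfl fun i _ => ?_
      rw [Fin.prod_univ_succ]; simp
    · cases hp : p 0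
      · simp
      · simp [Finset.prod_ite]

theorem sg_mul_self {n : ℕ} (p : Fin n → Bool) : sg p * sg p = 1 := by
  rw [sg_eq, theta, neg_one_pow_mul_self]

theorem sg_cons {n : ℕ} (a : Bool) (p : Fin n → Bool) :
    sg (Fin.cons a p : Fin (n + 1) → Bool) = sgn (a && opar p (chi Finset.univ)) * sg p := by
  rw [sg_eq, sg_eq, oddDeg_chi, Fin.sum_univ_succ, theta_add, opar, oddDeg_chi]
  simp only [Fin.cons_zero, Fin.cons_succ]
  cases a
  · simp [theta]
  · simp [theta, neg_one_pow_eq_sgn, mul_comm]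

theorem opar_chi_univ_succ {n : ℕ} (p : Fin (n + 1) → Bool) :
    opar p (chi Finset.univ) = (p 0 ^^ opar (fun j : Fin n => p j.succ) (chi Finset.univ)) := by
  have h : ∀ (a : Bool), (if a then 1 else 0 : ℕ).bodd = a := by decide
  rw [opar, oddDeg_chi, Fin.sum_univ_succ, Nat.bodd_add, h, opar, oddDeg_chi]

theorem oddDeg_comp {k n : ℕ} (p : Fin n → Bool) (e : Fin k ↪ Fin n) :
    oddDeg (p ∘ e) (chi Finset.univ) = oddDeg p (chi (Finset.univ.map e)) := by
  rw [oddDeg_chi, oddDeg_chi, Finset.sum_map]; rfl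

theorem koszul_strictMono {k n : ℕ} (p : Fin k → Bool) {e : Fin k → Fin n} (he : StrictMono e) :
    koszul p (fun j => e j) = 1 :=
  Finset.prod_eq_one fun i _ => Finset.prod_eq_one fun j _ => if_neg fun h =>
    absurd (he h.1) (not_lt.2 (le_of_lt h.2.1))

theorem koszul_swap {n : ℕ} (p : Fin n → Bool) (i : ℕ) (h : i + 1 < n) :
    koszul p (fun j => Equiv.swap (⟨i, by omega⟩ : Fin n) ⟨i + 1, h⟩ j) =
      sgn (p ⟨i, by omega⟩ && p ⟨i + 1, h⟩) := by
  have h1 : ∀ a b : Fin n, (a < b ∧ (Equiv.swap (⟨i, by omega⟩ : Fin n) ⟨i + 1, h⟩ b : ℕ) <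
      Equiv.swap (⟨i, by omega⟩ : Fin n) ⟨i + 1, h⟩ a) ↔ a = ⟨i, by omega⟩ ∧ b = ⟨i + 1, h⟩ := by
    rintro ⟨a, ha⟩ ⟨b, hb⟩
    simp only [Equiv.swap_apply_def, Fin.mk_lt_mk, Fin.mk.injEq]
    split_ifs <;> simp only [] <;> omega
  have h2 : ∀ a b : Fin n, (a < b ∧ (Equiv.swap (⟨i, by omega⟩ : Fin n) ⟨i + 1, h⟩ b : ℕ) <
      Equiv.swap (⟨i, by omega⟩ : Fin n) ⟨i + 1, h⟩ a ∧ p a = true ∧ p b = true) ↔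
      (a = ⟨i, by omega⟩ ∧ b = ⟨i + 1, h⟩) ∧ p a = true ∧ p b = true := fun a b => by
    rw [← and_assoc, h1]
  unfold koszul
  simp only [h2]
  rw [Finset.prod_eq_single ⟨i, by omega⟩, Finset.prod_eq_single ⟨i + 1, h⟩]
  · simp [sgn]
  · intro b _ hb; rw [if_neg (by tauto)]
  · simp
  · intro a _ ha
    exact Finset.prod_eq_one fun b _ => by rw [if_neg (by tauto)]
  · simp

/-- The rearrangement sign for two complementary subsets. -/
theorem koszul_compl {n : ℕ} (p : Fin n → Bool) (I : Finset (Fin n)) :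
    koszul p (fun j => if j ∈ I then 0 else 1) * (-1) ^ crossings p (chi Iᶜ) (chi I) =
      (-1) ^ (oddDeg p (chi I) * oddDeg p (chi Iᶜ)) := by
  rw [neg_one_pow_crossings, koszul, ← Finset.prod_mul_distrib, oddDeg_chi, oddDeg_chi,
    Finset.sum_mul_sum, Finset.sum_comm, ← Finset.prod_pow_eq_pow_sum,
    ← Finset.prod_subset (Finset.subset_univ Iᶜ)]
  · refine Finset.prod_congr rfl fun i hi => ?_
    rw [← Finset.prod_mul_distrib, ← Finset.prod_pow_eq_pow_sum,
      ← Finset.prod_subset (Finset.subset_univ I)]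
    · refine Finset.prod_congr rfl fun j hj => ?_
      have hne : i ≠ j := by rintro rfl; exact Finset.mem_compl.1 hi hj
      simp only [Finset.mem_compl.1 hi, hj, chi_apply, hi, if_true, if_false]
      rcases lt_or_gt_of_ne hne with h | h
      · simp [h, h.le, not_lt.2 h.le]; cases p i <;> cases p j <;> simp
      · simp [h, h.le, not_lt.2 h.le]; cases p i <;> cases p j <;> simp
    · intro j _ hj
      simp [chi_apply, hj, Finset.mem_compl.1 hi]
  · intro i _ hi
    have hi' : i ∈ I := by simpa using hi
    rw [← Finset.prod_mul_distrib]
    refine Finset.prod_eq_one fun j _ => ?_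
    simp [chi_apply, hi']

end SSer

/-! ### Taylor coefficients of formal maps -/

namespace SSer
variable {V : Type} [Ring V] [Algebra ℝ V] [SuperAlgebra V] {n k : ℕ}

/-- The formal point `∑ v_j t_j`. -/
noncomputable def lin (p : Fin n → Bool) (v : Fin n → V) : SSer V p := ∑ j, C p (v j) * X V p j

theorem isFP_lin {p : Fin n → Bool} {v : Fin n → V} (hv : ∀ j, HasParity (p j) (v j)) :
    IsFP (lin p v) := by
  constructor
  · refine HasParity.sum fun j _ => ?_
    have h := (hasParity_C (π := p) (hv j)).mul (hasParity_X (A := V) (π := p) j)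
    rwa [Bool.xor_self] at h
  · change coeffL 0 (lin p v) = 0
    rw [lin, map_sum]
    refine Finset.sum_eq_zero fun j _ => ?_
    exact (coeff_C_mul _ _ _).trans (by rw [coeff_zero_X, mul_zero])

theorem deriv_lin (p : Fin n → Bool) (v : Fin n → V) (i : Fin n) :
    deriv i (lin p v) = C p (pinv (p i) (v i)) := by
  rw [← derivL_apply, lin, map_sum, Finset.sum_eq_single i]
  · rw [(isDer_derivL i).leib, derivL_apply, derivL_apply, deriv_C, zero_mul, zero_add, deriv_X,
      if_pos rfl, mul_one, AlgHom.id_apply, pinv_C]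
  · intro j _ hj
    rw [(isDer_derivL i).leib, derivL_apply, derivL_apply, deriv_C, zero_mul, zero_add, deriv_X,
      if_neg hj.symm, mul_zero]
  · simp

theorem renPar_comp (p : Fin n → Bool) (e : Fin k → Fin n) :
    RenPar (p ∘ e) p fun j => some (e j) := fun j l h => by rw [← Option.some.inj h]; rfl

theorem kill_lin (p : Fin n → Bool) (v : Fin n → V) {e : Fin k → Fin n}
    (he : Function.Injective e) :
    kill V p (Finset.univ.image e)ᶜ (lin p v) =
      renP V (fun j => some (e j)) (renPar_comp p e) (lin (p ∘ e) (v ∘ e)) := by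
  rw [lin, lin, map_sum, kill, map_sum, ← Finset.sum_subset (Finset.subset_univ (Finset.univ.image e)),
    Finset.sum_image fun _ _ _ _ h => he h]
  · refine Finset.sum_congr rfl fun j _ => ?_
    rw [map_mul, map_mul, renP_C, renP_C, renP_X, renP_X, renX, renX, killE, if_neg (by simp)]
    rfl
  · intro j _ hj
    rw [map_mul, renP_C, renP_X, renX, killE, if_pos (by simpa using hj)]
    exact mul_zero _

theorem kill_C (p : Fin n → Bool) (S : Finset (Fin n)) (a : V) : kill V p S (C p a) = C p a :=
  renP_C _ a

theorem coeff_kill_chi (p : Fin n → Bool) (S : Finset (Fin n)) (F : SSer V p) :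
    coeff (chi S) (kill V p Sᶜ F) = coeff (chi S) F := by
  rw [coeff_kill, if_pos fun s hs => by rw [chi_apply, if_neg (Finset.mem_compl.1 hs)]]

end SSer

/-- Every argument is the sum of its even and its odd part. This carries sign identities, which only
make sense for homogeneous tuples, over to all tuples. -/
theorem MultilinearMap.ext_hasParity {V W : Type} [Ring V] [Algebra ℝ V] [SuperAlgebra V]
    [AddCommGroup W] [Module ℝ W] {n : ℕ} {f g : MultilinearMap ℝ (fun _ : Fin n => V) W}
    (h : ∀ (p : Fin n → Bool) (v : Fin n → V), (∀ j, HasParity (p j) (v j)) → f v = g v) : f = g := by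
  ext v
  have h1 : v = fun j => ∑ s : Bool, parPart s (v j) := funext fun j => by
    rw [Fintype.sum_bool, add_comm, parPart_add]
  rw [h1, MultilinearMap.map_sum, MultilinearMap.map_sum]
  exact Finset.sum_congr rfl fun p _ => h p _ fun j => parPart_hasParity _ _

namespace FormalMap
variable {V W : Type} [Ring V] [Algebra ℝ V] [SuperAlgebra V] [Ring W] [Algebra ℝ W]
    [SuperAlgebra W] {e : Bool} (Φ : FormalMap V W e) {n k : ℕ}

theorem coeff_val_image {p : Fin n → Bool} {v : Fin n → V} (hv : ∀ j, HasParity (p j) (v j))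
    {c : Fin k → Fin n} (hc : Function.Injective c) :
    coeff (chi (Finset.univ.image c)) (Φ.val (lin p v)) =
      koszul (p ∘ c) (fun j => c j) • coeff (chi Finset.univ) (Φ.val (lin (p ∘ c) (v ∘ c))) := by
  rw [← coeff_kill_chi, kill, Φ.val_ren (isFP_lin hv), ← kill, kill_lin p v hc,
    ← Φ.val_ren (isFP_lin (p := p ∘ c) (v := v ∘ c) fun j => hv (c j)), coeff_renP_chi hc]

theorem coeff_dir_image {p : Fin n → Bool} {v : Fin n → V} (hv : ∀ j, HasParity (p j) (v j))
    {c : Fin k → Fin n} (hc : Function.Injective c) (a : V) :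
    coeff (chi (Finset.univ.image c)) (Φ.dir (lin p v) (C p a)) =
      koszul (p ∘ c) (fun j => c j) •
        coeff (chi Finset.univ) (Φ.dir (lin (p ∘ c) (v ∘ c)) (C _ a)) := by
  rw [← coeff_kill_chi, kill, Φ.dir_ren (isFP_lin hv), ← kill, kill_lin p v hc,
    kill_C, ← renP_C (renPar_comp p c),
    ← Φ.dir_ren (isFP_lin (p := p ∘ c) (v := v ∘ c) fun j => hv (c j)), coeff_renP_chi hc]

/-- The coefficient of `t_1 ⋯ t_n` is read off after differentiation in `t_i`, which moves `v_i`
into a direction, where the formal map is linear. -/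
theorem coeff_dir_lin {p : Fin n → Bool} {v : Fin n → V} (hv : ∀ j, HasParity (p j) (v j))
    (i : Fin n) :
    coeff (chi Finset.univ) (Φ.val (lin p v)) =
      (sgn (p i && opar p (chi (Finset.univ.filter (· < i))))) •
        pinv (p i) (coeff (chi {i}ᶜ) (Φ.dir (lin p v) (C p (pinv (p i) (v i))))) := by
  have h1 := coeff_deriv i (chi {i}ᶜ) (Φ.val (lin p v))
  have h2 : (chi {i}ᶜ).filter (· < i) = chi (Finset.univ.filter (· < i)) := Finsupp.ext fun j => by
    rw [Finsupp.filter_apply, chi_apply, chi_apply]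
    by_cases h : j < i
    · simp [h, h.ne]
    · simp [h]
  have h3 : chi {i}ᶜ + Finsupp.single i 1 = chi (Finset.univ : Finset (Fin n)) := by
    rw [chi, chi, ← Finset.sum_compl_add_sum {i}, Finset.sum_singleton]
  rw [h2, h3, chi_apply, if_neg (by simp), Φ.val_deriv (isFP_lin hv), deriv_lin] at h1
  rw [h1]
  simp only [Nat.cast_zero, zero_add, mul_one, map_smul, pinv_self, smul_smul, sgn_mul_self, one_smul]

/-- The remaining coefficient does not involve `t_i`, so `t_i` can be set to zero in the base point.
Now `x` occurs only as a direction, which shows linearity in the `i`-th argument. -/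
theorem coeff_dir_lin_update {p : Fin n → Bool} {v : Fin n → V} (hv : ∀ j, HasParity (p j) (v j))
    (i : Fin n) {x : V} (hx : HasParity (p i) x) :
    coeff (chi Finset.univ) (Φ.val (lin p (Function.update v i x))) =
      (sgn (p i && opar p (chi (Finset.univ.filter (· < i))))) •
        pinv (p i) (coeff (chi {i}ᶜ) (Φ.dir (lin p (Function.update v i 0)) (C p (pinv (p i) x)))) := by
  have hu : ∀ {x : V}, HasParity (p i) x → ∀ j, HasParity (p j) (Function.update v i x j) :=
    fun {x} hx j => by
      by_cases h : j = i
      · subst h; rwa [Function.update_self]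
      · rw [Function.update_of_ne h]; exact hv j
  have hk : ∀ x : V, kill V p {i} (lin p (Function.update v i x)) = lin p (Function.update v i 0) :=
    fun x => by
      rw [lin, lin, kill, map_sum]
      refine Finset.sum_congr rfl fun j _ => ?_
      rw [map_mul, renP_C, renP_X, renX, killE]
      by_cases h : j = i
      · subst h
        rw [if_pos (Finset.mem_singleton_self _), Function.update_self, Function.update_self, C_zero,
          zero_mul]
        exact mul_zero _
      · rw [if_neg (by simpa using h), Function.update_of_ne h, Function.update_of_ne h]; rfl
  have h1 := coeff_kill_chi p {i}ᶜ (Φ.dir (lin p (Function.update v i x)) (C p (pinv (p i) x)))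
  rw [compl_compl, kill, Φ.dir_ren (isFP_lin (hu hx)), ← kill, hk, kill_C] at h1
  rw [coeff_dir_lin Φ (hu hx) i, Function.update_self, h1]

/-- The Taylor coefficients on homogeneous tuples. -/
noncomputable def taylorAux (p : Fin n → Bool) (v : Fin n → V) : W :=
  sg p • coeff (chi Finset.univ) (Φ.val (lin p v))

/-- The Taylor coefficients as multilinear maps. -/
noncomputable def taylorMap (n : ℕ) : MultilinearMap ℝ (fun _ : Fin n => V) W := by
  have h1 : ∀ (v : Fin n → V) (i : Fin n) (x : V) (s : Fin n → Bool),
      (fun j => parPart (s j) (Function.update v i x j)) =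
        Function.update (fun j => parPart (s j) (v j)) i (parPart (s i) x) := fun v i x s =>
    funext fun j => by
      by_cases h : j = i
      · subst h; simp
      · simp [h]
  exact MultilinearMap.mk'
    -- The parameter `t_j` must have the parity of its argument, so inhomogeneous arguments are
    -- split into their parity components.
    (fun v => ∑ s : Fin n → Bool, Φ.taylorAux s fun j => parPart (s j) (v j))
    (fun v i x y => by
      rw [← Finset.sum_add_distrib]
      refine Finset.sum_congr rfl fun s _ => ?_
      have hv : ∀ j, HasParity (s j) (parPart (s j) (v j)) := fun j => parPart_hasParity _ _
      simp only [h1, taylorAux]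
      rw [coeff_dir_lin_update Φ hv i (parPart_hasParity _ _),
        coeff_dir_lin_update Φ hv i (parPart_hasParity _ _),
        coeff_dir_lin_update Φ hv i (parPart_hasParity _ _)]
      simp only [map_add, C_add, coeff_add, smul_add])
    (fun v i c x => by
      rw [Finset.smul_sum]
      refine Finset.sum_congr rfl fun s _ => ?_
      have hv : ∀ j, HasParity (s j) (parPart (s j) (v j)) := fun j => parPart_hasParity _ _
      simp only [h1, taylorAux]
      rw [coeff_dir_lin_update Φ hv i (parPart_hasParity _ _),
        coeff_dir_lin_update Φ hv i (parPart_hasParity _ _)]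
      simp only [map_smul, C_smul, coeff_smul]
      rw [smul_comm c, smul_comm c])

theorem taylorMap_eq {p : Fin n → Bool} {v : Fin n → V} (hv : ∀ j, HasParity (p j) (v j)) :
    Φ.taylorMap n v = sg p • coeff (chi Finset.univ) (Φ.val (lin p v)) := by
  change ∑ s : Fin n → Bool, Φ.taylorAux s (fun j => parPart (s j) (v j)) = Φ.taylorAux p v
  rw [Finset.sum_eq_single p]
  · congr 1
    funext j
    rw [(hv j).parPart, if_pos rfl]
  · intro s _ hs
    obtain ⟨i, hi⟩ := Function.ne_iff.1 hs
    have h0 : parPart (s i) (v i) = 0 := by rw [(hv i).parPart, if_neg hi]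
    rw [taylorAux, coeff_dir_lin Φ (fun j => parPart_hasParity _ _) i, h0, map_zero, C_zero, map_zero,
      coeff_zero, map_zero, smul_zero, smul_zero]
  · simp

/-- The Taylor coefficients of a formal map. -/
noncomputable def taylor : SymFamily V W e where
  map := Φ.taylorMap
  parity n v := by
    have h : (SuperAlgebra.inv (A := W)).toLinearMap.compMultilinearMap (Φ.taylorMap n) =
        (if e then (-1 : ℝ) else 1) • (Φ.taylorMap n).compLinearMap
          fun _ => (SuperAlgebra.inv (A := V)).toLinearMap := by
      refine MultilinearMap.ext_hasParity fun p v hv => ?_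
      have h1 : (fun j => SuperAlgebra.inv (v j)) = fun j => sgn (p j) • v j :=
        funext fun j => hasParity_iff.1 (hv j)
      have h2 := hasParity_iff_coeff.1 (Φ.val_par (isFP_lin hv)) _ (adm_chi Finset.univ)
      have h3 : ∏ j, sgn (p j) = sgn (opar p (chi Finset.univ)) := by
        rw [opar, oddDeg_chi, ← neg_one_pow_eq_sgn, ← Finset.prod_pow_eq_pow_sum]
        exact Finset.prod_congr rfl fun j _ => (neg_one_pow_ite _).symm
      change SuperAlgebra.inv (Φ.taylorMap n v) =
        (if e then (-1 : ℝ) else 1) • Φ.taylorMap n fun j => SuperAlgebra.inv (v j)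
      rw [h1, MultilinearMap.map_smul_univ, taylorMap_eq Φ hv, map_smul, hasParity_iff.1 h2, h3,
        ← sgn_mul, smul_comm (sg p), ← smul_smul]
      cases e <;> simp
    exact DFunLike.congr_fun h v
  symm n p v hv i h := by
    -- Renaming the parameters along the transposition gives the symmetry. The sign comes from
    -- sorting the permuted parameters; the reversal sign `sg` is unchanged, as it only counts odd
    -- arguments.
    set c := Equiv.swap (⟨i, by omega⟩ : Fin n) ⟨i + 1, h⟩ with hc
    have h1 := coeff_val_image Φ hv c.injective
    have h2 : sg (p ∘ c) = sg p := by
      rw [sg_eq, sg_eq, ← Equiv.coe_toEmbedding, oddDeg_comp, Finset.map_univ_equiv]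
    have h3 := koszul_swap (p ∘ c) i h
    rw [Finset.image_univ_equiv] at h1
    rw [taylorMap_eq Φ hv, taylorMap_eq Φ (p := p ∘ c) (v := v ∘ c) (fun j => hv (c j)), h2, h1]
    rw [← hc] at h3
    rw [h3, smul_comm (sg p), smul_smul]
    simp only [Function.comp_apply, hc, Equiv.swap_apply_left, Equiv.swap_apply_right]
    cases p ⟨i, by omega⟩ <;> cases p ⟨i + 1, h⟩ <;> simp

theorem taylor_map {p : Fin n → Bool} {v : Fin n → V} (hv : ∀ j, HasParity (p j) (v j)) :
    Φ.taylor.map n v = sg p • coeff (chi Finset.univ) (Φ.val (lin p v)) := Φ.taylorMap_eq hv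

/-- The parameters outside `I` are set to zero and those in `I` are renamed in increasing order,
which costs no sign. -/
theorem coeff_val_lin {p : Fin n → Bool} {v : Fin n → V} (hv : ∀ j, HasParity (p j) (v j))
    (I : Finset (Fin n)) :
    coeff (chi I) (Φ.val (lin p v)) = sg (subTuple p I) • Φ.taylor.map _ (subTuple v I) := by
  have h1 := coeff_val_image Φ hv (I.orderEmbOfFin rfl).injective
  rw [koszul_strictMono _ (I.orderEmbOfFin rfl).strictMono, one_smul,
    Finset.image_orderEmbOfFin_univ] at h1
  rw [h1, taylor_map Φ (p := subTuple p I) (v := subTuple v I) (fun j => hv _), smul_smul, sg_mul_self, one_smul]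
  rfl

/-- The direction `a` is treated as a new argument in front, with its own parameter; differentiating
in this parameter recovers the derivative in the direction `a`. The signs come from the parity of
`a` and from `sg_cons`. -/
theorem coeff_chi_dir_lin_C {p : Fin n → Bool} {v : Fin n → V} (hv : ∀ j, HasParity (p j) (v j))
    {f : Bool} {a : V} (ha : HasParity f a) :
    coeff (chi Finset.univ) (Φ.dir (lin p v) (C p a)) = (sgn f * sgn (f && opar p (chi Finset.univ)) *
      sg p) • pinv f (Φ.taylor.map _ (Fin.cons a v)) := by
  have hq : ∀ j, HasParity ((Fin.cons f p : Fin _ → Bool) j) ((Fin.cons a v : Fin _ → V) j) :=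
    Fin.cases ha hv
  have h2 := coeff_dir_image Φ hq (Fin.succ_injective _) a
  have h3 : Finset.univ.image Fin.succ = ({0}ᶜ : Finset (Fin (n + 1))) := by
    ext j; cases j using Fin.cases <;> simp
  rw [koszul_strictMono _ (Fin.strictMono_succ), one_smul, h3] at h2
  change _ = coeff _ (Φ.dir (lin p v) _) at h2
  have h4 := coeff_dir_lin Φ hq 0
  simp only [Fin.cons_zero] at h4
  have h5 : Finset.univ.filter (· < (0 : Fin (n + 1))) = ∅ := by ext; simp
  rw [h5, (by simp [chi] : chi (∅ : Finset (Fin (n + 1))) = 0), opar_zero, Bool.and_false,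
    sgn_false, one_smul, ha.pinv_eq, C_smul, map_smul, coeff_smul, h2] at h4
  rw [taylor_map Φ hq, h4, sg_cons]
  simp only [map_smul, pinv_self, smul_smul]
  rw [eq_comm]
  convert one_smul ℝ _ using 2
  cases f
  · simp [sg_mul_self]
  · have h7 := sg_mul_self p
    have h8 := sgn_mul_self (opar p (chi Finset.univ))
    simp only [sgn_true, Bool.true_and] at h8 ⊢
    linear_combination h7 + sg p * sg p * h8
  · rfl

theorem oddDeg_subTuple (p : Fin n → Bool) (I : Finset (Fin n)) :
    oddDeg (subTuple p I) (chi Finset.univ) = oddDeg p (chi I) :=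
  (oddDeg_comp p (I.orderEmbOfFin rfl).toEmbedding).trans (by
    congr 2; exact Finset.map_orderEmbOfFin_univ I rfl)

theorem coeff_dir_lin_C {p : Fin n → Bool} {v : Fin n → V} (hv : ∀ j, HasParity (p j) (v j))
    (J : Finset (Fin n)) {f : Bool} {a : V} (ha : HasParity f a) :
    coeff (chi J) (Φ.dir (lin p v) (C p a)) = (sgn f * sgn (f && opar p (chi J)) *
      sg (subTuple p J)) • pinv f (Φ.taylor.map _ (Fin.cons a (subTuple v J))) := by
  have h1 := coeff_dir_image Φ hv (J.orderEmbOfFin rfl).injective a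
  rw [koszul_strictMono _ (J.orderEmbOfFin rfl).strictMono, one_smul,
    Finset.image_orderEmbOfFin_univ] at h1
  rw [h1, opar, ← oddDeg_subTuple]
  exact Φ.coeff_chi_dir_lin_C (p := subTuple p J) (v := subTuple v J) (fun j => hv _) ha

end FormalMap

/-! ### Compositions of formal maps and vector fields -/

namespace SSer
variable {A : Type*} [Ring A] [Algebra ℝ A] [SuperAlgebra A] {n : ℕ} {p : Fin n → Bool}

theorem chi_compl_add (I : Finset (Fin n)) : chi Iᶜ + chi I = chi Finset.univ :=
  Finset.sum_compl_add_sum I _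

theorem chi_injective : Function.Injective (chi : Finset (Fin n) → _) := fun I J h => by
  ext i
  have := DFunLike.congr_fun h i
  rw [chi_apply, chi_apply] at this
  by_cases h1 : i ∈ I <;> by_cases h2 : i ∈ J <;> simp_all

theorem exists_chi_of_add_eq {k m : Fin n →₀ ℕ} (h : k + m = chi Finset.univ) :
    ∃ I, k = chi Iᶜ ∧ m = chi I := by
  have h1 : ∀ i, k i + m i = 1 := fun i => by
    rw [← Finsupp.add_apply, h, chi_apply, if_pos (Finset.mem_univ i)]
  refine ⟨m.support, Finsupp.ext fun i => ?_, Finsupp.ext fun i => ?_⟩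
  all_goals
    have := h1 i
    simp only [chi_apply, Finset.mem_compl, Finsupp.mem_support_iff]
    split <;> omega

theorem coeff_chi_mul (F G : SSer A p) : coeff (chi Finset.univ) (F * G) =
    ∑ I : Finset (Fin n), (-1 : ℝ) ^ crossings p (chi Iᶜ) (chi I) •
      (coeff (chi Iᶜ) F * pinv (opar p (chi Iᶜ)) (coeff (chi I) G)) := by
  rw [coeff_mul' (adm_chi _)]
  symm
  refine Finset.sum_bij (fun I _ => (chi Iᶜ, chi I)) (fun I _ => ?_) (fun I _ J _ h => ?_)
    (fun x hx => ?_) (fun I _ => rfl)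
  · exact Finset.HasAntidiagonal.mem_antidiagonal.2 (chi_compl_add I)
  · exact chi_injective (Prod.ext_iff.1 h).2
  · obtain ⟨I, h1, h2⟩ := exists_chi_of_add_eq (Finset.HasAntidiagonal.mem_antidiagonal.1 hx)
    exact ⟨I, Finset.mem_univ _, Prod.ext h1.symm h2.symm⟩

theorem mono_add_single' (j : Fin n) (k : Fin n →₀ ℕ) : mono A p (k + Finsupp.single j 1) =
    (-1 : ℝ) ^ crossings p k (Finsupp.single j 1) • (mono A p k * X A p j) := by
  rw [X_eq_mono, mono_mul_mono, smul_smul, neg_one_pow_mul_self, one_smul]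

/-- The sign in the composition of Taylor coefficients. -/
theorem sign_compl (p : Fin n → Bool) (I : Finset (Fin n)) :
    (-1 : ℝ) ^ crossings p (chi Iᶜ) (chi I) * sg (subTuple p I) * sg (subTuple p Iᶜ) =
      koszul p (fun j => if j ∈ I then 0 else 1) * sg p := by
  have h := koszul_compl p I
  have h1 := neg_one_pow_mul_self (crossings p (chi Iᶜ) (chi I))
  have h2 := neg_one_pow_mul_self (oddDeg p (chi I) * oddDeg p (chi Iᶜ))
  have h3 : sg p = sg (subTuple p I) * sg (subTuple p Iᶜ) *
      (-1) ^ (oddDeg p (chi I) * oddDeg p (chi Iᶜ)) := by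
    rw [sg_eq, sg_eq, sg_eq, FormalMap.oddDeg_subTuple, FormalMap.oddDeg_subTuple, ← theta_add, ← oddDeg_add,
      add_comm (chi I), chi_compl_add]
  rw [h3]
  generalize sg (subTuple p I) = s
  generalize sg (subTuple p Iᶜ) = t
  generalize (-1 : ℝ) ^ crossings p (chi Iᶜ) (chi I) = c at *
  generalize (-1 : ℝ) ^ (oddDeg p (chi I) * oddDeg p (chi Iᶜ)) = d at *
  generalize (koszul p fun j => if j ∈ I then 0 else 1) = x at *
  linear_combination -(s * t * d * c) * h + s * t * d * x * h1 - s * t * c * h2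
end SSer

namespace FormalMap
variable {V W : Type} [Ring V] [Algebra ℝ V] [SuperAlgebra V] [Ring W] [Algebra ℝ W]
    [SuperAlgebra W] {e e' : Bool} (Φ : FormalMap V W e) {n : ℕ}

theorem taylor_hasParity {p : Fin n → Bool} {v : Fin n → V} (hv : ∀ j, HasParity (p j) (v j)) :
    HasParity (e ^^ opar p (chi Finset.univ)) (Φ.taylor.map n v) := by
  rw [Φ.taylor_map hv]
  exact (hasParity_iff_coeff.1 (Φ.val_par (isFP_lin hv)) _ (adm_chi _)).smul _

theorem dir_C_mul_mono {r : ℕ} {τ : Fin r → Bool} {g : SSer V τ} (hg : IsFP g) (a : V)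
    (k : Fin r →₀ ℕ) : Φ.dir g (C τ a * mono V τ k) =
      sgn (e && opar τ k) • (Φ.dir g (C τ a) * mono W τ k) := by
  refine mono_induction (P := fun k => Φ.dir g (C τ a * mono V τ k) =
      sgn (e && opar τ k) • (Φ.dir g (C τ a) * mono W τ k)) ?_ (fun j k ih => ?_) k
  · simp [mono_zero]
  · rw [mono_add_single', mono_add_single', mul_smul_comm, ← mul_assoc, map_smul, Φ.dir_X hg, ih,
      smul_mul_assoc, smul_smul, mul_smul_comm, ← mul_assoc, opar_add, opar_single, smul_comm,
      smul_smul, smul_smul]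
    congr 1
    cases e <;> simp [← sgn_mul, mul_comm, mul_assoc, mul_left_comm]

/-- The expansion of the derivative in a direction depending on the parameters. -/
theorem coeff_chi_dir {p : Fin n → Bool} {g : SSer V p} (hg : IsFP g) (h : SSer V p) :
    coeff (chi Finset.univ) (Φ.dir g h) = ∑ I : Finset (Fin n),
      (sgn (e && opar p (chi I)) * (-1 : ℝ) ^ crossings p (chi Iᶜ) (chi I)) •
        coeff (chi Iᶜ) (Φ.dir g (C p (coeff (chi I) h))) := by
  let L₀ : SSer V p →ₗ[ℝ] W := coeffL (chi Finset.univ) ∘ₗ Φ.dir g - ∑ I : Finset (Fin n),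
      (sgn (e && opar p (chi I)) * (-1 : ℝ) ^ crossings p (chi Iᶜ) (chi I)) •
        (coeffL (chi Iᶜ) ∘ₗ Φ.dir g ∘ₗ (CHom p).toLinearMap ∘ₗ coeffL (chi I))
  have hL₀ : ∀ h, L₀ h = coeff (chi Finset.univ) (Φ.dir g h) - ∑ I : Finset (Fin n),
      (sgn (e && opar p (chi I)) * (-1 : ℝ) ^ crossings p (chi Iᶜ) (chi I)) •
        coeff (chi Iᶜ) (Φ.dir g (C p (coeff (chi I) h))) := fun h => by
    simp only [L₀, LinearMap.sub_apply, LinearMap.sum_apply]; rfl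
  -- Composition with the constants only brings `L₀` into the scope of `linear_ext`. It is
  -- continuous because `L₀` reads coefficients of degree at most `n` and so kills order `n + 1`.
  let L : SSer V p →ₗ[ℝ] SSer W p := (CHom p).toLinearMap ∘ₗ L₀
  have hL : Cont L := fun N => ⟨n + 1, fun F hF => by
    have h0 : L₀ F = 0 := by
      rw [hL₀, Φ.dir_ord hg _ F hF _ (by rw [degree_chi, Finset.card_fin]; omega), zero_sub,
        neg_eq_zero]
      refine Finset.sum_eq_zero fun I _ => ?_
      rw [hF (chi I) (by rw [degree_chi]; have := Finset.card_le_univ I; simp at this; omega), C_zero,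
        map_zero, coeff_zero, smul_zero]
    change CHom p (L₀ F) ∈ _
    rw [h0, map_zero]; exact zero_mem _⟩
  have h1 := linear_ext hL (fun a k hk => by
    change CHom p (L₀ _) = 0
    rw [hL₀, Φ.dir_C_mul_mono hg, coeff_smul, coeff_chi_mul, Finset.smul_sum,
      ← Finset.sum_sub_distrib, Finset.sum_eq_zero, map_zero]
    intro I _
    rw [coeff_mono (adm_chi _), coeff_C_mul_mono (adm_chi _)]
    by_cases h : chi I = k
    · rw [if_pos h, if_pos h, ← h, map_one, mul_one, smul_smul, sub_self]
    · rw [if_neg h, if_neg h, map_zero, mul_zero, smul_zero, smul_zero, C_zero, map_zero, coeff_zero,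
        smul_zero, sub_zero]) h
  have h2 : L₀ h = 0 := C_injective (h1.trans C_zero.symm)
  rw [hL₀] at h2
  exact sub_eq_zero.1 h2

/-- The Taylor coefficients of the derivative of a formal map along a formal vector field. -/
theorem coeff_chi_dir_val (B : FormalMap V V e') {p : Fin n → Bool} {v : Fin n → V}
    (hv : ∀ j, HasParity (p j) (v j)) :
    coeff (chi Finset.univ) (Φ.dir (lin p v) (B.val (lin p v))) =
      (sgn (e && e') * sg p) • ∑ I : Finset (Fin n), koszul p (fun j => if j ∈ I then 0 else 1) •
        Φ.taylor.map (Iᶜ.card + 1) (Fin.cons (B.taylor.map _ (subTuple v I)) (subTuple v Iᶜ)) := by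
  rw [Φ.coeff_chi_dir (isFP_lin hv), Finset.smul_sum]
  refine Finset.sum_congr rfl fun I _ => ?_
  have hw : HasParity (e' ^^ opar p (chi I)) (B.taylor.map _ (subTuple v I)) := by
    have := B.taylor_hasParity (p := subTuple p I) (v := subTuple v I) fun j => hv _
    rwa [opar, FormalMap.oddDeg_subTuple] at this
  have hc := Φ.taylor_hasParity (p := Fin.cons (e' ^^ opar p (chi I)) (subTuple p Iᶜ))
    (v := Fin.cons (B.taylor.map _ (subTuple v I)) (subTuple v Iᶜ)) (Fin.cases hw fun j => hv _)
  have ho : opar (Fin.cons (e' ^^ opar p (chi I)) (subTuple p Iᶜ) : Fin (Iᶜ.card + 1) → Bool)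
      (chi Finset.univ) = (e' ^^ opar p (chi I) ^^ opar p (chi Iᶜ)) := by
    rw [opar_chi_univ_succ]
    simp only [Fin.cons_zero, Fin.cons_succ]
    rw [opar, opar, opar, oddDeg_subTuple]
  rw [ho] at hc
  rw [B.coeff_val_lin hv, C_smul, map_smul, coeff_smul, Φ.coeff_dir_lin_C hv _ hw, hc.pinv_eq,
    smul_smul, smul_smul, smul_smul, smul_smul, mul_assoc (sgn (e && e')), mul_comm (sg p),
    ← sign_compl]
  congr 1
  generalize (-1 : ℝ) ^ crossings p (chi Iᶜ) (chi I) = c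
  generalize sg (subTuple p I) = s
  generalize sg (subTuple p Iᶜ) = t
  generalize opar p (chi I) = a
  generalize opar p (chi Iᶜ) = b
  cases e <;> cases e' <;> cases a <;> cases b <;> simp <;> ring

end FormalMap

/-! ### The master equation and weights -/

namespace SSer
section Ham
variable {A : Type*} [Ring A] [Algebra ℝ A] [SuperAlgebra A] {n r : ℕ} {π : Fin n → Bool}
  {τ : Fin r → Bool} {g : SSer A τ} (hg : IsFP g) (cs : CoordSys A π)

include hg in
/-- A derivation of the variables applied to `H(x, ∂g/∂x)`. -/
theorem IsFP.der_ev {e : Bool} {D : A →ₗ[ℝ] A} (hD : IsDer (AlgHom.id ℝ A) e D) (H : SSer A π) :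
    mapL D (ev cs H g) = ev cs (mapL D H) g +
      ∑ b, mapL D (mapL (cs.d b) g) * ev cs (deriv b H) g :=
  sigma_der (hg.grad_par cs) (hg.grad_zero cs) (isDer_mapL_id hD) (cont_mapL _) hD
    (fun a => mapL_C _ _) H

include hg in
/-- The Hamilton-Jacobi vector field of a solution of the master equation is homological. -/
theorem IsFP.evd_ev {H : SSer A π} (hH : HasParity true H)
    (hm : ∑ a, sgn (π a) • (mapL (cs.d a) H * deriv a H) = 0) : evd cs H g (ev cs H g) = 0 := by
  have hU : ∀ a, HasParity (!π a) (ev cs (deriv a H) g) := fun a => by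
    have := hg.ev_par cs (hH.deriv a)
    rwa [Bool.xor_true] at this
  have hG : ∀ a b, HasParity (π a ^^ π b) (mapL (cs.d a) (mapL (cs.d b) g)) := fun a b =>
    (isDer_mapL_id (cs.d_der a)).hasParity (hg.grad_par cs b)
  have hs : ∀ a b, mapL (cs.d a) (mapL (cs.d b) g) =
      sgn (π a && π b) • mapL (cs.d b) (mapL (cs.d a) g) := fun a b => SSer.ext fun m _ => by
    rw [coeff_mapL, coeff_mapL, coeff_smul, coeff_mapL, coeff_mapL, cs.d_comm]
  -- The derivative `∂_a` of `H(x, ∂g/∂x)` has an explicit part and a part with second derivatives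
  -- of `g`. The explicit parts add up to the expression in the master equation.
  have h1 : evd cs H g (ev cs H g) = ev cs (∑ a, sgn (π a) • (mapL (cs.d a) H * deriv a H)) g +
      ∑ a, ∑ b, sgn (π a) • (mapL (cs.d a) (mapL (cs.d b) g) * ev cs (deriv b H) g *
        ev cs (deriv a H) g) := by
    rw [← hg.evHom_apply cs (∑ a, _), map_sum, ← Finset.sum_add_distrib]
    refine Finset.sum_congr rfl fun a _ => ?_
    rw [(hg.ev_par cs hH).pinv_eq, Bool.and_true, map_smul, hg.der_ev cs (cs.d_der a), smul_mul_assoc,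
      add_mul, Finset.sum_mul, smul_add, Finset.smul_sum, map_smul, map_mul]
    rfl
  have h2 : ev cs (0 : SSer A π) g = 0 := map_zero (hg.evHom cs)
  rw [h1, hm, h2, zero_add]
  -- Second derivatives are supersymmetric, while the momentum derivatives of the odd `H` have
  -- shifted parities; so each term changes sign when `a` and `b` are exchanged.
  have h3 : ∀ a b, sgn (π a) • (mapL (cs.d a) (mapL (cs.d b) g) * ev cs (deriv b H) g *
        ev cs (deriv a H) g) = -(sgn (π b) • (mapL (cs.d b) (mapL (cs.d a) g) *
          ev cs (deriv a H) g * ev cs (deriv b H) g)) := fun a b => by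
    rw [hs, mul_assoc, (hU b).comm_sgn (hU a), mul_smul_comm, smul_mul_assoc, smul_smul, smul_smul,
      ← mul_assoc, ← neg_smul]
    congr 1
    cases π a <;> cases π b <;> simp
  have h4 : ∀ F : Fin n → Fin n → SSer A τ, (∀ a b, F a b = -F b a) → ∑ a, ∑ b, F a b = 0 :=
    fun F h => by
      have h5 : ∑ a, ∑ b, F a b = -∑ a, ∑ b, F a b := by
        conv_lhs => rw [Finset.sum_comm]
        simp only [← Finset.sum_neg_distrib]
        exact Finset.sum_congr rfl fun a _ => Finset.sum_congr rfl fun b _ => h _ _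
      exact (smul_eq_zero.1 ((two_smul ℝ _).trans (eq_neg_iff_add_eq_zero.1 h5))).resolve_left
        two_ne_zero
  exact h4 _ h3

include hg in
-- The commutator `[∂_a, E] = w_a ∂_a` shows that `∂g/∂x^a` has weight `s - w_a`, which is the
-- weight of the momentum `p_a`. Inserting it into `H` therefore preserves the weight of `H`.
theorem IsFP.ev_weight {E : A →ₗ[ℝ] A} (hE : IsDer (AlgHom.id ℝ A) false E) {w : Fin n → ℝ}
    (hEd : ∀ b, E b = ∑ i, w i • (cs.y i * cs.d i b)) {u : Fin r → ℝ} {s t : ℝ}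
    (hgw : mapL E g + wtL u g = s • g) {H : SSer A π}
    (hH : mapL E H + wtL (fun a => s - w a) H = t • H) :
    mapL E (ev cs H g) + wtL u (ev cs H g) = t • ev cs H g := by
  have h1 := sigma_der (hg.grad_par cs) (hg.grad_zero cs) ((isDer_mapL_id hE).add (isDer_wtL u))
    ((cont_mapL _).add (cont_wtL _)) hE (fun a => by simp [wtL_C, mapL_C]) H
  have h2 : ∀ a b, cs.d a (E b) = w a • cs.d a b + E (cs.d a b) := fun a b => by
    have h3 : w a • cs.d a b = ∑ i, if a = i then w i • cs.d i b else 0 := by simp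
    rw [h3, hEd, hEd, map_sum, ← Finset.sum_add_distrib]
    refine Finset.sum_congr rfl fun i _ => ?_
    rw [map_smul, (cs.d_der a).leib, cs.d_y, AlgHom.id_apply, AlgHom.id_apply, cs.d_comm a i,
      (cs.y_par i).pinv_eq, smul_mul_smul_comm, sgn_mul_self, one_smul, smul_add]
    congr 1
    split <;> simp
  have h3 : ∀ a, (mapL E + wtL u : SSer A τ →ₗ[ℝ] SSer A τ) (mapL (cs.d a) g) =
      (s - w a) • mapL (cs.d a) g := fun a => by
    have h4 := congrArg (mapL (cs.d a)) hgw
    rw [sub_smul, ← map_smul, ← hgw, map_add, LinearMap.add_apply]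
    refine SSer.ext fun m _ => ?_
    simp only [coeff_add, coeff_sub, coeff_smul, coeff_mapL, coeff_wtL, h2, map_smul]
    abel
  rw [LinearMap.add_apply] at h1
  change mapL E (subst _ _ H) + wtL u (subst _ _ H) = t • subst _ _ H
  rw [h1]
  have h5 : mapL E H = t • H - ∑ a, (s - w a) • (X A π a * deriv a H) := by
    rw [← hH, wtL_eq_sum, add_sub_cancel_right]
  have h6 := congrArg (hg.evHom cs) h5
  simp only [map_sub, map_smul, map_sum, map_mul] at h6
  simp only [IsFP.evHom, sigma_X] at h6
  rw [← sigma_apply (hg.grad_par cs) (hg.grad_zero cs), h6, sigma_apply, sub_add_eq_add_sub, sub_eq_iff_eq_add]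
  congr 1
  refine Finset.sum_congr rfl fun a _ => ?_
  rw [h3, smul_mul_assoc, ← sigma_apply (hg.grad_par cs) (hg.grad_zero cs)]

end Ham

/-- The parameter `t_j` receives the weight `-w_j`, so that `v_j t_j` has weight `s`. Weights of
Taylor coefficients then follow from the weight of the formal map. -/
theorem serHasWeight_lin {M : GradedSupermanifold} {n : ℕ} {p : Fin n → Bool} {s : ℤ} {w : Fin n → ℤ}
    {v : Fin n → M.Fun} (hv : ∀ j, M.HasWeight (v j) (w j + s)) :
    M.SerHasWeight (fun j => -w j) (lin p v) s := fun m => by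
  by_cases hm : Adm p m
  · have h1 : coeff m (lin p v) = ∑ j, if m = Finsupp.single j 1 then v j else 0 := by
      rw [lin, coeff_sum]
      exact Finset.sum_congr rfl fun j _ => by rw [X_eq_mono, coeff_C_mul_mono hm]
    rw [h1, GradedSuperSpace.HasWeight, map_sum, Finset.smul_sum]
    refine Finset.sum_congr rfl fun j _ => ?_
    split
    · next h =>
      subst h
      rw [hv j, Finset.sum_eq_single j]
      · rw [Finsupp.single_eq_same]; congr 2; push_cast; ring
      · intro b _ hb; rw [Finsupp.single_eq_of_ne hb]; simp
      · simp
    · rw [map_zero, smul_zero]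
  · rw [coeff_of_not_adm hm, GradedSuperSpace.HasWeight, map_zero, smul_zero]

end SSer

namespace FormalMap
variable {M M' : GradedSupermanifold} {e : Bool}

theorem taylor_hasShiftedWeight (Φ : FormalMap M.Fun M'.Fun e) {s d : ℤ}
    (h : ∀ {r : ℕ} {τ : Fin r → Bool} {g : SSer M.Fun τ} {u : Fin r → ℤ}, IsFP g →
      M.SerHasWeight u g s → M'.SerHasWeight u (Φ.val g) (d + s)) :
    Φ.taylor.HasShiftedWeight s d := fun n w v hv => by
  change M'.euler ⊤ (∑ p : Fin n → Bool, Φ.taylorAux p _) = _ • ∑ p : Fin n → Bool, Φ.taylorAux p _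
  rw [map_sum, Finset.smul_sum]
  refine Finset.sum_congr rfl fun p _ => ?_
  have hp : ∀ j, M.HasWeight (parPart (p j) (v j)) (w j + s) := fun j => by
    rw [GradedSuperSpace.HasWeight, parPart_apply, map_smul, map_add, map_smul, M.euler_inv, hv j,
      map_smul]
    module
  have h1 := h (isFP_lin fun j => parPart_hasParity (p j) (v j)) (serHasWeight_lin (p := p) hp)
    (chi Finset.univ)
  rw [taylorAux, map_smul, h1, smul_comm]
  congr 3
  simp [chi_apply]
  ring

end FormalMap

namespace GradedSupermanifold
variable {M : GradedSupermanifold} {k : ℤ} (H : MasterHamiltonian M k)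

theorem poisson_eq (c : M.Coord) (F G : SSer (M.O c.dom) M.par) : poisson c F G =
    ∑ a, (sgn (M.par a) • (SSer.deriv a (pinv (M.par a) F) * mapL ((sys c.toChart le_rfl).d a) G) -
      mapL ((sys c.toChart le_rfl).d a) (pinv (M.par a) F) * SSer.deriv a G) := by
  have h1 : ∀ a, SSer.inv^[if M.par a then 1 else 0] F = pinv (M.par a) F :=
    fun a => inv_iterate_ite _ F
  simp only [poisson, h1, neg_one_pow_ite, map_pd_eq]

theorem hamMap_dir_val {r : ℕ} {τ : Fin r → Bool} {g : SSer M.Fun τ} (hg : IsFP g) :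
    (hamMap H).dir g ((hamMap H).val g) = 0 := by
  rw [hamMap_dir H hg, hamMap_val H hg]
  refine ser_ext_coord fun c => ?_
  rw [sres_hamDir H hg _ c le_rfl, evdAt, sres_hamVal H hg c le_rfl, sres_eq le_top 0, map_zero]
  refine (isFP_sres hg _).evd_ev _ (hamiltonian_par H c le_rfl) ?_
  have h1 := H.master c
  have hH : HasParity true (H.H c) := isOdd_iff.1 (H.odd c)
  -- For an odd `H` the two terms of the bracket `(H, H)` coincide after commuting the factors,
  -- whence the factor `-2`.
  have h2 : poisson c (H.H c) (H.H c) = (-2 : ℝ) • ∑ a, sgn (M.par a) •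
      (mapL ((sys c.toChart le_rfl).d a) (H.H c) * SSer.deriv a (H.H c)) := by
    rw [poisson_eq, Finset.smul_sum]
    refine Finset.sum_congr rfl fun a _ => ?_
    have h3 := (hH.deriv a).comm_sgn ((isDer_mapL_id ((sys c.toChart le_rfl).d_der a)).hasParity hH)
    rw [hH.pinv_eq, map_smul, ← derivL_apply,
      map_smul, derivL_apply, smul_mul_assoc, h3, smul_mul_assoc]
    cases M.par a <;> simp <;> module
  rw [h2] at h1
  rw [sres_refl]
  exact (smul_eq_zero.1 h1).resolve_left (by norm_num)

/-- The Jacobi expression is, up to sign, the coefficient of `t_1 ⋯ t_n` of the derivative of `Q_H`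
along itself, which vanishes. -/
theorem hamMap_jacobi : (hamMap H).taylor.Jacobi := fun n p v hv => by
  have h := (hamMap H).coeff_chi_dir_val (hamMap H) hv
  rw [hamMap_dir_val H (isFP_lin hv), coeff_zero, eq_comm, smul_eq_zero] at h
  refine h.resolve_left fun h0 => ?_
  have h1 := sg_mul_self p
  rcases mul_eq_zero.1 h0 with h | h
  · simp at h
  · rw [h] at h1; simp at h1

theorem sres_mapL_euler {U V : Opens M.pt} (h : V ≤ U) {r : ℕ} {τ : Fin r → Bool}
    (F : SSer (M.O U) τ) : M.sres h (mapL (M.euler U) F) = mapL (M.euler V) (M.sres h F) :=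
  SSer.ext fun m _ => by rw [coeff_sres, coeff_mapL, coeff_mapL, coeff_sres, M.euler_res]

theorem sres_wtL {U V : Opens M.pt} (h : V ≤ U) {r : ℕ} {τ : Fin r → Bool} (u : Fin r → ℝ)
    (F : SSer (M.O U) τ) : M.sres h (wtL u F) = wtL u (M.sres h F) :=
  SSer.ext fun m _ => by rw [coeff_sres, coeff_wtL, coeff_wtL, coeff_sres, map_smul]

theorem hamVal_weight {r : ℕ} {τ : Fin r → Bool} {g : SSer M.Fun τ} {u : Fin r → ℤ} (hg : IsFP g)
    (hu : M.SerHasWeight u g (1 - k)) : M.SerHasWeight u ((hamMap H).val g) (1 + (1 - k)) := by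
  rw [serHasWeight_iff, hamMap_val H hg]
  refine ser_ext_coord fun c => ?_
  have h1 := (isFP_sres hg _).ev_weight (sys c.toChart le_rfl) (isDer_euler _)
    (w := fun i => (c.wt i : ℝ)) (euler_eq c le_rfl) (u := fun i => (u i : ℝ)) (s := ((1 - k : ℤ) : ℝ))
    (t := ((1 + (1 - k) : ℤ) : ℝ)) ((serHasWeight_iff u _ _).1 (SerHasWeight.sres le_top hu))
    (H := M.sres le_rfl (H.H c)) (by
      have := (serHasWeight_iff _ _ _).1 (SerHasWeight.sres le_rfl (H.weight c))
      have h2 : (1 + (1 - k)) = 2 - k := by ring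
      rw [h2]
      simpa using this)
  rw [sres_eq, map_add, ← sres_eq, ← sres_eq, sres_eq _ (_ • _), map_smul, ← sres_eq, sres_mapL_euler,
    sres_wtL, sres_hamVal H hg c le_rfl]
  exact h1

theorem hamMap_hasShiftedWeight : (hamMap H).taylor.HasShiftedWeight (1 - k) 1 :=
  (hamMap H).taylor_hasShiftedWeight fun hg hu => hamVal_weight H hg hu

end GradedSupermanifold

namespace ThickMorphism
variable {M₁ M₂ : GradedSupermanifold} {s : ℤ} (Φ : ThickMorphism M₁ M₂ s)

theorem formalMap_hasShiftedWeight : Φ.formalMap.taylor.HasShiftedWeight s 0 :=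
  Φ.formalMap.taylor_hasShiftedWeight fun hg hu => by
    rw [zero_add]
    exact (Φ.isPullback_val (isFormalPoint_iff.2 hg)).weight (isFormalPoint_iff.2 hg) hu

theorem isTaylorOfPullback : Φ.IsTaylorOfPullback Φ.formalMap.taylor := fun n p v hv f hf => by
  have hg := isFormalPoint_iff.2 (isFP_lin hv)
  rw [hf.unique hg (Φ.isPullback_val hg), Φ.formalMap.taylor_map hv]
  exact ((smul_smul _ _ _).trans (by rw [← sg, sg_mul_self, one_smul]; rfl)).symm

/-- The pullback of `∑ v_j t_j` exists, so the condition fixes all values on homogeneous tuples, and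
these determine a multilinear map. -/
theorem isTaylorOfPullback_unique {F : SymFamily M₂.Fun M₁.Fun false} (h : Φ.IsTaylorOfPullback F) :
    F = Φ.formalMap.taylor := by
  have h1 : F.map = Φ.formalMap.taylor.map := funext fun n => MultilinearMap.ext_hasParity
    fun p v hv => by
      have hg := isFormalPoint_iff.2 (isFP_lin hv)
      have h2 := h n p v hv _ (Φ.isPullback_val hg)
      rw [Φ.isTaylorOfPullback n p v hv _ (Φ.isPullback_val hg)] at h2
      have h3 := congrArg (sg p • ·) h2
      simp only [smul_smul] at h3
      rwa [← sg, sg_mul_self, one_smul, one_smul, eq_comm] at h3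
  cases F
  cases h4 : Φ.formalMap.taylor
  rw [h4] at h1
  cases h1
  rfl

end ThickMorphism

/-! ### Derived brackets -/

section Fold
variable {S A : Type*} [AddCommGroup S] [Module ℝ S] [AddCommGroup A] [Module ℝ A]

/-- Iterated application of a bilinear operation. -/
noncomputable def foldM (β : S →ₗ[ℝ] A →ₗ[ℝ] S) :
    ∀ n, S →ₗ[ℝ] MultilinearMap ℝ (fun _ : Fin n => A) S
  | 0 => { toFun := fun F => MultilinearMap.constOfIsEmpty ℝ _ F
           map_add' := fun _ _ => rfl
           map_smul' := fun _ _ => rfl }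
  | n + 1 => (multilinearCurryLeftEquiv ℝ (fun _ : Fin (n + 1) => A) S).symm.toLinearMap ∘ₗ
      LinearMap.llcomp ℝ A S _ (foldM β n) ∘ₗ β

theorem foldM_zero (β : S →ₗ[ℝ] A →ₗ[ℝ] S) (F : S) (v : Fin 0 → A) : foldM β 0 F v = F := rfl

theorem foldM_succ (β : S →ₗ[ℝ] A →ₗ[ℝ] S) (n : ℕ) (F : S) (v : Fin (n + 1) → A) :
    foldM β (n + 1) F v = foldM β n (β F (v 0)) fun j => v j.succ := rfl

theorem foldM_eq (β : S →ₗ[ℝ] A →ₗ[ℝ] S) {n : ℕ} (F : S) (v : Fin n → A) :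
    foldM β n F v = (List.ofFn v).foldl (fun F a => β F a) F := by
  induction n generalizing F with
  | zero => simp [foldM_zero]
  | succ n ih => rw [foldM_succ, ih, List.ofFn_succ, List.foldl_cons]

end Fold

namespace SSer
section Ham
variable {A : Type} [Ring A] [Algebra ℝ A] [SuperAlgebra A] {n : ℕ} {π : Fin n → Bool}

/-- The Poisson bracket of a series in the momenta with a function of the variables. -/
noncomputable def pb (d : Fin n → A →ₗ[ℝ] A) : SSer A π →ₗ[ℝ] A →ₗ[ℝ] SSer A π :=
  LinearMap.mk₂ ℝ (fun F x => ∑ a, sgn (π a) • (derivL a (pinv (π a) F) * C π (d a x)))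
    (fun F G x => by simp only [map_add, add_mul, smul_add, Finset.sum_add_distrib])
    (fun c F x => by simp only [map_smul, smul_mul_assoc, Finset.smul_sum, smul_comm c])
    (fun F x y => by simp only [map_add, C_add, mul_add, smul_add, Finset.sum_add_distrib])
    (fun c F x => by simp only [map_smul, C_smul, mul_smul_comm, Finset.smul_sum, smul_comm c])

theorem pb_apply (d : Fin n → A →ₗ[ℝ] A) (F : SSer A π) (x : A) :
    pb d F x = ∑ a, sgn (π a) • (deriv a (pinv (π a) F) * C π (d a x)) := rfl

variable {d : Fin n → A →ₗ[ℝ] A} (hd : ∀ a, IsDer (AlgHom.id ℝ A) (π a) (d a))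

include hd in
theorem pb_hasParity {F : SSer A π} {e q : Bool} (hF : HasParity e F) {x : A} (hx : HasParity q x) :
    HasParity (e ^^ q) (pb d F x) := HasParity.sum fun a _ => by
  have := (((hF.pinv (π a)).deriv a).mul (hasParity_C (π := π) ((hd a).hasParity hx))).smul (sgn (π a))
  have h2 : ((π a ^^ e) ^^ (π a ^^ q)) = (e ^^ q) := by cases π a <;> cases q <;> cases e <;> rfl
  rwa [h2] at this

include hd in
theorem pb_of_hasParity {F : SSer A π} {e q : Bool} (hF : HasParity e F) {x : A} (hx : HasParity q x) :
    pb d F x = sgn (e && q) • ∑ a, C π (d a (pinv (π a) x)) * deriv a F := by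
  rw [pb_apply, Finset.smul_sum]
  refine Finset.sum_congr rfl fun a _ => ?_
  rw [hF.pinv_eq, hx.pinv_eq, ← derivL_apply, map_smul, derivL_apply, smul_mul_assoc,
    (hF.deriv a).comm_sgn (hasParity_C ((hd a).hasParity hx)), map_smul, C_smul, smul_mul_assoc,
    smul_smul, smul_smul, smul_smul]
  congr 1
  cases π a <;> cases e <;> cases q <;> simp

/-- The Hamilton-Jacobi vector field of a Hamiltonian. -/
noncomputable def evMap (cs : CoordSys A π) {e : Bool} {H : SSer A π} (hH : HasParity e H) :
    FormalMap A A e where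
  val g := ev cs H g
  dir g := { toFun := evd cs H g, map_add' := evd_add cs H g, map_smul' := evd_smul cs H g }
  val_par hg := hg.ev_par cs hH
  val_deriv hg j := hg.deriv_ev cs H j
  dir_par hg _ _ hh := evd_par hg cs hH hh
  dir_X hg h j := evd_mul_X hg cs hH h j
  dir_ord _ _ _ hh := evd_ord cs H _ hh
  val_ren hg _ he := by
    have h1 := hg.ren_ev (cs := cs) (cs' := cs) IsSuper.id (fun i x => rfl) he H
    rw [mapL_id_fun] at h1
    exact h1
  dir_ren hg _ he h := by
    have h1 := hg.ren_evd (cs := cs) (cs' := cs) IsSuper.id (fun i x => rfl) he H h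
    rw [mapL_id_fun] at h1
    exact h1

/-- Differentiating `H(x, ∂g/∂x)` in the constant direction `v_0` replaces `H` by `(H, v_0)` up to
sign, so each argument costs one bracket; without arguments there remains `H` at zero momenta. The
induction passes through Hamiltonians of both parities, which is why `evMap` admits both. -/
theorem evMap_taylor (cs : CoordSys A π) {m : ℕ} {p : Fin m → Bool} {v : Fin m → A}
    (hv : ∀ j, HasParity (p j) (v j)) {e : Bool} {H : SSer A π} (hH : HasParity e H) :
    (evMap cs hH).taylor.map m v = coeff 0 (foldM (pb cs.d) m H v) := by
  induction m generalizing e H with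
  | zero =>
    have h0 : chi (Finset.univ : Finset (Fin 0)) = 0 := by simp [chi]
    rw [FormalMap.taylor_map _ hv, foldM_zero, h0]
    have h1 : sg p = 1 := by simp [sg, koszul]
    rw [h1, one_smul]
    exact (coeff_zero_subst _ _ _).trans (coeff_zero_C _)
  | succ m ih =>
    set a := v 0
    set w : Fin m → A := fun j => v j.succ
    set q : Fin m → Bool := fun j => p j.succ
    have hw : ∀ j, HasParity (q j) (w j) := fun j => hv j.succ
    have hP := pb_hasParity cs.d_der hH (hv 0)
    have h1 := (evMap cs hH).coeff_chi_dir_lin_C hw (hv 0)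
    have hva : v = Fin.cons a w := (Fin.cons_self_tail v).symm
    have hpa : p = Fin.cons (p 0) q := (Fin.cons_self_tail p).symm
    have h2 := (evMap cs hH).taylor_hasParity hv
    have ho : opar p (chi Finset.univ) = (p 0 ^^ opar q (chi Finset.univ)) := opar_chi_univ_succ p
    have h3 : (evMap cs hH).dir (lin q w) (C q a) = sgn (e && p 0) •
        (evMap cs hP).val (lin q w) := by
      change evd cs H _ _ = _ • ev cs (pb cs.d H (v 0)) _
      rw [pb_of_hasParity cs.d_der hH (hv 0), ← (isFP_lin hw).evHom_apply, map_smul, smul_smul,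
        sgn_mul_self, one_smul, map_sum, evd]
      refine Finset.sum_congr rfl fun i _ => ?_
      rw [map_mul, IsFP.evHom, sigma_C, pinv_C, mapL_C]; rfl
    rw [h3, coeff_smul, ← hva, h2.pinv_eq, ho] at h1
    rw [foldM_succ, ← ih hw hP, FormalMap.taylor_map _ hw]
    have h4 := congrArg ((sgn (e && p 0) * sg q) • ·) h1
    simp only [smul_smul] at h4
    rw [(by rw [mul_assoc, mul_comm (sg q), ← mul_assoc, sgn_mul_self, one_mul] :
      sgn (e && p 0) * sg q * sgn (e && p 0) = sg q)] at h4
    rw [h4, eq_comm]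
    convert one_smul ℝ _ using 2
    have h5 := sg_mul_self q
    generalize sg q = s at *
    generalize opar q (chi Finset.univ) = o
    cases p 0 <;> cases o <;> cases e <;> simp <;> linear_combination h5

end Ham
end SSer

namespace GradedSupermanifold
variable {M : GradedSupermanifold} {k : ℤ} (H : MasterHamiltonian M k)

theorem poisson_C (c : M.Coord) (F : SSer (M.O c.dom) M.par) (x : M.O c.dom) :
    poisson c F (C M.par x) = pb (sys c.toChart le_rfl).d F x := by
  rw [poisson_eq, pb_apply]
  refine Finset.sum_congr rfl fun a _ => ?_
  rw [deriv_C, mul_zero, sub_zero, mapL_C]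

theorem res_hamMap_taylor (c : M.Coord) (n : ℕ) (v : Fin n → M.Fun) :
    M.res le_top ((hamMap H).taylor.map n v) =
      coeff 0 (foldM (pb (sys c.toChart le_rfl).d) n (H.H c) fun j => M.res le_top (v j)) := by
  have h : (M.res (le_top : c.dom ≤ ⊤)).toLinearMap.compMultilinearMap ((hamMap H).taylor.map n) =
      (coeffL 0).compMultilinearMap ((foldM (pb (sys c.toChart le_rfl).d) n (H.H c)).compLinearMap
        fun _ => (M.res le_top).toLinearMap) := MultilinearMap.ext_hasParity fun p v hv => by
    have hv' : ∀ j, HasParity (p j) (M.res (le_top : c.dom ≤ ⊤) (v j)) := fun j =>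
      (res_isSuper le_top).hasParity (hv j)
    change M.res le_top _ = coeff 0 (foldM _ n (H.H c) fun j => M.res le_top (v j))
    have hH : HasParity true (H.H c) := isOdd_iff.1 (H.odd c)
    rw [← evMap_taylor _ hv' hH, FormalMap.taylor_map _ hv, FormalMap.taylor_map _ hv', map_smul,
      ← coeff_sres, hamMap_val H (isFP_lin hv), sres_hamVal H _ c le_rfl]
    have h1 : M.sres (le_top : c.dom ≤ ⊤) (lin p v) = lin p fun j => M.res le_top (v j) := by
      rw [← sresHom_apply, lin, map_sum]
      refine Finset.sum_congr rfl fun j _ => ?_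
      rw [map_mul, sresHom_X, sresHom_apply, sres_eq, mapL_C]; rfl
    rw [evAt, h1, sres_refl]; rfl
  exact DFunLike.congr_fun h v

theorem hamMap_isDerivedBrackets : IsDerivedBrackets H (hamMap H).taylor := fun n v c => by
  rw [res_hamMap_taylor H c, foldM_eq, List.ofFn_eq_map, List.ofFn_eq_map, List.foldl_map,
    List.foldl_map]
  simp only [poisson_C]

end GradedSupermanifold

/-! ### Expansions of Hamiltonians in brackets -/

namespace SSer
variable {A : Type} [Ring A] [Algebra ℝ A] [SuperAlgebra A] {n l : ℕ} {π : Fin n → Bool}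
  {τ : Fin l → Bool}

section Euler
variable {z : Fin n → SSer A τ} (hz : ∀ i, HasParity (π i) (z i))

/-- The substitution in the homogeneous component of degree `N`, where the coefficients may depend on
the parameters. -/
noncomputable def substN (z : Fin n → SSer A τ) (N : ℕ) : SSer (SSer A τ) π →ₗ[ℝ] SSer A τ where
  toFun F := substDeg id z F N
  map_add' F G := by simp [substDeg_eq, coeff_add, add_mul, Finset.sum_add_distrib]
  map_smul' c F := by simp [substDeg_eq, coeff_smul, Finset.smul_sum]

theorem substN_apply (N : ℕ) (F : SSer (SSer A τ) π) :
    substN z N F = ∑ m ∈ Finset.finsuppAntidiag Finset.univ N, coeff m F * zpow z m := rfl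

theorem substN_C_mul (N : ℕ) (b : SSer A τ) (F : SSer (SSer A τ) π) :
    substN z N (C π b * F) = b * substN z N F := by
  simp only [substN_apply, Finset.mul_sum, coeff_C_mul, mul_assoc]

theorem cont_substN (N : ℕ) : Cont (substN z N : SSer (SSer A τ) π →ₗ[ℝ] SSer A τ) := fun _ =>
  ⟨N + 1, fun F hF => by
    have : substN z N F = 0 := substDeg_eq_zero (ρ := id) rfl z hF (by omega)
    rw [this]; exact zero_mem _⟩

theorem substN_mono (N : ℕ) {m : Fin n →₀ ℕ} (hm : Adm π m) :
    substN z N (mono (SSer A τ) π m) = if m.degree = N then zpow z m else 0 := by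
  have h : ∀ k, coeff k (mono (SSer A τ) π m) = if k = m then 1 else 0 := fun k => by
    by_cases hk : Adm π k
    · exact coeff_mono hk m
    · rw [coeff_of_not_adm hk, if_neg]; rintro rfl; exact hk hm
  rw [substN_apply]
  simp only [h, ite_mul, one_mul, zero_mul, Finset.sum_ite_eq', mem_finsuppAntidiag_univ]

include hz in
theorem substN_X_mul (N : ℕ) (a : Fin n) (F : SSer (SSer A τ) π) :
    substN z (N + 1) (X _ π a * F) = z a * substN z N F := by
  have key : ∀ (b : SSer A τ) (m : Fin n →₀ ℕ), Adm π m →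
      substN z (N + 1) (X (SSer A τ) π a * (C π b * mono (SSer A τ) π m)) =
        z a * substN z N (C π b * mono (SSer A τ) π m) := fun b m hm => by
    rw [← mul_assoc, (hasParity_X a).comm, pinv_C, mul_assoc, X_mul_mono, mul_smul_comm, map_smul,
      substN_C_mul, substN_C_mul, ← mul_assoc, (hz a).comm, mul_assoc, ← mul_smul_comm]
    congr 1
    have h1 := mul_zpow' hz a m
    by_cases hm' : Adm π (m + Finsupp.single a 1)
    · rw [substN_mono _ hm, substN_mono _ hm']
      have h2 : (m + Finsupp.single a 1).degree = m.degree + 1 := by simp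
      rw [h2]
      by_cases h : m.degree = N
      · rw [if_pos h, if_pos (by omega), h1]
      · rw [if_neg h, if_neg (by omega), mul_zero, smul_zero]
    · rw [mono_of_not_adm hm', map_zero, smul_zero, substN_mono _ hm]
      split
      · rw [h1, zpow_of_not_adm hz hm', smul_zero]
      · rw [mul_zero]
  let L : SSer (SSer A τ) π →ₗ[ℝ] SSer A τ := (substN z (N + 1)).comp
    (LinearMap.mulLeft ℝ (X (SSer A τ) π a)) - (LinearMap.mulLeft ℝ (z a)).comp (substN z N)
  have hL : Cont L := ((cont_substN _).comp (cont_mulLeft _)).sub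
    ((cont_mulLeft _).comp (cont_substN _))
  exact sub_eq_zero.1 (linear_ext (L := L) hL (fun b m hm => sub_eq_zero.2 (key b m hm)) F)

theorem substN_euler (N : ℕ) (F : SSer (SSer A τ) π) :
    substN z N (∑ a, X _ π a * deriv a F) = (N : ℝ) • substN z N F := by
  have h := wtL_eq_sum (fun _ => (1 : ℝ)) F
  simp only [one_smul] at h
  rw [← h, substN_apply, substN_apply, Finset.smul_sum]
  refine Finset.sum_congr rfl fun m hm => ?_
  rw [coeff_wtL, smul_mul_assoc, ← mem_finsuppAntidiag_univ.1 hm, Finsupp.degree_eq_sum]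
  simp

end Euler

section Pb
variable {d : Fin n → A →ₗ[ℝ] A} (hd : ∀ a, IsDer (AlgHom.id ℝ A) (π a) (d a))

include hd in
theorem pb_even (F : SSer A π) {x : A} (hx : HasParity false x) :
    pb d F x = ∑ a, C π (d a x) * deriv a F := by
  rw [pb_apply]
  refine Finset.sum_congr rfl fun a _ => ?_
  have h1 := hasParity_C (π := π) ((hd a).hasParity hx)
  rw [Bool.xor_false] at h1
  rw [h1.comm, ← derivL_apply, (isDer_derivL a).pinv_apply, smul_mul_assoc, Bool.and_self, smul_smul,
    sgn_mul_self, one_smul]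
  rfl

include hd in
theorem pb_mul_right (F : SSer A π) (x : A) {t : A} (ht : ∀ a, d a t = 0) :
    pb d F (x * t) = pb d F x * C π t := by
  rw [pb_apply, pb_apply, Finset.sum_mul]
  refine Finset.sum_congr rfl fun a _ => ?_
  rw [(hd a).leib, ht, mul_zero, add_zero, AlgHom.id_apply, C_mul, smul_mul_assoc, mul_assoc]

include hd in
theorem pb_mul_C (F : SSer A π) {q s : Bool} {x t : A} (hx : HasParity q x) (ht : HasParity s t) :
    pb d (F * C π t) x = sgn (s && q) • (pb d F x * C π t) := by
  rw [pb_apply, pb_apply, Finset.sum_mul, Finset.smul_sum]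
  refine Finset.sum_congr rfl fun a _ => ?_
  have h1 : deriv a (pinv (π a) (F * C π t)) =
      sgn (π a && s) • (deriv a (pinv (π a) F) * C π t) := by
    rw [map_mul, pinv_C, ht.pinv_eq, C_smul, mul_smul_comm, ← derivL_apply, map_smul,
      (isDer_derivL a).leib, derivL_apply, derivL_apply, deriv_C, mul_zero, add_zero]
    rfl
  rw [h1, smul_mul_assoc, smul_mul_assoc, mul_assoc, mul_assoc,
    (hasParity_C ht).comm_sgn (hasParity_C ((hd a).hasParity hx)), mul_smul_comm, smul_smul, smul_smul,
    smul_smul]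
  congr 1
  cases π a <;> cases s <;> cases q <;> simp

include hd in
/-- Factors that do not depend on the variables can be taken out of iterated brackets. -/
theorem foldM_pb_mul {r : ℕ} {q : Fin r → Bool} {x t : Fin r → A} (hx : ∀ b, HasParity (q b) (x b))
    (ht : ∀ b, HasParity (q b) (t b)) (ht0 : ∀ b a, d a (t b) = 0) (F : SSer A π) {s : Bool} {u : A}
    (hu : HasParity s u) : foldM (pb d) r (F * C π u) (fun b => x b * t b) =
      (sgn (s && opar q (chi Finset.univ)) * sg q) •
        (foldM (pb d) r F x * C π (u * (List.ofFn t).prod)) := by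
  induction r generalizing F s u with
  | zero =>
    have h0 : chi (Finset.univ : Finset (Fin 0)) = 0 := by simp [chi]
    rw [h0]
    simp [foldM_zero, sg, koszul]
  | succ r ih =>
    have hs : sg q = sgn (q 0 && opar (fun b : Fin r => q b.succ) (chi Finset.univ)) *
        sg fun b : Fin r => q b.succ := by
      conv_lhs => rw [← Fin.cons_self_tail q]
      exact sg_cons _ _
    rw [foldM_succ, foldM_succ, pb_mul_right hd _ _ (ht0 0), pb_mul_C hd _ (hx 0) hu, smul_mul_assoc,
      mul_assoc, ← C_mul, map_smul, MultilinearMap.smul_apply,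
      ih (q := fun b => q b.succ) (fun b => hx b.succ) (fun b => ht b.succ) (fun b => ht0 b.succ) _
        (hu.mul (ht 0)), smul_smul, List.ofFn_succ, List.prod_cons, ← mul_assoc u,
      opar_chi_univ_succ, hs]
    congr 1
    generalize opar (fun b : Fin r => q b.succ) (chi Finset.univ) = o
    generalize sg (fun b => q b.succ) = c
    cases s <;> cases q 0 <;> cases o <;> simp

theorem pb_mapL_C (F : SSer A π) (x : A) :
    pb (fun a => mapL (π := τ) (d a)) (mapL (CHom τ).toLinearMap F) (C τ x) =
      mapL (CHom τ).toLinearMap (pb d F x) := by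
  have h : ∀ F : SSer A π, mapL (CHom τ).toLinearMap F = mapHom (CHom τ) CHom_isSuper π F :=
    fun _ => rfl
  rw [pb_apply, pb_apply, map_sum]
  refine Finset.sum_congr rfl fun a _ => ?_
  rw [map_smul, h (_ * _), map_mul, ← h, ← h, mapL_deriv CHom_isSuper, h, h, (mapHom_isSuper _ _).pinv, mapL_C, h,
    mapHom_C]
  rfl

theorem foldM_mapL_C {r : ℕ} (F : SSer A π) (x : Fin r → A) :
    foldM (pb fun a => mapL (π := τ) (d a)) r (mapL (CHom τ).toLinearMap F) (fun b => C τ (x b)) =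
      mapL (CHom τ).toLinearMap (foldM (pb d) r F x) := by
  induction r generalizing F with
  | zero => rfl
  | succ r ih => rw [foldM_succ, foldM_succ, pb_mapL_C, ih]

end Pb

/-- The bracket with an even `f` is the derivative along `∑ ∂_a f ∂/∂p_a` in the fibre. By Euler's
identity, `r` such derivatives evaluated at zero momenta give `r!` times the component of degree `r`
at `p = ∂f/∂x`. -/
theorem factorial_smul_substN {d : Fin n → SSer A τ →ₗ[ℝ] SSer A τ}
    (hd : ∀ a, IsDer (AlgHom.id ℝ _) (π a) (d a)) {f : SSer A τ} (hf : HasParity false f) (r : ℕ)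
    (F : SSer (SSer A τ) π) : (r.factorial : ℝ) • substN (fun a => d a f) r F =
      coeff 0 (foldM (pb d) r F fun _ => f) := by
  have hz : ∀ a, HasParity (π a) (d a f) := fun a => by
    have := (hd a).hasParity hf
    rwa [Bool.xor_false] at this
  induction r generalizing F with
  | zero => simp [foldM_zero, substN_apply, zpow_zero']
  | succ r ih =>
    rw [foldM_succ, ← ih, pb_even hd F hf, map_sum]
    simp only [substN_C_mul, ← substN_X_mul hz]
    rw [← map_sum, substN_euler, smul_smul, Nat.factorial_succ, mul_comm]
    push_cast
    rfl

end SSer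

/-! ### The `L_∞`-morphism -/

namespace SSer

theorem theta_mul_self (N : ℕ) : theta N * theta N = 1 := neg_one_pow_mul_self _

/-- Reversing a whole word amounts to reversing the order of its blocks and reversing each block
internally; in the former only the parity of a block matters. -/
theorem theta_sum {r : ℕ} (N : Fin r → ℕ) :
    theta (∑ b, N b) * theta (∑ b, if (N b).bodd then 1 else 0) * ∏ b, theta (N b) = 1 := by
  induction r with
  | zero => simp [theta]
  | succ r ih =>
    have h := ih fun b => N b.succ
    have hb : ∀ (s : Finset (Fin r)), (∑ b ∈ s, if (N b.succ).bodd then 1 else 0 : ℕ).bodd =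
        (∑ b ∈ s, N b.succ).bodd := fun s => by
      induction s using Finset.induction_on with
      | empty => rfl
      | insert b s hs ih =>
        rw [Finset.sum_insert hs, Finset.sum_insert hs, Nat.bodd_add, Nat.bodd_add, ih]
        cases (N b.succ).bodd <;> rfl
    have h1 : theta (if (N 0).bodd then 1 else 0) = 1 := by split <;> simp [theta]
    have h2 : (-1 : ℝ) ^ (N 0 * ∑ b : Fin r, N b.succ) *
        (-1) ^ ((if (N 0).bodd then 1 else 0) * ∑ b : Fin r, if (N b.succ).bodd then 1 else 0) = 1 := by
      rw [neg_one_pow_eq_sgn, neg_one_pow_eq_sgn, Nat.bodd_mul, Nat.bodd_mul, hb]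
      have : (if (N 0).bodd then 1 else 0 : ℕ).bodd = (N 0).bodd := by
        cases (N 0).bodd <;> rfl
      rw [this, sgn_mul_self]
    have h3 := theta_mul_self (N 0)
    rw [Fin.sum_univ_succ, Fin.sum_univ_succ, Fin.prod_univ_succ, theta_add, theta_add, h1]
    calc _ = (theta (N 0) * theta (N 0)) * ((-1 : ℝ) ^ (N 0 * ∑ b : Fin r, N b.succ) *
        (-1) ^ ((if (N 0).bodd then 1 else 0) * ∑ b : Fin r, if (N b.succ).bodd then 1 else 0)) *
        (theta (∑ b : Fin r, N b.succ) * theta (∑ b : Fin r, if (N b.succ).bodd then 1 else 0) *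
          ∏ b : Fin r, theta (N b.succ)) := by ring
      _ = 1 := by rw [h2, h3, h, one_mul, one_mul]

/-- The sign of the reversal of a tuple that is divided into parts. -/
theorem sg_fiber {n r : ℕ} (p : Fin n → Bool) (κ : Fin n → Fin r) :
    sg p * sg (fun b => opar p (chi (Finset.univ.filter fun j => κ j = b))) *
      ∏ b, sg (subTuple p (Finset.univ.filter fun j => κ j = b)) = 1 := by
  have h1 : oddDeg p (chi Finset.univ) =
      ∑ b, oddDeg p (chi (Finset.univ.filter fun j => κ j = b)) := by
    simp only [oddDeg_chi, Finset.sum_fiberwise]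
  simp only [sg_eq, FormalMap.oddDeg_subTuple]
  rw [oddDeg_chi (fun b => opar p _), h1]
  exact theta_sum _

section Expansion
variable {A : Type} [Ring A] [Algebra ℝ A] [SuperAlgebra A] {n l : ℕ} {π : Fin n → Bool}
  {τ : Fin l → Bool}

/-- Every parameter occurs exactly once in the product, hence in exactly one factor; `κ` records
which one. -/
theorem exists_fiber_of_sum_eq {r : ℕ} {k : Fin r → Fin l →₀ ℕ} (h : ∑ b, k b = chi Finset.univ) :
    ∃ κ : Fin l → Fin r, (fun b => chi (Finset.univ.filter fun j => κ j = b)) = k := by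
  have h1 : ∀ j, ∑ b, k b j = 1 := fun j => by
    rw [← Finsupp.finset_sum_apply, h, chi_apply, if_pos (Finset.mem_univ j)]
  have h2 : ∀ j, ∃ b, k b j ≠ 0 := fun j => by
    obtain ⟨b, -, hb⟩ := Finset.exists_ne_zero_of_sum_ne_zero (by rw [h1 j]; exact one_ne_zero)
    exact ⟨b, hb⟩
  choose κ hκ using h2
  refine ⟨κ, funext fun b => Finsupp.ext fun j => ?_⟩
  have h3 := Finset.add_sum_erase Finset.univ (fun b => k b j) (Finset.mem_univ (κ j))
  have h4 := hκ j
  rw [h1] at h3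
  rw [chi_apply]
  by_cases hb : κ j = b
  · rw [if_pos (by simpa using hb)]; subst hb; omega
  · have h5 := Finset.single_le_sum (f := fun b => k b j) (fun _ _ => Nat.zero_le _)
      (Finset.mem_erase.2 ⟨fun h => hb h.symm, Finset.mem_univ b⟩)
    rw [if_neg (by simpa using hb)]; omega

theorem substDeg_sub_mem {z z' : Fin n → SSer A τ} {N : ℕ} (h : ∀ i, z i - z' i ∈ ordGE A τ N)
    (H : SSer A π) (r : ℕ) : substDeg (C τ) z H r - substDeg (C τ) z' H r ∈ ordGE A τ N := by
  rw [substDeg_eq, substDeg_eq, ← Finset.sum_sub_distrib]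
  refine sum_mem fun m _ => ?_
  rw [← mul_sub]
  exact mul_ordGE_right (zpow_sub_zpow_mem h m) _

/-- Series in the parameters are taken as the coefficient algebra, so that `f` becomes a single
function and the parameters are constants for the derivations. -/
theorem factorial_smul_substDeg (cs : CoordSys A π) {f : SSer A τ} (hf : HasParity false f)
    (H : SSer A π) (r : ℕ) : (r.factorial : ℝ) • substDeg (C τ) (fun a => mapL (cs.d a) f) H r =
      coeff 0 (foldM (pb fun a => mapL (π := τ) (cs.d a)) r (mapL (CHom τ).toLinearMap H)
        fun _ => f) := by
  rw [← factorial_smul_substN (fun a => isDer_mapL_id (cs.d_der a)) hf, substN_apply, substDeg_eq]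
  simp only [coeff_mapL]
  rfl

theorem mapL_mono {B : Type} [Ring B] [Algebra ℝ B] [SuperAlgebra B] {e : Bool} {D : B →ₗ[ℝ] B}
    (hD : IsDer (AlgHom.id ℝ B) e D) (k : Fin l →₀ ℕ) : mapL D (mono B τ k) = 0 :=
  SSer.ext fun m hm => by
    rw [coeff_mapL, coeff_mono hm, coeff_zero]
    split
    · exact hD.map_one
    · exact map_zero D

/-- The coefficients of `H(x, ∂f/∂x)` in terms of the brackets generated by `H`. -/
theorem coeff_chi_substDeg (cs : CoordSys A π) {f : SSer A τ} (hf : HasParity false f) (H : SSer A π)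
    (r : ℕ) : (r.factorial : ℝ) • coeff (chi Finset.univ)
        (substDeg (C τ) (fun a => mapL (cs.d a) f) H r) =
      ∑ κ : Fin l → Fin r, (sg (fun b => opar τ (chi (Finset.univ.filter fun j => κ j = b))) *
        koszul τ (fun j => κ j)) • coeff 0 (foldM (pb cs.d) r H fun b =>
          coeff (chi (Finset.univ.filter fun j => κ j = b)) f) := by
  -- Degrees above `l` cannot contribute to the coefficient of `t_1 ⋯ t_l`, and a finite sum can be
  -- expanded by multilinearity.
  set f₀ := ∑ k ∈ expLT (Fin l) (l + 1), C τ (coeff k f) * mono A τ k with hf₀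
  have hpar : ∀ k, HasParity (opar τ k) (coeff k f) := fun k => by
    by_cases hk : Adm τ k
    · simpa using hasParity_iff_coeff.1 hf k hk
    · rw [coeff_of_not_adm hk]; exact HasParity.zero
  have hf₀' : HasParity false f₀ := HasParity.sum fun k _ => by
    have := (hasParity_C (π := τ) (hpar k)).mul (hasParity_mono (A := A) (π := τ) k)
    rwa [Bool.xor_self] at this
  have h1 : coeff (chi Finset.univ) (substDeg (C τ) (fun a => mapL (cs.d a) f) H r) =
      coeff (chi Finset.univ) (substDeg (C τ) (fun a => mapL (cs.d a) f₀) H r) := by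
    have h2 := substDeg_sub_mem (z := fun a => mapL (cs.d a) f) (z' := fun a => mapL (cs.d a) f₀)
      (N := l + 1) (fun a => by
        rw [← map_sub]; exact mapL_ordGE _ (sub_trunc_mem (l + 1) f)) H r (chi Finset.univ)
      (by rw [degree_chi, Finset.card_fin]; omega)
    rwa [coeff_sub, sub_eq_zero] at h2
  have hd : ∀ a, IsDer (AlgHom.id ℝ (SSer A τ)) (π a) (mapL (cs.d a)) :=
    fun a => isDer_mapL_id (cs.d_der a)
  have h3 : ∀ k : Fin r → Fin l →₀ ℕ, coeff 0 (foldM (pb fun a => mapL (π := τ) (cs.d a)) r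
      (mapL (CHom τ).toLinearMap H) fun b => C τ (coeff (k b) f) * mono A τ (k b)) =
        sg (fun b => opar τ (k b)) • (C τ (coeff 0 (foldM (pb cs.d) r H fun b => coeff (k b) f)) *
          (List.ofFn fun b => mono A τ (k b)).prod) := fun k => by
    have h4 := foldM_pb_mul hd (fun b => hasParity_C (hpar (k b))) (fun b => hasParity_mono (k b))
      (fun b a => mapL_mono (cs.d_der a) (k b)) (mapL (CHom τ).toLinearMap H)
      (HasParity.one : HasParity false (1 : SSer A τ))
    have hC1 : C π (1 : SSer A τ) = 1 := map_one (CHom π)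
    rw [hC1, mul_one, one_mul, Bool.false_and, sgn_false, one_mul] at h4
    have h5 := h4.trans (congrArg (fun Z => sg (fun b => opar τ (k b)) • (Z * C π
      (List.ofFn fun b => mono A τ (k b)).prod))
        (foldM_mapL_C (τ := τ) (d := cs.d) H fun b => coeff (k b) f))
    refine (congrArg (coeff 0) h5).trans ?_
    rw [coeff_smul, coeff_mul_C, coeff_mapL, opar_zero, pinv_false]
    rfl
  rw [h1, ← coeff_smul, factorial_smul_substDeg cs hf₀', hf₀, MultilinearMap.map_sum_finset, coeff_sum,
    coeff_sum]
  symm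
  -- Among all families of exponents only those adding up to `t_1 ⋯ t_l` contribute, and these are
  -- the families of fibres of maps `κ`.
  refine Finset.sum_of_injOn (fun κ b => chi (Finset.univ.filter fun j => κ j = b))
    (fun κ _ κ' _ h => funext fun j => ?_) (fun κ _ => ?_) (fun k _ hk => ?_) (fun κ _ => ?_)
  · have h5 := chi_injective (congrFun h (κ j))
    have h6 : j ∈ Finset.univ.filter fun i => κ i = κ j := by simp
    rw [h5] at h6
    exact (Finset.mem_filter.1 h6).2.symm
  · refine Finset.mem_coe.2 (Fintype.mem_piFinset.2 fun b => mem_expLT.2 ?_)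
    rw [degree_chi]
    have := Finset.card_le_univ (Finset.univ.filter fun j => κ j = b)
    simp only [Fintype.card_fin] at this
    omega
  · rw [h3, coeff_smul, coeff_C_mul, prod_mono, coeff_smul, coeff_mono (adm_chi _), if_neg, smul_zero,
      mul_zero, smul_zero]
    intro h5
    obtain ⟨κ, hκ⟩ := exists_fiber_of_sum_eq h5.symm
    exact hk ⟨κ, Finset.mem_coe.2 (Finset.mem_univ _), hκ⟩
  · rw [h3, coeff_smul, coeff_C_mul, prod_mono_fiber, coeff_smul, coeff_mono (adm_chi _), if_pos rfl,
      mul_smul_comm, mul_one, smul_smul]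

end Expansion
end SSer

theorem GradedSupermanifold.IsLocSum.smul {M : GradedSupermanifold} {U : Opens M.pt} {F : ℕ → M.O U}
    {f : M.O U} (h : M.IsLocSum F f) (a : ℝ) : M.IsLocSum (fun N => a • F N) (a • f) := fun x hx => by
  obtain ⟨W, hW, N₀, hx, h1, h2⟩ := h x hx
  refine ⟨W, hW, N₀, hx, fun N hN => ?_, ?_⟩
  · rw [map_smul, h1 N hN, smul_zero]
  · simp only [map_smul, ← Finset.smul_sum, h2]

namespace ThickMorphism
variable {M₁ M₂ : GradedSupermanifold} {s k : ℤ} {Φ : ThickMorphism M₁ M₂ s}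
  {H₁ : MasterHamiltonian M₁ k} {H₂ : MasterHamiltonian M₂ k}

/-- The coefficients of `f` are Taylor coefficients of the pullback, and the reversal signs of the
parts, of their order and of the whole tuple cancel by `sg_fiber`. The Koszul sign of the partition
is what remains. -/
theorem sg_smul_coeff_hamJacobi (H₁ : MasterHamiltonian M₁ k) (Φ : ThickMorphism M₁ M₂ s) (c : M₁.Coord)
    {n : ℕ} {p : Fin n → Bool} {v : Fin n → M₂.Fun} (hv : ∀ j, HasParity (p j) (v j)) (r : ℕ) :
    sg p • coeff (chi Finset.univ)
        (hamJacobi H₁ c le_rfl (M₁.sres le_top (Φ.formalMap.val (lin p v))) r) =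
      M₁.res le_top (((r.factorial : ℝ)⁻¹) • ∑ κ : Fin n → Fin r, koszul p (fun j => κ j) •
        (hamMap H₁).taylor.map r (fun b => Φ.formalMap.taylor.map _
          (subTuple v (Finset.univ.filter fun j => κ j = b)))) := by
  have hr : (r.factorial : ℝ) ≠ 0 := Nat.cast_ne_zero.2 r.factorial_ne_zero
  set f := Φ.formalMap.val (lin p v)
  have hf : HasParity false (M₁.sres (le_top : c.dom ≤ ⊤) f) := by
    rw [← sresHom_apply]
    exact (sresHom_isSuper _ _).hasParity (Φ.formalMap.val_par (isFP_lin hv))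
  rw [hamJacobi_eq, sres_refl, map_smul, eq_inv_smul_iff₀ hr, smul_comm, coeff_chi_substDeg _ hf,
    Finset.smul_sum, map_sum]
  refine Finset.sum_congr rfl fun κ _ => ?_
  have h1 : (fun b => coeff (chi (Finset.univ.filter fun j => κ j = b))
      (M₁.sres (le_top : c.dom ≤ ⊤) f)) = fun b =>
        sg (subTuple p (Finset.univ.filter fun j => κ j = b)) •
          M₁.res (le_top : c.dom ≤ ⊤) (Φ.formalMap.taylor.map _
            (subTuple v (Finset.univ.filter fun j => κ j = b))) := funext fun b => by
    rw [coeff_sres, Φ.formalMap.coeff_val_lin hv, map_smul]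
  rw [h1, MultilinearMap.map_smul_univ, coeff_smul, map_smul, res_hamMap_taylor H₁ c, smul_smul,
    smul_smul]
  congr 1
  have := sg_fiber p κ
  linear_combination koszul p (fun j => κ j) * this

/-- The relation is the coefficient of `t_1 ⋯ t_n` in the identity between `Q_{H₁}(Φ^* g)` and the
tangent image of `Q_{H₂}(g)` at `g = ∑ v_j t_j`. The Hamiltonian side is expanded in a chart of
`M₁`, which suffices since locally finite sums can be checked locally. -/
theorem isLInfMorphism (hΦ : Φ.HamiltonJacobi H₁ H₂) :
    IsLInfMorphism (hamMap H₂).taylor (hamMap H₁).taylor Φ.formalMap.taylor := fun n p v hv => by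
  have hg := isFormalPoint_iff.2 (isFP_lin hv)
  have h1 := isHamJacobiValue_dir hΦ hg (Φ.isPullback_val hg)
  have h2 := Φ.formalMap.coeff_chi_dir_val (hamMap H₂) hv
  rw [Bool.false_and, sgn_false, one_mul, formalMap_dir hg, hamMap_val H₂ (isFP_lin hv)] at h2
  refine isLocSum_of_locally fun x _ => ?_
  obtain ⟨c, hc⟩ := M₁.exists_chart x
  refine ⟨c.dom, le_top, hc, ?_⟩
  have h3 := IsLocSum.smul (h1 c (chi Finset.univ)) (sg p)
  rw [coeff_sres, h2, map_smul, smul_smul, sg_mul_self, one_smul] at h3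
  simp only [sg_smul_coeff_hamJacobi H₁ Φ c hv] at h3
  exact h3

end ThickMorphism

theorem mainTheorem1 (M₁ M₂ : GradedSupermanifold) (k : ℤ)
    (H₁ : MasterHamiltonian M₁ k) (H₂ : MasterHamiltonian M₂ k)
    (Φ : ThickMorphism M₁ M₂ (1 - k)) (hΦ : Φ.HamiltonJacobi H₁ H₂) :
    Φ.PullbackWellDefined ∧ Φ.IsFormalQMorphism H₁ H₂ ∧
    ∃ (B₁ : SymFamily M₁.Fun M₁.Fun true) (B₂ : SymFamily M₂.Fun M₂.Fun true)
      (F : SymFamily M₂.Fun M₁.Fun false),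
      (IsDerivedBrackets H₁ B₁ ∧ B₁.Jacobi ∧ B₁.HasShiftedWeight (1 - k) 1) ∧
      (IsDerivedBrackets H₂ B₂ ∧ B₂.Jacobi ∧ B₂.HasShiftedWeight (1 - k) 1) ∧
      (Φ.IsTaylorOfPullback F ∧ ∀ F', Φ.IsTaylorOfPullback F' → F' = F) ∧
      F.HasShiftedWeight (1 - k) 0 ∧ IsLInfMorphism B₂ B₁ F :=
  ⟨Φ.pullbackWellDefined, ThickMorphism.isFormalQMorphism hΦ, (hamMap H₁).taylor, (hamMap H₂).taylor,
    Φ.formalMap.taylor,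
    ⟨hamMap_isDerivedBrackets H₁, hamMap_jacobi H₁, hamMap_hasShiftedWeight H₁⟩,
    ⟨hamMap_isDerivedBrackets H₂, hamMap_jacobi H₂, hamMap_hasShiftedWeight H₂⟩,
    ⟨Φ.isTaylorOfPullback, fun _ h => Φ.isTaylorOfPullback_unique h⟩,
    Φ.formalMap_hasShiftedWeight, ThickMorphism.isLInfMorphism hΦ⟩
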